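/- **Theorem ($L^2$ error estimate for the semi-discrete sparse grid central DG scheme).** Let $d\ge2$, $k\ge1$, $\Omega=[0,1]^d$, $h_N=2^{-N}$, $T>0$, and consider $u_t+\nabla\cdot(\mathbf A u)=0$ on $[0,T]\times\Omega$ with a $C^1$ coefficient field $\mathbf A(t,\mathbf x)=(A_1,\dots,A_d)$, either (a) with $\mathbf A$ and $u$ $1$-periodic in every $x_i$, or (b) with $A_i(t,\mathbf x)\ne0$ for all $i,t,\mathbf x$ and inflow data $u=g_i$ on $\{x_i=0\}$ where $A_i>0$ and on $\{x_i=1\}$ where $A_i<0$. *Spaces.* For $a\in\mathbb R$ let $V_n^k([a,a+1])$ be the piecewise polynomials of degree $\le k$ on the $2^n$ equal cells of $[a,a+1]$, let $W_0^k=V_0^k$, and let $W_n^k$ be the $L^2$-orthogonal complement of $V_{n-1}^k$ in $V_n^k$. Put $\hat{\mathbf V}_N^k([a,a+1]^d)=\bigoplus_{|\mathbf l|_1\le N}W_{l_1}^k\times\cdots\times W_{l_d}^k$. The primal space $\mathbf V_P$ is $\hat{\mathbf V}_N^k([0,1]^d)$. The dual space $\mathbf V_D$ is, in case (a), the periodic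 extension of $\hat{\mathbf V}_N^k([-\frac{h_N}2,1-\frac{h_N}2]^d)$ restricted to $\Omega$. In case (b) it is $\bigoplus_{|\mathbf l|_1\le N}W_{l_1,N,D}^k\times\cdots\times W_{l_d,N,D}^k$, where $W_{0,N,D}^k$ consists of the piecewise polynomials of degree $\le k$ on the two cells $[0,1-\frac{h_N}2]$, $[1-\frac{h_N}2,1]$, and $W_{l,N,D}^k=W_l^k([-\frac{h_N}2,1-\frac{h_N}2])|_{[0,1]}$ (extended by zero) for $l\ge1$. *Scheme.* With the parameter $\tau_{\max}>0$, find $u_h(t)\in\mathbf V_P$, $v_h(t)\in\mathbf V_D$, differentiable in $t\in[0,T]$, such that for all $\varphi\in\mathbf V_P$, $\psi\in\mathbf V_D$ $$\int_\Omega (u_h)_t\varphi=\frac1{\tau_{\max}}\int_\Omega(v_h-u_h)\varphi+\int_\Omega v_h\mathbf A\cdot\nabla\varphi-\sum_{e\in\Gamma_P}\int_e v_h\mathbf A\cdot[\varphi]\,ds,$$ $$\int_\Omega (v_h)_t\psi=\frac1{\tau_{\max}}\int_\Omega(u_h-v_h)\psi+\int_\Omega u_h\mathbf A\cdot\nabla\psi-\sum_{e\in\Gamma_D}\int_e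 u_h\mathbf A\cdot[\psi]\,ds,$$ where gradients are taken cell by cell, $\Gamma_P,\Gamma_D$ are the faces $x_i=jh_N$, respectively $x_i=(j+\frac12)h_N$, of the level-$N$ meshes (identified periodically in case (a), together with the faces of $\partial\Omega$ in case (b)), and $[\varphi]=\varphi^-\mathbf n^-+\varphi^+\mathbf n^+$. In case (b), on $\partial\Omega$ one has $[\varphi]=\varphi\,\mathbf n$, and $v_h$ (resp. $u_h$) in the face integral is replaced by $g_i$ on the inflow part and is the interior trace on the outflow part. Initially, $u_h(0)$ and $v_h(0)$ are the $L^2(\Omega)$ projections of $u_0=u(0,\cdot)$ onto $\mathbf V_P$ and $\mathbf V_D$. *Norms.* $|v|_{\mathcal H^{m}(\Omega)}=\max_{\emptyset\ne L\subset\{1,\dots,d\}}\|\prod_{i\in L}\partial_{x_i}^{m}v\|_{L^2(\Omega)}$ with weak derivatives (of the periodic extension of $v$ in case (a)), and $=\infty$ if one of them is not in $L^2(\Omega)$; $v\in\mathcal H^m(\Omega)$ means that all weak derivatives $\partial^\alpha v$ with $\max_i\alpha_i\le m$ are in $L^2(\Omega)$. *Claim.* Let $u$ be a classical ($C^1$)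 solution with $u_0\in\mathcal H^{p+1}(\Omega)$, and let $1\le q\le\min\{p,k\}$ and $c_1>0$. Assume $c_1h_N\le\tau_{\max}$ together with, in case (a), $\tau_{\max}\le c_2h_N$ for some given $c_2>0$, and in case (b), $\tau_{\max}\sum_i|A_i(t,\mathbf x)|\le\kappa h_N$ on $[0,T]\times\Omega$, where $\kappa>0$ is a constant depending only on $d$ and $k$. Then there is a constant $C$, depending on $d,k,p,q,T,\mathbf A,c_1$ (and $c_2$ in case (a)) but not on $N$, $\tau_{\max}$, $u$, $g_i$, such that for all $N\ge1$ and all $t\in[0,T]$ $$\|u(t)-u_h(t)\|_{L^2(\Omega)}+\|u(t)-v_h(t)\|_{L^2(\Omega)}\le C\,N^d2^{-Nq}\sup_{0\le s\le t}|u(s)|_{\mathcal H^{q+1}(\Omega)}.$$ -/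

import Mathlib

open MeasureTheory Set
open scoped Polynomial ENNReal

noncomputable section

namespace SparseCDG

/-! ### Partial derivatives, weak derivatives, mixed Sobolev regularity -/

/-- The domain `Ω = [0,1]^d`. -/
def unitCube (d : ℕ) : Set (Fin d → ℝ) := Set.Icc 0 1

/-- The partial derivative `∂f/∂x_i`. -/
def pderiv {d : ℕ} (i : Fin d) (f : (Fin d → ℝ) → ℝ) (x : Fin d → ℝ) : ℝ :=
  lineDeriv ℝ f x (Pi.single i 1)

/-- The mixed partial derivative `∂^α f`. -/
def mixedDeriv {d : ℕ} (α : Fin d → ℕ) (f : (Fin d → ℝ) → ℝ) : (Fin d → ℝ) → ℝ :=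
  (List.finRange d).foldr (fun i g => (pderiv i)^[α i] g) f

/-- `w` is the weak derivative `∂^α v` on the open set `U`. -/
def HasWeakDeriv {d : ℕ} (U : Set (Fin d → ℝ)) (α : Fin d → ℕ) (v w : (Fin d → ℝ) → ℝ) : Prop :=
  LocallyIntegrableOn v U ∧ LocallyIntegrableOn w U ∧
    ∀ φ : (Fin d → ℝ) → ℝ, ContDiff ℝ (⊤ : ℕ∞) φ → HasCompactSupport φ → tsupport φ ⊆ U →
      ∫ x in U, v x * mixedDeriv α φ x = (-1 : ℝ) ^ (∑ i, α i) * ∫ x in U, w x * φ x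

/-- Membership in the mixed Sobolev space `𝓗^m(Ω)`: the weak derivatives `∂^α v` on `U` with
`α_i ≤ m` for all `i` exist and are in `L²(Ω)`.  Here `U` is the interior of `Ω`, or, for periodic
functions, the whole space (so that regularity is also required across the identified faces). -/
def MemMixedSobolev {d : ℕ} (U : Set (Fin d → ℝ)) (m : ℕ) (v : (Fin d → ℝ) → ℝ) : Prop :=
  ∀ α : Fin d → ℕ, (∀ i, α i ≤ m) →
    ∃ w, HasWeakDeriv U α v w ∧ MemLp w 2 (volume.restrict (unitCube d))

/-- The semi-norm `|v|_{𝓗^m(Ω)}`: the maximum over non-empty `L ⊆ {1,…,d}` of the `L²(Ω)` norm of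
the weak derivative `(∏_{i ∈ L} ∂_i^m) v`; it is `∞` if one of these derivatives does not exist. -/
def mixedSeminorm {d : ℕ} (U : Set (Fin d → ℝ)) (m : ℕ) (v : (Fin d → ℝ) → ℝ) : ℝ≥0∞ :=
  ⨆ (L : Finset (Fin d)) (_ : L.Nonempty),
    ⨅ (w : (Fin d → ℝ) → ℝ) (_ : HasWeakDeriv U (fun i => if i ∈ L then m else 0) v w),
      eLpNorm w 2 (volume.restrict (unitCube d))

/-! ### Sparse finite element spaces

Piecewise polynomials are represented by functions which are given by a polynomial on each
half-open cell; one-sided limits supply the traces on faces. -/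

/-- The mesh size `h_n = 2^{-n}`. -/
def meshSize (n : ℕ) : ℝ := ((2 : ℝ) ^ n)⁻¹

/-- `V_n^k([a,a+1])`: piecewise polynomials of degree at most `k` on `2^n` equal cells. -/
def piecewisePoly (k : ℕ) (a : ℝ) (n : ℕ) : Set (ℝ → ℝ) :=
  {v | (∀ j : ℕ, j < 2 ^ n → ∃ p : ℝ[X], p.natDegree ≤ k ∧
          ∀ x ∈ Ico (a + j * meshSize n) (a + (j + 1) * meshSize n), v x = p.eval x) ∧
        ∀ x, x ∉ Ico a (a + 1) → v x = 0}

/-- `W_n^k([a,a+1])`: the `L²`-orthogonal complement of `V_{n-1}^k` in `V_n^k`; `W_0^k = V_0^k`. -/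
def multiwavelet (k : ℕ) (a : ℝ) : ℕ → Set (ℝ → ℝ)
  | 0 => piecewisePoly k a 0
  | n + 1 => {w | w ∈ piecewisePoly k a (n + 1) ∧
      ∀ v ∈ piecewisePoly k a n, ∫ x in Ico a (a + 1), w x * v x = 0}

/-- The space `V_{0,N,D}^k` of piecewise polynomials on the two cells `[0, 1 - h_N/2]` and
`[1 - h_N/2, 1]`. -/
def dualCoarse (k N : ℕ) : Set (ℝ → ℝ) :=
  {v | (∃ p : ℝ[X], p.natDegree ≤ k ∧ ∀ x ∈ Ico 0 (1 - meshSize N / 2), v x = p.eval x) ∧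
        (∃ p : ℝ[X], p.natDegree ≤ k ∧ ∀ x ∈ Ico (1 - meshSize N / 2) 1, v x = p.eval x) ∧
        ∀ x, x ∉ Ico (0 : ℝ) 1 → v x = 0}

/-- The one-dimensional increment spaces `W_{l,N,D}^k` on the non-periodic dual mesh: for `l ≥ 1`
the restrictions to `[0,1]` of the functions of `W_l^k([-h_N/2, 1-h_N/2])`. -/
def dualWavelet (k N : ℕ) : ℕ → Set (ℝ → ℝ)
  | 0 => dualCoarse k N
  | l + 1 => (fun w => (Ico (0 : ℝ) 1).indicator w) '' multiwavelet k (-(meshSize N / 2)) (l + 1)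

/-- The sparse space `⨁_{|l|_1 ≤ N} W_{l_1} × ⋯ × W_{l_d}` built from one-dimensional increment
spaces `W_0, W_1, …`. -/
def sparseSpace (W : ℕ → Set (ℝ → ℝ)) (d N : ℕ) : Submodule ℝ ((Fin d → ℝ) → ℝ) :=
  Submodule.span ℝ {f | ∃ l : Fin d → ℕ, ∑ i, l i ≤ N ∧
    ∃ w : Fin d → ℝ → ℝ, (∀ i, w i ∈ W (l i)) ∧ f = fun x => ∏ i, w i (x i)}

/-- The representative in `[a,a+1)^d` of a point modulo `ℤ^d`. -/
def wrap {d : ℕ} (a : ℝ) (x : Fin d → ℝ) : Fin d → ℝ := fun i => a + Int.fract (x i - a)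

/-- The periodic extensions of the functions of the sparse space on `[a,a+1]^d`. -/
def periodicSpace (k d N : ℕ) (a : ℝ) : Submodule ℝ ((Fin d → ℝ) → ℝ) :=
  (sparseSpace (multiwavelet k a) d N).map (LinearMap.funLeft ℝ ℝ (wrap a))

/-- Primal sparse space, periodic case. -/
def primalPer (k d N : ℕ) : Submodule ℝ ((Fin d → ℝ) → ℝ) := periodicSpace k d N 0

/-- Dual sparse space, periodic case. -/
def dualPer (k d N : ℕ) : Submodule ℝ ((Fin d → ℝ) → ℝ) := periodicSpace k d N (-(meshSize N / 2))

/-- Primal sparse space, non-periodic case. -/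
def primalDir (k d N : ℕ) : Submodule ℝ ((Fin d → ℝ) → ℝ) := sparseSpace (multiwavelet k 0) d N

/-- Dual sparse space, non-periodic case. -/
def dualDir (k d N : ℕ) : Submodule ℝ ((Fin d → ℝ) → ℝ) := sparseSpace (dualWavelet k N) d N

/-- `v` is the `L²(Ω)` projection of `f` onto `V`. -/
def IsL2Proj {d : ℕ} (V : Submodule ℝ ((Fin d → ℝ) → ℝ)) (f v : (Fin d → ℝ) → ℝ) : Prop :=
  v ∈ V ∧ ∀ φ ∈ V, ∫ x in unitCube d, (v x - f x) * φ x = 0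

/-! ### The semi-discrete scheme

An integral over the cross-section `{x ∈ Ω : x_i = c}` is written as an integral over `Ω` of the
integrand at the point with `i`-th coordinate replaced by `c`; the dummy coordinate `x_i` runs
through an interval of length one. -/

/-- The limit of `φ` at `x_i = c` from the left in direction `i`. -/
def traceL {d : ℕ} (i : Fin d) (c : ℝ) (φ : (Fin d → ℝ) → ℝ) (x : Fin d → ℝ) : ℝ :=
  Function.leftLim (fun s : ℝ => φ (Function.update x i s)) c

/-- The limit of `φ` at `x_i = c` from the right in direction `i`. -/
def traceR {d : ℕ} (i : Fin d) (c : ℝ) (φ : (Fin d → ℝ) → ℝ) (x : Fin d → ℝ) : ℝ :=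
  Function.rightLim (fun s : ℝ => φ (Function.update x i s)) c

/-- `∫_Ω w A·∇φ`, with the gradient taken cell by cell. -/
def volumeTerm {d : ℕ} (A : (Fin d → ℝ) → Fin d → ℝ) (w φ : (Fin d → ℝ) → ℝ) : ℝ :=
  ∫ x in unitCube d, w x * ∑ i, A x i * pderiv i φ x

/-- `∑_e ∫_e w A·[φ]` over the faces `x_i = (j + δ) h_N` with `j ∈ J` and `i = 1, …, d`. On such a
face `[φ] = φ^- n^- + φ^+ n^+` is the left limit minus the right limit, times the `i`-th unit
vector. -/
def faceTerm {d : ℕ} (N : ℕ) (J : Finset ℕ) (δ : ℝ) (A : (Fin d → ℝ) → Fin d → ℝ)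
    (w φ : (Fin d → ℝ) → ℝ) : ℝ :=
  ∑ i : Fin d, ∑ j ∈ J, ∫ x in unitCube d,
    w (Function.update x i ((j + δ) * meshSize N)) *
      A (Function.update x i ((j + δ) * meshSize N)) i *
      (traceL i ((j + δ) * meshSize N) φ x - traceR i ((j + δ) * meshSize N) φ x)

/-- `∫_{∂Ω} w* A·n φ`, where `w*` is the prescribed value `g_i` on the inflow part of the
boundary and the trace of `w` on the outflow part. -/
def boundaryTerm {d : ℕ} (A : (Fin d → ℝ) → Fin d → ℝ) (g : Fin d → (Fin d → ℝ) → ℝ)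
    (w φ : (Fin d → ℝ) → ℝ) : ℝ :=
  ∑ i : Fin d,
    ((∫ x in unitCube d,
        (if A (Function.update x i 1) i < 0 then g i (Function.update x i 1) else traceL i 1 w x) *
          A (Function.update x i 1) i * traceL i 1 φ x) -
      ∫ x in unitCube d,
        (if 0 < A (Function.update x i 0) i then g i (Function.update x i 0) else traceR i 0 w x) *
          A (Function.update x i 0) i * traceR i 0 φ x)

/-- Flux form of the primal equation, periodic case: the faces are `x_i = j h_N`,
`0 ≤ j < 2^N`. -/
def fluxPrimalPer {d : ℕ} (N : ℕ) (A : (Fin d → ℝ) → Fin d → ℝ) (w φ : (Fin d → ℝ) → ℝ) : ℝ :=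
  volumeTerm A w φ - faceTerm N (Finset.range (2 ^ N)) 0 A w φ

/-- Flux form of the dual equation, periodic case: the faces are `x_i = (j + 1/2) h_N`,
`0 ≤ j < 2^N`. -/
def fluxDualPer {d : ℕ} (N : ℕ) (A : (Fin d → ℝ) → Fin d → ℝ) (w φ : (Fin d → ℝ) → ℝ) : ℝ :=
  volumeTerm A w φ - faceTerm N (Finset.range (2 ^ N)) (1 / 2) A w φ

/-- Flux form of the primal equation, non-periodic case: the interior faces are `x_i = j h_N`,
`1 ≤ j < 2^N`. -/
def fluxPrimalDir {d : ℕ} (N : ℕ) (A : (Fin d → ℝ) → Fin d → ℝ) (g : Fin d → (Fin d → ℝ) → ℝ)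
    (w φ : (Fin d → ℝ) → ℝ) : ℝ :=
  volumeTerm A w φ - faceTerm N (Finset.Ico 1 (2 ^ N)) 0 A w φ - boundaryTerm A g w φ

/-- Flux form of the dual equation, non-periodic case: the interior faces are
`x_i = (j + 1/2) h_N`, `0 ≤ j < 2^N`. -/
def fluxDualDir {d : ℕ} (N : ℕ) (A : (Fin d → ℝ) → Fin d → ℝ) (g : Fin d → (Fin d → ℝ) → ℝ)
    (w φ : (Fin d → ℝ) → ℝ) : ℝ :=
  volumeTerm A w φ - faceTerm N (Finset.range (2 ^ N)) (1 / 2) A w φ - boundaryTerm A g w φ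

/-- The time derivative on `[0,T]` (one-sided at the end points). -/
def timeDeriv {d : ℕ} (T : ℝ) (u : ℝ → (Fin d → ℝ) → ℝ) (t : ℝ) (x : Fin d → ℝ) : ℝ :=
  derivWithin (fun s => u s x) (Icc 0 T) t

/-- `(u_h, v_h)` solves on `[0,T]` the semi-discrete central DG scheme with primal space `VP`, dual
space `VD`, parameter `τ = τ_max` and flux forms `FP`, `FD`. -/
structure IsCDGSolution {d : ℕ} (T τ : ℝ) (VP VD : Submodule ℝ ((Fin d → ℝ) → ℝ))
    (FP FD : ℝ → ((Fin d → ℝ) → ℝ) → ((Fin d → ℝ) → ℝ) → ℝ)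
    (uh vh : ℝ → (Fin d → ℝ) → ℝ) : Prop where
  mem_primal : ∀ t ∈ Icc 0 T, uh t ∈ VP
  mem_dual : ∀ t ∈ Icc 0 T, vh t ∈ VD
  diff_primal : ∀ t ∈ Icc 0 T, ∀ x, DifferentiableWithinAt ℝ (fun s => uh s x) (Icc 0 T) t
  diff_dual : ∀ t ∈ Icc 0 T, ∀ x, DifferentiableWithinAt ℝ (fun s => vh s x) (Icc 0 T) t
  eq_primal : ∀ t ∈ Icc 0 T, ∀ φ ∈ VP,
    ∫ x in unitCube d, timeDeriv T uh t x * φ x =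
      1 / τ * (∫ x in unitCube d, (vh t x - uh t x) * φ x) + FP t (vh t) φ
  eq_dual : ∀ t ∈ Icc 0 T, ∀ ψ ∈ VD,
    ∫ x in unitCube d, timeDeriv T vh t x * ψ x =
      1 / τ * (∫ x in unitCube d, (uh t x - vh t x) * ψ x) + FD t (uh t) ψ

/-! ### The continuous problem -/

/-- `f` is `1`-periodic in every coordinate. -/
def IsPeriodic {d : ℕ} {β : Type*} (f : (Fin d → ℝ) → β) : Prop :=
  ∀ i : Fin d, Function.Periodic f (Pi.single i 1)

/-- The coefficient field is `C¹` on `[0,T] × D`. -/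
def IsSmoothField {d : ℕ} (T : ℝ) (D : Set (Fin d → ℝ)) (A : ℝ → (Fin d → ℝ) → Fin d → ℝ) : Prop :=
  ContDiffOn ℝ 1 (fun z : ℝ × (Fin d → ℝ) => A z.1 z.2) (Icc 0 T ×ˢ D)

/-- `u` is a classical solution of `u_t + ∇·(A u) = 0` on `[0,T] × D`. -/
def IsClassicalSolution {d : ℕ} (T : ℝ) (D : Set (Fin d → ℝ)) (A : ℝ → (Fin d → ℝ) → Fin d → ℝ)
    (u : ℝ → (Fin d → ℝ) → ℝ) : Prop :=
  ContDiffOn ℝ 1 (fun z : ℝ × (Fin d → ℝ) => u z.1 z.2) (Icc 0 T ×ˢ D) ∧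
    ∀ t ∈ Ioo 0 T, ∀ x ∈ interior D,
      deriv (fun s => u s x) t + ∑ i, pderiv i (fun y => A t y i * u t y) x = 0

/-- The inflow boundary condition `u = g_i` on the inflow part of the faces `x_i = 0`, `x_i = 1`. -/
def HasInflowData {d : ℕ} (T : ℝ) (A : ℝ → (Fin d → ℝ) → Fin d → ℝ)
    (g : ℝ → Fin d → (Fin d → ℝ) → ℝ) (u : ℝ → (Fin d → ℝ) → ℝ) : Prop :=
  ∀ t ∈ Icc 0 T, ∀ x ∈ unitCube d, ∀ i,
    (x i = 0 ∧ 0 < A t x i) ∨ (x i = 1 ∧ A t x i < 0) → u t x = g t i x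

/-- The `L²(Ω)` norm. -/
def l2Norm {d : ℕ} (f : (Fin d → ℝ) → ℝ) : ℝ≥0∞ := eLpNorm f 2 (volume.restrict (unitCube d))

end SparseCDG

end

/-!
The proof is an energy estimate for the difference between the discrete solution and the `L²`
projections of the exact one, combined with an approximation theorem for sparse grid spaces in
mixed norms.

**Energy estimate.** Let `ξ = P u - u_h` and `ζ = Q u - v_h`, where `P` and `Q` are the `L²`
projections onto the primal and the dual space; both vanish at time `0`. The exact solution
satisfies the equations of the scheme (`integral_mul_eq_hflux`), so half the derivative of
`‖ξ‖² + ‖ζ‖²` consists of the two flux forms evaluated at `(ζ, ξ)` and `(ξ, ζ)`, of the dissipation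
`-τ⁻¹ ‖ξ - ζ‖²` from the coupling term, and of terms linear in the projection errors. Functions on
one mesh are continuous across the interior faces of the other. Integrating by parts along the
coordinate lines, all face terms therefore cancel in the sum of the two flux forms
(`hflux_add_hflux_le`). What remains is `-∫ (div A) ξ ζ` and, with inflow data, a boundary integral of
`-|A · n| ξ ζ ≤ |A · n| (ξ - ζ)² / 4`. By the inverse trace inequality the latter is dominated by the
dissipation as soon as `τ Σ |A_i| ≤ κ h_N` with `κ = 1 / (d · invConst k)` (`couplingConst`,
`flux_sum_le`). Grönwall's inequality concludes (`energy_estimate`); the bound `c₁ h_N ≤ τ` makes the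
projection errors in the coupling term harmless.

**Approximation.** On each cell of a dyadic mesh there is a kernel, polynomial of degree at most `k`
in the first variable, smooth and compactly supported in the cell in the second one, which
reproduces polynomials of degree at most `k`. In contrast to `L²` projections, the difference of the
kernels of two consecutive levels is a derivative of order `q + 1` of a test function
(`dker_eq_deriv`). Hence the hierarchical increments of `u`, which are integrals against tensor
products of such differences, are bounded by box averages of a weak mixed derivative directly from
the definition of weak derivatives, without approximation by smooth functions (`enorm_incr_le`,
`lintegral_incr_sq_le`). The sparse quasi-interpolant sums the increments with `|l|₁ ≤ N`. Its error
is sorted into parts of levels `n ≥ N`, each a piecewise polynomial on the uniform grid of size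
`2^{-(n+1)}` with norm at most a constant times `(n + 1)^d 2^{-n(q+1)}` (`eLpNorm_sparseRes_le`). The
traces and the flux forms of these parts are bounded by the inverse estimate of their own level, at
the price of a factor `2^n`, and `Σ_{n ≥ N} (n + 1)^d 2^{-nq}` is at most a constant times
`N^d 2^{-Nq}` (`sum_level_le`, `MultilevelApprox.exists_bounds`). Best approximation transfers the
estimates to the projections (`MultilevelApprox.proj_bounds`).

**Meshes and representatives.** The primal mesh, the shifted periodic mesh and the shifted mesh
clipped to the unit interval are treated at once, as dyadic meshes with an origin `a` clipped to
`[lo, lo + 1)`. In the periodic case the shifted cell `[a, a + 1)^d` is related to the cube by the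
measure preserving map that reduces coordinates modulo `1`, under which weak derivatives of periodic
functions are invariant (`HasWeakDeriv.ae_add_int`). Discrete functions are right-continuous
representatives on `ℝ^d`, so right limits at faces are values, and only left limits enter the jumps.
-/


section
open MeasureTheory Set Filter Topology
open scoped Polynomial ENNReal
namespace SparseCDG

/-! ### Moment functionals and local polynomial estimates -/

lemma poly_eval_eq_sum {k : ℕ} {p : ℝ[X]} (hp : p.natDegree ≤ k) (x : ℝ) :
    p.eval x = ∑ a ∈ Finset.range (k + 1), p.coeff a * x ^ a :=
  Polynomial.eval_eq_sum_range' (Nat.lt_succ_of_le hp) x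

/-- Functions biorthogonal to the monomials in the span of `y ^ a ρ`, with `ρ` a bump function: the Gram
matrix of the monomials with weight `ρ` is invertible. -/
lemma exists_dual_moments (k : ℕ) : ∃ μ : ℕ → ℝ → ℝ,
    (∀ a, ContDiff ℝ (⊤ : ℕ∞) (μ a)) ∧ (∀ a y, y ∉ Icc (1 / 4 : ℝ) (3 / 4) → μ a y = 0) ∧
    ∀ a ≤ k, ∀ p : ℝ[X], p.natDegree ≤ k → ∫ y, μ a y * p.eval y = p.coeff a := by
  classical
  let ρ : ContDiffBump (1 / 2 : ℝ) := ⟨1 / 8, 1 / 4, by norm_num, by norm_num⟩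
  have hρc : Continuous (ρ : ℝ → ℝ) := ρ.contDiff (n := 0) |>.continuous
  have hρs : HasCompactSupport (ρ : ℝ → ℝ) := ρ.hasCompactSupport
  have hint : ∀ f : ℝ → ℝ, Continuous f → Integrable (fun y => ρ y * f y) := fun f hf =>
    (hρc.mul hf).integrable_of_hasCompactSupport (hρs.mul_right)
  let P : (Fin (k + 1) → ℝ) →ₗ[ℝ] ℝ[X] :=
    { toFun := fun c => ∑ a : Fin (k + 1), Polynomial.monomial (a : ℕ) (c a)
      map_add' := fun c e => by simp [Finset.sum_add_distrib]
      map_smul' := fun r c => by simp [Finset.smul_sum, Polynomial.smul_monomial] }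
  have hPe : ∀ c y, (P c).eval y = ∑ a, c a * y ^ (a : ℕ) := fun c y => by
    simp [P, Polynomial.eval_finsetSum]
  have hPcoeff : ∀ c (a : Fin (k + 1)), (P c).coeff a = c a := fun c a => by
    simp only [P, LinearMap.coe_mk, AddHom.coe_mk, Polynomial.finsetSum_coeff,
      Polynomial.coeff_monomial]
    rw [Finset.sum_eq_single a] <;> simp +contextual [Fin.ext_iff]
  let L : (Fin (k + 1) → ℝ) →ₗ[ℝ] (Fin (k + 1) → ℝ) :=
    { toFun := fun c b => ∫ y, ρ y * ((P c).eval y * y ^ (b : ℕ))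
      map_add' := fun c e => by
        ext b
        simp only [map_add, Polynomial.eval_add, Pi.add_apply]
        rw [← integral_add (hint _ (by fun_prop)) (hint _ (by fun_prop))]
        congr 1; ext y; ring
      map_smul' := fun r c => by
        ext b
        simp only [map_smul, Polynomial.eval_smul, Pi.smul_apply, smul_eq_mul, RingHom.id_apply]
        rw [← integral_const_mul]
        congr 1; ext y; ring }
  have hL : ∀ c b, L c b = ∫ y, ρ y * ((P c).eval y * y ^ (b : ℕ)) := fun _ _ => rfl
  have hsum : ∀ c e, ∑ b, e b * L c b = ∫ y, ρ y * ((P c).eval y * (P e).eval y) := by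
    intro c e
    simp only [hL, ← integral_const_mul]
    rw [← integral_finsetSum _ fun b _ => (hint _ (by fun_prop)).const_mul _]
    congr 1; ext y
    rw [hPe e, Finset.mul_sum, Finset.mul_sum]
    exact Finset.sum_congr rfl fun b _ => by ring
  have hinj : Function.Injective L := by
    rw [← LinearMap.ker_eq_bot, LinearMap.ker_eq_bot']
    intro c hc
    have h0 : ∫ y, ρ y * ((P c).eval y * (P c).eval y) = 0 := by rw [← hsum, hc]; simp
    have hcont : Continuous fun y => ρ y * ((P c).eval y * (P c).eval y) := by fun_prop
    have h1 : (fun y => ρ y * ((P c).eval y * (P c).eval y)) = 0 :=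
      (hcont.ae_eq_iff_eq volume continuous_zero).1 ((integral_eq_zero_iff_of_nonneg
        (fun y => mul_nonneg ρ.nonneg (mul_self_nonneg _))
        (hint _ ((P c).continuous.mul (P c).continuous))).1 h0)
    have hP0 : P c = 0 := by
      refine Polynomial.eq_zero_of_infinite_isRoot _
        ((Ioo_infinite (show (3 / 8 : ℝ) < 5 / 8 by norm_num)).mono fun y hy => ?_)
      have h2 := congrFun h1 y
      have h3 : ρ y ≠ 0 := by
        refine (ρ.pos_of_mem_ball ?_).ne'
        rw [Metric.mem_ball, Real.dist_eq]
        change _ < (1 / 4 : ℝ)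
        rw [abs_lt]
        exact ⟨by linarith [hy.1], by linarith [hy.2]⟩
      simpa [h3] using h2
    ext a
    rw [← hPcoeff c a, hP0]; simp
  have hsurj : Function.Surjective L := LinearMap.injective_iff_surjective.1 hinj
  choose R hR using hsurj
  refine ⟨fun a y => if h : a < k + 1 then ρ y * (P (R (Pi.single ⟨a, h⟩ 1))).eval y else 0,
    fun a => ?_, fun a y hy => ?_, fun a ha p hp => ?_⟩
  · by_cases h : a < k + 1
    · simp only [h, dif_pos]
      exact ρ.contDiff.mul (by simp only [hPe]; fun_prop)
    · simp only [h, dif_neg, not_false_eq_true]; exact contDiff_const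
  · have : ρ y = 0 := by
      refine ρ.zero_of_le_dist ?_
      change (1 / 4 : ℝ) ≤ _
      rw [Real.dist_eq]
      by_contra hlt
      rw [not_le, abs_lt] at hlt
      exact hy ⟨by linarith, by linarith⟩
    simp [this]
  · have h : a < k + 1 := Nat.lt_succ_of_le ha
    simp only [h, dif_pos]
    have hpP : p = P (fun b => p.coeff b) := by
      refine Polynomial.funext fun y => ?_
      rw [poly_eval_eq_sum hp, hPe, Finset.sum_range]
    have := hsum (R (Pi.single ⟨a, h⟩ 1)) (fun b => p.coeff b)
    rw [hR, ← hpP] at this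
    rw [Finset.sum_eq_single ⟨a, h⟩ (fun b _ hb => by simp [hb]) (by simp)] at this
    simp only [Pi.single_eq_same, mul_one] at this
    rw [this]; congr 1; ext y; ring

/-- Smooth functions `μ_0, …, μ_k`, supported in `[1/4, 3/4]`, which return the coefficients of
polynomials of degree at most `k`. -/
noncomputable def dualMoment (k : ℕ) : ℕ → ℝ → ℝ := (exists_dual_moments k).choose

lemma dualMoment_contDiff (k a : ℕ) : ContDiff ℝ (⊤ : ℕ∞) (dualMoment k a) :=
  (exists_dual_moments k).choose_spec.1 a

lemma dualMoment_eq_zero {k a : ℕ} {y : ℝ} (hy : y ∉ Icc (1 / 4 : ℝ) (3 / 4)) :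
    dualMoment k a y = 0 := (exists_dual_moments k).choose_spec.2.1 a y hy

lemma integral_dualMoment {k a : ℕ} (ha : a ≤ k) {p : ℝ[X]} (hp : p.natDegree ≤ k) :
    ∫ y, dualMoment k a y * p.eval y = p.coeff a :=
  (exists_dual_moments k).choose_spec.2.2 a ha p hp

lemma dualMoment_hasCompactSupport (k a : ℕ) : HasCompactSupport (dualMoment k a) :=
  HasCompactSupport.intro isCompact_Icc fun _ hx => dualMoment_eq_zero hx

lemma exists_dualMoment_bound (k : ℕ) :
    ∃ B : ℝ, 0 < B ∧ ∀ a ∈ Finset.range (k + 1), ∀ y, |dualMoment k a y| ≤ B := by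
  choose b hb using fun a => (dualMoment_hasCompactSupport k a).exists_bound_of_continuous
    (dualMoment_contDiff k a).continuous
  refine ⟨1 + ∑ a ∈ Finset.range (k + 1), |b a|, by positivity, fun a ha y => ?_⟩
  have h1 := (hb a y).trans (le_abs_self _)
  have h2 : |b a| ≤ ∑ a ∈ Finset.range (k + 1), |b a| :=
    Finset.single_le_sum (f := fun a => |b a|) (fun _ _ => abs_nonneg _) ha
  rw [Real.norm_eq_abs] at h1
  linarith

/-- A common bound for the functions `μ_0, …, μ_k`. -/
noncomputable def dualMomentBound (k : ℕ) : ℝ := (exists_dualMoment_bound k).choose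

lemma dualMomentBound_pos (k : ℕ) : 0 < dualMomentBound k :=
  (exists_dualMoment_bound k).choose_spec.1

lemma abs_dualMoment_le {k a : ℕ} (ha : a ∈ Finset.range (k + 1)) (y : ℝ) :
    |dualMoment k a y| ≤ dualMomentBound k :=
  (exists_dualMoment_bound k).choose_spec.2 a ha y

lemma sq_coeff_le {k a : ℕ} (ha : a ∈ Finset.range (k + 1)) {p : ℝ[X]} (hp : p.natDegree ≤ k) :
    p.coeff a ^ 2 ≤ dualMomentBound k ^ 2 * ∫ y in (0 : ℝ)..1, p.eval y ^ 2 := by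
  set B := dualMomentBound k
  have hB := dualMomentBound_pos k
  have hc := (dualMoment_contDiff k a).continuous
  have h1 : p.coeff a = ∫ y in (0 : ℝ)..1, dualMoment k a y * p.eval y := by
    rw [← integral_dualMoment (Nat.lt_succ_iff.1 (Finset.mem_range.1 ha)) hp,
      intervalIntegral.integral_of_le zero_le_one]
    refine (setIntegral_eq_integral_of_forall_compl_eq_zero fun y hy => ?_).symm
    rw [dualMoment_eq_zero, zero_mul]
    rintro ⟨h1, h2⟩
    exact hy ⟨by linarith, by linarith⟩
  have h2 : ∫ y in (0 : ℝ)..1, dualMoment k a y ^ 2 ≤ B ^ 2 := by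
    have := intervalIntegral.integral_mono_on (μ := volume) (a := (0 : ℝ)) (b := 1) zero_le_one
      (f := fun y => dualMoment k a y ^ 2) (g := fun _ => B ^ 2)
      ((hc.pow 2).intervalIntegrable _ _) (continuous_const.intervalIntegrable _ _)
      (fun y _ => by
        rw [← sq_abs]; gcongr; exact abs_dualMoment_le ha y)
    simpa using this
  set t := p.coeff a / B ^ 2
  have h3 : 0 ≤ ∫ y in (0 : ℝ)..1, (p.eval y - t * dualMoment k a y) ^ 2 :=
    intervalIntegral.integral_nonneg zero_le_one fun y _ => sq_nonneg _
  have h4 : ∫ y in (0 : ℝ)..1, (p.eval y - t * dualMoment k a y) ^ 2 =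
      (∫ y in (0 : ℝ)..1, p.eval y ^ 2) - 2 * t * p.coeff a +
        t ^ 2 * ∫ y in (0 : ℝ)..1, dualMoment k a y ^ 2 := by
    rw [h1, ← intervalIntegral.integral_const_mul, ← intervalIntegral.integral_const_mul,
      ← intervalIntegral.integral_sub, ← intervalIntegral.integral_add]
    · congr 1; ext y; ring
    all_goals exact Continuous.intervalIntegrable (by fun_prop) _ _
  have h5 : t * B ^ 2 = p.coeff a := div_mul_cancel₀ _ (by positivity)
  have h6 : t ^ 2 * ∫ y in (0 : ℝ)..1, dualMoment k a y ^ 2 ≤ t ^ 2 * B ^ 2 := by gcongr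
  have h7 : 0 ≤ (∫ y in (0 : ℝ)..1, p.eval y ^ 2) - t * p.coeff a := by
    have : t ^ 2 * B ^ 2 = t * p.coeff a := by rw [← h5]; ring
    nlinarith
  calc p.coeff a ^ 2 = B ^ 2 * (t * p.coeff a) := by rw [← h5]; ring
    _ ≤ _ := by gcongr; linarith

/-- The constant in the local inverse estimates for polynomials of degree at most `k`. -/
noncomputable def invConst (k : ℕ) : ℝ := ((k : ℝ) + 1) ^ 4 * dualMomentBound k ^ 2

lemma invConst_pos (k : ℕ) : 0 < invConst k := by
  have := dualMomentBound_pos k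
  unfold invConst; positivity

/-- On the unit interval values and derivatives of a polynomial are controlled by its `L²` norm, since
the coefficients are integrals against the functions `μ_a`. -/
lemma poly_unit_estimate {k : ℕ} {p : ℝ[X]} (hp : p.natDegree ≤ k) {t : ℝ} (ht : t ∈ Icc (0 : ℝ) 1) :
    p.eval t ^ 2 ≤ invConst k * ∫ y in (0 : ℝ)..1, p.eval y ^ 2 ∧
    p.derivative.eval t ^ 2 ≤ invConst k * ∫ y in (0 : ℝ)..1, p.eval y ^ 2 := by
  set I := ∫ y in (0 : ℝ)..1, p.eval y ^ 2
  have hI : 0 ≤ I := intervalIntegral.integral_nonneg zero_le_one fun y _ => sq_nonneg _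
  set B := dualMomentBound k
  have key : ∀ w : ℕ → ℝ, (∀ a ∈ Finset.range (k + 1), |w a| ≤ (k : ℝ) + 1) →
      (∑ a ∈ Finset.range (k + 1), p.coeff a * w a) ^ 2 ≤ invConst k * I := by
    intro w hw
    calc (∑ a ∈ Finset.range (k + 1), p.coeff a * w a) ^ 2
        ≤ (Finset.range (k + 1)).card * ∑ a ∈ Finset.range (k + 1), (p.coeff a * w a) ^ 2 :=
          sq_sum_le_card_mul_sum_sq
      _ ≤ (Finset.range (k + 1)).card * ∑ a ∈ Finset.range (k + 1),
            (B ^ 2 * I) * ((k : ℝ) + 1) ^ 2 := by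
          gcongr with a ha
          rw [mul_pow]
          have h2 : w a ^ 2 ≤ ((k : ℝ) + 1) ^ 2 := by
            rw [← sq_abs]; gcongr; exact hw a ha
          exact mul_le_mul (sq_coeff_le ha hp) h2 (sq_nonneg _) (by positivity)
      _ = invConst k * I := by
          simp only [Finset.card_range, Finset.sum_const, nsmul_eq_mul, invConst]
          push_cast; ring
  constructor
  · rw [poly_eval_eq_sum hp]
    refine key _ fun a _ => ?_
    rw [abs_of_nonneg (pow_nonneg ht.1 _)]
    have := pow_le_one₀ (n := a) ht.1 ht.2
    have : (0 : ℝ) ≤ k := Nat.cast_nonneg _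
    linarith
  · have : p.derivative.eval t =
        ∑ a ∈ Finset.range (k + 1), p.coeff a * ((a : ℝ) * t ^ (a - 1)) := by
      rw [Polynomial.derivative_eval, Polynomial.sum_over_range' _ _ _ (Nat.lt_succ_of_le hp)]
      · exact Finset.sum_congr rfl fun a _ => by ring
      · simp
    rw [this]
    refine key _ fun a ha => ?_
    rw [abs_of_nonneg (mul_nonneg (Nat.cast_nonneg _) (pow_nonneg ht.1 _))]
    have h1 := pow_le_one₀ (n := a - 1) ht.1 ht.2
    have h2 : (a : ℝ) ≤ k := by exact_mod_cast Nat.lt_succ_iff.1 (Finset.mem_range.1 ha)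
    have h3 : (0 : ℝ) ≤ a := Nat.cast_nonneg _
    nlinarith

lemma natDegree_comp_affine_le {k : ℕ} {p : ℝ[X]} (hp : p.natDegree ≤ k) (u v : ℝ) :
    (p.comp (Polynomial.C u * Polynomial.X + Polynomial.C v)).natDegree ≤ k := by
  refine Polynomial.natDegree_comp_le.trans ?_
  have : (Polynomial.C u * Polynomial.X + Polynomial.C v).natDegree ≤ 1 :=
    Polynomial.natDegree_linear_le
  calc _ ≤ k * 1 := Nat.mul_le_mul hp this
    _ = k := mul_one k

/-- Local inverse estimates: values and derivatives of a polynomial on an interval are controlled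
by its mean square. -/
lemma poly_estimate {k : ℕ} {p : ℝ[X]} (hp : p.natDegree ≤ k) {α δ s : ℝ} (hδ : 0 < δ)
    (hs : s ∈ Icc α (α + δ)) :
    p.eval s ^ 2 ≤ invConst k / δ * ∫ y in α..(α + δ), p.eval y ^ 2 ∧
    p.derivative.eval s ^ 2 ≤ invConst k / δ ^ 3 * ∫ y in α..(α + δ), p.eval y ^ 2 := by
  set r := p.comp (Polynomial.C δ * Polynomial.X + Polynomial.C α) with hr
  have hrd : r.natDegree ≤ k := natDegree_comp_affine_le hp _ _
  set t := (s - α) / δ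
  have ht : t ∈ Icc (0 : ℝ) 1 :=
    ⟨div_nonneg (by linarith [hs.1]) hδ.le, (div_le_one hδ).2 (by linarith [hs.2])⟩
  have hst : δ * t + α = s := by simp only [t]; field_simp; ring
  have hre : ∀ y, r.eval y = p.eval (δ * y + α) := fun y => by simp [hr]
  have hint : ∫ y in (0 : ℝ)..1, r.eval y ^ 2 = δ⁻¹ * ∫ y in α..(α + δ), p.eval y ^ 2 := by
    simp only [hre]
    rw [intervalIntegral.integral_comp_mul_add (fun y => p.eval y ^ 2) hδ.ne' α]
    simp [add_comm]
  have hder : r.derivative.eval t = δ * p.derivative.eval s := by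
    simp [hr, Polynomial.derivative_comp, hst]
  obtain ⟨h1, h2⟩ := poly_unit_estimate hrd ht
  rw [hint] at h1 h2
  rw [hre, hst] at h1
  rw [hder] at h2
  refine ⟨h1.trans_eq (by ring), ?_⟩
  have : p.derivative.eval s ^ 2 = (δ ^ 2)⁻¹ * (δ * p.derivative.eval s) ^ 2 := by
    field_simp
  rw [this]
  calc _ ≤ (δ ^ 2)⁻¹ * (invConst k * (δ⁻¹ * ∫ y in α..(α + δ), p.eval y ^ 2)) := by gcongr
    _ = _ := by field_simp

/-! ### Local quasi-interpolation kernels -/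

/-- The kernel of the quasi-interpolation operator onto polynomials of degree at most `k` on the
cell `[α, β]`: smooth and compactly supported inside the cell in `y`, polynomial in `x`. -/
noncomputable def cellKer (k : ℕ) (α β x y : ℝ) : ℝ :=
  (β - α)⁻¹ * ∑ a ∈ Finset.range (k + 1),
    ((x - α) / (β - α)) ^ a * dualMoment k a ((y - α) / (β - α))

/-- The constant in the bound `|cellKer| ≤ kerConst / (β - α)`. -/
noncomputable def kerConst (k : ℕ) : ℝ := ((k : ℝ) + 1) * dualMomentBound k

lemma kerConst_pos (k : ℕ) : 0 < kerConst k := by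
  have := dualMomentBound_pos k
  unfold kerConst; positivity

lemma cellKer_contDiff (k : ℕ) (α β x : ℝ) : ContDiff ℝ (⊤ : ℕ∞) (cellKer k α β x) := by
  unfold cellKer
  refine contDiff_const.mul (ContDiff.sum fun a _ => contDiff_const.mul ?_)
  exact (dualMoment_contDiff k a).comp (by fun_prop)

lemma cellKer_eq_zero {k : ℕ} {α β x y : ℝ} (h : α < β)
    (hy : y ∉ Icc (α + (β - α) / 4) (β - (β - α) / 4)) : cellKer k α β x y = 0 := by
  unfold cellKer
  rw [Finset.sum_eq_zero, mul_zero]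
  intro a _
  rw [dualMoment_eq_zero, mul_zero]
  have hl : 0 < β - α := sub_pos.2 h
  rintro ⟨h1, h2⟩
  rw [le_div_iff₀ hl] at h1
  rw [div_le_iff₀ hl] at h2
  exact hy ⟨by linarith, by linarith⟩

lemma abs_cellKer_le {k : ℕ} {α β x : ℝ} (h : α < β) (hx : x ∈ Icc α β) (y : ℝ) :
    |cellKer k α β x y| ≤ kerConst k / (β - α) := by
  have hl : 0 < β - α := sub_pos.2 h
  unfold cellKer
  rw [abs_mul, abs_of_pos (inv_pos.2 hl), div_eq_inv_mul (kerConst k)]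
  refine mul_le_mul_of_nonneg_left ?_ (inv_pos.2 hl).le
  calc _ ≤ ∑ a ∈ Finset.range (k + 1), |((x - α) / (β - α)) ^ a *
          dualMoment k a ((y - α) / (β - α))| := Finset.abs_sum_le_sum_abs _ _
    _ ≤ ∑ a ∈ Finset.range (k + 1), 1 * dualMomentBound k := by
        gcongr with a ha
        rw [abs_mul]
        gcongr
        · rw [abs_pow]
          refine pow_le_one₀ (abs_nonneg _) ?_
          rw [abs_of_nonneg (div_nonneg (by linarith [hx.1]) hl.le), div_le_one hl]
          linarith [hx.2]
        · exact abs_dualMoment_le ha _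
    _ = kerConst k := by simp [kerConst]

lemma integral_cellKer {k : ℕ} {α β : ℝ} (h : α < β) {p : ℝ[X]} (hp : p.natDegree ≤ k) (x : ℝ) :
    ∫ y, cellKer k α β x y * p.eval y = p.eval x := by
  have hl : 0 < β - α := sub_pos.2 h
  set r := p.comp (Polynomial.C (β - α) * Polynomial.X + Polynomial.C α) with hr
  have hrd : r.natDegree ≤ k := natDegree_comp_affine_le hp _ _
  have hre : ∀ y, r.eval ((y - α) / (β - α)) = p.eval y := fun y => by
    simp [hr]; congr 1; field_simp; ring
  have hI : ∀ a, Integrable fun t => dualMoment k a t * r.eval t := fun a =>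
    (((dualMoment_contDiff k a).continuous.mul r.continuous)).integrable_of_hasCompactSupport
      (dualMoment_hasCompactSupport k a).mul_right
  set F : ℝ → ℝ := fun t => (β - α)⁻¹ * ∑ a ∈ Finset.range (k + 1),
    ((x - α) / (β - α)) ^ a * (dualMoment k a t * r.eval t)
  have h1 : ∀ y, cellKer k α β x y * p.eval y = F ((y - α) / (β - α)) := fun y => by
    simp only [F, cellKer, hre, mul_assoc, Finset.sum_mul]
  simp only [h1]
  rw [integral_sub_right_eq_self (fun y => F (y / (β - α))) α, Measure.integral_comp_div F (β - α)]
  simp only [F]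
  rw [integral_const_mul, integral_finsetSum _ fun a _ => (hI a).const_mul _]
  simp only [integral_const_mul]
  rw [Finset.sum_congr rfl fun a ha => by
    rw [integral_dualMoment (Nat.lt_succ_iff.1 (Finset.mem_range.1 ha)) hrd]]
  rw [abs_of_pos hl, smul_eq_mul, mul_inv_cancel_left₀ hl.ne', ← hre x, poly_eval_eq_sum hrd]
  exact Finset.sum_congr rfl fun a _ => by ring

/-! ### Compactly supported iterated antiderivatives -/

/-- A function with support in `[α, β]` that is orthogonal to the polynomials of degree less than `n` is
the `n`-th derivative of a function with support in `[α, β]`. -/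
lemma exists_compact_antideriv {α β : ℝ} (hαβ : α ≤ β) (n : ℕ) : ∀ (ψ : ℝ → ℝ) (B : ℝ),
    ContDiff ℝ (⊤ : ℕ∞) ψ → (∀ y, y ∉ Icc α β → ψ y = 0) → (∀ y, |ψ y| ≤ B) →
    (∀ p : ℝ[X], p.natDegree < n → ∫ y, ψ y * p.eval y = 0) →
    ∃ G : ℝ → ℝ, ContDiff ℝ (⊤ : ℕ∞) G ∧ (∀ y, y ∉ Icc α β → G y = 0) ∧
      (∀ y, |G y| ≤ B * (β - α) ^ n) ∧ deriv^[n] G = ψ := by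
  induction n with
  | zero => exact fun ψ B h1 h2 h3 _ => ⟨ψ, h1, h2, by simpa using h3, rfl⟩
  | succ n ih =>
    intro ψ B h1 h2 h3 h4
    have hψc := h1.continuous
    have hB : 0 ≤ B := (abs_nonneg _).trans (h3 0)
    set G : ℝ → ℝ := fun y => ∫ t in α..y, ψ t with hG
    have hd : ∀ y, HasDerivAt G (ψ y) y := fun y =>
      intervalIntegral.integral_hasDerivAt_right (hψc.intervalIntegrable _ _)
        (hψc.stronglyMeasurableAtFilter _ _) hψc.continuousAt
    have hdG : deriv G = ψ := funext fun y => (hd y).deriv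
    have hGs : ContDiff ℝ (⊤ : ℕ∞) G :=
      contDiff_infty_iff_deriv.2 ⟨fun y => (hd y).differentiableAt, by rw [hdG]; exact h1⟩
    have hwhole : ∀ (f : ℝ → ℝ), (∀ y, y ∉ Icc α β → f y = 0) → ∫ y, f y = ∫ y in α..β, f y := by
      intro f hf
      rw [intervalIntegral.integral_of_le hαβ, ← integral_Icc_eq_integral_Ioc]
      exact (setIntegral_eq_integral_of_forall_compl_eq_zero hf).symm
    have hGβ : G β = 0 := by
      have := h4 1 (by simp)
      simp only [Polynomial.eval_one, mul_one] at this
      rw [hwhole ψ h2] at this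
      exact this
    have hGz : ∀ y, y ∉ Icc α β → G y = 0 := by
      intro y hy
      rw [mem_Icc, not_and_or, not_le, not_le] at hy
      rcases hy with hy | hy
      · simp only [hG]
        rw [intervalIntegral.integral_zero_ae]
        filter_upwards [compl_mem_ae_iff.2 (measure_singleton α)] with t ht1 ht
        rw [uIoc_of_ge hy.le] at ht
        exact h2 t fun h => ht1 (le_antisymm ht.2 h.1)
      · have : G y = G β + ∫ t in β..y, ψ t := by
          simp only [hG]
          rw [intervalIntegral.integral_add_adjacent_intervals] <;>
            exact hψc.intervalIntegrable _ _
        rw [this, hGβ, zero_add, intervalIntegral.integral_zero_ae]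
        filter_upwards with t ht
        rw [uIoc_of_le hy.le] at ht
        exact h2 t fun h => absurd h.2 (not_le.2 ht.1)
    have hGb : ∀ y, |G y| ≤ B * (β - α) := by
      intro y
      by_cases hy : y ∈ Icc α β
      · have := intervalIntegral.norm_integral_le_of_norm_le_const (a := α) (b := y) (f := ψ)
          (C := B) fun t _ => h3 t
        rw [Real.norm_eq_abs, abs_of_nonneg (sub_nonneg.2 hy.1)] at this
        refine this.trans ?_
        gcongr
        exact hy.2
      · rw [hGz y hy, abs_zero]
        exact mul_nonneg hB (sub_nonneg.2 hαβ)
    have hGm : ∀ p : ℝ[X], p.natDegree < n → ∫ y, G y * p.eval y = 0 := by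
      intro p hp
      obtain ⟨P, hP⟩ : ∃ P : ℝ[X], P.derivative = p ∧ P.natDegree < n + 1 := by
        refine ⟨∑ a ∈ Finset.range n, Polynomial.monomial (a + 1) (p.coeff a / (a + 1)), ?_, ?_⟩
        · conv_rhs => rw [p.as_sum_range' n hp]
          rw [Polynomial.derivative_sum]
          refine Finset.sum_congr rfl fun a _ => ?_
          rw [Polynomial.derivative_monomial]
          congr 1
          push_cast; field_simp
        · refine Nat.lt_succ_of_le (Polynomial.natDegree_sum_le_of_forall_le _ _ fun a ha => ?_)
          exact (Polynomial.natDegree_monomial_le _).trans (Finset.mem_range.1 ha)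
      rw [hwhole _ fun y hy => by rw [hGz y hy, zero_mul]]
      have hibp := intervalIntegral.integral_mul_deriv_eq_deriv_mul (a := α) (b := β)
        (u := G) (v := fun y => P.eval y) (u' := ψ) (v' := fun y => p.eval y)
        (fun y _ => hd y) (fun y _ => by simpa [hP.1] using P.hasDerivAt y)
        (hψc.intervalIntegrable _ _) (p.continuous.intervalIntegrable _ _)
      have hGα : G α = 0 := by simp [hG]
      rw [hibp, hGβ, hGα, ← hwhole _ fun y hy => by rw [h2 y hy, zero_mul], h4 P hP.2]
      simp
    obtain ⟨H, H1, H2, H3, H4⟩ := ih G (B * (β - α)) hGs hGz hGb hGm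
    refine ⟨H, H1, H2, fun y => (H3 y).trans_eq (by ring), ?_⟩
    rw [Function.iterate_succ_apply', H4, hdG]

/-! ### Nested dyadic meshes, clipped to an interval of length one -/

lemma meshSize_pos (n : ℕ) : 0 < meshSize n := by unfold meshSize; positivity

lemma meshSize_succ (n : ℕ) : meshSize (n + 1) = meshSize n / 2 := by
  unfold meshSize; rw [pow_succ]; field_simp

lemma meshSize_le_one (n : ℕ) : meshSize n ≤ 1 := by
  unfold meshSize; exact inv_le_one_of_one_le₀ (one_le_pow₀ one_le_two)

/-- Left end of the `j`-th cell of level `n`: the dyadic mesh with origin `a` is clipped to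
`[lo, lo + 1)`. -/
noncomputable def cellL (a lo : ℝ) (n j : ℕ) : ℝ := max lo (a + j * meshSize n)

/-- Right end of the `j`-th cell of level `n`. -/
noncomputable def cellR (a lo : ℝ) (n j : ℕ) : ℝ := min (lo + 1) (a + (j + 1) * meshSize n)

/-- The index of the level `n` cell containing `x`. -/
noncomputable def cellIdx (a : ℝ) (n : ℕ) (x : ℝ) : ℕ := ⌊(x - a) * 2 ^ n⌋₊

/-- Left end of the level `n` cell containing `x`. -/
noncomputable def lft (a lo : ℝ) (n : ℕ) (x : ℝ) : ℝ := cellL a lo n (cellIdx a n x)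

/-- Right end of the level `n` cell containing `x`. -/
noncomputable def rgt (a lo : ℝ) (n : ℕ) (x : ℝ) : ℝ := cellR a lo n (cellIdx a n x)

/-- The clipped dyadic mesh with origin `a` on `[lo, lo + 1)` is admissible: cells shrink by a
bounded factor from one level to the next. -/
structure IsMesh (a lo : ℝ) : Prop where
  le : a ≤ lo
  le' : lo ≤ a + 1
  ratio : ∀ n, ∀ x ∈ Ico lo (lo + 1),
    rgt a lo n x - lft a lo n x ≤ 4 * (rgt a lo (n + 1) x - lft a lo (n + 1) x)

section mesh
variable {a lo : ℝ} {n : ℕ} {x y : ℝ}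

lemma cellIdx_bounds (h : a ≤ x) (n : ℕ) :
    a + cellIdx a n x * meshSize n ≤ x ∧ x < a + (cellIdx a n x + 1) * meshSize n := by
  have h0 : 0 ≤ (x - a) * 2 ^ n := mul_nonneg (sub_nonneg.2 h) (by positivity)
  have h1 := Nat.floor_le h0
  have h2 := Nat.lt_floor_add_one ((x - a) * 2 ^ n)
  have h3 : (x - a) * 2 ^ n * meshSize n = x - a := by unfold meshSize; field_simp
  have hp := meshSize_pos n
  constructor
  · have := mul_le_mul_of_nonneg_right h1 hp.le
    rw [h3] at this
    unfold cellIdx; linarith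
  · have := mul_lt_mul_of_pos_right h2 hp
    rw [h3] at this
    unfold cellIdx; linarith

lemma cellIdx_eq {j : ℕ} (h1 : a + j * meshSize n ≤ x) (h2 : x < a + (j + 1) * meshSize n) :
    cellIdx a n x = j := by
  have hp := meshSize_pos n
  have h3 : (x - a) * 2 ^ n = (x - a) / meshSize n := by unfold meshSize; field_simp
  unfold cellIdx
  rw [h3, Nat.floor_eq_iff (div_nonneg (by have : 0 ≤ (j : ℝ) * meshSize n := by positivity
                                           linarith) hp.le)]
  rw [le_div_iff₀ hp, div_lt_iff₀ hp]
  constructor <;> linarith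

lemma mem_cell (ha : a ≤ lo) (hx : x ∈ Ico lo (lo + 1)) :
    x ∈ Ico (lft a lo n x) (rgt a lo n x) := by
  obtain ⟨h1, h2⟩ := cellIdx_bounds (ha.trans hx.1) n
  exact ⟨max_le hx.1 h1, lt_min hx.2 h2⟩

lemma lft_lt_rgt (ha : a ≤ lo) (hx : x ∈ Ico lo (lo + 1)) : lft a lo n x < rgt a lo n x :=
  (mem_cell ha hx).1.trans_lt (mem_cell ha hx).2

lemma le_lft : lo ≤ lft a lo n x := le_max_left _ _

lemma rgt_le : rgt a lo n x ≤ lo + 1 := min_le_left _ _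

lemma rgt_sub_lft_le : rgt a lo n x - lft a lo n x ≤ meshSize n := by
  have h1 : rgt a lo n x ≤ a + (cellIdx a n x + 1) * meshSize n := min_le_right _ _
  have h2 : a + cellIdx a n x * meshSize n ≤ lft a lo n x := le_max_right _ _
  linarith

lemma cellIdx_eq_of_mem_cell {j : ℕ} (hy : y ∈ Ico (cellL a lo n j) (cellR a lo n j)) :
    cellIdx a n y = j :=
  cellIdx_eq ((le_max_right _ _).trans hy.1) (hy.2.trans_le (min_le_right _ _))

lemma mem_Ico_of_mem_cell {j : ℕ} (hy : y ∈ Ico (cellL a lo n j) (cellR a lo n j)) :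
    y ∈ Ico lo (lo + 1) :=
  ⟨(le_max_left _ _).trans hy.1, hy.2.trans_le (min_le_left _ _)⟩

lemma cellIdx_lt (h : a ≤ lo) (h' : lo ≤ a + 1) (hx : x ∈ Ico lo (lo + 1)) :
    cellIdx a n x < 2 ^ (n + 1) := by
  obtain ⟨h1, -⟩ := cellIdx_bounds (h.trans hx.1) n
  have h2 : (cellIdx a n x : ℝ) * meshSize n < 2 := by linarith [hx.2]
  have h3 : (cellIdx a n x : ℝ) < 2 ^ (n + 1) := by
    unfold meshSize at h2
    rw [← div_eq_mul_inv, div_lt_iff₀ (by positivity)] at h2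
    rw [pow_succ]; linarith
  exact_mod_cast h3

lemma cellIdx_succ (n : ℕ) (x : ℝ) : cellIdx a n x = cellIdx a (n + 1) x / 2 := by
  unfold cellIdx
  rw [← Nat.floor_div_ofNat]
  congr 1
  rw [pow_succ]; field_simp

lemma cell_nested : lft a lo n x ≤ lft a lo (n + 1) x ∧ rgt a lo (n + 1) x ≤ rgt a lo n x := by
  have h := cellIdx_succ (a := a) n x
  have h1 : cellIdx a n x * 2 ≤ cellIdx a (n + 1) x := by rw [h]; exact Nat.div_mul_le_self _ _
  have h2 : cellIdx a (n + 1) x + 1 ≤ (cellIdx a n x + 1) * 2 := by omega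
  have h1' : (cellIdx a n x : ℝ) * 2 ≤ cellIdx a (n + 1) x := by exact_mod_cast h1
  have h2' : (cellIdx a (n + 1) x : ℝ) + 1 ≤ (cellIdx a n x + 1) * 2 := by exact_mod_cast h2
  have hp := meshSize_pos n
  unfold lft rgt cellL cellR
  rw [meshSize_succ]
  constructor
  · refine max_le_max le_rfl ?_
    nlinarith
  · refine min_le_min le_rfl ?_
    nlinarith

lemma measurable_cellIdx (a : ℝ) (n : ℕ) : Measurable (cellIdx a n) :=
  Nat.measurable_floor.comp (by fun_prop)

lemma measurable_lft (a lo : ℝ) (n : ℕ) : Measurable (lft a lo n) :=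
  (measurable_from_nat (f := cellL a lo n)).comp (measurable_cellIdx a n)

lemma measurable_rgt (a lo : ℝ) (n : ℕ) : Measurable (rgt a lo n) :=
  (measurable_from_nat (f := cellR a lo n)).comp (measurable_cellIdx a n)

lemma cell_eq_of_mem (hy : y ∈ Ico (lft a lo n x) (rgt a lo n x)) :
    lft a lo n y = lft a lo n x ∧ rgt a lo n y = rgt a lo n x := by
  have := cellIdx_eq_of_mem_cell hy
  unfold lft rgt
  rw [this]; exact ⟨rfl, rfl⟩

end mesh

/-! ### Quasi-interpolation kernels and their increments -/

/-- The kernel of the quasi-interpolation operator of level `n`. -/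
noncomputable def ker (k : ℕ) (a lo : ℝ) (n : ℕ) (x y : ℝ) : ℝ :=
  (Ico lo (lo + 1)).indicator (fun x => cellKer k (lft a lo n x) (rgt a lo n x) x y) x

/-- The increments of the quasi-interpolation kernels between consecutive levels. -/
noncomputable def dker (k : ℕ) (a lo : ℝ) : ℕ → ℝ → ℝ → ℝ
  | 0 => ker k a lo 0
  | n + 1 => fun x y => ker k a lo (n + 1) x y - ker k a lo n x y

section kernels
variable {k : ℕ} {a lo : ℝ} {n : ℕ} {x y : ℝ}

lemma ker_of_mem (hx : x ∈ Ico lo (lo + 1)) :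
    ker k a lo n x = cellKer k (lft a lo n x) (rgt a lo n x) x := by
  ext y; simp [ker, hx]

lemma ker_of_notMem (hx : x ∉ Ico lo (lo + 1)) : ker k a lo n x = 0 := by
  ext y; simp [ker, hx]

lemma sum_dker (n : ℕ) (x y : ℝ) :
    ∑ l ∈ Finset.range (n + 1), dker k a lo l x y = ker k a lo n x y := by
  induction n with
  | zero => simp [dker]
  | succ n ih => rw [Finset.sum_range_succ, ih]; simp [dker]

lemma ker_contDiff (k : ℕ) (a lo : ℝ) (n : ℕ) (x : ℝ) :
    ContDiff ℝ (⊤ : ℕ∞) (ker k a lo n x) := by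
  by_cases hx : x ∈ Ico lo (lo + 1)
  · rw [ker_of_mem hx]; exact cellKer_contDiff _ _ _ _
  · rw [ker_of_notMem hx]; exact contDiff_const

lemma dker_contDiff (k : ℕ) (a lo : ℝ) (n : ℕ) (x : ℝ) :
    ContDiff ℝ (⊤ : ℕ∞) (dker k a lo n x) := by
  cases n with
  | zero => exact ker_contDiff k a lo 0 x
  | succ n => exact (ker_contDiff k a lo (n + 1) x).sub (ker_contDiff k a lo n x)

lemma ker_eq_zero (ha : a ≤ lo) (hy : y ∉ Ioo (lft a lo n x) (rgt a lo n x)) :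
    ker k a lo n x y = 0 := by
  by_cases hx : x ∈ Ico lo (lo + 1)
  · rw [ker_of_mem hx]
    have h := lft_lt_rgt (n := n) ha hx
    exact cellKer_eq_zero h fun h' => hy ⟨by linarith [h'.1], by linarith [h'.2]⟩
  · rw [ker_of_notMem hx]; rfl

lemma ker_eq_zero' (ha : a ≤ lo) (hy : y ∉ Ioo lo (lo + 1)) : ker k a lo n x y = 0 :=
  ker_eq_zero ha fun h => hy ⟨le_lft.trans_lt h.1, h.2.trans_le rgt_le⟩

lemma dker_eq_zero' (ha : a ≤ lo) (hy : y ∉ Ioo lo (lo + 1)) : dker k a lo n x y = 0 := by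
  cases n with
  | zero => exact ker_eq_zero' ha hy
  | succ n => simp [dker, ker_eq_zero' ha hy]

lemma integral_ker (ha : a ≤ lo) (hx : x ∈ Ico lo (lo + 1)) {p : ℝ[X]} (hp : p.natDegree ≤ k) :
    ∫ y, ker k a lo n x y * p.eval y = p.eval x := by
  rw [ker_of_mem hx]; exact integral_cellKer (lft_lt_rgt ha hx) hp x

lemma abs_ker_le (ha : a ≤ lo) (hx : x ∈ Ico lo (lo + 1)) (y : ℝ) :
    |ker k a lo n x y| ≤ kerConst k / (rgt a lo n x - lft a lo n x) := by
  rw [ker_of_mem hx]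
  exact abs_cellKer_le (lft_lt_rgt ha hx) (Ico_subset_Icc_self (mem_cell ha hx)) y

lemma ker_hasCompactSupport (ha : a ≤ lo) : HasCompactSupport (ker k a lo n x) :=
  HasCompactSupport.intro (isCompact_Icc (a := lo) (b := lo + 1)) fun _ h =>
    ker_eq_zero' ha fun h' => h (Ioo_subset_Icc_self h')

/-- The increment kernel of level `n ≥ 1` is a derivative of order `q + 1` of a test function
supported in the cell of level `n - 1`, of size `h^q`; this encodes the approximation order. -/
lemma dker_eq_deriv (hm : IsMesh a lo) {q : ℕ} (hq : q ≤ k) (hx : x ∈ Ico lo (lo + 1)) (n : ℕ) :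
    ∃ G : ℝ → ℝ, ContDiff ℝ (⊤ : ℕ∞) G ∧ HasCompactSupport G ∧
      tsupport G ⊆ Ioo lo (lo + 1) ∧
      (∀ y, |G y| ≤ 5 * kerConst k * 2 ^ (q + 1) * meshSize n ^ (q + 1) *
        (Ico (lft a lo (n - 1) x) (rgt a lo (n - 1) x)).indicator
          (fun _ => (rgt a lo (n - 1) x - lft a lo (n - 1) x)⁻¹) y) ∧
      deriv^[if n ≠ 0 then q + 1 else 0] G = dker k a lo n x := by
  have hK := kerConst_pos k
  cases n with
  | zero =>
    have hl := lft_lt_rgt (n := 0) hm.le hx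
    set α := lft a lo 0 x
    set β := rgt a lo 0 x
    have hlo : lo ≤ α := le_lft
    have hro : β ≤ lo + 1 := rgt_le
    have hz : ∀ y, y ∉ Icc (α + (β - α) / 4) (β - (β - α) / 4) → ker k a lo 0 x y = 0 := by
      intro y hy; rw [ker_of_mem hx]; exact cellKer_eq_zero hl hy
    refine ⟨ker k a lo 0 x, ker_contDiff _ _ _ _ _, HasCompactSupport.intro isCompact_Icc hz,
      ?_, fun y => ?_, rfl⟩
    · refine (closure_minimal (fun y hy => ?_) isClosed_Icc).trans
        (Icc_subset_Ioo (a₁ := α + (β - α) / 4) (b₁ := β - (β - α) / 4) (by linarith)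
          (by linarith))
      by_contra h
      exact hy (hz y h)
    · by_cases hy : y ∈ Ico α β
      · simp only [meshSize, pow_zero, inv_one, one_pow, mul_one]
        rw [indicator_of_mem hy]
        refine (abs_ker_le hm.le hx y).trans ?_
        rw [div_eq_mul_inv]
        have : (0 : ℝ) ≤ (β - α)⁻¹ := (inv_pos.2 (sub_pos.2 hl)).le
        refine mul_le_mul_of_nonneg_right ?_ this
        have : (1 : ℝ) ≤ 2 ^ (q + 1) := one_le_pow₀ one_le_two
        nlinarith
      · rw [indicator_of_notMem hy, ker_eq_zero hm.le fun h => hy (Ioo_subset_Ico_self h)]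
        simp
  | succ n =>
    have hl := lft_lt_rgt (n := n) hm.le hx
    have hl' := lft_lt_rgt (n := n + 1) hm.le hx
    have hr := hm.ratio n x hx
    obtain ⟨hn1, hn2⟩ := cell_nested (a := a) (lo := lo) (n := n) (x := x)
    have hw : rgt a lo n x - lft a lo n x ≤ meshSize n := rgt_sub_lft_le
    have hk := abs_ker_le (k := k) (n := n) hm.le hx
    have hk' := abs_ker_le (k := k) (n := n + 1) hm.le hx
    have hlo : lo ≤ lft a lo n x := le_lft
    have hro : rgt a lo n x ≤ lo + 1 := rgt_le
    have hz : ∀ y, y ∉ Icc (lft a lo n x + (rgt a lo n x - lft a lo n x) / 4)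
        (rgt a lo n x - (rgt a lo n x - lft a lo n x) / 4) → ker k a lo n x y = 0 := by
      intro y hy; rw [ker_of_mem hx]; exact cellKer_eq_zero hl hy
    have hz' : ∀ y, y ∉ Icc (lft a lo (n + 1) x + (rgt a lo (n + 1) x - lft a lo (n + 1) x) / 4)
        (rgt a lo (n + 1) x - (rgt a lo (n + 1) x - lft a lo (n + 1) x) / 4) →
        ker k a lo (n + 1) x y = 0 := by
      intro y hy; rw [ker_of_mem hx]; exact cellKer_eq_zero hl' hy
    simp only [Nat.add_sub_cancel, ne_eq, Nat.add_eq_zero_iff, one_ne_zero, and_false,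
      not_false_eq_true, if_true]
    set α := lft a lo n x
    set β := rgt a lo n x
    set α' := lft a lo (n + 1) x
    set β' := rgt a lo (n + 1) x
    -- `[γ, ε]` contains the supports of both kernels and lies in the interior of the coarser cell
    set γ := min (α + (β - α) / 4) (α' + (β' - α') / 4) with hγ
    set ε := max (β - (β - α) / 4) (β' - (β' - α') / 4) with hε
    have hγ1 : α < γ := lt_min (by linarith) (by linarith)
    have hε1 : ε < β := max_lt (by linarith) (by linarith)
    have hγ2 : γ ≤ α + (β - α) / 4 := min_le_left _ _
    have hγ3 : γ ≤ α' + (β' - α') / 4 := min_le_right _ _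
    have hε2 : β - (β - α) / 4 ≤ ε := le_max_left _ _
    have hε3 : β' - (β' - α') / 4 ≤ ε := le_max_right _ _
    have hγε : γ ≤ ε := by linarith
    have hzd : ∀ y, y ∉ Icc γ ε → dker k a lo (n + 1) x y = 0 := by
      intro y hy
      simp only [dker]
      rw [hz y fun h => hy ⟨hγ2.trans h.1, h.2.trans hε2⟩,
        hz' y fun h => hy ⟨hγ3.trans h.1, h.2.trans hε3⟩, sub_zero]
    -- a cell is at most four times as long as its subcells, whence `5 = 4 + 1`
    have hbd : ∀ y, |dker k a lo (n + 1) x y| ≤ 5 * kerConst k / (β - α) := by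
      intro y
      simp only [dker]
      refine (abs_sub _ _).trans ((add_le_add (hk' y) (hk y)).trans ?_)
      have h1 : kerConst k / (β' - α') ≤ 4 * kerConst k / (β - α) := by
        rw [div_le_div_iff₀ (by linarith) (by linarith)]
        nlinarith
      calc _ ≤ 4 * kerConst k / (β - α) + kerConst k / (β - α) := by gcongr
        _ = _ := by ring
    have hint : ∀ (m : ℕ) (p : ℝ[X]), Integrable fun y => ker k a lo m x y * p.eval y :=
      fun m p => ((ker_contDiff _ _ _ _ _).continuous.mul p.continuous).integrable_of_hasCompactSupport
        (ker_hasCompactSupport hm.le).mul_right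
    -- both kernels reproduce polynomials, so the moments of the increment vanish
    have hmom : ∀ p : ℝ[X], p.natDegree < q + 1 → ∫ y, dker k a lo (n + 1) x y * p.eval y = 0 := by
      intro p hp
      have hp' : p.natDegree ≤ k := by omega
      simp only [dker, sub_mul]
      rw [integral_sub (hint _ p) (hint _ p), integral_ker hm.le hx hp', integral_ker hm.le hx hp',
        sub_self]
    obtain ⟨G, H1, H2, H3, H4⟩ := exists_compact_antideriv hγε (q + 1) _ _
      (dker_contDiff k a lo (n + 1) x) hzd hbd hmom
    refine ⟨G, H1, HasCompactSupport.intro isCompact_Icc H2, ?_, fun y => ?_, H4⟩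
    · refine (closure_minimal (fun y hy => ?_) isClosed_Icc).trans
        (Icc_subset_Ioo (a₁ := γ) (b₁ := ε) (by linarith) (by linarith))
      by_contra h
      exact hy (H2 y h)
    · by_cases hy : y ∈ Ico α β
      · rw [indicator_of_mem hy]
        refine (H3 y).trans ?_
        have h1 : (ε - γ) ^ (q + 1) ≤ (meshSize n) ^ (q + 1) := by
          gcongr
          linarith
        have h2 : meshSize n = 2 * meshSize (n + 1) := by rw [meshSize_succ]; ring
        rw [h2, mul_pow] at h1
        have h3 : 0 ≤ 5 * kerConst k / (β - α) := div_nonneg (by positivity) (by linarith)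
        calc _ ≤ 5 * kerConst k / (β - α) * (2 ^ (q + 1) * meshSize (n + 1) ^ (q + 1)) := by gcongr
          _ = _ := by ring
      · rw [indicator_of_notMem hy, H2 y fun h => hy ⟨by linarith [h.1], by linarith [h.2]⟩]
        simp

end kernels

/-! ### Mixed derivatives of products, and averages over boxes -/

section mixed
variable {d : ℕ}

lemma prod_update_apply (f : Fin d → ℝ → ℝ) (i : Fin d) (g : ℝ → ℝ) (y : Fin d → ℝ) :
    ∏ j, Function.update f i g j (y j) = g (y i) * ∏ j ∈ Finset.univ.erase i, f j (y j) := by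
  rw [← Finset.mul_prod_erase _ _ (Finset.mem_univ i), Function.update_self]
  congr 1
  refine Finset.prod_congr rfl fun j hj => ?_
  rw [Function.update_of_ne (Finset.ne_of_mem_erase hj)]

lemma pderiv_prod (f : Fin d → ℝ → ℝ) (i : Fin d) (hf : Differentiable ℝ (f i)) :
    pderiv i (fun y => ∏ j, f j (y j)) = fun y => ∏ j, Function.update f i (deriv (f i)) j (y j) := by
  ext y
  rw [prod_update_apply]
  unfold pderiv lineDeriv
  have h : (fun t : ℝ => ∏ j, f j ((y + t • Pi.single i (1 : ℝ) : Fin d → ℝ) j)) =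
      fun t => f i (y i + t) * ∏ j ∈ Finset.univ.erase i, f j (y j) := by
    ext t
    rw [← Finset.mul_prod_erase _ _ (Finset.mem_univ i)]
    congr 1
    · simp
    · refine Finset.prod_congr rfl fun j hj => ?_
      simp [Pi.single_eq_of_ne (Finset.ne_of_mem_erase hj)]
  rw [h, deriv_mul_const (by fun_prop), deriv_comp_const_add]
  simp

lemma iterate_pderiv_prod (f : Fin d → ℝ → ℝ) (i : Fin d) (hf : ContDiff ℝ (⊤ : ℕ∞) (f i)) (n : ℕ) :
    (pderiv i)^[n] (fun y => ∏ j, f j (y j)) =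
      fun y => ∏ j, Function.update f i (deriv^[n] (f i)) j (y j) := by
  induction n with
  | zero => simp
  | succ n ih =>
    rw [Function.iterate_succ_apply', ih, pderiv_prod]
    · simp only [Function.update_self, Function.update_idem, Function.iterate_succ_apply']
    · rw [Function.update_self]
      exact (hf.iterate_deriv n).differentiable (by simp)

/-- The mixed derivative of a tensor product of smooth functions. -/
lemma mixedDeriv_prod (f : Fin d → ℝ → ℝ) (hf : ∀ i, ContDiff ℝ (⊤ : ℕ∞) (f i)) (α : Fin d → ℕ) :
    mixedDeriv α (fun y => ∏ j, f j (y j)) = fun y => ∏ j, deriv^[α j] (f j) (y j) := by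
  classical
  have key : ∀ L : List (Fin d), L.Nodup →
      L.foldr (fun i g => (pderiv i)^[α i] g) (fun y => ∏ j, f j (y j)) =
        fun y => ∏ j, (if j ∈ L then deriv^[α j] (f j) else f j) (y j) := by
    intro L
    induction L with
    | nil => simp
    | cons i L ih =>
      intro hn
      rw [List.nodup_cons] at hn
      rw [List.foldr_cons, ih hn.2,
        iterate_pderiv_prod (fun j => if j ∈ L then deriv^[α j] (f j) else f j) i]
      · ext y
        refine Finset.prod_congr rfl fun j _ => ?_
        by_cases hj : j = i
        · subst hj; simp [hn.1]
        · simp [hj]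
      · simp only [hn.1, if_false]; exact hf i
  unfold mixedDeriv
  rw [key _ (List.nodup_finRange d)]
  simp

end mixed

/-- A symmetric kernel with row integrals at most one is a contraction of `L²`. -/
lemma lintegral_sq_kernel_le {X : Type*} [MeasurableSpace X] {ν : Measure X} [SFinite ν]
    {κ : X → X → ℝ≥0∞} (hκ : Measurable fun p : X × X => κ p.1 p.2) {S : Set X} (hS : MeasurableSet S)
    (hsymm : ∀ x ∈ S, ∀ y ∈ S, κ x y = κ y x) (hone : ∀ x ∈ S, ∫⁻ y in S, κ x y ∂ν ≤ 1)
    {g : X → ℝ≥0∞} (hg : AEMeasurable g (ν.restrict S)) :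
    ∫⁻ x in S, (∫⁻ y in S, κ x y * g y ∂ν) ^ 2 ∂ν ≤ ∫⁻ y in S, g y ^ 2 ∂ν := by
  have hrow : ∀ x, Measurable (κ x) := fun x => hκ.comp measurable_prodMk_left
  have h1 : ∀ x ∈ S, (∫⁻ y in S, κ x y * g y ∂ν) ^ 2 ≤ ∫⁻ y in S, κ x y * g y ^ 2 ∂ν := by
    intro x hx
    have hH := ENNReal.lintegral_mul_le_Lp_mul_Lq (ν.restrict S)
      (Real.HolderConjugate.two_two) (f := fun y => κ x y ^ (1 / 2 : ℝ))
      (g := fun y => κ x y ^ (1 / 2 : ℝ) * g y) ((hrow x).pow_const _).aemeasurable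
      (((hrow x).pow_const _).aemeasurable.mul hg)
    have e0 : ∀ y, κ x y ^ (1 / 2 : ℝ) * κ x y ^ (1 / 2 : ℝ) = κ x y := fun y => by
      rw [← ENNReal.rpow_add_of_nonneg _ _ (by norm_num) (by norm_num)]; norm_num
    have e1 : ∀ y, ((fun y => κ x y ^ (1 / 2 : ℝ)) * fun y => κ x y ^ (1 / 2 : ℝ) * g y) y =
        κ x y * g y := fun y => by
      simp only [Pi.mul_apply]; rw [← mul_assoc, e0]
    have e2 : ∀ y, (κ x y ^ (1 / 2 : ℝ)) ^ (2 : ℝ) = κ x y := fun y => by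
      rw [← ENNReal.rpow_mul]; norm_num
    have e3 : ∀ y, (κ x y ^ (1 / 2 : ℝ) * g y) ^ (2 : ℝ) = κ x y * g y ^ 2 := fun y => by
      rw [ENNReal.mul_rpow_of_nonneg _ _ (by norm_num), e2, ENNReal.rpow_two]
    simp only [e1, e2, e3] at hH
    calc (∫⁻ y in S, κ x y * g y ∂ν) ^ 2
        ≤ ((∫⁻ y in S, κ x y ∂ν) ^ (1 / 2 : ℝ) * (∫⁻ y in S, κ x y * g y ^ 2 ∂ν) ^ (1 / 2 : ℝ)) ^ 2 := by
          gcongr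
      _ = (∫⁻ y in S, κ x y ∂ν) * ∫⁻ y in S, κ x y * g y ^ 2 ∂ν := by
          rw [mul_pow, ← ENNReal.rpow_two, ← ENNReal.rpow_two, ← ENNReal.rpow_mul,
            ← ENNReal.rpow_mul]; norm_num
      _ ≤ 1 * ∫⁻ y in S, κ x y * g y ^ 2 ∂ν := by gcongr; exact hone x hx
      _ = _ := one_mul _
  calc ∫⁻ x in S, (∫⁻ y in S, κ x y * g y ∂ν) ^ 2 ∂ν
      ≤ ∫⁻ x in S, ∫⁻ y in S, κ x y * g y ^ 2 ∂ν ∂ν := setLIntegral_mono' hS h1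
    _ = ∫⁻ y in S, ∫⁻ x in S, κ x y * g y ^ 2 ∂ν ∂ν := by
        refine lintegral_lintegral_swap (f := fun x y => κ x y * g y ^ 2) ?_
        exact hκ.aemeasurable.mul ((hg.pow_const 2).comp_quasiMeasurePreserving
          Measure.quasiMeasurePreserving_snd)
    _ ≤ ∫⁻ y in S, g y ^ 2 ∂ν := by
        refine setLIntegral_mono' hS fun y hy => ?_
        have hcol : Measurable fun x => κ x y := hκ.comp measurable_prodMk_right
        rw [lintegral_mul_const _ hcol, setLIntegral_congr_fun hS fun x hx => hsymm x hx y hy]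
        calc _ ≤ 1 * g y ^ 2 := by gcongr; exact hone y hy
          _ = _ := one_mul _

/-- The half-open cube `[lo, lo + 1)^d`. -/
def box (d : ℕ) (lo : ℝ) : Set (Fin d → ℝ) := pi univ fun _ => Ico lo (lo + 1)

lemma measurableSet_box (d : ℕ) (lo : ℝ) : MeasurableSet (box d lo) :=
  MeasurableSet.univ_pi fun _ => measurableSet_Ico

/-- The kernel of the averaging operator over the cells of level `n`. -/
noncomputable def avgKer (a lo : ℝ) (n : ℕ) (x y : ℝ) : ℝ≥0∞ :=
  (Ico (lft a lo n x) (rgt a lo n x)).indicator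
    (fun _ => ENNReal.ofReal (rgt a lo n x - lft a lo n x)⁻¹) y

/-- The kernel of the averaging operator over products of cells of levels `l_1, …, l_d`. -/
noncomputable def boxKer {d : ℕ} (a lo : ℝ) (l : Fin d → ℕ) (x y : Fin d → ℝ) : ℝ≥0∞ :=
  ∏ i, avgKer a lo (l i) (x i) (y i)

section average
variable {d : ℕ} {a lo : ℝ}

lemma measurable_avgKer (a lo : ℝ) (n : ℕ) :
    Measurable fun p : ℝ × ℝ => avgKer a lo n p.1 p.2 := by
  classical
  have hl : Measurable fun p : ℝ × ℝ => lft a lo n p.1 := (measurable_lft a lo n).comp measurable_fst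
  have hr : Measurable fun p : ℝ × ℝ => rgt a lo n p.1 := (measurable_rgt a lo n).comp measurable_fst
  simp only [avgKer, indicator_apply]
  exact Measurable.ite ((measurableSet_le hl measurable_snd).inter
    (measurableSet_lt measurable_snd hr)) (hr.sub hl).inv.ennreal_ofReal measurable_const

lemma measurable_boxKer (a lo : ℝ) (l : Fin d → ℕ) :
    Measurable fun p : (Fin d → ℝ) × (Fin d → ℝ) => boxKer a lo l p.1 p.2 := by
  simp only [boxKer]
  refine Finset.measurable_prod _ fun i _ => ?_
  have h : Measurable fun p : (Fin d → ℝ) × (Fin d → ℝ) => (p.1 i, p.2 i) := by fun_prop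
  have h' := (measurable_avgKer a lo (l i)).comp h
  exact h'

lemma avgKer_symm (ha : a ≤ lo) {n : ℕ} {x y : ℝ} (hx : x ∈ Ico lo (lo + 1))
    (hy : y ∈ Ico lo (lo + 1)) : avgKer a lo n x y = avgKer a lo n y x := by
  have key : ∀ {x y : ℝ}, x ∈ Ico lo (lo + 1) → y ∈ Ico (lft a lo n x) (rgt a lo n x) →
      x ∈ Ico (lft a lo n y) (rgt a lo n y) := by
    intro x y hx hxy
    obtain ⟨h1, h2⟩ := cell_eq_of_mem hxy
    rw [h1, h2]; exact mem_cell ha hx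
  unfold avgKer
  by_cases h : y ∈ Ico (lft a lo n x) (rgt a lo n x)
  · have h' := key hx h
    obtain ⟨h1, h2⟩ := cell_eq_of_mem h
    rw [indicator_of_mem h, indicator_of_mem h', h1, h2]
  · rw [indicator_of_notMem h, indicator_of_notMem fun h' => h (key hy h')]

lemma lintegral_boxKer_le (ha : a ≤ lo) (l : Fin d → ℕ) {x : Fin d → ℝ} (hx : x ∈ box d lo) :
    ∫⁻ y in box d lo, boxKer a lo l x y ≤ 1 := by
  set c : Fin d → ℝ := fun i => rgt a lo (l i) (x i) - lft a lo (l i) (x i)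
  have hc : ∀ i, 0 < c i := fun i => sub_pos.2 (lft_lt_rgt ha (hx i trivial))
  have h : ∀ y, boxKer a lo l x y ≤
      (pi univ fun i => Ico (lft a lo (l i) (x i)) (rgt a lo (l i) (x i))).indicator
        (fun _ => ∏ i, ENNReal.ofReal (c i)⁻¹) y := by
    intro y
    by_cases hy : y ∈ pi univ fun i => Ico (lft a lo (l i) (x i)) (rgt a lo (l i) (x i))
    · rw [indicator_of_mem hy]
      refine Finset.prod_le_prod' fun i _ => ?_
      rw [avgKer, indicator_of_mem (hy i trivial)]
    · have : ∃ i, ¬ y i ∈ Ico (lft a lo (l i) (x i)) (rgt a lo (l i) (x i)) := by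
        by_contra h; push Not at h; exact hy fun i _ => h i
      obtain ⟨i, hi⟩ := this
      rw [indicator_of_notMem hy, boxKer, Finset.prod_eq_zero (Finset.mem_univ i)]
      rw [avgKer, indicator_of_notMem hi]
  calc ∫⁻ y in box d lo, boxKer a lo l x y ≤ ∫⁻ y, boxKer a lo l x y := setLIntegral_le_lintegral _ _
    _ ≤ _ := lintegral_mono h
    _ = 1 := by
      rw [lintegral_indicator (MeasurableSet.univ_pi fun _ => measurableSet_Ico),
        setLIntegral_const, Real.volume_pi_Ico, ← Finset.prod_mul_distrib]
      refine Finset.prod_eq_one fun i _ => ?_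
      rw [← ENNReal.ofReal_mul (inv_nonneg.2 (hc i).le), inv_mul_cancel₀ (hc i).ne',
        ENNReal.ofReal_one]

end average

/-! ### Increments of the sparse quasi-interpolant -/

/-- The hierarchical increment of `u` of multi-level `l`. -/
noncomputable def incr {d : ℕ} (k : ℕ) (a lo : ℝ) (l : Fin d → ℕ) (u : (Fin d → ℝ) → ℝ)
    (x : Fin d → ℝ) : ℝ :=
  ∫ y, u y * ∏ i, dker k a lo (l i) (x i) (y i)

/-- The constant in the bound for hierarchical increments. -/
noncomputable def incrConst (k q : ℕ) : ℝ := 5 * kerConst k * 2 ^ (q + 1)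

lemma incrConst_pos (k q : ℕ) : 0 < incrConst k q := by
  have := kerConst_pos k
  unfold incrConst; positivity

section increments
variable {d k : ℕ} {a lo : ℝ}

/-- The mixed derivative order attached to a multi-level: `q + 1` in each refined direction. -/
def levelOrder (q : ℕ) (l : Fin d → ℕ) : Fin d → ℕ :=
  fun i => if i ∈ Finset.univ.filter (fun i => l i ≠ 0) then q + 1 else 0

/-- Pointwise bound of an increment by box averages of a weak mixed derivative: the kernel of the
increment is a mixed derivative of a test function. -/
lemma enorm_incr_le (hm : IsMesh a lo) {q : ℕ} (hq : q ≤ k) {U : Set (Fin d → ℝ)}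
    (hU : (pi univ fun _ => Ioo lo (lo + 1)) ⊆ U) (l : Fin d → ℕ) {u w : (Fin d → ℝ) → ℝ}
    (hw : HasWeakDeriv U (levelOrder q l) u w) {x : Fin d → ℝ} (hx : x ∈ box d lo) :
    ‖incr k a lo l u x‖ₑ ≤ ENNReal.ofReal (∏ i, (incrConst k q * meshSize (l i) ^ (q + 1))) *
      ∫⁻ y in box d lo, boxKer a lo (fun i => l i - 1) x y * ‖w y‖ₑ := by
  choose G hG1 hG2 hG3 hG4 hG5 using fun i => dker_eq_deriv hm hq (hx i trivial) (l i)
  set φ : (Fin d → ℝ) → ℝ := fun y => ∏ i, G i (y i)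
  have hφs : ContDiff ℝ (⊤ : ℕ∞) φ := contDiff_prod fun i _ =>
    (hG1 i).comp (contDiff_apply ℝ ℝ i)
  have hφ0 : ∀ y, y ∉ (pi univ fun i => tsupport (G i)) → φ y = 0 := by
    intro y hy
    have : ∃ i, y i ∉ tsupport (G i) := by
      by_contra h; push Not at h; exact hy fun i _ => h i
    obtain ⟨i, hi⟩ := this
    exact Finset.prod_eq_zero (Finset.mem_univ i) (image_eq_zero_of_notMem_tsupport hi)
  have hcomp : IsCompact (pi univ fun i => tsupport (G i)) := isCompact_univ_pi fun i => hG2 i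
  have hφc : HasCompactSupport φ := HasCompactSupport.intro hcomp hφ0
  have hφt : tsupport φ ⊆ U := by
    refine (closure_minimal (fun y hy => ?_) hcomp.isClosed).trans
      ((pi_mono fun i _ => hG3 i).trans hU)
    by_contra h
    exact hy (hφ0 y h)
  have hmix : mixedDeriv (levelOrder q l) φ = fun y => ∏ i, dker k a lo (l i) (x i) (y i) := by
    rw [mixedDeriv_prod G hG1]
    ext y
    refine Finset.prod_congr rfl fun i _ => ?_
    rw [← hG5 i]
    simp [levelOrder]
  have hweak := hw.2.2 φ hφs hφc hφt
  rw [hmix] at hweak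
  have hincr : incr k a lo l u x = (-1 : ℝ) ^ (∑ i, levelOrder q l i) * ∫ y in U, w y * φ y := by
    rw [← hweak]
    refine (setIntegral_eq_integral_of_forall_compl_eq_zero fun y hy => ?_).symm
    have : ∃ i, y i ∉ Ioo lo (lo + 1) := by
      by_contra h; push Not at h; exact hy (hU fun i _ => h i)
    obtain ⟨i, hi⟩ := this
    rw [Finset.prod_eq_zero (Finset.mem_univ i) (dker_eq_zero' hm.le hi), mul_zero]
  have hone : ‖((-1 : ℝ) ^ (∑ i, levelOrder q l i))‖ₑ = 1 := by
    rw [enorm_pow]; simp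
  rw [hincr, enorm_mul, hone, one_mul]
  refine (enorm_integral_le_lintegral_enorm _).trans ?_
  have hpt : ∀ y, ‖w y * φ y‖ₑ ≤ (box d lo).indicator (fun y =>
      ENNReal.ofReal (∏ i, (incrConst k q * meshSize (l i) ^ (q + 1))) *
        (boxKer a lo (fun i => l i - 1) x y * ‖w y‖ₑ)) y := by
    intro y
    by_cases hy : y ∈ box d lo
    · rw [indicator_of_mem hy, enorm_mul, mul_comm ‖w y‖ₑ, ← mul_assoc]
      gcongr
      rw [ENNReal.ofReal_prod_of_nonneg fun i _ =>
        mul_nonneg (incrConst_pos k q).le (pow_nonneg (meshSize_pos _).le _),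
        boxKer, ← Finset.prod_mul_distrib]
      simp only [φ]
      rw [← ofReal_norm, norm_prod, ENNReal.ofReal_prod_of_nonneg fun i _ => norm_nonneg _]
      refine Finset.prod_le_prod' fun i _ => ?_
      have hb := hG4 i (y i)
      rw [avgKer]
      by_cases h : y i ∈ Ico (lft a lo (l i - 1) (x i)) (rgt a lo (l i - 1) (x i))
      · rw [indicator_of_mem h] at hb ⊢
        rw [← ENNReal.ofReal_mul (mul_nonneg (incrConst_pos k q).le (pow_nonneg (meshSize_pos _).le _))]
        exact ENNReal.ofReal_le_ofReal hb
      · rw [indicator_of_notMem h, mul_zero] at hb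
        rw [le_antisymm hb (abs_nonneg _) |> fun h => (show ‖G i (y i)‖ = 0 from h)]
        simp
    · have : ∃ i, y i ∉ Ioo lo (lo + 1) := by
        by_contra h; push Not at h; exact hy fun i _ => Ioo_subset_Ico_self (h i)
      obtain ⟨i, hi⟩ := this
      rw [indicator_of_notMem hy, hφ0 y fun h => hi (hG3 i (h i trivial))]
      simp
  calc ∫⁻ y in U, ‖w y * φ y‖ₑ ≤ ∫⁻ y, ‖w y * φ y‖ₑ := setLIntegral_le_lintegral _ _
    _ ≤ _ := lintegral_mono hpt
    _ = _ := by
      rw [lintegral_indicator (measurableSet_box d lo),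
        lintegral_const_mul' _ _ ENNReal.ofReal_ne_top]

/-- The `L²` bound of an increment by a weak mixed derivative. -/
lemma lintegral_incr_sq_le (hm : IsMesh a lo) {q : ℕ} (hq : q ≤ k) {U : Set (Fin d → ℝ)}
    (hU : (pi univ fun _ => Ioo lo (lo + 1)) ⊆ U) (l : Fin d → ℕ) {u w : (Fin d → ℝ) → ℝ}
    (hw : HasWeakDeriv U (levelOrder q l) u w)
    (hwm : AEStronglyMeasurable w (volume.restrict (box d lo))) :
    ∫⁻ x in box d lo, ‖incr k a lo l u x‖ₑ ^ 2 ≤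
      ENNReal.ofReal (∏ i, (incrConst k q * meshSize (l i) ^ (q + 1))) ^ 2 *
        ∫⁻ y in box d lo, ‖w y‖ₑ ^ 2 := by
  calc ∫⁻ x in box d lo, ‖incr k a lo l u x‖ₑ ^ 2
      ≤ ∫⁻ x in box d lo, ENNReal.ofReal (∏ i, (incrConst k q * meshSize (l i) ^ (q + 1))) ^ 2 *
        (∫⁻ y in box d lo, boxKer a lo (fun i => l i - 1) x y * ‖w y‖ₑ) ^ 2 := by
        refine setLIntegral_mono' (measurableSet_box d lo) fun x hx => ?_
        rw [← mul_pow]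
        gcongr
        exact enorm_incr_le hm hq hU l hw hx
    _ ≤ _ := by
        rw [lintegral_const_mul' _ _ (by simp)]
        refine mul_le_mul' le_rfl ?_
        refine lintegral_sq_kernel_le (measurable_boxKer a lo _) (measurableSet_box d lo)
          (fun x hx y hy => Finset.prod_congr rfl fun i _ =>
            avgKer_symm hm.le (hx i trivial) (hy i trivial))
          (fun x hx => lintegral_boxKer_le hm.le _ hx) hwm.enorm

end increments

/-! ### Tensor products of one-dimensional spaces -/

/-- The span of tensor products of functions from given one-dimensional sets. -/
def tensorSpan {d : ℕ} (S : Fin d → Set (ℝ → ℝ)) : Submodule ℝ ((Fin d → ℝ) → ℝ) :=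
  Submodule.span ℝ {f | ∃ w : Fin d → ℝ → ℝ, (∀ i, w i ∈ S i) ∧ f = fun x => ∏ i, w i (x i)}

/-- The tensor product is multilinear, so the factors may be taken from the spans. -/
lemma tensor_mem_tensorSpan {d : ℕ} {S : Fin d → Set (ℝ → ℝ)} {f : Fin d → ℝ → ℝ}
    (hf : ∀ i, f i ∈ Submodule.span ℝ (S i)) : (fun x => ∏ i, f i (x i)) ∈ tensorSpan S := by
  classical
  have key : ∀ s : Finset (Fin d), ∀ f : Fin d → ℝ → ℝ, (∀ i ∈ s, f i ∈ Submodule.span ℝ (S i)) →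
      (∀ i ∉ s, f i ∈ S i) → (fun x : Fin d → ℝ => ∏ i, f i (x i)) ∈ tensorSpan S := by
    intro s
    induction s using Finset.induction_on with
    | empty => exact fun f _ h => Submodule.subset_span ⟨f, fun i => h i (Finset.notMem_empty i), rfl⟩
    | insert i s hi ih =>
      intro f h1 h2
      have hu : ∀ g ∈ Submodule.span ℝ (S i),
          (fun x : Fin d → ℝ => ∏ j, Function.update f i g j (x j)) ∈ tensorSpan S := by
        intro g hg
        induction hg using Submodule.span_induction with
        | mem g hg =>
          refine ih _ (fun j hj => ?_) fun j hj => ?_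
          · rw [Function.update_of_ne (fun h : j = i => hi (h ▸ hj))]
            exact h1 j (Finset.mem_insert_of_mem hj)
          · by_cases hji : j = i
            · subst hji; rwa [Function.update_self]
            · rw [Function.update_of_ne hji]
              exact h2 j (by simp [hji, hj])
        | zero =>
          convert Submodule.zero_mem _ using 1
          ext x; rw [prod_update_apply]; simp
        | add g g' _ _ h h' =>
          convert Submodule.add_mem _ h h' using 1
          ext x
          simp only [Pi.add_apply, prod_update_apply]; ring
        | smul c g _ h =>
          convert Submodule.smul_mem _ c h using 1
          ext x
          simp only [Pi.smul_apply, prod_update_apply, smul_eq_mul]; ring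
      simpa using hu (f i) (h1 i (Finset.mem_insert_self _ _))
  exact key Finset.univ f (fun i _ => hf i) (fun i hi => absurd (Finset.mem_univ i) hi)

/-- Polynomials of degree at most `k` on single cells of level at most `n`. -/
def cellPoly (k : ℕ) (a lo : ℝ) (n : ℕ) : Set (ℝ → ℝ) :=
  {f | ∃ n' ≤ n, ∃ j : ℕ, ∃ p : ℝ[X], p.natDegree ≤ k ∧
    f = (Ico (cellL a lo n' j) (cellR a lo n' j)).indicator fun x => p.eval x}

lemma cellPoly_mono (k : ℕ) (a lo : ℝ) {m n : ℕ} (h : m ≤ n) :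
    cellPoly k a lo m ⊆ cellPoly k a lo n :=
  fun _ ⟨n', h1, h2⟩ => ⟨n', h1.trans h, h2⟩

/-- The kernel `D` is a finite sum of products, with first factors in the span of `S`. -/
def IsSeparable (S : Set (ℝ → ℝ)) (D : ℝ → ℝ → ℝ) : Prop :=
  ∃ (ι : Type) (_ : Fintype ι) (e m : ι → ℝ → ℝ), (∀ b, e b ∈ Submodule.span ℝ S) ∧
    (∀ b, Continuous (m b)) ∧ ∀ x y, D x y = ∑ b, e b x * m b y

section separable
variable {k : ℕ} {a lo : ℝ}

lemma isSeparable_ker (hm : IsMesh a lo) (n : ℕ) :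
    IsSeparable (cellPoly k a lo n) (ker k a lo n) := by
  classical
  let lam : ℕ → ℝ := fun j => cellR a lo n j - cellL a lo n j
  let P : ℕ → ℕ → ℝ[X] := fun j b => (Polynomial.X : ℝ[X]) ^ b |>.comp
    (Polynomial.C (lam j)⁻¹ * Polynomial.X + Polynomial.C (-(lam j)⁻¹ * cellL a lo n j))
  refine ⟨Fin (2 ^ (n + 1)) × Fin (k + 1), inferInstance,
    fun b => (Ico (cellL a lo n b.1) (cellR a lo n b.1)).indicator fun x => (P b.1 b.2).eval x,
    fun b y => (lam b.1)⁻¹ * dualMoment k b.2 ((y - cellL a lo n b.1) / lam b.1),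
    fun b => Submodule.subset_span ⟨n, le_rfl, b.1, P b.1 b.2, ?_, rfl⟩, fun b => ?_, fun x y => ?_⟩
  · refine natDegree_comp_affine_le ?_ _ _
    rw [Polynomial.natDegree_X_pow]
    exact Nat.lt_succ_iff.1 b.2.2
  · exact continuous_const.mul ((dualMoment_contDiff k _).continuous.comp (by fun_prop))
  · rw [Fintype.sum_prod_type]
    by_cases hx : x ∈ Ico lo (lo + 1)
    · have hlt := cellIdx_lt (n := n) hm.le hm.le' hx
      rw [Finset.sum_eq_single (⟨cellIdx a n x, hlt⟩ : Fin (2 ^ (n + 1)))]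
      · rw [ker_of_mem hx, cellKer, Finset.sum_range, Finset.mul_sum]
        refine Finset.sum_congr rfl fun b _ => ?_
        have hmem : x ∈ Ico (cellL a lo n (cellIdx a n x)) (cellR a lo n (cellIdx a n x)) :=
          mem_cell hm.le hx
        beta_reduce
        rw [indicator_of_mem hmem]
        simp only [P, lam, lft, rgt, Polynomial.eval_comp, Polynomial.eval_pow, Polynomial.eval_X,
          Polynomial.eval_add, Polynomial.eval_mul, Polynomial.eval_C]
        rw [show (cellR a lo n (cellIdx a n x) - cellL a lo n (cellIdx a n x))⁻¹ * x +
          -(cellR a lo n (cellIdx a n x) - cellL a lo n (cellIdx a n x))⁻¹ *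
            cellL a lo n (cellIdx a n x) = (x - cellL a lo n (cellIdx a n x)) /
              (cellR a lo n (cellIdx a n x) - cellL a lo n (cellIdx a n x)) by ring]
        ring
      · intro j _ hj
        refine Finset.sum_eq_zero fun b _ => ?_
        beta_reduce
        rw [indicator_of_notMem, zero_mul]
        intro h
        exact hj (Fin.ext (cellIdx_eq_of_mem_cell h).symm)
      · simp
    · rw [ker_of_notMem hx, Finset.sum_eq_zero fun j _ => Finset.sum_eq_zero fun b _ => ?_]
      · rfl
      · beta_reduce
        rw [indicator_of_notMem fun h => hx (mem_Ico_of_mem_cell h), zero_mul]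

lemma isSeparable_dker (hm : IsMesh a lo) (n : ℕ) :
    IsSeparable (cellPoly k a lo n) (dker k a lo n) := by
  cases n with
  | zero => exact isSeparable_ker hm 0
  | succ n =>
    obtain ⟨ι, _, e, m, h1, h2, h3⟩ := isSeparable_ker (k := k) hm (n + 1)
    obtain ⟨ι', _, e', m', h1', h2', h3'⟩ := isSeparable_ker (k := k) hm n
    refine ⟨ι ⊕ ι', inferInstance, Sum.elim e e', Sum.elim m (fun b y => -m' b y), ?_, ?_, ?_⟩
    · rintro (b | b)
      · exact h1 b
      · exact Submodule.span_mono (cellPoly_mono k a lo n.le_succ) (h1' b)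
    · rintro (b | b)
      · exact h2 b
      · exact (h2' b).neg
    · intro x y
      rw [Fintype.sum_sum_type]
      simp [dker, h3, h3', sub_eq_add_neg]

end separable

section decomposition
variable {d k : ℕ} {a lo : ℝ}

/-- The closed cube `[lo, lo + 1]^d`. -/
def cbox (d : ℕ) (lo : ℝ) : Set (Fin d → ℝ) := pi univ fun _ => Icc lo (lo + 1)

lemma isCompact_cbox (d : ℕ) (lo : ℝ) : IsCompact (cbox d lo) :=
  isCompact_univ_pi fun _ => isCompact_Icc

lemma box_subset_cbox (d : ℕ) (lo : ℝ) : box d lo ⊆ cbox d lo :=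
  pi_mono fun _ _ => Ico_subset_Icc_self

lemma exists_notMem_of_notMem_pi {s : Set ℝ} {y : Fin d → ℝ} (hy : y ∉ pi univ fun _ : Fin d => s) :
    ∃ i, y i ∉ s := by
  by_contra h; push Not at h; exact hy fun i _ => h i

/-- Increments are tensor-product piecewise polynomials. -/
lemma incr_mem_tensorSpan (hm : IsMesh a lo) (l : Fin d → ℕ) {u : (Fin d → ℝ) → ℝ}
    (hu : ContinuousOn u (cbox d lo)) :
    incr k a lo l u ∈ tensorSpan fun i => cellPoly k a lo (l i) := by
  classical
  choose ι hι e m he hmc hD using fun i => isSeparable_dker (k := k) hm (l i)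
  have h1 : incr k a lo l u = ∑ b : ∀ i, ι i,
      (∫ y in cbox d lo, u y * ∏ i, m i (b i) (y i)) • fun x => ∏ i, e i (b i) (x i) := by
    ext x
    have : incr k a lo l u x = ∫ y in cbox d lo, u y * ∏ i, dker k a lo (l i) (x i) (y i) := by
      refine (setIntegral_eq_integral_of_forall_compl_eq_zero fun y hy => ?_).symm
      obtain ⟨i, hi⟩ := exists_notMem_of_notMem_pi hy
      rw [Finset.prod_eq_zero (Finset.mem_univ i)
        (dker_eq_zero' hm.le fun h => hi (Ioo_subset_Icc_self h)), mul_zero]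
    rw [this]
    simp only [hD, Finset.prod_univ_sum, Finset.sum_apply, Pi.smul_apply, smul_eq_mul,
      Fintype.piFinset_univ, Finset.mul_sum]
    rw [integral_finsetSum]
    · refine Finset.sum_congr rfl fun b _ => ?_
      rw [← integral_mul_const]
      congr 1; ext y
      rw [Finset.prod_mul_distrib]; ring
    · intro b _
      refine ContinuousOn.integrableOn_compact (isCompact_cbox d lo) (hu.mul ?_)
      refine Continuous.continuousOn (continuous_finsetProd _ fun i _ => ?_)
      exact continuous_const.mul ((hmc i (b i)).comp (continuous_apply i))
  rw [h1]
  exact Submodule.sum_mem _ fun b _ => Submodule.smul_mem _ _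
    (tensor_mem_tensorSpan fun i => he i (b i))

/-- The full-grid quasi-interpolant of level `n`. -/
noncomputable def fullInterp (k : ℕ) (a lo : ℝ) (n : ℕ) (u : (Fin d → ℝ) → ℝ) (x : Fin d → ℝ) : ℝ :=
  ∫ y, u y * ∏ i, ker k a lo n (x i) (y i)

lemma integrable_mul_prod {u : (Fin d → ℝ) → ℝ} (hu : ContinuousOn u (cbox d lo))
    {f : Fin d → ℝ → ℝ} (hf : ∀ i, Continuous (f i)) (h0 : ∀ i, ∀ y ∉ Ioo lo (lo + 1), f i y = 0) :
    Integrable fun y => u y * ∏ i, f i (y i) := by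
  rw [← integrableOn_iff_integrable_of_support_subset (s := cbox d lo)]
  · refine ContinuousOn.integrableOn_compact (isCompact_cbox d lo) (hu.mul ?_)
    exact Continuous.continuousOn (continuous_finsetProd _ fun i _ => (hf i).comp (continuous_apply i))
  · intro y hy
    by_contra h
    obtain ⟨i, hi⟩ := exists_notMem_of_notMem_pi h
    refine hy ?_
    beta_reduce
    rw [Finset.prod_eq_zero (Finset.mem_univ i) (h0 i _ fun h => hi (Ioo_subset_Icc_self h)), mul_zero]

lemma fullInterp_eq_sum (hm : IsMesh a lo) (n : ℕ) {u : (Fin d → ℝ) → ℝ}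
    (hu : ContinuousOn u (cbox d lo)) :
    fullInterp k a lo n u =
      ∑ l ∈ Fintype.piFinset (fun _ : Fin d => Finset.range (n + 1)), incr k a lo l u := by
  ext x
  simp only [fullInterp, Finset.sum_apply, incr, ← sum_dker, Finset.prod_univ_sum, Finset.mul_sum]
  rw [integral_finsetSum]
  intro l _
  exact integrable_mul_prod hu (fun i => (dker_contDiff k a lo (l i) (x i)).continuous)
    fun i y hy => dker_eq_zero' hm.le hy

lemma integral_abs_ker_le (ha : a ≤ lo) {n : ℕ} {x : ℝ} (hx : x ∈ Ico lo (lo + 1)) :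
    ∫ y, |ker k a lo n x y| ≤ kerConst k := by
  have hl := lft_lt_rgt (n := n) ha hx
  calc ∫ y, |ker k a lo n x y| = ∫ y in lft a lo n x..rgt a lo n x, |ker k a lo n x y| := by
        rw [intervalIntegral.integral_of_le hl.le]
        refine (setIntegral_eq_integral_of_forall_compl_eq_zero fun y hy => ?_).symm
        rw [ker_eq_zero ha fun h => hy (Ioo_subset_Ioc_self h), abs_zero]
    _ ≤ ∫ y in lft a lo n x..rgt a lo n x, kerConst k / (rgt a lo n x - lft a lo n x) := by
        refine intervalIntegral.integral_mono_on hl.le ?_ (continuous_const.intervalIntegrable _ _)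
          fun y _ => abs_ker_le ha hx y
        exact ((ker_contDiff k a lo n x).continuous.abs).intervalIntegrable _ _
    _ = kerConst k := by
        rw [intervalIntegral.integral_const, smul_eq_mul, mul_div_cancel₀]
        exact (sub_pos.2 hl).ne'

/-- Uniform convergence of the full-grid quasi-interpolants of a continuous function. -/
lemma fullInterp_tendsto (hm : IsMesh a lo) {u : (Fin d → ℝ) → ℝ}
    (hu : ContinuousOn u (cbox d lo)) {ε : ℝ} (hε : 0 < ε) :
    ∃ n₀, ∀ n ≥ n₀, ∀ x ∈ box d lo, |u x - fullInterp k a lo n u x| ≤ ε := by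
  have hK := kerConst_pos k
  set η := ε / kerConst k ^ d
  have hη : 0 < η := by positivity
  obtain ⟨δ, hδ, hunif⟩ := Metric.uniformContinuousOn_iff.1
    ((isCompact_cbox d lo).uniformContinuousOn_of_continuous hu) η hη
  obtain ⟨n₀, hn₀⟩ := exists_pow_lt_of_lt_one hδ (show (1 / 2 : ℝ) < 1 by norm_num)
  refine ⟨n₀, fun n hn x hx => ?_⟩
  have hsmall : meshSize n < δ := by
    refine lt_of_le_of_lt ?_ hn₀
    unfold meshSize
    rw [← inv_pow, ← one_div]
    exact pow_le_pow_of_le_one (by norm_num) (by norm_num) hn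
  have hcont : ∀ i, Continuous (ker k a lo n (x i)) := fun i => (ker_contDiff _ _ _ _ _).continuous
  have hz : ∀ i, ∀ y ∉ Ioo lo (lo + 1), ker k a lo n (x i) y = 0 := fun i y hy => ker_eq_zero' hm.le hy
  have hone : ∫ y : Fin d → ℝ, ∏ i, ker k a lo n (x i) (y i) = 1 := by
    rw [integral_fintype_prod_volume_eq_prod]
    refine Finset.prod_eq_one fun i _ => ?_
    have := integral_ker (k := k) (n := n) (p := 1) hm.le (hx i trivial) (by simp)
    simpa using this
  have hI1 := integrable_mul_prod hu hcont hz
  have hI2 : Integrable fun y : Fin d → ℝ => u x * ∏ i, ker k a lo n (x i) (y i) :=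
    integrable_mul_prod (u := fun _ => u x) continuousOn_const hcont hz
  have hdiff : u x - fullInterp k a lo n u x =
      ∫ y, (u x - u y) * ∏ i, ker k a lo n (x i) (y i) := by
    simp only [sub_mul]
    rw [integral_sub hI2 hI1, integral_const_mul, hone, mul_one]; rfl
  rw [hdiff]
  have hbd : ∀ y : Fin d → ℝ, ‖(u x - u y) * ∏ i, ker k a lo n (x i) (y i)‖ ≤
      η * ∏ i, |ker k a lo n (x i) (y i)| := by
    intro y
    rw [norm_mul, Finset.abs_prod _ _ |>.symm, Real.norm_eq_abs, Real.norm_eq_abs]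
    by_cases hy : ∀ i, y i ∈ Ioo (lft a lo n (x i)) (rgt a lo n (x i))
    · gcongr
      have hyb : y ∈ cbox d lo := fun i _ =>
        ⟨le_lft.trans (hy i).1.le, (hy i).2.le.trans rgt_le⟩
      have := hunif x (box_subset_cbox d lo hx) y hyb ?_
      · rw [Real.dist_eq] at this; exact this.le
      · rw [dist_pi_lt_iff hδ]
        intro i
        refine lt_of_le_of_lt ?_ hsmall
        have hxi := mem_cell (n := n) hm.le (hx i trivial)
        have hw := rgt_sub_lft_le (a := a) (lo := lo) (n := n) (x := x i)
        have hyi := hy i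
        rw [Real.dist_eq, abs_le]
        constructor <;> linarith [hxi.1, hxi.2, hyi.1, hyi.2]
    · push Not at hy
      obtain ⟨i, hi⟩ := hy
      rw [Finset.prod_eq_zero (Finset.mem_univ i) (ker_eq_zero hm.le hi)]
      simp
  calc |∫ y, (u x - u y) * ∏ i, ker k a lo n (x i) (y i)|
      ≤ ∫ y : Fin d → ℝ, η * ∏ i, |ker k a lo n (x i) (y i)| := by
        rw [← Real.norm_eq_abs]
        refine norm_integral_le_of_norm_le ?_ (Filter.Eventually.of_forall hbd)
        exact integrable_mul_prod (lo := lo) (u := fun _ => η)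
          (f := fun i y => |ker k a lo n (x i) y|)
          continuousOn_const (fun i => (hcont i).abs) fun i y hy => by simp [hz i y hy]
    _ = η * ∏ i, ∫ y, |ker k a lo n (x i) y| := by
        rw [integral_const_mul, integral_fintype_prod_volume_eq_prod
          (fun i y => |ker k a lo n (x i) y|)]
    _ ≤ η * ∏ _i : Fin d, kerConst k := by
        gcongr with i _
        exact integral_abs_ker_le hm.le (hx i trivial)
    _ = ε := by simp [η]; field_simp

/-- The sparse quasi-interpolant. -/
noncomputable def sparseInterp (k : ℕ) (a lo : ℝ) (N : ℕ) (u : (Fin d → ℝ) → ℝ) : (Fin d → ℝ) → ℝ :=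
  ∑ l ∈ (Fintype.piFinset fun _ : Fin d => Finset.range (N + 1)).filter (fun l => ∑ i, l i ≤ N),
    incr k a lo l u

/-- The multi-levels of the `n`-th part of the error of the sparse quasi-interpolant: for `n = N`
those of the full grid of level `N` missing from the sparse grid, for `n > N` those with maximal
level `n`. -/
def resLevels (d N n : ℕ) : Finset (Fin d → ℕ) :=
  if n = N then (Fintype.piFinset fun _ : Fin d => Finset.range (N + 1)).filter
    (fun l => ¬ ∑ i, l i ≤ N)
  else (Fintype.piFinset fun _ : Fin d => Finset.range (n + 1)) \
    Fintype.piFinset fun _ : Fin d => Finset.range n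

/-- The `n`-th part of the error of the sparse quasi-interpolant. -/
noncomputable def sparseRes (k : ℕ) (a lo : ℝ) (N n : ℕ) (u : (Fin d → ℝ) → ℝ) : (Fin d → ℝ) → ℝ :=
  ∑ l ∈ resLevels d N n, incr k a lo l u

/-- The sparse quasi-interpolant and the parts of its error up to level `m` telescope to the full-grid
quasi-interpolant of level `m`. -/
lemma sparseInterp_add_sum_sparseRes (hm : IsMesh a lo) {N m : ℕ} (h : N ≤ m)
    {u : (Fin d → ℝ) → ℝ} (hu : ContinuousOn u (cbox d lo)) :
    sparseInterp k a lo N u + ∑ n ∈ Finset.Icc N m, sparseRes k a lo N n u =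
      fullInterp k a lo m u := by
  induction m, h using Nat.le_induction with
  | base =>
    rw [Finset.Icc_self, Finset.sum_singleton, sparseInterp, sparseRes, resLevels, if_pos rfl,
      Finset.sum_filter_add_sum_filter_not, fullInterp_eq_sum hm N hu]
  | succ m h ih =>
    rw [Finset.sum_Icc_succ_top (by omega), ← add_assoc, ih, sparseRes, resLevels,
      if_neg (by omega), fullInterp_eq_sum hm _ hu, fullInterp_eq_sum hm _ hu, add_comm,
      Finset.sum_sdiff]
    exact Fintype.piFinset_subset _ _ fun i => Finset.range_subset_range.2 (by omega)

/-- The multi-levels in the `n`-th part satisfy `max l ≤ n ≤ |l|₁`: the first bound gives the mesh on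
which the part is polynomial, the second its size. -/
lemma resLevels_spec {N n : ℕ} (hn : N ≤ n) {l : Fin d → ℕ} (hl : l ∈ resLevels d N n)
    (hN : 1 ≤ N) : (∀ i, l i ≤ n) ∧ n ≤ ∑ i, l i ∧ ∃ i, l i ≠ 0 := by
  unfold resLevels at hl
  split_ifs at hl with h
  · subst h
    rw [Finset.mem_filter, Fintype.mem_piFinset] at hl
    refine ⟨fun i => Nat.lt_succ_iff.1 (Finset.mem_range.1 (hl.1 i)), by omega, ?_⟩
    by_contra hz
    push Not at hz
    simp [hz] at hl
  · rw [Finset.mem_sdiff, Fintype.mem_piFinset, Fintype.mem_piFinset] at hl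
    obtain ⟨h1, h2⟩ := hl
    push Not at h2
    obtain ⟨i, hi⟩ := h2
    rw [Finset.mem_range, not_lt] at hi
    have := Finset.single_le_sum (f := l) (fun _ _ => Nat.zero_le _) (Finset.mem_univ i)
    exact ⟨fun i => Nat.lt_succ_iff.1 (Finset.mem_range.1 (h1 i)), by omega, i, by omega⟩

lemma card_resLevels_le (d N n : ℕ) : (resLevels d N n).card ≤ (n + 1) ^ d := by
  unfold resLevels
  split_ifs with h
  · subst h
    refine (Finset.card_filter_le _ _).trans ?_
    simp
  · refine (Finset.card_le_card Finset.sdiff_subset).trans ?_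
    simp

/-- The `L²` size of the parts of the error of the sparse quasi-interpolant. -/
lemma eLpNorm_sparseRes_le (hm : IsMesh a lo) {q : ℕ} (hq : q ≤ k) {U : Set (Fin d → ℝ)}
    (hU : (pi univ fun _ => Ioo lo (lo + 1)) ⊆ U) {u : (Fin d → ℝ) → ℝ}
    (hu : ∀ l : Fin d → ℕ, Measurable (incr k a lo l u)) {M : ℝ≥0∞}
    (hM : ∀ L : Finset (Fin d), L.Nonempty →
      ∃ w, HasWeakDeriv U (fun i => if i ∈ L then q + 1 else 0) u w ∧
        AEStronglyMeasurable w (volume.restrict (box d lo)) ∧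
        eLpNorm w 2 (volume.restrict (box d lo)) ≤ M)
    {N n : ℕ} (hN : 1 ≤ N) (hn : N ≤ n) :
    eLpNorm (sparseRes k a lo N n u) 2 (volume.restrict (box d lo)) ≤
      ENNReal.ofReal (((n : ℝ) + 1) ^ d * (incrConst k q ^ d * meshSize n ^ (q + 1))) * M := by
  have hone : ∀ l ∈ resLevels d N n, eLpNorm (incr k a lo l u) 2 (volume.restrict (box d lo)) ≤
      ENNReal.ofReal (incrConst k q ^ d * meshSize n ^ (q + 1)) * M := by
    intro l hl
    obtain ⟨-, h2, i, hi⟩ := resLevels_spec hn hl hN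
    obtain ⟨w, hw, hwm, hwM⟩ := hM (Finset.univ.filter fun i => l i ≠ 0) ⟨i, by simpa using hi⟩
    have hb := lintegral_incr_sq_le hm hq hU l hw hwm
    have e2 : ∀ f : (Fin d → ℝ) → ℝ, eLpNorm f 2 (volume.restrict (box d lo)) =
        (∫⁻ x in box d lo, ‖f x‖ₑ ^ 2) ^ (1 / 2 : ℝ) := fun f => by
      rw [eLpNorm_eq_lintegral_rpow_enorm_toReal (by norm_num) (by norm_num)]; simp
    have hle : ∏ i, (incrConst k q * meshSize (l i) ^ (q + 1)) ≤
        incrConst k q ^ d * meshSize n ^ (q + 1) := by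
      rw [Finset.prod_mul_distrib, Finset.prod_const, Finset.card_univ, Fintype.card_fin,
        Finset.prod_pow]
      have hc := incrConst_pos k q
      have : ∏ i, meshSize (l i) ≤ meshSize n := by
        unfold meshSize
        rw [Finset.prod_inv_distrib, Finset.prod_pow_eq_pow_sum]
        exact inv_anti₀ (by positivity) (pow_le_pow_right₀ one_le_two h2)
      gcongr
      exact Finset.prod_nonneg fun i _ => (meshSize_pos _).le
    rw [e2]
    calc _ ≤ (ENNReal.ofReal (∏ i, (incrConst k q * meshSize (l i) ^ (q + 1))) ^ 2 *
          ∫⁻ y in box d lo, ‖w y‖ₑ ^ 2) ^ (1 / 2 : ℝ) := by gcongr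
      _ = ENNReal.ofReal (∏ i, (incrConst k q * meshSize (l i) ^ (q + 1))) *
          eLpNorm w 2 (volume.restrict (box d lo)) := by
          rw [ENNReal.mul_rpow_of_nonneg _ _ (by norm_num), e2, ← ENNReal.rpow_two,
            ← ENNReal.rpow_mul]; norm_num
      _ ≤ _ := by gcongr
  calc eLpNorm (sparseRes k a lo N n u) 2 (volume.restrict (box d lo))
      ≤ ∑ l ∈ resLevels d N n, eLpNorm (incr k a lo l u) 2 (volume.restrict (box d lo)) :=
        eLpNorm_sum_le (fun l _ => (hu l).aestronglyMeasurable) (by norm_num)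
    _ ≤ ∑ l ∈ resLevels d N n, ENNReal.ofReal (incrConst k q ^ d * meshSize n ^ (q + 1)) * M :=
        Finset.sum_le_sum hone
    _ ≤ ((n + 1) ^ d : ℕ) * (ENNReal.ofReal (incrConst k q ^ d * meshSize n ^ (q + 1)) * M) := by
        rw [Finset.sum_const, nsmul_eq_mul]
        gcongr
        exact card_resLevels_le d N n
    _ = _ := by
        rw [ENNReal.ofReal_mul (p := ((n : ℝ) + 1) ^ d) (by positivity), ← mul_assoc]
        congr 2
        rw [← ENNReal.ofReal_natCast]; push_cast; rfl

end decomposition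

/-! ### Piecewise polynomials on uniform grids -/

/-- Functions on the line which are polynomials of degree at most `k` on each cell
`[j 2^{-m}, (j + 1) 2^{-m})`. -/
def PW1 (k m : ℕ) : Submodule ℝ (ℝ → ℝ) where
  carrier := {f | ∀ j : ℤ, ∃ p : ℝ[X], p.natDegree ≤ k ∧
    ∀ x ∈ Ico (j * meshSize m) ((j + 1) * meshSize m), f x = p.eval x}
  add_mem' := fun {f g} hf hg j => by
    obtain ⟨p, hp, h⟩ := hf j
    obtain ⟨r, hr, h'⟩ := hg j
    exact ⟨p + r, Polynomial.natDegree_add_le_of_degree_le hp hr, fun x hx => by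
      simp [h x hx, h' x hx]⟩
  zero_mem' := fun j => ⟨0, by simp, fun x _ => by simp⟩
  smul_mem' := fun c f hf j => by
    obtain ⟨p, hp, h⟩ := hf j
    exact ⟨c • p, (Polynomial.natDegree_smul_le c p).trans hp, fun x hx => by simp [h x hx]⟩

lemma PW1_le_succ (k m : ℕ) : PW1 k m ≤ PW1 k (m + 1) := by
  intro f hf j
  obtain ⟨p, hp, h⟩ := hf (j / 2)
  refine ⟨p, hp, fun x hx => h x ?_⟩
  have h1 : (j / 2) * 2 ≤ j := Int.ediv_mul_le j two_ne_zero
  have h2 : j + 1 ≤ (j / 2 + 1) * 2 := by omega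
  have h1' : ((j / 2 : ℤ) : ℝ) * 2 ≤ j := by exact_mod_cast h1
  have h2' : (j : ℝ) + 1 ≤ (((j / 2 : ℤ) : ℝ) + 1) * 2 := by exact_mod_cast h2
  have hp := meshSize_pos m
  rw [meshSize_succ] at hx
  exact ⟨by nlinarith [hx.1], by nlinarith [hx.2]⟩

lemma PW1_mono (k : ℕ) {m n : ℕ} (h : m ≤ n) : PW1 k m ≤ PW1 k n := by
  induction n, h using Nat.le_induction with
  | base => exact le_rfl
  | succ n _ ih => exact ih.trans (PW1_le_succ k n)

section PW1
variable {k m : ℕ} {f : ℝ → ℝ}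

lemma exists_mem_Ico_grid (m : ℕ) (x : ℝ) :
    ∃ j : ℤ, x ∈ Ico (j * meshSize m) ((j + 1) * meshSize m) := by
  have hp := meshSize_pos m
  refine ⟨⌊x / meshSize m⌋, ?_, ?_⟩
  · rw [← le_div_iff₀ hp]; exact Int.floor_le _
  · rw [← div_lt_iff₀ hp]; exact Int.lt_floor_add_one _

lemma exists_mem_Ioc_grid (m : ℕ) (x : ℝ) :
    ∃ j : ℤ, x ∈ Ioc (j * meshSize m) ((j + 1) * meshSize m) := by
  have hp := meshSize_pos m
  refine ⟨⌈x / meshSize m⌉ - 1, ?_, ?_⟩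
  · rw [← lt_div_iff₀ hp]; push_cast
    linarith [Int.ceil_lt_add_one (x / meshSize m)]
  · rw [← div_le_iff₀ hp]; push_cast
    linarith [Int.le_ceil (x / meshSize m)]

lemma PW1.exists_right (hf : f ∈ PW1 k m) (x : ℝ) :
    ∃ p : ℝ[X], p.natDegree ≤ k ∧ f x = p.eval x ∧ (∀ᶠ y in 𝓝[≥] x, f y = p.eval y) := by
  obtain ⟨j, hj⟩ := exists_mem_Ico_grid m x
  obtain ⟨p, hp, h⟩ := hf j
  refine ⟨p, hp, h x hj, ?_⟩
  filter_upwards [Ico_mem_nhdsGE hj.2] with y hy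
  exact h y ⟨hj.1.trans hy.1, hy.2⟩

lemma PW1.exists_left (hf : f ∈ PW1 k m) (x : ℝ) :
    ∃ p : ℝ[X], p.natDegree ≤ k ∧ (∀ᶠ y in 𝓝[<] x, f y = p.eval y) := by
  obtain ⟨j, hj⟩ := exists_mem_Ioc_grid m x
  obtain ⟨p, hp, h⟩ := hf j
  refine ⟨p, hp, ?_⟩
  filter_upwards [Ioo_mem_nhdsLT hj.1] with y hy
  exact h y ⟨hy.1.le, hy.2.trans_le hj.2⟩

lemma PW1.rightCont (hf : f ∈ PW1 k m) (x : ℝ) : ContinuousWithinAt f (Ici x) x := by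
  obtain ⟨p, -, h1, h2⟩ := PW1.exists_right hf x
  exact (p.continuous.continuousWithinAt).congr_of_eventuallyEq h2 h1

lemma PW1.tendsto_right (hf : f ∈ PW1 k m) (x : ℝ) : Tendsto f (𝓝[>] x) (𝓝 (f x)) :=
  (PW1.rightCont hf x).tendsto.mono_left (nhdsWithin_mono _ Ioi_subset_Ici_self)

lemma PW1.exists_tendsto_left (hf : f ∈ PW1 k m) (x : ℝ) : ∃ y, Tendsto f (𝓝[<] x) (𝓝 y) := by
  obtain ⟨p, -, h⟩ := PW1.exists_left hf x
  exact ⟨p.eval x, (p.continuous.continuousAt.mono_left nhdsWithin_le_nhds).congr'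
    (h.mono fun y hy => hy.symm)⟩

lemma PW1.hasDerivWithinAt (hf : f ∈ PW1 k m) (x : ℝ) :
    HasDerivWithinAt f (derivWithin f (Ici x) x) (Ici x) x := by
  obtain ⟨p, -, h1, h2⟩ := PW1.exists_right hf x
  have := (p.hasDerivAt x).hasDerivWithinAt (s := Ici x)
  exact (this.congr_of_eventuallyEq h2 h1).differentiableWithinAt.hasDerivWithinAt

lemma PW1.derivWithin_eq {j : ℤ} {p : ℝ[X]}
    (h : ∀ x ∈ Ico (j * meshSize m) ((j + 1) * meshSize m), f x = p.eval x) {x : ℝ}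
    (hx : x ∈ Ico (j * meshSize m) ((j + 1) * meshSize m)) :
    derivWithin f (Ici x) x = p.derivative.eval x := by
  have h2 : ∀ᶠ y in 𝓝[≥] x, f y = p.eval y := by
    filter_upwards [Ico_mem_nhdsGE hx.2] with y hy
    exact h y ⟨hx.1.trans hy.1, hy.2⟩
  exact (((p.hasDerivAt x).hasDerivWithinAt (s := Ici x)).congr_of_eventuallyEq h2
    (h x hx)).derivWithin (uniqueDiffWithinAt_Ici x)

lemma PW1.deriv_eq {j : ℤ} {p : ℝ[X]}
    (h : ∀ x ∈ Ico (j * meshSize m) ((j + 1) * meshSize m), f x = p.eval x) {x : ℝ}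
    (hx : x ∈ Ioo (j * meshSize m) ((j + 1) * meshSize m)) :
    deriv f x = p.derivative.eval x := by
  have h2 : f =ᶠ[𝓝 x] fun y => p.eval y := by
    filter_upwards [Ioo_mem_nhds hx.1 hx.2] with y hy
    exact h y (Ioo_subset_Ico_self hy)
  rw [h2.deriv_eq]; simp

lemma leftLim_eq {g : ℝ → ℝ} {x y : ℝ} (h : Tendsto g (𝓝[<] x) (𝓝 y)) : Function.leftLim g x = y :=
  leftLim_eq_of_tendsto h

lemma rightLim_eq {g : ℝ → ℝ} {x y : ℝ} (h : Tendsto g (𝓝[>] x) (𝓝 y)) :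
    Function.rightLim g x = y :=
  rightLim_eq_of_tendsto h

lemma PW1.tendsto_leftLim (hf : f ∈ PW1 k m) (x : ℝ) :
    Tendsto f (𝓝[<] x) (𝓝 (Function.leftLim f x)) := by
  obtain ⟨y, hy⟩ := PW1.exists_tendsto_left hf x
  rwa [leftLim_eq hy]

lemma PW1.leftLim_eq_eval {j : ℤ} {p : ℝ[X]}
    (h : ∀ x ∈ Ico (j * meshSize m) ((j + 1) * meshSize m), f x = p.eval x) :
    Function.leftLim f ((j + 1) * meshSize m) = p.eval ((j + 1) * meshSize m) := by
  refine leftLim_eq ((p.continuous.continuousAt.mono_left nhdsWithin_le_nhds).congr' ?_)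
  have : (j : ℝ) * meshSize m < (j + 1) * meshSize m := by nlinarith [meshSize_pos m]
  filter_upwards [Ioo_mem_nhdsLT this] with y hy
  exact (h y (Ioo_subset_Ico_self hy)).symm

lemma PW1.measurable (hf : f ∈ PW1 k m) : Measurable f := by
  choose P _ hP using hf
  have h1 : Measurable fun q : ℤ × ℝ => (P q.1).eval q.2 :=
    measurable_from_prod_countable_right fun j => (P j).continuous.measurable
  have h2 : Measurable fun x : ℝ => (⌊x / meshSize m⌋, x) :=
    (Int.measurable_floor.comp (by fun_prop)).prodMk measurable_id
  convert h1.comp h2 using 1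
  ext x
  have hp := meshSize_pos m
  refine hP _ x ⟨?_, ?_⟩
  · rw [← le_div_iff₀ hp]; exact Int.floor_le _
  · rw [← div_lt_iff₀ hp]; exact Int.lt_floor_add_one _

/-- Inverse estimates on one cell. -/
lemma PW1.cell_estimate (hf : f ∈ PW1 k m) {j : ℤ} {x : ℝ}
    (hx : x ∈ Ico (j * meshSize m) ((j + 1) * meshSize m)) :
    f x ^ 2 ≤ invConst k * 2 ^ m *
      (∫ y in (j * meshSize m)..((j + 1) * meshSize m), f y ^ 2) ∧
    derivWithin f (Ici x) x ^ 2 ≤ invConst k * (2 ^ m) ^ 3 *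
      (∫ y in (j * meshSize m)..((j + 1) * meshSize m), f y ^ 2) ∧
    Function.leftLim f ((j + 1) * meshSize m) ^ 2 ≤ invConst k * 2 ^ m *
      ∫ y in (j * meshSize m)..((j + 1) * meshSize m), f y ^ 2 := by
  obtain ⟨p, hp, h⟩ := hf j
  have hd := meshSize_pos m
  have hle : (j : ℝ) * meshSize m ≤ (j + 1) * meshSize m := by nlinarith
  have hint : ∫ y in (j * meshSize m)..((j + 1) * meshSize m), f y ^ 2 =
      ∫ y in (j * meshSize m)..((j + 1) * meshSize m), p.eval y ^ 2 := by
    refine intervalIntegral.integral_congr_ae ?_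
    filter_upwards [compl_mem_ae_iff.2 (measure_singleton ((j + 1) * meshSize m))] with y hy1 hy2
    rw [uIoc_of_le hle] at hy2
    rw [h y ⟨hy2.1.le, lt_of_le_of_ne hy2.2 hy1⟩]
  have e : (j : ℝ) * meshSize m + meshSize m = (j + 1) * meshSize m := by ring
  have e1 : invConst k / meshSize m = invConst k * 2 ^ m := by simp [meshSize]
  have e2 : invConst k / meshSize m ^ 3 = invConst k * (2 ^ m) ^ 3 := by simp [meshSize]
  have k1 := poly_estimate hp hd (α := j * meshSize m) (s := x) ⟨hx.1, by rw [e]; exact hx.2.le⟩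
  have k2 := poly_estimate hp hd (α := j * meshSize m) (s := (j + 1) * meshSize m)
    ⟨hle, by rw [e]⟩
  rw [e, e1, e2] at k1 k2
  rw [hint, h x hx, PW1.derivWithin_eq h hx, PW1.leftLim_eq_eval h]
  exact ⟨k1.1, k1.2, k2.1⟩

end PW1

/-! ### Classes of functions on the cube, and the `L²` norm -/

section classes
variable {d : ℕ}

lemma cubeMeasure_eq_pi (d : ℕ) : (volume.restrict (unitCube d) : Measure (Fin d → ℝ)) =
    Measure.pi fun _ => (volume.restrict (Icc (0 : ℝ) 1)) := by
  have : unitCube d = pi univ fun _ => Icc (0 : ℝ) 1 := by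
    rw [pi_univ_Icc]; rfl
  rw [this, volume_pi, Measure.restrict_pi_pi]

instance isProbabilityMeasure_Icc : IsProbabilityMeasure (volume.restrict (Icc (0 : ℝ) 1)) :=
  ⟨by simp⟩

instance isProbabilityMeasure_cube (d : ℕ) :
    IsProbabilityMeasure (volume.restrict (unitCube d) : Measure (Fin d → ℝ)) := by
  rw [cubeMeasure_eq_pi]; infer_instance

lemma measurableSet_unitCube (d : ℕ) : MeasurableSet (unitCube d) := measurableSet_Icc

/-- Replacing one coordinate by an independent uniform one preserves the measure of the cube. -/
lemma measurePreserving_update (i : Fin d) :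
    MeasurePreserving (fun z : (Fin d → ℝ) × ℝ => Function.update z.1 i z.2)
      ((volume.restrict (unitCube d)).prod (volume.restrict (Icc (0 : ℝ) 1)))
      (volume.restrict (unitCube d)) := by
  have hm : Measurable fun z : (Fin d → ℝ) × ℝ => Function.update z.1 i z.2 := by
    refine measurable_pi_lambda _ fun j => ?_
    by_cases h : j = i
    · subst h; simp only [Function.update_self]; exact measurable_snd
    · simp only [Function.update_of_ne h]; exact (measurable_pi_apply j).comp measurable_fst
  refine ⟨hm, ?_⟩
  conv_rhs => rw [cubeMeasure_eq_pi]
  refine (Measure.pi_eq fun s hs => ?_).symm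
  rw [Measure.map_apply hm (MeasurableSet.univ_pi hs)]
  have : (fun z : (Fin d → ℝ) × ℝ => Function.update z.1 i z.2) ⁻¹' (pi univ s) =
      (pi univ (Function.update s i univ)) ×ˢ s i := by
    ext ⟨x, r⟩
    simp only [mem_preimage, mem_prod, Set.mem_pi, mem_univ, true_implies]
    constructor
    · intro h
      refine ⟨fun j => ?_, by simpa using h i⟩
      by_cases hj : j = i
      · subst hj; simp
      · simpa [hj] using h j
    · rintro ⟨h1, h2⟩ j
      by_cases hj : j = i
      · subst hj; simpa using h2
      · simpa [hj] using h1 j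
  rw [this, Measure.prod_prod, cubeMeasure_eq_pi, Measure.pi_pi,
    ← Finset.mul_prod_erase _ _ (Finset.mem_univ i), ← Finset.mul_prod_erase _ _ (Finset.mem_univ i)]
  rw [Function.update_self, measure_univ, one_mul, mul_comm]
  congr 1
  refine Finset.prod_congr rfl fun j hj => ?_
  rw [Function.update_of_ne (Finset.ne_of_mem_erase hj)]

/-- Fubini on the cube: the coordinate `x_i` may be integrated first. -/
lemma integral_slice (i : Fin d) {F : (Fin d → ℝ) → ℝ}
    (hF : Integrable F (volume.restrict (unitCube d))) :
    ∫ x in unitCube d, F x = ∫ x in unitCube d, ∫ s in (0 : ℝ)..1, F (Function.update x i s) := by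
  have hp := measurePreserving_update i
  have h1 : ∫ x in unitCube d, F x = ∫ z : (Fin d → ℝ) × ℝ, F (Function.update z.1 i z.2)
      ∂((volume.restrict (unitCube d)).prod (volume.restrict (Icc (0 : ℝ) 1))) := by
    conv_lhs => rw [← hp.map_eq]
    refine integral_map hp.measurable.aemeasurable ?_
    rw [hp.map_eq]; exact hF.aestronglyMeasurable
  have h2 : Integrable (fun z : (Fin d → ℝ) × ℝ => F (Function.update z.1 i z.2))
      ((volume.restrict (unitCube d)).prod (volume.restrict (Icc (0 : ℝ) 1))) :=
    hp.integrable_comp_of_integrable hF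
  rw [h1, integral_prod _ h2]
  congr 1; ext x
  rw [intervalIntegral.integral_of_le zero_le_one, integral_Icc_eq_integral_Ioc]

lemma integrable_slice (i : Fin d) {F : (Fin d → ℝ) → ℝ}
    (hF : Integrable F (volume.restrict (unitCube d))) :
    Integrable (fun x => ∫ s in (0 : ℝ)..1, F (Function.update x i s))
      (volume.restrict (unitCube d)) := by
  have hp := measurePreserving_update i
  have := (hp.integrable_comp_of_integrable hF).integral_prod_left
  refine this.congr (Eventually.of_forall fun x => ?_)
  simp only [Function.comp_apply]
  rw [intervalIntegral.integral_of_le zero_le_one, integral_Icc_eq_integral_Ioc]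

/-- Almost everywhere bounded measurable functions on the cube. -/
def BM (d : ℕ) : Submodule ℝ ((Fin d → ℝ) → ℝ) where
  carrier := {f | AEStronglyMeasurable f (volume.restrict (unitCube d)) ∧
    ∃ C : ℝ, ∀ᵐ x ∂(volume.restrict (unitCube d)), |f x| ≤ C}
  add_mem' := fun {f g} ⟨h1, C, hC⟩ ⟨h2, D, hD⟩ => ⟨h1.add h2, C + D, by
    filter_upwards [hC, hD] with x h h'
    exact (abs_add_le _ _).trans (add_le_add h h')⟩
  zero_mem' := ⟨aestronglyMeasurable_zero, 0, by simp⟩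
  smul_mem' := fun c f ⟨h1, C, hC⟩ => ⟨h1.const_smul c, |c| * C, by
    filter_upwards [hC] with x h
    simp only [Pi.smul_apply, smul_eq_mul, abs_mul]
    gcongr⟩

lemma BM.mul {f g : (Fin d → ℝ) → ℝ} (hf : f ∈ BM d) (hg : g ∈ BM d) :
    (fun x => f x * g x) ∈ BM d := by
  obtain ⟨h1, C, hC⟩ := hf
  obtain ⟨h2, D, hD⟩ := hg
  refine ⟨h1.mul h2, C * D, ?_⟩
  filter_upwards [hC, hD] with x h h'
  rw [abs_mul]
  exact mul_le_mul h h' (abs_nonneg _) ((abs_nonneg _).trans h)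

lemma BM.integrable {f : (Fin d → ℝ) → ℝ} (hf : f ∈ BM d) :
    Integrable f (volume.restrict (unitCube d)) := by
  obtain ⟨h1, C, hC⟩ := hf
  exact (integrable_const C).mono' h1 (by filter_upwards [hC] with x h using h)

lemma BM.congr {f g : (Fin d → ℝ) → ℝ} (hf : f ∈ BM d)
    (h : f =ᵐ[volume.restrict (unitCube d)] g) : g ∈ BM d := by
  obtain ⟨h1, C, hC⟩ := hf
  refine ⟨h1.congr h, C, ?_⟩
  filter_upwards [hC, h] with x h2 h3
  rwa [← h3]

lemma BM.of_continuousOn {f : (Fin d → ℝ) → ℝ} (hf : ContinuousOn f (unitCube d)) : f ∈ BM d := by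
  have hK : IsCompact (unitCube d) := isCompact_Icc
  obtain ⟨C, hC⟩ := hK.exists_bound_of_continuousOn hf
  exact ⟨hf.aestronglyMeasurable (measurableSet_unitCube d), C,
    (ae_restrict_mem (measurableSet_unitCube d)).mono fun x hx => hC x hx⟩

lemma BM.memLp {f : (Fin d → ℝ) → ℝ} (hf : f ∈ BM d) :
    MemLp f 2 (volume.restrict (unitCube d)) := by
  obtain ⟨h1, C, hC⟩ := hf
  exact MemLp.of_bound h1 C hC

/-- The `L²(Ω)` norm as a real number. -/
noncomputable def nrm (f : (Fin d → ℝ) → ℝ) : ℝ := Real.sqrt (∫ x in unitCube d, f x ^ 2)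

lemma nrm_nonneg (f : (Fin d → ℝ) → ℝ) : 0 ≤ nrm f := Real.sqrt_nonneg _

lemma nrm_sq (f : (Fin d → ℝ) → ℝ) : nrm f ^ 2 = ∫ x in unitCube d, f x ^ 2 :=
  Real.sq_sqrt (integral_nonneg fun _ => sq_nonneg _)

lemma l2Norm_eq {f : (Fin d → ℝ) → ℝ} (hf : f ∈ BM d) : l2Norm f = ENNReal.ofReal (nrm f) := by
  unfold l2Norm nrm
  rw [(BM.memLp hf).eLpNorm_eq_integral_rpow_norm (by norm_num) (by norm_num), Real.sqrt_eq_rpow]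
  simp

lemma nrm_add_le {f g : (Fin d → ℝ) → ℝ} (hf : f ∈ BM d) (hg : g ∈ BM d) :
    nrm (f + g) ≤ nrm f + nrm g := by
  have h := eLpNorm_add_le (p := 2) hf.1 hg.1 (by norm_num)
  change l2Norm (f + g) ≤ l2Norm f + l2Norm g at h
  rw [l2Norm_eq hf, l2Norm_eq hg, l2Norm_eq (add_mem hf hg),
    ← ENNReal.ofReal_add (nrm_nonneg f) (nrm_nonneg g)] at h
  exact (ENNReal.ofReal_le_ofReal_iff (add_nonneg (nrm_nonneg f) (nrm_nonneg g))).1 h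

lemma nrm_neg (f : (Fin d → ℝ) → ℝ) : nrm (-f) = nrm f := by simp [nrm]

lemma nrm_sub_le {f g : (Fin d → ℝ) → ℝ} (hf : f ∈ BM d) (hg : g ∈ BM d) :
    nrm (f - g) ≤ nrm f + nrm g := by
  rw [sub_eq_add_neg, ← nrm_neg g]
  exact nrm_add_le hf (neg_mem hg)

lemma nrm_sum_le {ι : Type*} (s : Finset ι) {f : ι → (Fin d → ℝ) → ℝ} (hf : ∀ i ∈ s, f i ∈ BM d) :
    nrm (∑ i ∈ s, f i) ≤ ∑ i ∈ s, nrm (f i) := by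
  classical
  induction s using Finset.induction_on with
  | empty => simp [nrm]
  | insert i s hi ih =>
    rw [Finset.sum_insert hi, Finset.sum_insert hi]
    have h1 := hf i (Finset.mem_insert_self _ _)
    have h2 : ∀ j ∈ s, f j ∈ BM d := fun j hj => hf j (Finset.mem_insert_of_mem hj)
    exact (nrm_add_le h1 (Submodule.sum_mem _ h2)).trans (add_le_add_right (ih h2) _)

lemma nrm_le_of_abs_le {f : (Fin d → ℝ) → ℝ} {C : ℝ} (hC : 0 ≤ C)
    (h : ∀ᵐ x ∂(volume.restrict (unitCube d)), |f x| ≤ C) : nrm f ≤ C := by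
  refine Real.sqrt_le_iff.2 ⟨hC, ?_⟩
  have h2 := norm_integral_le_of_norm_le_const (μ := volume.restrict (unitCube d))
    (f := fun x => f x ^ 2) (C := C ^ 2) (by
      filter_upwards [h] with x hx
      rw [norm_pow, Real.norm_eq_abs]
      exact pow_le_pow_left₀ (abs_nonneg _) hx 2)
  have h3 := (Real.le_norm_self _).trans h2
  simpa using h3

/-- A quantity bounded by all weighted sums `θ a² + b² / θ` is bounded by the product. -/
lemma le_two_mul_of_forall {X K a b : ℝ} (hK : 0 ≤ K) (ha : 0 ≤ a) (hb : 0 ≤ b)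
    (h : ∀ θ > 0, X ≤ K * (θ * a ^ 2 + θ⁻¹ * b ^ 2)) : X ≤ 2 * K * a * b := by
  refine le_of_forall_pos_le_add fun ε hε => ?_
  have hcont : Tendsto (fun e : ℝ => 2 * K * (a + e) * (b + e)) (𝓝[>] 0) (𝓝 (2 * K * (a + 0) * (b + 0))) := by
    refine tendsto_nhdsWithin_of_tendsto_nhds (Continuous.tendsto ?_ 0)
    fun_prop
  rw [add_zero, add_zero] at hcont
  have hev := hcont.eventually (gt_mem_nhds (show 2 * K * a * b < 2 * K * a * b + ε by linarith))
  obtain ⟨e, he, hpos⟩ := (hev.and self_mem_nhdsWithin).exists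
  have hpos' : (0 : ℝ) < e := hpos
  have hθ := h ((b + e) / (a + e)) (by positivity)
  refine hθ.trans (le_trans ?_ he.le)
  have h1 : (b + e) / (a + e) * a ^ 2 ≤ (b + e) * (a + e) := by
    rw [div_mul_eq_mul_div, div_le_iff₀ (by positivity)]
    have : a ^ 2 ≤ (a + e) ^ 2 := by gcongr; linarith
    nlinarith
  have h2 : ((b + e) / (a + e))⁻¹ * b ^ 2 ≤ (b + e) * (a + e) := by
    rw [inv_div, div_mul_eq_mul_div, div_le_iff₀ (by positivity)]
    have : b ^ 2 ≤ (b + e) ^ 2 := by gcongr; linarith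
    nlinarith
  nlinarith

/-- The Cauchy–Schwarz inequality. -/
lemma abs_integral_mul_le {f g : (Fin d → ℝ) → ℝ} (hf : f ∈ BM d) (hg : g ∈ BM d) :
    |∫ x in unitCube d, f x * g x| ≤ nrm f * nrm g := by
  have key : ∀ θ > 0, |∫ x in unitCube d, f x * g x| ≤
      (1 / 2) * (θ * nrm f ^ 2 + θ⁻¹ * nrm g ^ 2) := by
    intro θ hθ
    have hff : Integrable (fun x => f x ^ 2) (volume.restrict (unitCube d)) := by
      simpa [sq] using (BM.integrable (BM.mul hf hf))
    have hgg : Integrable (fun x => g x ^ 2) (volume.restrict (unitCube d)) := by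
      simpa [sq] using (BM.integrable (BM.mul hg hg))
    rw [nrm_sq, nrm_sq, ← integral_const_mul, ← integral_const_mul,
      ← integral_add (hff.const_mul _) (hgg.const_mul _), ← integral_const_mul]
    refine (abs_integral_le_integral_abs).trans (integral_mono ((BM.integrable (BM.mul hf hg)).abs)
      (((hff.const_mul _).add (hgg.const_mul _)).const_mul _) fun x => ?_)
    simp only
    rw [abs_mul, ← sq_abs (f x), ← sq_abs (g x)]
    have h1 : 0 ≤ θ⁻¹ * (θ * |f x| - |g x|) ^ 2 := by positivity
    have h2 : θ⁻¹ * (θ * |f x| - |g x|) ^ 2 =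
        θ * |f x| ^ 2 + θ⁻¹ * |g x| ^ 2 - 2 * (|f x| * |g x|) := by
      field_simp; ring
    linarith
  have := le_two_mul_of_forall (by norm_num) (nrm_nonneg f) (nrm_nonneg g) key
  linarith

/-- Bounded measurable functions with one-sided limits along all coordinate lines. -/
def Adm (d : ℕ) : Submodule ℝ ((Fin d → ℝ) → ℝ) where
  carrier := {f | Measurable f ∧ (∃ C : ℝ, ∀ x, |f x| ≤ C) ∧ ∀ x i c,
    (∃ y, Tendsto (fun s => f (Function.update x i s)) (𝓝[<] c) (𝓝 y)) ∧
    ∃ y, Tendsto (fun s => f (Function.update x i s)) (𝓝[>] c) (𝓝 y)}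
  add_mem' := fun {f g} ⟨h1, ⟨C, hC⟩, h2⟩ ⟨h1', ⟨D, hD⟩, h2'⟩ =>
    ⟨h1.add h1', ⟨C + D, fun x => (abs_add_le _ _).trans (add_le_add (hC x) (hD x))⟩,
      fun x i c => by
        obtain ⟨⟨y, hy⟩, z, hz⟩ := h2 x i c
        obtain ⟨⟨y', hy'⟩, z', hz'⟩ := h2' x i c
        exact ⟨⟨_, hy.add hy'⟩, _, hz.add hz'⟩⟩
  zero_mem' := ⟨measurable_const, ⟨0, by simp⟩, fun x i c =>
    ⟨⟨0, tendsto_const_nhds⟩, 0, tendsto_const_nhds⟩⟩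
  smul_mem' := fun r f ⟨h1, ⟨C, hC⟩, h2⟩ => ⟨h1.const_smul r, ⟨|r| * C, fun x => by
    simp only [Pi.smul_apply, smul_eq_mul, abs_mul]
    have := hC x
    gcongr⟩, fun x i c => by
        obtain ⟨⟨y, hy⟩, z, hz⟩ := h2 x i c
        exact ⟨⟨_, hy.const_smul r⟩, _, hz.const_smul r⟩⟩

/-- Bounded measurable functions on `ℝ^d` that are right-continuous and, along each coordinate
line, piecewise polynomial of degree at most `k` on the grid of mesh size `2^{-m}`. -/
def PW (k m d : ℕ) : Submodule ℝ ((Fin d → ℝ) → ℝ) where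
  carrier := {f | Measurable f ∧ (∃ C : ℝ, ∀ x, |f x| ≤ C) ∧
    (∀ x, ContinuousWithinAt f (Ici x) x) ∧ ∀ x i, (fun s => f (Function.update x i s)) ∈ PW1 k m}
  add_mem' := fun {f g} ⟨h1, ⟨C, hC⟩, h2, h3⟩ ⟨h1', ⟨D, hD⟩, h2', h3'⟩ =>
    ⟨h1.add h1', ⟨C + D, fun x => (abs_add_le _ _).trans (add_le_add (hC x) (hD x))⟩,
      fun x => (h2 x).add (h2' x), fun x i => add_mem (h3 x i) (h3' x i)⟩
  zero_mem' := ⟨measurable_const, ⟨0, by simp⟩, fun x => continuousWithinAt_const,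
    fun x i => zero_mem _⟩
  smul_mem' := fun r f ⟨h1, ⟨C, hC⟩, h2, h3⟩ => ⟨h1.const_smul r, ⟨|r| * C, fun x => by
    simp only [Pi.smul_apply, smul_eq_mul, abs_mul]
    have := hC x
    gcongr⟩, fun x => (h2 x).const_smul r, fun x i => Submodule.smul_mem _ r (h3 x i)⟩

variable {k m : ℕ}

lemma PW.measurable {f : (Fin d → ℝ) → ℝ} (hf : f ∈ PW k m d) : Measurable f := hf.1

lemma PW.slice {f : (Fin d → ℝ) → ℝ} (hf : f ∈ PW k m d) (x : Fin d → ℝ) (i : Fin d) :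
    (fun s => f (Function.update x i s)) ∈ PW1 k m := hf.2.2.2 x i

lemma PW_le_Adm (k m d : ℕ) : PW k m d ≤ Adm d := fun _ hf =>
  ⟨hf.1, hf.2.1, fun x i c => ⟨PW1.exists_tendsto_left (PW.slice hf x i) c,
    _, PW1.tendsto_right (PW.slice hf x i) c⟩⟩

lemma Adm_le_BM (d : ℕ) : Adm d ≤ BM d := fun _ hf =>
  ⟨hf.1.aestronglyMeasurable, hf.2.1.imp fun _ h => Eventually.of_forall h⟩

lemma PW_le_BM (k m d : ℕ) : PW k m d ≤ BM d := (PW_le_Adm k m d).trans (Adm_le_BM d)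

lemma prod_mem_PW {w : Fin d → ℝ → ℝ} (hw : ∀ i, w i ∈ PW1 k m)
    (hb : ∀ i, ∃ C : ℝ, ∀ x, |w i x| ≤ C) : (fun x => ∏ i, w i (x i)) ∈ PW k m d := by
  classical
  choose C hC using hb
  refine ⟨Finset.measurable_prod _ fun i _ => (PW1.measurable (hw i)).comp (measurable_pi_apply i),
    ⟨∏ i, C i, fun x => ?_⟩, fun x => ?_, fun x i => ?_⟩
  · rw [Finset.abs_prod]
    exact Finset.prod_le_prod (fun i _ => abs_nonneg _) fun i _ => hC i _
  · refine tendsto_finsetProd _ fun i _ => ?_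
    refine (PW1.rightCont (hw i) (x i)).tendsto.comp ?_
    refine tendsto_nhdsWithin_iff.2 ⟨((continuous_apply i).continuousWithinAt).tendsto, ?_⟩
    filter_upwards [self_mem_nhdsWithin] with y hy using hy i
  · have : (fun s => ∏ j, w j (Function.update x i s j)) =
        (∏ j ∈ Finset.univ.erase i, w j (x j)) • w i := by
      ext s
      rw [← Finset.mul_prod_erase _ _ (Finset.mem_univ i), Function.update_self, Pi.smul_apply,
        smul_eq_mul, mul_comm]
      congr 1
      refine Finset.prod_congr rfl fun j hj => ?_
      rw [Function.update_of_ne (Finset.ne_of_mem_erase hj)]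
    rw [this]
    exact Submodule.smul_mem _ _ (hw i)

/-- A right-continuous function with vanishing mean square vanishes on `[0, 1)^d`. -/
lemma PW.eq_zero_of_integral {f : (Fin d → ℝ) → ℝ} (hf : f ∈ PW k m d)
    (h : ∫ x in unitCube d, f x * f x = 0) {x : Fin d → ℝ} (hx : x ∈ box d 0) : f x = 0 := by
  have hff := BM.integrable (BM.mul (PW_le_BM k m d hf) (PW_le_BM k m d hf))
  have h0 := (integral_eq_zero_iff_of_nonneg (fun x => mul_self_nonneg (f x)) hff).1 h
  by_contra hne
  have hev : ∀ᶠ y in 𝓝[≥] x, f y ≠ 0 := (hf.2.2.1 x).eventually_ne hne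
  rw [eventually_nhdsWithin_iff, Metric.eventually_nhds_iff] at hev
  obtain ⟨ε, hε, hball⟩ := hev
  set B : Set (Fin d → ℝ) := pi univ fun i => Ioo (x i) (min 1 (x i + ε / 2)) with hB
  have hxi : ∀ i, 0 ≤ x i ∧ x i < 1 := fun i => by simpa using hx i trivial
  have hBpos : 0 < volume B := by
    rw [hB, Real.volume_pi_Ioo]
    refine pos_iff_ne_zero.2 (Finset.prod_ne_zero_iff.2 fun i _ => ?_)
    have : x i < min 1 (x i + ε / 2) := lt_min (hxi i).2 (by linarith)
    simpa using this
  have hBc : B ⊆ unitCube d := fun y hy =>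
    ⟨fun i => (hxi i).1.trans (hy i trivial).1.le, fun i => (hy i trivial).2.le.trans (min_le_left _ _)⟩
  have hBne : ∀ y ∈ B, f y * f y ≠ 0 := by
    intro y hy
    refine mul_self_ne_zero.2 (hball ?_ fun i => (hy i trivial).1.le)
    rw [dist_pi_lt_iff hε]
    intro i
    have h1 := (hy i trivial).1
    have h2 := (hy i trivial).2.trans_le (min_le_right _ _)
    rw [Real.dist_eq, abs_lt]
    constructor <;> linarith
  have : volume.restrict (unitCube d) B = 0 := by
    refine measure_mono_null (fun y hy => ?_) h0
    exact hBne y hy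
  rw [Measure.restrict_apply' (measurableSet_unitCube d), inter_eq_left.2 hBc] at this
  exact hBpos.ne' this

end classes

/-! ### Inverse estimates along coordinate lines -/

section oneD
variable {k m N : ℕ} {f : ℝ → ℝ}

lemma intervalIntegrable_of_bdd {g : ℝ → ℝ} (hm : Measurable g) (hb : ∃ C : ℝ, ∀ x, |g x| ≤ C)
    (a b : ℝ) : IntervalIntegrable g volume a b := by
  obtain ⟨C, hC⟩ := hb
  exact (intervalIntegrable_const (c := C)).mono_fun hm.aestronglyMeasurable
    (Eventually.of_forall fun x => (hC x).trans (le_abs_self C))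

lemma intervalIntegrable_sq {g : ℝ → ℝ} (hm : Measurable g) (hb : ∃ C : ℝ, ∀ x, |g x| ≤ C)
    (a b : ℝ) : IntervalIntegrable (fun x => g x ^ 2) volume a b := by
  obtain ⟨C, hC⟩ := hb
  refine intervalIntegrable_of_bdd (hm.pow_const 2) ⟨C ^ 2, fun x => ?_⟩ a b
  rw [abs_pow]
  exact pow_le_pow_left₀ (abs_nonneg _) (hC x) 2

lemma sum_integral_cells {g : ℝ → ℝ} (hg : ∀ a b, IntervalIntegrable g volume a b) (a H : ℝ) (M : ℕ) :
    ∑ j ∈ Finset.range M, ∫ y in (a + j * H)..(a + (j + 1) * H), g y =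
      ∫ y in a..(a + M * H), g y := by
  have := intervalIntegral.sum_integral_adjacent_intervals (f := g) (μ := volume)
    (a := fun j : ℕ => a + j * H) (n := M) fun j _ => hg _ _
  simpa using this

lemma integral_sq_mono {g : ℝ → ℝ} (hg : ∀ a b, IntervalIntegrable (fun x => g x ^ 2) volume a b)
    {a b c e : ℝ} (h1 : c ≤ a) (h2 : a ≤ b) (h3 : b ≤ e) :
    ∫ y in a..b, g y ^ 2 ≤ ∫ y in c..e, g y ^ 2 :=
  intervalIntegral.integral_mono_interval h1 h2 h3 (Eventually.of_forall fun _ => sq_nonneg _) (hg _ _)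

lemma two_pow_mul_meshSize (n : ℕ) : (2 : ℝ) ^ n * meshSize n = 1 := by
  unfold meshSize; field_simp

lemma meshSize_mul_pow {m N : ℕ} (h : N ≤ m) : (2 : ℝ) ^ (m - N) * meshSize m = meshSize N := by
  unfold meshSize
  have : (2 : ℝ) ^ m = 2 ^ (m - N) * 2 ^ N := by rw [← pow_add]; congr 1; omega
  rw [this]; field_simp

/-- Values at the left ends of cells, in one form for both shifts of the faces. -/
lemma PW1.sum_sq_faces_le (hf : f ∈ PW1 k m) (hb : ∃ C : ℝ, ∀ x, |f x| ≤ C) (hN : N + 1 ≤ m)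
    {δ : ℝ} (hδ : δ = 0 ∨ δ = 1 / 2) :
    ∑ j ∈ Finset.range (2 ^ N), f ((j + δ) * meshSize N) ^ 2 ≤
      invConst k * 2 ^ m * ∫ s in (0 : ℝ)..1, f s ^ 2 := by
  have hI := intervalIntegrable_sq (PW1.measurable hf) hb
  have hp := meshSize_pos m
  have hpN := meshSize_pos N
  have hC := invConst_pos k
  have hhalf : meshSize m ≤ meshSize N / 2 := by
    rw [← meshSize_succ, ← meshSize_mul_pow hN]
    have : (1 : ℝ) ≤ 2 ^ (m - (N + 1)) := one_le_pow₀ one_le_two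
    nlinarith
  have hgrid : ∀ j : ℕ, ∃ J : ℤ, (j + δ) * meshSize N = J * meshSize m := by
    intro j
    rcases hδ with rfl | rfl
    · refine ⟨j * 2 ^ (m - N), ?_⟩
      push_cast; rw [mul_assoc, meshSize_mul_pow (by omega)]; ring
    · refine ⟨(2 * j + 1) * 2 ^ (m - (N + 1)), ?_⟩
      push_cast; rw [mul_assoc, meshSize_mul_pow hN, meshSize_succ]; ring
  have hcell : ∀ j : ℕ, f ((j + δ) * meshSize N) ^ 2 ≤ invConst k * 2 ^ m *
      ∫ y in (0 + j * meshSize N)..(0 + (j + 1) * meshSize N), f y ^ 2 := by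
    intro j
    obtain ⟨J, hJ⟩ := hgrid j
    have h0 : 0 ≤ δ ∧ δ ≤ 1 / 2 := by rcases hδ with rfl | rfl <;> norm_num
    have := (PW1.cell_estimate hf (j := J) (x := (j + δ) * meshSize N)
      ⟨hJ.ge, by rw [hJ]; nlinarith⟩).1
    refine this.trans ?_
    gcongr
    refine integral_sq_mono hI ?_ (by nlinarith) ?_
    · rw [← hJ]; nlinarith
    · have : ((J : ℝ) + 1) * meshSize m = (j + δ) * meshSize N + meshSize m := by rw [hJ]; ring
      rw [this]; nlinarith
  calc _ ≤ ∑ j ∈ Finset.range (2 ^ N), invConst k * 2 ^ m *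
        ∫ y in (0 + j * meshSize N)..(0 + (j + 1) * meshSize N), f y ^ 2 :=
        Finset.sum_le_sum fun j _ => hcell j
    _ = _ := by
        rw [← Finset.mul_sum, sum_integral_cells hI]
        push_cast
        rw [two_pow_mul_meshSize, zero_add]

/-- The left traces belong to the cells to the left of the faces. For the face at `0` this is a half cell
outside of the domain, which `htail` accounts for. -/
lemma PW1.sum_sq_jumps_le (hf : f ∈ PW1 k (N + 1)) (hb : ∃ C : ℝ, ∀ x, |f x| ≤ C)
    {δ : ℝ} (hδ : δ = 0 ∨ δ = 1 / 2)
    (htail : ∫ s in (-(meshSize N / 2))..0, f s ^ 2 ≤ ∫ s in (0 : ℝ)..1, f s ^ 2) :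
    ∑ j ∈ Finset.range (2 ^ N), (Function.leftLim f ((j + δ) * meshSize N) -
      f ((j + δ) * meshSize N)) ^ 2 ≤ 8 * invConst k * 2 ^ N * ∫ s in (0 : ℝ)..1, f s ^ 2 := by
  have hI := intervalIntegrable_sq (PW1.measurable hf) hb
  have hpN := meshSize_pos N
  have hC := invConst_pos k
  have hgrid : ∃ z : ℤ, δ = z / 2 := by
    rcases hδ with rfl | rfl
    · exact ⟨0, by simp⟩
    · exact ⟨1, by simp⟩
  obtain ⟨z, hz⟩ := hgrid
  have hcell : ∀ j : ℕ, (Function.leftLim f ((j + δ) * meshSize N) -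
      f ((j + δ) * meshSize N)) ^ 2 ≤ 4 * invConst k * 2 ^ N *
      ∫ y in ((δ - 1 / 2) * meshSize N + j * meshSize N)..((δ - 1 / 2) * meshSize N +
        (j + 1) * meshSize N), f y ^ 2 := by
    intro j
    have e0 : (j + δ) * meshSize N = ((2 * j + z : ℤ) : ℝ) * meshSize (N + 1) := by
      rw [meshSize_succ, hz]; push_cast; ring
    have e1 : (j + δ) * meshSize N = (((2 * j + z - 1 : ℤ) : ℝ) + 1) * meshSize (N + 1) := by
      rw [meshSize_succ, hz]; push_cast; ring
    have hp := meshSize_pos (N + 1)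
    have h1 := (PW1.cell_estimate hf (j := 2 * j + z) (x := (j + δ) * meshSize N)
      ⟨e0.ge, by rw [e0]; nlinarith⟩).1
    have h2 := (PW1.cell_estimate hf (j := 2 * j + z - 1)
      (x := ((2 * j + z - 1 : ℤ) : ℝ) * meshSize (N + 1)) ⟨le_rfl, by nlinarith⟩).2.2
    rw [← e1] at h2
    have e2 : ((2 * j + z - 1 : ℤ) : ℝ) * meshSize (N + 1) =
        (δ - 1 / 2) * meshSize N + j * meshSize N := by
      rw [meshSize_succ, hz]; push_cast; ring
    have e3 : (((2 * j + z : ℤ) : ℝ) + 1) * meshSize (N + 1) =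
        (δ - 1 / 2) * meshSize N + (j + 1) * meshSize N := by
      rw [meshSize_succ, hz]; push_cast; ring
    rw [e2] at h2
    rw [e3, ← e0] at h1
    rw [← intervalIntegral.integral_add_adjacent_intervals (hI _ ((j + δ) * meshSize N)) (hI _ _)]
    have e4 : (2 : ℝ) ^ (N + 1) = 2 * 2 ^ N := by rw [pow_succ]; ring
    rw [e4] at h1 h2
    nlinarith [sq_nonneg (Function.leftLim f ((j + δ) * meshSize N) + f ((j + δ) * meshSize N))]
  have hnn : 0 ≤ ∫ s in (0 : ℝ)..1, f s ^ 2 :=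
    intervalIntegral.integral_nonneg zero_le_one fun _ _ => sq_nonneg _
  have htot : ∫ y in ((δ - 1 / 2) * meshSize N)..((δ - 1 / 2) * meshSize N + 1), f y ^ 2 ≤
      2 * ∫ s in (0 : ℝ)..1, f s ^ 2 := by
    rcases hδ with rfl | rfl
    · rw [← intervalIntegral.integral_add_adjacent_intervals (hI _ 0) (hI 0 _)]
      have h1 : (0 - 1 / 2 : ℝ) * meshSize N = -(meshSize N / 2) := by ring
      rw [h1]
      have h2 : ∫ y in (0 : ℝ)..(-(meshSize N / 2) + 1), f y ^ 2 ≤ ∫ s in (0 : ℝ)..1, f s ^ 2 := by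
        have := meshSize_le_one N
        exact integral_sq_mono hI le_rfl (by linarith) (by linarith)
      linarith
    · simp only [sub_self, zero_mul, zero_add]; linarith
  calc _ ≤ ∑ j ∈ Finset.range (2 ^ N), 4 * invConst k * 2 ^ N *
        ∫ y in ((δ - 1 / 2) * meshSize N + j * meshSize N)..((δ - 1 / 2) * meshSize N +
        (j + 1) * meshSize N), f y ^ 2 := Finset.sum_le_sum fun j _ => hcell j
    _ = 4 * invConst k * 2 ^ N *
        ∫ y in ((δ - 1 / 2) * meshSize N)..((δ - 1 / 2) * meshSize N + 1), f y ^ 2 := by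
        rw [← Finset.mul_sum, sum_integral_cells hI]
        push_cast
        rw [two_pow_mul_meshSize]
    _ ≤ 4 * invConst k * 2 ^ N * (2 * ∫ s in (0 : ℝ)..1, f s ^ 2) := by gcongr
    _ = _ := by ring

lemma PW1.leftLim_one_sq_le (hf : f ∈ PW1 k m) (hb : ∃ C : ℝ, ∀ x, |f x| ≤ C) :
    Function.leftLim f 1 ^ 2 ≤ invConst k * 2 ^ m * ∫ s in (0 : ℝ)..1, f s ^ 2 := by
  have hI := intervalIntegrable_sq (PW1.measurable hf) hb
  have hp := meshSize_pos m
  have hC := invConst_pos k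
  have e : (((2 ^ m - 1 : ℤ) : ℝ) + 1) * meshSize m = 1 := by
    push_cast; rw [sub_add_cancel, two_pow_mul_meshSize]
  have := (PW1.cell_estimate hf (j := 2 ^ m - 1) (x := ((2 ^ m - 1 : ℤ) : ℝ) * meshSize m)
    ⟨le_rfl, by nlinarith⟩).2.2
  rw [e] at this
  refine this.trans ?_
  gcongr
  have e' : ((2 ^ m - 1 : ℤ) : ℝ) * meshSize m = 1 - meshSize m := by linarith
  rw [e']
  exact integral_sq_mono hI (by linarith [meshSize_le_one m]) (by linarith) le_rfl

lemma PW1.zero_sq_le (hf : f ∈ PW1 k m) (hb : ∃ C : ℝ, ∀ x, |f x| ≤ C) :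
    f 0 ^ 2 ≤ invConst k * 2 ^ m * ∫ s in (0 : ℝ)..1, f s ^ 2 := by
  have hI := intervalIntegrable_sq (PW1.measurable hf) hb
  have hp := meshSize_pos m
  have hC := invConst_pos k
  have := (PW1.cell_estimate hf (j := 0) (x := 0) ⟨by simp, by simpa using hp⟩).1
  refine this.trans ?_
  gcongr
  refine integral_sq_mono hI (by simp) (by simpa using hp.le) ?_
  simpa using meshSize_le_one m

lemma PW1.deriv_bdd (hf : f ∈ PW1 k m) {C : ℝ} (hC : ∀ x, |f x| ≤ C) (x : ℝ) :
    derivWithin f (Ici x) x ^ 2 ≤ invConst k * (2 ^ m) ^ 3 * C ^ 2 := by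
  obtain ⟨j, hj⟩ := exists_mem_Ico_grid m x
  have hk := invConst_pos k
  have hp := meshSize_pos m
  refine (PW1.cell_estimate hf hj).2.1.trans ?_
  gcongr
  have hle : (j : ℝ) * meshSize m ≤ (j + 1) * meshSize m := by nlinarith
  have h1 := intervalIntegral.integral_mono_on hle
    (intervalIntegrable_sq (PW1.measurable hf) ⟨C, hC⟩ _ _)
    (intervalIntegrable_const (μ := volume) (c := C ^ 2)) fun y _ => by
      rw [← sq_abs]; exact pow_le_pow_left₀ (abs_nonneg _) (hC y) 2
  rw [intervalIntegral.integral_const, smul_eq_mul] at h1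
  refine h1.trans ?_
  have : ((j : ℝ) + 1) * meshSize m - j * meshSize m = meshSize m := by ring
  rw [this]
  have := meshSize_le_one m
  nlinarith [sq_nonneg C]

lemma PW1.integral_deriv_sq_le (hf : f ∈ PW1 k m) (hb : ∃ C : ℝ, ∀ x, |f x| ≤ C)
    (hdm : Measurable fun x => derivWithin f (Ici x) x) :
    ∫ s in (0 : ℝ)..1, derivWithin f (Ici s) s ^ 2 ≤
      invConst k * (2 ^ m) ^ 2 * ∫ s in (0 : ℝ)..1, f s ^ 2 := by
  have hI := intervalIntegrable_sq (PW1.measurable hf) hb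
  have hp := meshSize_pos m
  obtain ⟨C, hC⟩ := hb
  have hID : ∀ a b, IntervalIntegrable (fun s => derivWithin f (Ici s) s ^ 2) volume a b := by
    intro a b
    refine intervalIntegrable_of_bdd (hdm.pow_const 2) ⟨invConst k * (2 ^ m) ^ 3 * C ^ 2, fun x => ?_⟩ a b
    rw [abs_of_nonneg (sq_nonneg _)]
    exact PW1.deriv_bdd hf hC x
  have hcell : ∀ j : ℕ, ∫ s in (0 + j * meshSize m)..(0 + (j + 1) * meshSize m),
      derivWithin f (Ici s) s ^ 2 ≤ invConst k * (2 ^ m) ^ 2 *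
        ∫ s in (0 + j * meshSize m)..(0 + (j + 1) * meshSize m), f s ^ 2 := by
    intro j
    simp only [zero_add]
    have hle : (j : ℝ) * meshSize m ≤ (j + 1) * meshSize m := by nlinarith
    have h1 := intervalIntegral.integral_mono_on_of_le_Ioo hle (hID _ _)
      (intervalIntegrable_const (μ := volume) (c := invConst k * (2 ^ m) ^ 3 *
        ∫ s in (j * meshSize m)..((j + 1) * meshSize m), f s ^ 2)) fun y hy => by
        have := (PW1.cell_estimate hf (j := j) (x := y)
          (by simpa using Ioo_subset_Ico_self hy)).2.1
        simpa using this
    rw [intervalIntegral.integral_const, smul_eq_mul] at h1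
    refine h1.trans_eq ?_
    have : ((j : ℝ) + 1) * meshSize m - j * meshSize m = meshSize m := by ring
    rw [this]
    have h2 := two_pow_mul_meshSize m
    linear_combination (invConst k * (2 ^ m) ^ 2 *
      ∫ s in (j * meshSize m)..((j + 1) * meshSize m), f s ^ 2) * h2
  have h1 := sum_integral_cells hID 0 (meshSize m) (2 ^ m)
  have h2 := sum_integral_cells hI 0 (meshSize m) (2 ^ m)
  push_cast at h1 h2
  rw [two_pow_mul_meshSize, zero_add] at h1 h2
  rw [← h1, ← h2, Finset.mul_sum]
  exact Finset.sum_le_sum fun j _ => hcell j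

end oneD

/-! ### Flux forms as integrals of one-dimensional forms over coordinate lines -/

section flux
variable {d k m N : ℕ} {f φ : (Fin d → ℝ) → ℝ}

/-- The right derivative in the `i`-th coordinate; unlike `pderiv` it exists everywhere for the
right-continuous representatives of piecewise polynomials. -/
noncomputable def rderiv (i : Fin d) (φ : (Fin d → ℝ) → ℝ) (x : Fin d → ℝ) : ℝ :=
  derivWithin (fun s => φ (Function.update x i s)) (Ici (x i)) (x i)

lemma rderiv_update (i : Fin d) (φ : (Fin d → ℝ) → ℝ) (x : Fin d → ℝ) (s : ℝ) :
    rderiv i φ (Function.update x i s) =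
      derivWithin (fun s => φ (Function.update x i s)) (Ici s) s := by
  simp [rderiv]

lemma measurable_update_const (i : Fin d) (c : ℝ) :
    Measurable fun x : Fin d → ℝ => Function.update x i c :=
  measurable_update_left

lemma tendsto_add_inv (c : ℝ) :
    Tendsto (fun n : ℕ => c + 1 / ((n : ℝ) + 1)) atTop (𝓝[>] c) := by
  refine tendsto_nhdsWithin_iff.2 ⟨?_, Eventually.of_forall fun n => ?_⟩
  · simpa using (tendsto_one_div_add_atTop_nhds_zero_nat (𝕜 := ℝ)).const_add c
  · have : (0 : ℝ) < 1 / ((n : ℝ) + 1) := by positivity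
    simpa using this

lemma tendsto_sub_inv (c : ℝ) :
    Tendsto (fun n : ℕ => c - 1 / ((n : ℝ) + 1)) atTop (𝓝[<] c) := by
  refine tendsto_nhdsWithin_iff.2 ⟨?_, Eventually.of_forall fun n => ?_⟩
  · simpa using (tendsto_one_div_add_atTop_nhds_zero_nat (𝕜 := ℝ)).const_sub c
  · have : (0 : ℝ) < 1 / ((n : ℝ) + 1) := by positivity
    simpa using this

lemma measurable_update_shift (i : Fin d) (c : ℝ) :
    Measurable fun x : Fin d → ℝ => Function.update x i (x i + c) := by
  refine measurable_pi_lambda _ fun j => ?_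
  by_cases h : j = i
  · subst h; simp only [Function.update_self]; fun_prop
  · simp only [Function.update_of_ne h]; fun_prop

lemma measurable_rderiv (hφ : φ ∈ PW k m d) (i : Fin d) : Measurable (rderiv i φ) := by
  refine measurable_of_tendsto_metrizable (f := fun (n : ℕ) x =>
    (1 / ((n : ℝ) + 1))⁻¹ * (φ (Function.update x i (x i + 1 / ((n : ℝ) + 1))) - φ x)) (fun n => ?_) ?_
  · exact (((PW.measurable hφ).comp (measurable_update_shift i _)).sub
      (PW.measurable hφ)).const_mul _
  · rw [tendsto_pi_nhds]
    intro x
    have h1 := PW1.hasDerivWithinAt (PW.slice hφ x i) (x i)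
    rw [hasDerivWithinAt_iff_tendsto_slope, Ici_sdiff_left] at h1
    refine (h1.comp (tendsto_add_inv (x i))).congr fun n => ?_
    simp [slope_def_field, div_eq_inv_mul]

lemma rderiv_bdd (hφ : φ ∈ PW k m d) (i : Fin d) : ∃ C : ℝ, ∀ x, |rderiv i φ x| ≤ C := by
  obtain ⟨C, hC⟩ := hφ.2.1
  refine ⟨Real.sqrt (invConst k * (2 ^ m) ^ 3 * C ^ 2), fun x => Real.abs_le_sqrt ?_⟩
  exact PW1.deriv_bdd (PW.slice hφ x i) (fun s => hC _) _

lemma add_smul_single (x : Fin d → ℝ) (i : Fin d) (t : ℝ) :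
    x + t • Pi.single i (1 : ℝ) = Function.update x i (x i + t) := by
  ext j
  by_cases h : j = i
  · subst h; simp
  · simp [h]

lemma pderiv_eq_deriv (i : Fin d) (f : (Fin d → ℝ) → ℝ) (x : Fin d → ℝ) :
    pderiv i f x = deriv (fun s => f (Function.update x i s)) (x i) := by
  unfold pderiv lineDeriv
  simp_rw [add_smul_single]
  rw [deriv_comp_const_add (fun s => f (Function.update x i s)) (x i) 0, add_zero]

lemma ae_coord_ne (i : Fin d) (c : ℝ) :
    ∀ᵐ x ∂(volume.restrict (unitCube d)), x i ≠ c := by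
  refine ae_restrict_of_ae ?_
  rw [volume_pi]
  exact Measure.ae_eval_ne (fun _ : Fin d => (volume : Measure ℝ)) i c

lemma pderiv_ae_eq (hφ : φ ∈ PW k m d) (i : Fin d) :
    pderiv i φ =ᵐ[volume.restrict (unitCube d)] rderiv i φ := by
  have h : ∀ᵐ x ∂(volume.restrict (unitCube d)), ∀ j : ℤ, x i ≠ j * meshSize m :=
    ae_all_iff.2 fun j => ae_coord_ne i _
  filter_upwards [h] with x hx
  obtain ⟨j, hj⟩ := exists_mem_Ico_grid m (x i)
  obtain ⟨p, -, hp⟩ := PW.slice hφ x i j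
  rw [pderiv_eq_deriv, rderiv, PW1.deriv_eq hp ⟨lt_of_le_of_ne hj.1 (hx j).symm, hj.2⟩,
    PW1.derivWithin_eq hp hj]

lemma Adm.tendsto_traceL (hf : f ∈ Adm d) (x : Fin d → ℝ) (i : Fin d) (c : ℝ) :
    Tendsto (fun s => f (Function.update x i s)) (𝓝[<] c) (𝓝 (traceL i c f x)) := by
  obtain ⟨⟨y, hy⟩, -⟩ := hf.2.2 x i c
  rwa [traceL, leftLim_eq hy]

lemma Adm.tendsto_traceR (hf : f ∈ Adm d) (x : Fin d → ℝ) (i : Fin d) (c : ℝ) :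
    Tendsto (fun s => f (Function.update x i s)) (𝓝[>] c) (𝓝 (traceR i c f x)) := by
  obtain ⟨-, y, hy⟩ := hf.2.2 x i c
  rwa [traceR, rightLim_eq hy]

lemma Adm.traceL_mem_BM (hf : f ∈ Adm d) (i : Fin d) (c : ℝ) : traceL i c f ∈ BM d := by
  have ht : ∀ x, Tendsto (fun n : ℕ => f (Function.update x i (c - 1 / ((n : ℝ) + 1)))) atTop
      (𝓝 (traceL i c f x)) := fun x => (Adm.tendsto_traceL hf x i c).comp (tendsto_sub_inv c)
  obtain ⟨C, hC⟩ := hf.2.1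
  refine ⟨Measurable.aestronglyMeasurable ?_, C, Eventually.of_forall fun x =>
    le_of_tendsto (ht x).abs (Eventually.of_forall fun n => hC _)⟩
  exact measurable_of_tendsto_metrizable (fun n => hf.1.comp (measurable_update_const i _))
    (tendsto_pi_nhds.2 ht)

lemma Adm.traceR_mem_BM (hf : f ∈ Adm d) (i : Fin d) (c : ℝ) : traceR i c f ∈ BM d := by
  have ht : ∀ x, Tendsto (fun n : ℕ => f (Function.update x i (c + 1 / ((n : ℝ) + 1)))) atTop
      (𝓝 (traceR i c f x)) := fun x => (Adm.tendsto_traceR hf x i c).comp (tendsto_add_inv c)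
  obtain ⟨C, hC⟩ := hf.2.1
  refine ⟨Measurable.aestronglyMeasurable ?_, C, Eventually.of_forall fun x =>
    le_of_tendsto (ht x).abs (Eventually.of_forall fun n => hC _)⟩
  exact measurable_of_tendsto_metrizable (fun n => hf.1.comp (measurable_update_const i _))
    (tendsto_pi_nhds.2 ht)

lemma Adm.update_mem_BM (hf : f ∈ Adm d) (i : Fin d) (c : ℝ) :
    (fun x => f (Function.update x i c)) ∈ BM d := by
  obtain ⟨C, hC⟩ := hf.2.1
  exact ⟨(hf.1.comp (measurable_update_const i c)).aestronglyMeasurable, C,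
    Eventually.of_forall fun x => hC _⟩

lemma update_mem_unitCube {x : Fin d → ℝ} (hx : x ∈ unitCube d) (i : Fin d) {c : ℝ}
    (hc : c ∈ Icc (0 : ℝ) 1) : Function.update x i c ∈ unitCube d := by
  constructor <;> intro j <;> by_cases h : j = i
  · subst h; simpa using hc.1
  · simpa [h] using hx.1 j
  · subst h; simpa using hc.2
  · simpa [h] using hx.2 j

lemma continuousOn_update {g : (Fin d → ℝ) → ℝ} (hg : ContinuousOn g (unitCube d)) (i : Fin d)
    {c : ℝ} (hc : c ∈ Icc (0 : ℝ) 1) :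
    ContinuousOn (fun x => g (Function.update x i c)) (unitCube d) :=
  hg.comp (by fun_prop) fun _ hx => update_mem_unitCube hx i hc

lemma continuousOn_slice {g : (Fin d → ℝ) → ℝ} (hg : ContinuousOn g (unitCube d)) {x : Fin d → ℝ}
    (hx : x ∈ unitCube d) (i : Fin d) :
    ContinuousOn (fun s => g (Function.update x i s)) (Icc 0 1) :=
  hg.comp (by fun_prop) fun _ hs => update_mem_unitCube hx i hs

lemma face_mem_Icc {J : Finset ℕ} (hJ : J ⊆ Finset.range (2 ^ N)) {δ : ℝ}
    (hδ : δ = 0 ∨ δ = 1 / 2) {j : ℕ} (hj : j ∈ J) : (j + δ) * meshSize N ∈ Ico (0 : ℝ) 1 := by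
  have h1 : (j : ℝ) + 1 ≤ 2 ^ N := by exact_mod_cast Finset.mem_range.1 (hJ hj)
  have h2 := meshSize_pos N
  have h3 := two_pow_mul_meshSize N
  have h0 : 0 ≤ δ ∧ δ < 1 := by rcases hδ with rfl | rfl <;> norm_num
  exact ⟨mul_nonneg (add_nonneg j.cast_nonneg h0.1) h2.le, by nlinarith⟩

/-- The flux form with homogeneous inflow data; `θ = 0` drops the boundary term. -/
noncomputable def hflux (θ : ℝ) (N : ℕ) (J : Finset ℕ) (δ : ℝ) (A : (Fin d → ℝ) → Fin d → ℝ)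
    (f φ : (Fin d → ℝ) → ℝ) : ℝ :=
  volumeTerm A f φ - faceTerm N J δ A f φ - θ * boundaryTerm A 0 f φ

/-- The flux form with homogeneous inflow data in one space dimension. -/
noncomputable def hflux1 (θ : ℝ) (N : ℕ) (J : Finset ℕ) (δ : ℝ) (a f φ : ℝ → ℝ) : ℝ :=
  (∫ s in (0 : ℝ)..1, f s * (a s * derivWithin φ (Ici s) s)) -
    (∑ j ∈ J, f ((j + δ) * meshSize N) * a ((j + δ) * meshSize N) *
      (Function.leftLim φ ((j + δ) * meshSize N) - Function.rightLim φ ((j + δ) * meshSize N))) -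
    θ * ((max (a 1) 0 * Function.leftLim f 1 * Function.leftLim φ 1) -
      min (a 0) 0 * Function.rightLim f 0 * Function.rightLim φ 0)

variable {A : (Fin d → ℝ) → Fin d → ℝ} {θ δ : ℝ} {J : Finset ℕ}

lemma rderiv_mem_BM (hφ : φ ∈ PW k m d) (i : Fin d) : rderiv i φ ∈ BM d :=
  ⟨(measurable_rderiv hφ i).aestronglyMeasurable,
    (rderiv_bdd hφ i).imp fun _ h => Eventually.of_forall h⟩

lemma volumeTerm_eq (hA : ∀ i, ContinuousOn (fun x => A x i) (unitCube d)) (hf : f ∈ BM d)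
    (hφ : φ ∈ PW k m d) :
    (∀ i, (fun x => f x * (A x i * rderiv i φ x)) ∈ BM d) ∧
    volumeTerm A f φ = ∑ i, ∫ x in unitCube d, f x * (A x i * rderiv i φ x) := by
  have h1 : ∀ i, (fun x => f x * (A x i * rderiv i φ x)) ∈ BM d := fun i =>
    BM.mul hf (BM.mul (BM.of_continuousOn (hA i)) (rderiv_mem_BM hφ i))
  refine ⟨h1, ?_⟩
  rw [← integral_finsetSum _ fun i _ => BM.integrable (h1 i)]
  refine integral_congr_ae ?_
  filter_upwards [ae_all_iff.2 fun i => pderiv_ae_eq hφ i] with x hx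
  rw [Finset.mul_sum]
  exact Finset.sum_congr rfl fun i _ => by rw [hx i]

lemma integrable_outflow_one (hA : ∀ i, ContinuousOn (fun x => A x i) (unitCube d)) (hf : f ∈ Adm d)
    (hφ : φ ∈ Adm d) (i : Fin d) :
    Integrable (fun x => max (A (Function.update x i 1) i) 0 * traceL i 1 f x *
      traceL i 1 φ x) (volume.restrict (unitCube d)) := BM.integrable
  (BM.mul (BM.mul (BM.of_continuousOn (ContinuousOn.sup (continuousOn_update (hA i) i
    (c := 1) (by simp)) continuousOn_const)) (Adm.traceL_mem_BM hf i _))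
    (Adm.traceL_mem_BM hφ i _))

lemma integrable_outflow_zero (hA : ∀ i, ContinuousOn (fun x => A x i) (unitCube d)) (hf : f ∈ Adm d)
    (hφ : φ ∈ Adm d) (i : Fin d) :
    Integrable (fun x => min (A (Function.update x i 0) i) 0 * traceR i 0 f x *
      traceR i 0 φ x) (volume.restrict (unitCube d)) := BM.integrable
  (BM.mul (BM.mul (BM.of_continuousOn (ContinuousOn.inf (continuousOn_update (hA i) i
    (c := 0) (by simp)) continuousOn_const)) (Adm.traceR_mem_BM hf i _))
    (Adm.traceR_mem_BM hφ i _))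

lemma boundaryTerm_zero (A : (Fin d → ℝ) → Fin d → ℝ) (f φ : (Fin d → ℝ) → ℝ) :
    boundaryTerm A 0 f φ = ∑ i, ((∫ x in unitCube d,
      max (A (Function.update x i 1) i) 0 * traceL i 1 f x * traceL i 1 φ x) -
      ∫ x in unitCube d, min (A (Function.update x i 0) i) 0 * traceR i 0 f x *
      traceR i 0 φ x) := by
  unfold boundaryTerm
  refine Finset.sum_congr rfl fun i _ => ?_
  congr 1 <;> congr 1 <;> ext x <;> simp only [Pi.zero_apply]
  · split_ifs with h
    · rw [max_eq_right h.le]; ring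
    · rw [max_eq_left (not_lt.1 h)]; ring
  · split_ifs with h
    · rw [min_eq_right h.le]; ring
    · rw [min_eq_left (not_lt.1 h)]; ring

/-- The flux form is the sum over the coordinate directions of the integrals of the
one-dimensional forms of the slices. -/
lemma hflux_eq (hA : ∀ i, ContinuousOn (fun x => A x i) (unitCube d)) (hf : f ∈ Adm d)
    (hφ : φ ∈ PW k m d) (hJ : J ⊆ Finset.range (2 ^ N)) (hδ : δ = 0 ∨ δ = 1 / 2) (θ : ℝ) :
    (∀ i, Integrable (fun x => hflux1 θ N J δ (fun s => A (Function.update x i s) i)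
      (fun s => f (Function.update x i s)) (fun s => φ (Function.update x i s)))
      (volume.restrict (unitCube d))) ∧
    hflux θ N J δ A f φ = ∑ i, ∫ x in unitCube d,
      hflux1 θ N J δ (fun s => A (Function.update x i s) i)
        (fun s => f (Function.update x i s)) (fun s => φ (Function.update x i s)) := by
  have hφA := PW_le_Adm k m d hφ
  obtain ⟨hv1, hv2⟩ := volumeTerm_eq hA (Adm_le_BM d hf) hφ
  have hv3 : ∀ i, Integrable (fun x => ∫ s in (0 : ℝ)..1, f (Function.update x i s) *
      (A (Function.update x i s) i * derivWithin (fun s => φ (Function.update x i s)) (Ici s) s))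
      (volume.restrict (unitCube d)) := fun i => by
    simpa only [rderiv_update] using integrable_slice i (BM.integrable (hv1 i))
  have hv4 : volumeTerm A f φ = ∑ i, ∫ x in unitCube d, ∫ s in (0 : ℝ)..1,
      f (Function.update x i s) * (A (Function.update x i s) i *
        derivWithin (fun s => φ (Function.update x i s)) (Ici s) s) := by
    rw [hv2]
    refine Finset.sum_congr rfl fun i _ => ?_
    rw [integral_slice i (BM.integrable (hv1 i))]
    simp only [rderiv_update]
  have hface : ∀ i, ∀ j ∈ J, Integrable (fun x => f (Function.update x i ((j + δ) * meshSize N)) *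
      A (Function.update x i ((j + δ) * meshSize N)) i *
      (traceL i ((j + δ) * meshSize N) φ x - traceR i ((j + δ) * meshSize N) φ x))
      (volume.restrict (unitCube d)) := fun i j hj => BM.integrable
    (BM.mul (BM.mul (Adm.update_mem_BM hf i _) (BM.of_continuousOn (continuousOn_update (hA i) i
      (Ico_subset_Icc_self (face_mem_Icc hJ hδ hj)))))
      (sub_mem (Adm.traceL_mem_BM hφA i _) (Adm.traceR_mem_BM hφA i _)))
  have hb1 := integrable_outflow_one hA hf hφA
  have hb0 := integrable_outflow_zero hA hf hφA
  have hbd := boundaryTerm_zero A f φ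
  have hI : ∀ i, Integrable (fun x => ∑ j ∈ J, f (Function.update x i ((j + δ) * meshSize N)) *
      A (Function.update x i ((j + δ) * meshSize N)) i *
      (traceL i ((j + δ) * meshSize N) φ x - traceR i ((j + δ) * meshSize N) φ x))
      (volume.restrict (unitCube d)) := fun i => integrable_finsetSum _ (hface i)
  refine ⟨fun i => ((hv3 i).sub (hI i)).sub (((hb1 i).sub (hb0 i)).const_mul θ), ?_⟩
  unfold hflux faceTerm
  rw [hv4, hbd, Finset.mul_sum, ← Finset.sum_sub_distrib, ← Finset.sum_sub_distrib]
  refine Finset.sum_congr rfl fun i _ => ?_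
  rw [← integral_finsetSum _ (hface i), ← integral_sub (hb1 i) (hb0 i), ← integral_sub (hv3 i) (hI i),
    ← integral_const_mul]
  exact (integral_sub ((hv3 i).sub (hI i)) (((hb1 i).sub (hb0 i)).const_mul θ)).symm

end flux

/-! ### Linearity and boundedness of the flux forms -/

section bounds
variable {k m N : ℕ} {a f g φ : ℝ → ℝ} {θ δ : ℝ} {J : Finset ℕ}

lemma intervalIntegrable_mul_of_continuousOn {a D : ℝ → ℝ} (hf : Measurable f)
    (hfb : ∃ C : ℝ, ∀ x, |f x| ≤ C) (ha : ContinuousOn a (Icc 0 1)) (hD : Measurable D)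
    (hDb : ∃ C : ℝ, ∀ x, |D x| ≤ C) :
    IntervalIntegrable (fun s => f s * (a s * D s)) volume 0 1 := by
  obtain ⟨C, hC⟩ := hfb
  obtain ⟨C', hC'⟩ := hDb
  have h1 : IntervalIntegrable (fun s => f s * D s) volume 0 1 := by
    refine intervalIntegrable_of_bdd (hf.mul hD) ⟨C * C', fun x => ?_⟩ 0 1
    rw [Pi.mul_apply, abs_mul]
    exact mul_le_mul (hC x) (hC' x) (abs_nonneg _) ((abs_nonneg _).trans (hC x))
  have h2 := h1.continuousOn_mul (g := a) (by rwa [uIcc_of_le zero_le_one])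
  exact h2.congr fun s _ => by ring

lemma hflux1_sub (hf : Measurable f) (hfb : ∃ C : ℝ, ∀ x, |f x| ≤ C) (hg : Measurable g)
    (hgb : ∃ C : ℝ, ∀ x, |g x| ≤ C)
    (hfl : ∀ c, (∃ y, Tendsto f (𝓝[<] c) (𝓝 y)) ∧ ∃ y, Tendsto f (𝓝[>] c) (𝓝 y))
    (hgl : ∀ c, (∃ y, Tendsto g (𝓝[<] c) (𝓝 y)) ∧ ∃ y, Tendsto g (𝓝[>] c) (𝓝 y))
    (ha : ContinuousOn a (Icc 0 1)) (hD : Measurable fun s => derivWithin φ (Ici s) s)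
    (hDb : ∃ C : ℝ, ∀ x, |derivWithin φ (Ici x) x| ≤ C) :
    hflux1 θ N J δ a (f - g) φ = hflux1 θ N J δ a f φ - hflux1 θ N J δ a g φ := by
  have h1 := intervalIntegrable_mul_of_continuousOn hf hfb ha hD hDb
  have h2 := intervalIntegrable_mul_of_continuousOn hg hgb ha hD hDb
  obtain ⟨⟨y, hy⟩, -⟩ := hfl 1
  obtain ⟨⟨z, hz⟩, -⟩ := hgl 1
  obtain ⟨-, y', hy'⟩ := hfl 0
  obtain ⟨-, z', hz'⟩ := hgl 0
  have e1 : Function.leftLim (f - g) 1 = Function.leftLim f 1 - Function.leftLim g 1 := by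
    rw [leftLim_eq hy, leftLim_eq hz]; exact leftLim_eq (hy.sub hz)
  have e2 : Function.rightLim (f - g) 0 = Function.rightLim f 0 - Function.rightLim g 0 := by
    rw [rightLim_eq hy', rightLim_eq hz']; exact rightLim_eq (hy'.sub hz')
  have e3 : ∫ s in (0 : ℝ)..1, (f - g) s * (a s * derivWithin φ (Ici s) s) =
      (∫ s in (0 : ℝ)..1, f s * (a s * derivWithin φ (Ici s) s)) -
      ∫ s in (0 : ℝ)..1, g s * (a s * derivWithin φ (Ici s) s) := by
    rw [← intervalIntegral.integral_sub h1 h2]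
    simp only [Pi.sub_apply, sub_mul]
  unfold hflux1
  rw [e1, e2, e3]
  simp only [Pi.sub_apply, sub_mul, Finset.sum_sub_distrib]
  ring

/-- The squares of the quantities entering the flux form in one dimension. -/
noncomputable def fluxEnergy (N : ℕ) (δ : ℝ) (f : ℝ → ℝ) : ℝ :=
  2 ^ N * (∫ s in (0 : ℝ)..1, f s ^ 2) + ∑ j ∈ Finset.range (2 ^ N), f ((j + δ) * meshSize N) ^ 2 +
    Function.leftLim f 1 ^ 2 + Function.rightLim f 0 ^ 2

lemma abs_mul_le_weighted {K lam r x b y : ℝ} (hr : 0 < r) (hlam : 0 < lam) (hb : |b| ≤ K) :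
    |x * b * y| ≤ K / 2 * (lam * (r * x ^ 2) + lam⁻¹ * (r⁻¹ * y ^ 2)) := by
  have hlr : 0 < lam * r := mul_pos hlam hr
  have h : |x| * |y| ≤ 1 / 2 * (lam * (r * x ^ 2) + lam⁻¹ * (r⁻¹ * y ^ 2)) := by
    have h1 : 0 ≤ (lam * r)⁻¹ * (lam * r * |x| - |y|) ^ 2 := by positivity
    have h2 : (lam * r)⁻¹ * (lam * r * |x| - |y|) ^ 2 =
        lam * (r * |x| ^ 2) + lam⁻¹ * (r⁻¹ * |y| ^ 2) - 2 * (|x| * |y|) := by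
      field_simp; ring
    rw [sq_abs, sq_abs] at h2
    linarith
  have hK : 0 ≤ K := (abs_nonneg b).trans hb
  calc |x * b * y| = |b| * (|x| * |y|) := by rw [abs_mul, abs_mul]; ring
    _ ≤ K * (1 / 2 * (lam * (r * x ^ 2) + lam⁻¹ * (r⁻¹ * y ^ 2))) :=
        mul_le_mul hb h (by positivity) hK
    _ = _ := by ring

/-- Weighted estimate of the one-dimensional flux form. -/
lemma abs_hflux1_le {K lam : ℝ} (hlam : 0 < lam) (hf : Measurable f)
    (hfb : ∃ C : ℝ, ∀ x, |f x| ≤ C) (ha : ContinuousOn a (Icc 0 1))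
    (haK : ∀ s ∈ Icc (0 : ℝ) 1, |a s| ≤ K) (hφ : φ ∈ PW1 k (N + 1))
    (hφb : ∃ C : ℝ, ∀ x, |φ x| ≤ C) (hD : Measurable fun s => derivWithin φ (Ici s) s)
    (hDb : ∃ C : ℝ, ∀ x, |derivWithin φ (Ici x) x| ≤ C)
    (htail : ∫ s in (-(meshSize N / 2))..0, φ s ^ 2 ≤ ∫ s in (0 : ℝ)..1, φ s ^ 2)
    (hJ : J ⊆ Finset.range (2 ^ N)) (hδ : δ = 0 ∨ δ = 1 / 2) (hθ : θ = 0 ∨ θ = 1) :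
    |hflux1 θ N J δ a f φ| ≤ K / 2 * (lam * fluxEnergy N δ f +
      lam⁻¹ * (16 * invConst k * 2 ^ N * ∫ s in (0 : ℝ)..1, φ s ^ 2)) := by
  have hK : 0 ≤ K := (abs_nonneg _).trans (haK 0 (by simp))
  have hC := invConst_pos k
  have hR : ∀ c, Function.rightLim φ c = φ c := fun c => rightLim_eq (PW1.tendsto_right hφ c)
  set P := ∫ s in (0 : ℝ)..1, φ s ^ 2 with hP
  set D := fun s => derivWithin φ (Ici s) s with hDdef
  have b1 : ∫ s in (0 : ℝ)..1, D s ^ 2 ≤ invConst k * (2 ^ (N + 1)) ^ 2 * P :=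
    PW1.integral_deriv_sq_le hφ hφb hD
  have b2 := PW1.sum_sq_jumps_le hφ hφb hδ htail
  have b3 := PW1.leftLim_one_sq_le hφ hφb
  have b4 := PW1.zero_sq_le hφ hφb
  have h2N : (0 : ℝ) < 2 ^ N := by positivity
  -- the volume term
  have t1 : |∫ s in (0 : ℝ)..1, f s * (a s * D s)| ≤
      K / 2 * (lam * (2 ^ N * ∫ s in (0 : ℝ)..1, f s ^ 2) +
        lam⁻¹ * ((2 ^ N)⁻¹ * ∫ s in (0 : ℝ)..1, D s ^ 2)) := by
    have i1 := intervalIntegrable_sq hf hfb 0 1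
    have i2 := intervalIntegrable_sq hD hDb 0 1
    refine (intervalIntegral.abs_integral_le_integral_abs zero_le_one).trans ?_
    have h := intervalIntegral.integral_mono_on zero_le_one
      (intervalIntegrable_mul_of_continuousOn hf hfb ha hD hDb).abs
      ((((i1.const_mul (2 ^ N)).const_mul lam).add
        ((i2.const_mul (2 ^ N)⁻¹).const_mul lam⁻¹)).const_mul (K / 2)) fun s hs => by
        rw [← mul_assoc]
        exact abs_mul_le_weighted h2N hlam (haK s hs)
    refine h.trans_eq ?_
    rw [intervalIntegral.integral_const_mul, intervalIntegral.integral_add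
      ((i1.const_mul _).const_mul _) ((i2.const_mul _).const_mul _)]
    simp only [intervalIntegral.integral_const_mul]
  -- the interior faces
  have t2 : |∑ j ∈ J, f ((j + δ) * meshSize N) * a ((j + δ) * meshSize N) *
      (Function.leftLim φ ((j + δ) * meshSize N) - Function.rightLim φ ((j + δ) * meshSize N))| ≤
      K / 2 * (lam * ∑ j ∈ Finset.range (2 ^ N), f ((j + δ) * meshSize N) ^ 2 +
        lam⁻¹ * ∑ j ∈ Finset.range (2 ^ N), (Function.leftLim φ ((j + δ) * meshSize N) -
          φ ((j + δ) * meshSize N)) ^ 2) := by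
    refine (Finset.abs_sum_le_sum_abs _ _).trans ?_
    rw [Finset.mul_sum, Finset.mul_sum, ← Finset.sum_add_distrib, Finset.mul_sum]
    refine (Finset.sum_le_sum fun j hj => ?_).trans (Finset.sum_le_sum_of_subset_of_nonneg hJ
      fun j _ _ => by positivity)
    have := abs_mul_le_weighted (x := f ((j + δ) * meshSize N))
      (y := Function.leftLim φ ((j + δ) * meshSize N) - Function.rightLim φ ((j + δ) * meshSize N))
      one_pos hlam (haK _ (Ico_subset_Icc_self (face_mem_Icc hJ hδ hj)))
    rw [hR] at this ⊢
    simpa using this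
  -- the boundary
  have m1 : |max (a 1) 0| ≤ K := by
    refine le_trans ?_ (haK 1 (by simp))
    rw [abs_of_nonneg (le_max_right _ _)]
    exact max_le (le_abs_self _) (abs_nonneg _)
  have m0 : |min (a 0) 0| ≤ K := by
    refine le_trans ?_ (haK 0 (by simp))
    rw [abs_of_nonpos (min_le_right _ _)]
    rcases le_total (a 0) 0 with h | h
    · rw [min_eq_left h]; exact neg_le_abs _
    · rw [min_eq_right h]; simp
  have t3 := abs_mul_le_weighted (x := Function.leftLim f 1) (y := Function.leftLim φ 1)
    one_pos hlam m1
  have t4 := abs_mul_le_weighted (x := Function.rightLim f 0) (y := Function.rightLim φ 0)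
    one_pos hlam m0
  rw [hR] at t4
  have t5 : |θ * ((max (a 1) 0 * Function.leftLim f 1 * Function.leftLim φ 1) -
      min (a 0) 0 * Function.rightLim f 0 * Function.rightLim φ 0)| ≤
      K / 2 * (lam * (Function.leftLim f 1 ^ 2 + Function.rightLim f 0 ^ 2) +
        lam⁻¹ * (Function.leftLim φ 1 ^ 2 + φ 0 ^ 2)) := by
    rcases hθ with rfl | rfl
    · rw [zero_mul, abs_zero]; positivity
    · rw [one_mul, hR]
      refine (abs_sub _ _).trans ?_
      rw [mul_comm (max (a 1) 0), mul_comm (min (a 0) 0)]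
      simp only [one_mul, inv_one] at t3 t4
      linarith
  have e4 : (2 : ℝ) ^ (N + 1) = 2 * 2 ^ N := by rw [pow_succ]; ring
  rw [e4] at b1 b3 b4
  have b1' : (2 ^ N)⁻¹ * ∫ s in (0 : ℝ)..1, D s ^ 2 ≤ 4 * invConst k * 2 ^ N * P := by
    rw [inv_mul_le_iff₀ h2N]
    refine b1.trans_eq ?_
    ring
  have hsum : |hflux1 θ N J δ a f φ| ≤ K / 2 * (lam * fluxEnergy N δ f + lam⁻¹ *
      ((2 ^ N)⁻¹ * (∫ s in (0 : ℝ)..1, D s ^ 2) +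
      (∑ j ∈ Finset.range (2 ^ N), (Function.leftLim φ ((j + δ) * meshSize N) -
          φ ((j + δ) * meshSize N)) ^ 2) + (Function.leftLim φ 1 ^ 2 + φ 0 ^ 2))) := by
    unfold hflux1 fluxEnergy
    refine (abs_sub _ _).trans ((add_le_add (abs_sub _ _) le_rfl).trans ?_)
    refine (add_le_add (add_le_add t1 t2) t5).trans_eq ?_
    ring
  refine hsum.trans ?_
  gcongr
  linarith

end bounds

section bounds
variable {d k m N : ℕ} {f g φ ψ : (Fin d → ℝ) → ℝ} {A : (Fin d → ℝ) → Fin d → ℝ} {θ δ : ℝ}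
  {J : Finset ℕ}

lemma measurable_update_right (x : Fin d → ℝ) (i : Fin d) :
    Measurable fun s : ℝ => Function.update x i s := measurable_update x

lemma PW.measurable_deriv_slice (hφ : φ ∈ PW k m d) (x : Fin d → ℝ) (i : Fin d) :
    Measurable fun s => derivWithin (fun s => φ (Function.update x i s)) (Ici s) s := by
  simp_rw [← rderiv_update]
  exact (measurable_rderiv hφ i).comp (measurable_update_right x i)

lemma PW.deriv_slice_bdd (hφ : φ ∈ PW k m d) (x : Fin d → ℝ) (i : Fin d) :
    ∃ C : ℝ, ∀ s, |derivWithin (fun s => φ (Function.update x i s)) (Ici s) s| ≤ C := by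
  obtain ⟨C, hC⟩ := rderiv_bdd hφ i
  exact ⟨C, fun s => by rw [← rderiv_update]; exact hC _⟩

lemma Adm.measurable_slice (hf : f ∈ Adm d) (x : Fin d → ℝ) (i : Fin d) :
    Measurable fun s => f (Function.update x i s) := hf.1.comp (measurable_update_right x i)

lemma Adm.slice_bdd (hf : f ∈ Adm d) (x : Fin d → ℝ) (i : Fin d) :
    ∃ C : ℝ, ∀ s, |f (Function.update x i s)| ≤ C := hf.2.1.imp fun _ h _ => h _

lemma hflux_sub (hA : ∀ i, ContinuousOn (fun x => A x i) (unitCube d)) (hf : f ∈ Adm d)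
    (hg : g ∈ Adm d) (hφ : φ ∈ PW k m d) (hJ : J ⊆ Finset.range (2 ^ N)) (hδ : δ = 0 ∨ δ = 1 / 2)
    (θ : ℝ) : hflux θ N J δ A (f - g) φ = hflux θ N J δ A f φ - hflux θ N J δ A g φ := by
  obtain ⟨h1, h1'⟩ := hflux_eq hA hf hφ hJ hδ θ
  obtain ⟨h2, h2'⟩ := hflux_eq hA hg hφ hJ hδ θ
  rw [(hflux_eq hA (sub_mem hf hg) hφ hJ hδ θ).2, h1', h2', ← Finset.sum_sub_distrib]
  refine Finset.sum_congr rfl fun i _ => ?_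
  rw [← integral_sub (h1 i) (h2 i)]
  refine setIntegral_congr_fun (measurableSet_unitCube d) fun x hx => ?_
  exact hflux1_sub (Adm.measurable_slice hf x i) (Adm.slice_bdd hf x i) (Adm.measurable_slice hg x i)
    (Adm.slice_bdd hg x i) (hf.2.2 x i) (hg.2.2 x i) (continuousOn_slice (hA i) hx i)
    (PW.measurable_deriv_slice hφ x i) (PW.deriv_slice_bdd hφ x i)

lemma integrable_slice_sq (hf : f ∈ BM d) (i : Fin d) :
    Integrable (fun x => ∫ s in (0 : ℝ)..1, f (Function.update x i s) ^ 2)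
      (volume.restrict (unitCube d)) ∧
    ∫ x in unitCube d, ∫ s in (0 : ℝ)..1, f (Function.update x i s) ^ 2 = nrm f ^ 2 := by
  have h : Integrable (fun x => f x ^ 2) (volume.restrict (unitCube d)) := by
    simpa [sq] using BM.integrable (BM.mul hf hf)
  rw [nrm_sq, integral_slice i h]
  exact ⟨integrable_slice i h, rfl⟩

/-- The square integrals over the half cell left of the domain do not exceed those over the domain;
this holds for periodic functions and for functions supported in `[0, 1)^d`. -/
def TailLe (N : ℕ) (φ : (Fin d → ℝ) → ℝ) : Prop :=
  ∀ x i, ∫ s in (-(meshSize N / 2))..0, φ (Function.update x i s) ^ 2 ≤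
    ∫ s in (0 : ℝ)..1, φ (Function.update x i s) ^ 2

lemma ae_mem_box (d : ℕ) : ∀ᵐ x ∂(volume.restrict (unitCube d)), x ∈ box d 0 := by
  filter_upwards [ae_restrict_mem (measurableSet_unitCube d), ae_all_iff.2 fun i => ae_coord_ne i 1]
    with x hx h1
  intro i _
  exact ⟨hx.1 i, by simpa using lt_of_le_of_ne (hx.2 i) (h1 i)⟩

/-- The flux form is bounded by the `L²` norm of the test function times any bound on the
values and traces of the flux function on the mesh lines. -/
lemma abs_hflux_le {K R : ℝ} (hA : ∀ i, ContinuousOn (fun x => A x i) (unitCube d))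
    (hAK : ∀ x ∈ unitCube d, ∀ i, |A x i| ≤ K) (hK : 0 ≤ K) (hf : f ∈ Adm d)
    (hφ : φ ∈ PW k (N + 1) d)
    (htail : TailLe N φ) (hJ : J ⊆ Finset.range (2 ^ N)) (hδ : δ = 0 ∨ δ = 1 / 2)
    (hθ : θ = 0 ∨ θ = 1) (hR : 0 ≤ R)
    (hΨ : ∀ i, ∃ Ψ : (Fin d → ℝ) → ℝ, Integrable Ψ (volume.restrict (unitCube d)) ∧
      (∀ x ∈ box d 0, fluxEnergy N δ (fun s => f (Function.update x i s)) ≤ Ψ x) ∧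
      ∫ x in unitCube d, Ψ x ≤ R ^ 2) :
    |hflux θ N J δ A f φ| ≤ d * (K * R * (4 * Real.sqrt (invConst k * 2 ^ N) * nrm φ)) := by
  have hC := invConst_pos k
  obtain ⟨h1, h2⟩ := hflux_eq hA hf hφ hJ hδ θ
  rw [h2]
  refine (Finset.abs_sum_le_sum_abs _ _).trans ?_
  have : ∀ i : Fin d, |∫ x in unitCube d, hflux1 θ N J δ (fun s => A (Function.update x i s) i)
        (fun s => f (Function.update x i s)) (fun s => φ (Function.update x i s))| ≤
      K * R * (4 * Real.sqrt (invConst k * 2 ^ N) * nrm φ) := by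
    intro i
    obtain ⟨Ψ, hΨ1, hΨ2, hΨ3⟩ := hΨ i
    obtain ⟨s1, s2⟩ := integrable_slice_sq (PW_le_BM k _ d hφ) i
    have hpos : 0 ≤ 4 * Real.sqrt (invConst k * 2 ^ N) * nrm φ :=
      mul_nonneg (by positivity) (nrm_nonneg φ)
    have key := le_two_mul_of_forall (X := |∫ x in unitCube d, hflux1 θ N J δ
        (fun s => A (Function.update x i s) i)
        (fun s => f (Function.update x i s)) (fun s => φ (Function.update x i s))|)
      (K := K / 2) (by positivity) hR hpos fun lam hlam => ?_
    · linarith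
    have hmono : ∫ x in unitCube d, |hflux1 θ N J δ (fun s => A (Function.update x i s) i)
        (fun s => f (Function.update x i s)) (fun s => φ (Function.update x i s))| ≤
        ∫ x in unitCube d, K / 2 * (lam * Ψ x + lam⁻¹ * (16 * invConst k * 2 ^ N *
          ∫ s in (0 : ℝ)..1, φ (Function.update x i s) ^ 2)) := by
      refine integral_mono_ae (h1 i).abs (((hΨ1.const_mul lam).add
        ((s1.const_mul _).const_mul _)).const_mul _) ?_
      filter_upwards [ae_mem_box d, ae_restrict_mem (measurableSet_unitCube d)] with x hx hx'
      refine (abs_hflux1_le hlam (Adm.measurable_slice hf x i) (Adm.slice_bdd hf x i)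
        (continuousOn_slice (hA i) hx' i) (fun s hs => hAK _ (update_mem_unitCube hx' i hs) i)
        (PW.slice hφ x i) (Adm.slice_bdd (PW_le_Adm _ _ _ hφ) x i)
        (PW.measurable_deriv_slice hφ x i) (PW.deriv_slice_bdd hφ x i) (htail x i) hJ hδ hθ).trans ?_
      have := hΨ2 x hx
      gcongr
    refine abs_integral_le_integral_abs.trans (hmono.trans ?_)
    rw [integral_const_mul, integral_add (hΨ1.const_mul lam) ((s1.const_mul _).const_mul _),
      integral_const_mul, integral_const_mul, integral_const_mul, s2, mul_pow, mul_pow,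
      Real.sq_sqrt (by positivity)]
    have e : (4 : ℝ) ^ 2 = 16 := by norm_num
    rw [e, ← mul_assoc 16]
    gcongr
  refine (Finset.sum_le_sum fun i _ => this i).trans_eq ?_
  simp

/-- Piecewise polynomials as flux functions. -/
lemma abs_hflux_le_of_PW {K : ℝ} (hA : ∀ i, ContinuousOn (fun x => A x i) (unitCube d))
    (hAK : ∀ x ∈ unitCube d, ∀ i, |A x i| ≤ K) (hK : 0 ≤ K) (hf : f ∈ PW k m d) (hm : N + 1 ≤ m)
    (hφ : φ ∈ PW k (N + 1) d)
    (htail : TailLe N φ) (hJ : J ⊆ Finset.range (2 ^ N)) (hδ : δ = 0 ∨ δ = 1 / 2)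
    (hθ : θ = 0 ∨ θ = 1) :
    |hflux θ N J δ A f φ| ≤ d * (4 * K * (1 + 3 * invConst k) * 2 ^ m * nrm f * nrm φ) := by
  have hC := invConst_pos k
  have hfn := nrm_nonneg f
  have h2 : (2 : ℝ) ^ N ≤ 2 ^ m := pow_le_pow_right₀ one_le_two (by omega)
  refine (abs_hflux_le hA hAK hK (PW_le_Adm _ _ _ hf) hφ htail hJ hδ hθ
    (R := Real.sqrt ((1 + 3 * invConst k) * 2 ^ m) * nrm f) (by positivity) fun i =>
      ⟨fun x => (1 + 3 * invConst k) * 2 ^ m * ∫ s in (0 : ℝ)..1, f (Function.update x i s) ^ 2,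
        (integrable_slice_sq (PW_le_BM _ _ _ hf) i).1.const_mul _, fun x _ => ?_, ?_⟩).trans ?_
  · have hs := PW.slice hf x i
    have hb := Adm.slice_bdd (PW_le_Adm _ _ _ hf) x i
    have b1 := PW1.sum_sq_faces_le hs hb hm hδ
    have b2 := PW1.leftLim_one_sq_le hs hb
    have b3 := PW1.zero_sq_le hs hb
    have hnn : 0 ≤ ∫ s in (0 : ℝ)..1, f (Function.update x i s) ^ 2 :=
      intervalIntegral.integral_nonneg zero_le_one fun _ _ => sq_nonneg _
    have b0 := mul_le_mul_of_nonneg_right h2 hnn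
    unfold fluxEnergy
    rw [rightLim_eq (PW1.tendsto_right hs 0)]
    linarith
  · rw [integral_const_mul, (integrable_slice_sq (PW_le_BM _ _ _ hf) i).2, mul_pow,
      Real.sq_sqrt (by positivity)]
  · have h3 : Real.sqrt ((1 + 3 * invConst k) * 2 ^ m) * Real.sqrt (invConst k * 2 ^ N) ≤
        (1 + 3 * invConst k) * 2 ^ m := by
      rw [← Real.sqrt_mul (by positivity)]
      refine Real.sqrt_le_iff.2 ⟨by positivity, ?_⟩
      rw [sq]
      gcongr
      linarith
    have hφn := nrm_nonneg φ
    calc _ = d * (4 * K * (Real.sqrt ((1 + 3 * invConst k) * 2 ^ m) *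
          Real.sqrt (invConst k * 2 ^ N)) * nrm f * nrm φ) := by ring
      _ ≤ d * (4 * K * ((1 + 3 * invConst k) * 2 ^ m) * nrm f * nrm φ) := by gcongr
      _ = _ := by ring

/-- Uniformly small flux functions. -/
lemma abs_hflux_le_of_small {K ε : ℝ} (hA : ∀ i, ContinuousOn (fun x => A x i) (unitCube d))
    (hAK : ∀ x ∈ unitCube d, ∀ i, |A x i| ≤ K) (hK : 0 ≤ K) (hf : f ∈ Adm d)
    (hfε : ∀ x ∈ box d 0, |f x| ≤ ε) (hε : 0 ≤ ε) (hφ : φ ∈ PW k (N + 1) d)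
    (htail : TailLe N φ) (hJ : J ⊆ Finset.range (2 ^ N)) (hδ : δ = 0 ∨ δ = 1 / 2)
    (hθ : θ = 0 ∨ θ = 1) :
    |hflux θ N J δ A f φ| ≤
      d * (K * (2 * 2 ^ N * ε) * (4 * Real.sqrt (invConst k * 2 ^ N) * nrm φ)) := by
  refine abs_hflux_le hA hAK hK hf hφ htail hJ hδ hθ (by positivity) fun i =>
      ⟨fun x => (2 * 2 ^ N * ε) ^ 2, integrable_const _, fun x hx => ?_, by simp⟩
  have hup : ∀ s ∈ Ico (0 : ℝ) 1, |f (Function.update x i s)| ≤ ε := by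
    intro s hs
    refine hfε _ fun j _ => ?_
    by_cases h : j = i
    · subst h; simpa using hs
    · simpa [h] using hx j trivial
  have hsq : ∀ s ∈ Ico (0 : ℝ) 1, f (Function.update x i s) ^ 2 ≤ ε ^ 2 := fun s hs => by
    rw [← sq_abs]; exact pow_le_pow_left₀ (abs_nonneg _) (hup s hs) 2
  have h1 : ∫ s in (0 : ℝ)..1, f (Function.update x i s) ^ 2 ≤ ε ^ 2 := by
    have := intervalIntegral.integral_mono_on_of_le_Ioo zero_le_one
      (intervalIntegrable_sq (Adm.measurable_slice hf x i) (Adm.slice_bdd hf x i) 0 1)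
      (intervalIntegrable_const (μ := volume) (c := ε ^ 2)) fun s hs => hsq s ⟨hs.1.le, hs.2⟩
    simpa using this
  have h2 : ∑ j ∈ Finset.range (2 ^ N), f (Function.update x i ((j + δ) * meshSize N)) ^ 2 ≤
      2 ^ N * ε ^ 2 := by
    refine (Finset.sum_le_sum fun j hj => hsq _ (face_mem_Icc le_rfl hδ hj)).trans_eq ?_
    simp
  have h3 : traceL i 1 f x ^ 2 ≤ ε ^ 2 := by
    refine le_of_tendsto ((Adm.tendsto_traceL hf x i 1).pow 2) ?_
    filter_upwards [Ioo_mem_nhdsLT (zero_lt_one (α := ℝ))] with s hs using hsq s ⟨hs.1.le, hs.2⟩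
  have h4 : traceR i 0 f x ^ 2 ≤ ε ^ 2 := by
    refine le_of_tendsto ((Adm.tendsto_traceR hf x i 0).pow 2) ?_
    filter_upwards [Ioo_mem_nhdsGT (zero_lt_one (α := ℝ))] with s hs using hsq s ⟨hs.1.le, hs.2⟩
  have h5 : (1 : ℝ) ≤ 2 ^ N := one_le_pow₀ one_le_two
  have h6 := mul_le_mul_of_nonneg_left h1 (show (0 : ℝ) ≤ 2 ^ N by positivity)
  have h7 : fluxEnergy N δ (fun s => f (Function.update x i s)) ≤
      2 ^ N * ε ^ 2 + 2 ^ N * ε ^ 2 + ε ^ 2 + ε ^ 2 := add_le_add (add_le_add (add_le_add h6 h2) h3) h4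
  have h8 := mul_le_mul_of_nonneg_right h5 (sq_nonneg ε)
  have h9 := mul_le_mul_of_nonneg_right (mul_le_mul h5 h5 zero_le_one (by positivity)) (sq_nonneg ε)
  have h10 : 2 ^ N * 1 * ε ^ 2 ≤ 2 ^ N * 2 ^ N * ε ^ 2 := by gcongr
  nlinarith

end bounds

/-! ### Integration by parts and the energy identity -/

section parts
variable {k N : ℕ} {a f g : ℝ → ℝ} {θ : ℝ} {J : Finset ℕ}

lemma sum_range_two_mul (W : ℕ → ℝ) (n : ℕ) :
    ∑ j ∈ Finset.range (2 * n), W j = ∑ i ∈ Finset.range n, (W (2 * i) + W (2 * i + 1)) := by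
  induction n with
  | zero => simp
  | succ n ih => rw [mul_add, mul_one, Finset.sum_range_succ, Finset.sum_range_succ, ih,
      Finset.sum_range_succ, add_assoc]

lemma continuousOn_deriv (ha : ContDiffOn ℝ 1 a (Icc 0 1)) :
    ContinuousOn (derivWithin a (Icc 0 1)) (Icc 0 1) :=
  ha.continuousOn_derivWithin (uniqueDiffOn_Icc zero_lt_one) le_rfl

/-- Integration by parts for piecewise polynomials with a `C¹` weight; the grid points are
separated into the faces of the primal and of the dual mesh. -/
lemma PW1.integral_by_parts (hf : f ∈ PW1 k (N + 1)) (hfb : ∃ C : ℝ, ∀ x, |f x| ≤ C)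
    (hfD : Measurable fun s => derivWithin f (Ici s) s)
    (hfDb : ∃ C : ℝ, ∀ x, |derivWithin f (Ici x) x| ≤ C)
    (hg : g ∈ PW1 k (N + 1)) (hgb : ∃ C : ℝ, ∀ x, |g x| ≤ C)
    (hgD : Measurable fun s => derivWithin g (Ici s) s)
    (hgDb : ∃ C : ℝ, ∀ x, |derivWithin g (Ici x) x| ≤ C) (ha : ContDiffOn ℝ 1 a (Icc 0 1)) :
    (∫ s in (0 : ℝ)..1, f s * (a s * derivWithin g (Ici s) s)) +
      (∫ s in (0 : ℝ)..1, g s * (a s * derivWithin f (Ici s) s)) +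
      ∫ s in (0 : ℝ)..1, f s * (derivWithin a (Icc 0 1) s * g s) =
    a 1 * (Function.leftLim f 1 * Function.leftLim g 1) -
      a 0 * (Function.leftLim f 0 * Function.leftLim g 0) +
      ∑ δ ∈ ({0, 1 / 2} : Finset ℝ), ∑ j ∈ Finset.range (2 ^ N), a ((j + δ) * meshSize N) *
        (Function.leftLim f ((j + δ) * meshSize N) * Function.leftLim g ((j + δ) * meshSize N) -
          f ((j + δ) * meshSize N) * g ((j + δ) * meshSize N)) := by
  have i1 := intervalIntegrable_mul_of_continuousOn (PW1.measurable hf) hfb ha.continuousOn hgD hgDb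
  have i2 := intervalIntegrable_mul_of_continuousOn (PW1.measurable hg) hgb ha.continuousOn hfD hfDb
  have i3 := intervalIntegrable_mul_of_continuousOn (PW1.measurable hf) hfb (continuousOn_deriv ha)
    (PW1.measurable hg) hgb
  rw [← intervalIntegral.integral_add i1 i2, ← intervalIntegral.integral_add (i1.add i2) i3]
  set G : ℝ → ℝ := fun s => f s * (a s * derivWithin g (Ici s) s) +
    g s * (a s * derivWithin f (Ici s) s) + f s * (derivWithin a (Icc 0 1) s * g s) with hG
  have iG : IntervalIntegrable G volume 0 1 := (i1.add i2).add i3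
  have hp := meshSize_pos (N + 1)
  have hM := two_pow_mul_meshSize (N + 1)
  set X : ℕ → ℝ := fun j => a (j * meshSize (N + 1)) *
    (Function.leftLim f (j * meshSize (N + 1)) * Function.leftLim g (j * meshSize (N + 1))) with hX
  set Y : ℕ → ℝ := fun j => a (j * meshSize (N + 1)) *
    (f (j * meshSize (N + 1)) * g (j * meshSize (N + 1))) with hY
  have hsub : ∀ j : ℕ, j < 2 ^ (N + 1) → 0 ≤ (j : ℝ) * meshSize (N + 1) ∧
      ((j + 1 : ℕ) : ℝ) * meshSize (N + 1) ≤ 1 := by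
    intro j hj
    have h1 : ((j + 1 : ℕ) : ℝ) ≤ 2 ^ (N + 1) := by exact_mod_cast hj
    exact ⟨by positivity, by rw [← hM]; gcongr⟩
  have hle : ∀ j : ℕ, (j : ℝ) * meshSize (N + 1) ≤ ((j + 1 : ℕ) : ℝ) * meshSize (N + 1) :=
    fun j => by push_cast; nlinarith
  have iGc : ∀ j : ℕ, j < 2 ^ (N + 1) → IntervalIntegrable G volume (j * meshSize (N + 1))
      ((j + 1 : ℕ) * meshSize (N + 1)) := fun j hj => iG.mono_set (by
    rw [uIcc_of_le (hle j), uIcc_of_le zero_le_one]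
    exact Icc_subset_Icc (hsub j hj).1 (hsub j hj).2)
  have hcell : ∀ j : ℕ, j < 2 ^ (N + 1) → ∫ s in (j * meshSize (N + 1))..((j + 1 : ℕ) * meshSize (N + 1)),
      G s = X (j + 1) - Y j := by
    intro j hj
    obtain ⟨p, -, hp1⟩ := hf j
    obtain ⟨r, -, hr1⟩ := hg j
    have hle' : (j : ℝ) * meshSize (N + 1) < ((j : ℝ) + 1) * meshSize (N + 1) := by nlinarith
    have hs := hsub j hj
    have e1 := PW1.leftLim_eq_eval hp1
    have e2 := PW1.leftLim_eq_eval hr1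
    have iGc' := iGc j hj
    simp only [hX, hY]
    push_cast at hs iGc' hp1 hr1 e1 e2 ⊢
    rw [hp1 _ ⟨le_rfl, hle'⟩, hr1 _ ⟨le_rfl, hle'⟩, e1, e2]
    refine intervalIntegral.integral_eq_sub_of_hasDerivAt_of_le
      (f := fun s => a s * (p.eval s * r.eval s)) hle'.le ?_ (fun s hsI => ?_) iGc'
    · exact (ha.continuousOn.mono (Icc_subset_Icc hs.1 hs.2)).mul
        (p.continuous.mul r.continuous).continuousOn
    · have hsI' := Ioo_subset_Ico_self hsI
      have h01 : s ∈ Icc (0 : ℝ) 1 := ⟨hs.1.trans hsI.1.le, hsI.2.le.trans hs.2⟩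
      have hda : HasDerivAt a (derivWithin a (Icc 0 1) s) s :=
        ((ha.differentiableOn one_ne_zero) s h01).hasDerivWithinAt.hasDerivAt
          (Icc_mem_nhds (hs.1.trans_lt hsI.1) (hsI.2.trans_le hs.2))
      refine (hda.mul ((p.hasDerivAt s).mul (r.hasDerivAt s))).congr_deriv ?_
      have d1 := PW1.derivWithin_eq (m := N + 1) (j := j) (by push_cast; exact hp1)
        (by push_cast; exact hsI')
      have d2 := PW1.derivWithin_eq (m := N + 1) (j := j) (by push_cast; exact hr1)
        (by push_cast; exact hsI')
      simp only [hG]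
      rw [d1, d2, hp1 s hsI', hr1 s hsI']
      simp only [Pi.mul_apply]
      ring
  have htot := intervalIntegral.sum_integral_adjacent_intervals (f := G) (μ := volume)
    (a := fun j : ℕ => (j : ℝ) * meshSize (N + 1)) (n := 2 ^ (N + 1)) fun j hj => iGc j hj
  have e0 : ((2 ^ (N + 1) : ℕ) : ℝ) * meshSize (N + 1) = 1 := by push_cast; exact hM
  rw [e0, Nat.cast_zero, zero_mul] at htot
  have hXM : X (2 ^ (N + 1)) = a 1 * (Function.leftLim f 1 * Function.leftLim g 1) := by
    simp only [hX, e0]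
  have hX0 : X 0 = a 0 * (Function.leftLim f 0 * Function.leftLim g 0) := by
    simp [hX]
  rw [← htot, Finset.sum_congr rfl fun j hj => hcell j (Finset.mem_range.1 hj), ← hXM, ← hX0,
    ← Finset.sum_range_sub X, Finset.sum_pair (by norm_num), ← Finset.sum_add_distrib]
  have hpar : ∑ j ∈ Finset.range (2 ^ (N + 1)), (X j - Y j) =
      ∑ i ∈ Finset.range (2 ^ N), ((X (2 * i) - Y (2 * i)) + (X (2 * i + 1) - Y (2 * i + 1))) := by
    rw [pow_succ, mul_comm (2 ^ N) 2, sum_range_two_mul]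
  have hsplit : ∑ j ∈ Finset.range (2 ^ (N + 1)), (X (j + 1) - Y j) =
      ∑ j ∈ Finset.range (2 ^ (N + 1)), (X (j + 1) - X j) +
      ∑ j ∈ Finset.range (2 ^ (N + 1)), (X j - Y j) := by
    rw [← Finset.sum_add_distrib]
    exact Finset.sum_congr rfl fun j _ => by ring
  rw [hsplit, hpar]
  congr 1
  refine Finset.sum_congr rfl fun i _ => ?_
  have c1 : ((2 * i : ℕ) : ℝ) * meshSize (N + 1) = (i + 0) * meshSize N := by
    rw [meshSize_succ]; push_cast; ring
  have c2 : ((2 * i + 1 : ℕ) : ℝ) * meshSize (N + 1) = (i + 1 / 2) * meshSize N := by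
    rw [meshSize_succ]; push_cast; ring
  simp only [hX, hY, c1, c2]
  ring

/-- The boundary situation along a coordinate line: either everything is periodic, or the boundary
faces are separated from the interior ones. -/
def LineBC (θ : ℝ) (N : ℕ) (J : Finset ℕ) (a f g : ℝ → ℝ) : Prop :=
  (θ = 0 ∧ J = Finset.range (2 ^ N) ∧ a 1 = a 0 ∧ Function.leftLim f 1 = Function.leftLim f 0 ∧
    Function.leftLim g 1 = Function.leftLim g 0) ∨ (θ = 1 ∧ J = Finset.Ico 1 (2 ^ N))

/-- Integration by parts for a function that jumps only at the primal faces and one that jumps only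
at the dual faces. -/
lemma PW1.integral_by_parts_staggered (hf : f ∈ PW1 k (N + 1)) (hfb : ∃ C : ℝ, ∀ x, |f x| ≤ C)
    (hfD : Measurable fun s => derivWithin f (Ici s) s)
    (hfDb : ∃ C : ℝ, ∀ x, |derivWithin f (Ici x) x| ≤ C)
    (hg : g ∈ PW1 k (N + 1)) (hgb : ∃ C : ℝ, ∀ x, |g x| ≤ C)
    (hgD : Measurable fun s => derivWithin g (Ici s) s)
    (hgDb : ∃ C : ℝ, ∀ x, |derivWithin g (Ici x) x| ≤ C) (ha : ContDiffOn ℝ 1 a (Icc 0 1))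
    (hfc : ∀ j ∈ Finset.range (2 ^ N), Function.leftLim f ((j + 1 / 2) * meshSize N) =
      f ((j + 1 / 2) * meshSize N))
    (hgc : ∀ j ∈ J, Function.leftLim g ((j + 0) * meshSize N) = g ((j + 0) * meshSize N))
    (hbc : LineBC θ N J a f g) :
    (∫ s in (0 : ℝ)..1, f s * (a s * derivWithin g (Ici s) s)) +
      (∫ s in (0 : ℝ)..1, g s * (a s * derivWithin f (Ici s) s)) +
      ∫ s in (0 : ℝ)..1, f s * (derivWithin a (Icc 0 1) s * g s) =
    (∑ j ∈ J, g ((j + 0) * meshSize N) * a ((j + 0) * meshSize N) *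
        (Function.leftLim f ((j + 0) * meshSize N) - f ((j + 0) * meshSize N))) +
      (∑ j ∈ Finset.range (2 ^ N), f ((j + 1 / 2) * meshSize N) * a ((j + 1 / 2) * meshSize N) *
        (Function.leftLim g ((j + 1 / 2) * meshSize N) - g ((j + 1 / 2) * meshSize N))) +
      θ * (a 1 * (Function.leftLim f 1 * Function.leftLim g 1) - a 0 * (f 0 * g 0)) := by
  rw [PW1.integral_by_parts hf hfb hfD hfDb hg hgb hgD hgDb ha, Finset.sum_pair (by norm_num)]
  have h2 : ∑ j ∈ Finset.range (2 ^ N), a ((j + 1 / 2) * meshSize N) *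
      (Function.leftLim f ((j + 1 / 2) * meshSize N) * Function.leftLim g ((j + 1 / 2) * meshSize N) -
        f ((j + 1 / 2) * meshSize N) * g ((j + 1 / 2) * meshSize N)) =
      ∑ j ∈ Finset.range (2 ^ N), f ((j + 1 / 2) * meshSize N) * a ((j + 1 / 2) * meshSize N) *
        (Function.leftLim g ((j + 1 / 2) * meshSize N) - g ((j + 1 / 2) * meshSize N)) :=
    Finset.sum_congr rfl fun j hj => by rw [hfc j hj]; ring
  have h1 : ∑ j ∈ J, a ((j + 0) * meshSize N) *
      (Function.leftLim f ((j + 0) * meshSize N) * Function.leftLim g ((j + 0) * meshSize N) -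
        f ((j + 0) * meshSize N) * g ((j + 0) * meshSize N)) =
      ∑ j ∈ J, g ((j + 0) * meshSize N) * a ((j + 0) * meshSize N) *
        (Function.leftLim f ((j + 0) * meshSize N) - f ((j + 0) * meshSize N)) :=
    Finset.sum_congr rfl fun j hj => by rw [hgc j hj]; ring
  rw [h2]
  rcases hbc with ⟨rfl, rfl, h3, h4, h5⟩ | ⟨rfl, rfl⟩
  · rw [h1, h3, h4, h5]; ring
  · rw [← h1, Finset.range_eq_Ico, Finset.sum_eq_sum_Ico_succ_bot (by positivity)]
    simp only [Nat.cast_zero, add_zero, zero_mul]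
    ring

/-- The energy estimate along a coordinate line. The inflow and outflow terms at the end points are
absorbed by the difference `f - g`. -/
lemma PW1.hflux1_add_hflux1_le {K β : ℝ} (hf : f ∈ PW1 k (N + 1)) (hfb : ∃ C : ℝ, ∀ x, |f x| ≤ C)
    (hfD : Measurable fun s => derivWithin f (Ici s) s)
    (hfDb : ∃ C : ℝ, ∀ x, |derivWithin f (Ici x) x| ≤ C)
    (hg : g ∈ PW1 k (N + 1)) (hgb : ∃ C : ℝ, ∀ x, |g x| ≤ C)
    (hgD : Measurable fun s => derivWithin g (Ici s) s)
    (hgDb : ∃ C : ℝ, ∀ x, |derivWithin g (Ici x) x| ≤ C) (ha : ContDiffOn ℝ 1 a (Icc 0 1))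
    (hfc : ∀ j ∈ Finset.range (2 ^ N), Function.leftLim f ((j + 1 / 2) * meshSize N) =
      f ((j + 1 / 2) * meshSize N))
    (hgc : ∀ j ∈ J, Function.leftLim g ((j + 0) * meshSize N) = g ((j + 0) * meshSize N))
    (hbc : LineBC θ N J a f g) (hβ : 0 ≤ β) (hβa : θ = 0 ∨ (|a 1| ≤ β ∧ |a 0| ≤ β))
    (haK : ∀ s ∈ Icc (0 : ℝ) 1, |derivWithin a (Icc 0 1) s| ≤ K) :
    hflux1 θ N J 0 a g f + hflux1 θ N (Finset.range (2 ^ N)) (1 / 2) a f g ≤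
      K / 2 * ((∫ s in (0 : ℝ)..1, f s ^ 2) + ∫ s in (0 : ℝ)..1, g s ^ 2) +
      β * invConst k * 2 ^ N * ∫ s in (0 : ℝ)..1, (f s - g s) ^ 2 := by
  have hIBP := PW1.integral_by_parts_staggered hf hfb hfD hfDb hg hgb hgD hgDb ha hfc hgc hbc
  have i3 := intervalIntegrable_mul_of_continuousOn (PW1.measurable hf) hfb (continuousOn_deriv ha)
    (PW1.measurable hg) hgb
  have jf := intervalIntegrable_sq (PW1.measurable hf) hfb 0 1
  have jg := intervalIntegrable_sq (PW1.measurable hg) hgb 0 1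
  have hC := invConst_pos k
  have hRf : ∀ c, Function.rightLim f c = f c := fun c => rightLim_eq (PW1.tendsto_right hf c)
  have hRg : ∀ c, Function.rightLim g c = g c := fun c => rightLim_eq (PW1.tendsto_right hg c)
  have hvol : -∫ s in (0 : ℝ)..1, f s * (derivWithin a (Icc 0 1) s * g s) ≤
      K / 2 * ((∫ s in (0 : ℝ)..1, f s ^ 2) + ∫ s in (0 : ℝ)..1, g s ^ 2) := by
    refine (neg_le_abs _).trans ((intervalIntegral.abs_integral_le_integral_abs zero_le_one).trans ?_)
    rw [← intervalIntegral.integral_add jf jg, ← intervalIntegral.integral_const_mul]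
    refine intervalIntegral.integral_mono_on zero_le_one i3.abs ((jf.add jg).const_mul _)
      fun s hs => ?_
    have := abs_mul_le_weighted (x := f s) (y := g s) one_pos one_pos (haK s hs)
    simp only [one_mul, inv_one] at this
    rwa [← mul_assoc]
  have hfg : f - g ∈ PW1 k (N + 1) := sub_mem hf hg
  have hfgb : ∃ C : ℝ, ∀ x, |(f - g) x| ≤ C := by
    obtain ⟨C, hC⟩ := hfb
    obtain ⟨D, hD⟩ := hgb
    exact ⟨C + D, fun x => (abs_sub _ _).trans (add_le_add (hC x) (hD x))⟩
  have b1 := PW1.leftLim_one_sq_le hfg hfgb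
  have b0 := PW1.zero_sq_le hfg hfgb
  have eL : Function.leftLim (f - g) 1 = Function.leftLim f 1 - Function.leftLim g 1 :=
    leftLim_eq ((PW1.tendsto_leftLim hf 1).sub (PW1.tendsto_leftLim hg 1))
  rw [eL] at b1
  simp only [Pi.sub_apply] at b1 b0
  have e4 : (2 : ℝ) ^ (N + 1) = 2 * 2 ^ N := by rw [pow_succ]; ring
  rw [e4] at b1 b0
  set Q := ∫ s in (0 : ℝ)..1, (f s - g s) ^ 2 with hQ
  have hQ0 : 0 ≤ Q := intervalIntegral.integral_nonneg zero_le_one fun _ _ => sq_nonneg _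
  -- `- x y ≤ (x - y)² / 4`
  have hprod : ∀ b x y : ℝ, |b| ≤ β → (x - y) ^ 2 ≤ invConst k * (2 * 2 ^ N) * Q →
      -(|b| * (x * y)) ≤ β * invConst k * 2 ^ N * Q / 2 := by
    intro b x y hb hxy
    have h1 : -(|b| * (x * y)) ≤ |b| * ((x - y) ^ 2 / 4) := by
      nlinarith [abs_nonneg b, mul_nonneg (abs_nonneg b) (sq_nonneg (x + y))]
    have h2 : |b| * ((x - y) ^ 2 / 4) ≤ β * ((invConst k * (2 * 2 ^ N) * Q) / 4) := by gcongr
    linarith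
  have habs1 : a 1 - 2 * max (a 1) 0 = -|a 1| := by
    rcases le_total (a 1) 0 with h | h
    · rw [max_eq_right h, abs_of_nonpos h]; ring
    · rw [max_eq_left h, abs_of_nonneg h]; ring
  have habs0 : -a 0 + 2 * min (a 0) 0 = -|a 0| := by
    rcases le_total (a 0) 0 with h | h
    · rw [min_eq_left h, abs_of_nonpos h]; ring
    · rw [min_eq_right h, abs_of_nonneg h]; ring
  -- the face terms cancel; upwinding turns the boundary coefficients into `-|a|`
  have htotal : hflux1 θ N J 0 a g f + hflux1 θ N (Finset.range (2 ^ N)) (1 / 2) a f g =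
      -(∫ s in (0 : ℝ)..1, f s * (derivWithin a (Icc 0 1) s * g s)) +
      θ * (-(|a 1| * (Function.leftLim f 1 * Function.leftLim g 1)) + -(|a 0| * (f 0 * g 0))) := by
    unfold hflux1
    simp only [hRf, hRg]
    have e1 : -(|a 1| * (Function.leftLim f 1 * Function.leftLim g 1)) =
      (a 1 - 2 * max (a 1) 0) * (Function.leftLim f 1 * Function.leftLim g 1) := by rw [habs1]; ring
    have e2 : -(|a 0| * (f 0 * g 0)) = (-a 0 + 2 * min (a 0) 0) * (f 0 * g 0) := by rw [habs0]; ring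
    rw [e1, e2]
    linear_combination hIBP
  rw [htotal]
  refine add_le_add hvol ?_
  rcases hβa with rfl | ⟨h1, h0⟩
  · rw [zero_mul]; positivity
  · have p1 := hprod _ _ _ h1 b1
    have p0 := hprod _ _ _ h0 b0
    have hnn : 0 ≤ β * invConst k * 2 ^ N * Q := by positivity
    rcases hbc with ⟨rfl, -⟩ | ⟨rfl, -⟩
    · linarith
    · linarith

end parts

/-! ### Stability and consistency of the flux forms -/

section stab
variable {d k m N : ℕ} {f g φ ψ u U Ut : (Fin d → ℝ) → ℝ} {A : (Fin d → ℝ) → Fin d → ℝ} {θ δ : ℝ}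
  {J : Finset ℕ}

/-- Continuity across the faces `x_i = (j + δ) h_N`, `j ∈ J`. -/
def FaceCont (N : ℕ) (J : Finset ℕ) (δ : ℝ) (φ : (Fin d → ℝ) → ℝ) : Prop :=
  ∀ x i, ∀ j ∈ J, Function.leftLim (fun s => φ (Function.update x i s)) ((j + δ) * meshSize N) =
    φ (Function.update x i ((j + δ) * meshSize N))

/-- Equality of the left limits at both ends of the coordinate lines through the cube. -/
def PerTrace (φ : (Fin d → ℝ) → ℝ) : Prop :=
  ∀ x i, Function.leftLim (fun s => φ (Function.update x i s)) 1 =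
    Function.leftLim (fun s => φ (Function.update x i s)) 0

lemma contDiffOn_slice {g : (Fin d → ℝ) → ℝ} (hg : ContDiffOn ℝ 1 g (unitCube d)) {x : Fin d → ℝ}
    (hx : x ∈ unitCube d) (i : Fin d) :
    ContDiffOn ℝ 1 (fun s => g (Function.update x i s)) (Icc 0 1) :=
  hg.comp (contDiff_update 1 x i).contDiffOn fun _ hs => update_mem_unitCube hx i hs

/-- Stability: the sum of the primal and the dual flux form is bounded by the `L²` norms and, if there is
a boundary, by the difference of the two functions. -/
lemma hflux_add_hflux_le {K β : ℝ} (hA : ∀ i, ContDiffOn ℝ 1 (fun x => A x i) (unitCube d))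
    (hAK : ∀ x ∈ unitCube d, ∀ i, ∀ s ∈ Icc (0 : ℝ) 1,
      |derivWithin (fun s => A (Function.update x i s) i) (Icc 0 1) s| ≤ K)
    (hφ : φ ∈ PW k (N + 1) d) (hψ : ψ ∈ PW k (N + 1) d)
    (hφc : FaceCont N (Finset.range (2 ^ N)) (1 / 2) φ) (hψc : FaceCont N J 0 ψ)
    (hbc : (θ = 0 ∧ J = Finset.range (2 ^ N) ∧
      (∀ x i, A (Function.update x i 1) i = A (Function.update x i 0) i) ∧ PerTrace φ ∧ PerTrace ψ) ∨
      (θ = 1 ∧ J = Finset.Ico 1 (2 ^ N)))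
    (hβ : 0 ≤ β) (hβA : θ = 0 ∨ ∀ x ∈ unitCube d, ∀ i, |A x i| ≤ β) :
    hflux θ N J 0 A ψ φ + hflux θ N (Finset.range (2 ^ N)) (1 / 2) A φ ψ ≤
      d * (K / 2 * (nrm φ ^ 2 + nrm ψ ^ 2) + β * invConst k * 2 ^ N * nrm (φ - ψ) ^ 2) := by
  have hJ : J ⊆ Finset.range (2 ^ N) := by
    rcases hbc with ⟨-, rfl, -⟩ | ⟨-, rfl⟩
    · exact le_rfl
    · intro j hj; simp at hj ⊢; omega
  have hφA := PW_le_Adm _ _ _ hφ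
  have hψA := PW_le_Adm _ _ _ hψ
  obtain ⟨h1, h1'⟩ := hflux_eq (fun i => (hA i).continuousOn) hψA hφ hJ (Or.inl rfl) θ
  obtain ⟨h2, h2'⟩ := hflux_eq (fun i => (hA i).continuousOn) hφA hψ
    (le_refl (Finset.range (2 ^ N))) (Or.inr rfl) θ
  rw [h1', h2', ← Finset.sum_add_distrib]
  have hi : ∀ i : Fin d, (∫ x in unitCube d, hflux1 θ N J 0 (fun s => A (Function.update x i s) i)
        (fun s => ψ (Function.update x i s)) (fun s => φ (Function.update x i s))) +
      (∫ x in unitCube d, hflux1 θ N (Finset.range (2 ^ N)) (1 / 2)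
        (fun s => A (Function.update x i s) i)
        (fun s => φ (Function.update x i s)) (fun s => ψ (Function.update x i s))) ≤
      K / 2 * (nrm φ ^ 2 + nrm ψ ^ 2) + β * invConst k * 2 ^ N * nrm (φ - ψ) ^ 2 := by
    intro i
    obtain ⟨s1, s1'⟩ := integrable_slice_sq (PW_le_BM _ _ _ hφ) i
    obtain ⟨s2, s2'⟩ := integrable_slice_sq (PW_le_BM _ _ _ hψ) i
    obtain ⟨s3, s3'⟩ := integrable_slice_sq (PW_le_BM _ _ _ (sub_mem hφ hψ)) i
    rw [← integral_add (h1 i) (h2 i), ← s1', ← s2', ← s3', ← integral_add s1 s2,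
      ← integral_const_mul, ← integral_const_mul]
    refine le_trans ?_ (integral_add ((s1.add s2).const_mul (K / 2))
      (s3.const_mul (β * invConst k * 2 ^ N))).le
    refine setIntegral_mono_on ((h1 i).add (h2 i)) (((s1.add s2).const_mul _).add (s3.const_mul _))
      (measurableSet_unitCube d) fun x hx => ?_
    refine PW1.hflux1_add_hflux1_le (PW.slice hφ x i) (Adm.slice_bdd hφA x i)
      (PW.measurable_deriv_slice hφ x i) (PW.deriv_slice_bdd hφ x i) (PW.slice hψ x i)
      (Adm.slice_bdd hψA x i) (PW.measurable_deriv_slice hψ x i) (PW.deriv_slice_bdd hψ x i)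
      (contDiffOn_slice (hA i) hx i) (hφc x i) (hψc x i) ?_ hβ ?_ (hAK x hx i)
    · rcases hbc with ⟨e1, e2, e3, e4, e5⟩ | h
      · exact Or.inl ⟨e1, e2, e3 x i, e4 x i, e5 x i⟩
      · exact Or.inr h
    · exact hβA.imp_right fun h => ⟨h _ (update_mem_unitCube hx i (by simp)) i,
        h _ (update_mem_unitCube hx i (by simp)) i⟩
  refine (Finset.sum_le_sum fun i _ => hi i).trans_eq ?_
  rw [Finset.sum_const, Finset.card_univ, Fintype.card_fin, nsmul_eq_mul]

/-- Integration by parts along all coordinate lines against `C¹` functions, when the only jumps of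
`φ` are at the faces `x_i = (j + δ) h_N`, `j ∈ J`. -/
def PartsRule (θ : ℝ) (N : ℕ) (J : Finset ℕ) (δ : ℝ) (φ : (Fin d → ℝ) → ℝ) : Prop :=
  ∀ x i, ∀ F : ℝ → ℝ, ContDiffOn ℝ 1 F (Icc 0 1) → (θ = 1 ∨ F 1 = F 0) →
    (∫ s in (0 : ℝ)..1, F s * derivWithin (fun s => φ (Function.update x i s)) (Ici s) s) +
      (∫ s in (0 : ℝ)..1, derivWithin F (Icc 0 1) s * φ (Function.update x i s)) =
    (∑ j ∈ J, F ((j + δ) * meshSize N) *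
      (Function.leftLim (fun s => φ (Function.update x i s)) ((j + δ) * meshSize N) -
        φ (Function.update x i ((j + δ) * meshSize N)))) +
      θ * (F 1 * Function.leftLim (fun s => φ (Function.update x i s)) 1 -
        F 0 * φ (Function.update x i 0))

lemma one_mem_PW1 (k m : ℕ) : (fun _ : ℝ => (1 : ℝ)) ∈ PW1 k m := fun _ => ⟨1, by simp, by simp⟩

lemma leftLim_one (c : ℝ) : Function.leftLim (fun _ : ℝ => (1 : ℝ)) c = 1 :=
  leftLim_eq tendsto_const_nhds

/-- Integration by parts against the constant function, which has no jumps, on the other mesh. -/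
lemma partsRule_primal (hφ : φ ∈ PW k (N + 1) d)
    (hφc : FaceCont N (Finset.range (2 ^ N)) (1 / 2) φ)
    (hbc : (θ = 0 ∧ J = Finset.range (2 ^ N) ∧ PerTrace φ) ∨
      (θ = 1 ∧ J = Finset.Ico 1 (2 ^ N))) : PartsRule θ N J 0 φ := by
  intro x i F hF hFb
  have h := PW1.integral_by_parts_staggered (J := J) (θ := θ) (PW.slice hφ x i)
    (Adm.slice_bdd (PW_le_Adm _ _ _ hφ) x i)
    (PW.measurable_deriv_slice hφ x i) (PW.deriv_slice_bdd hφ x i) (one_mem_PW1 k (N + 1))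
    ⟨1, by simp⟩ (by simp) ⟨0, by simp⟩ hF (hφc x i) (fun j _ => leftLim_one _) (by
      rcases hbc with ⟨e1, e2, e3⟩ | h
      · refine Or.inl ⟨e1, e2, hFb.resolve_left (by rw [e1]; norm_num), e3 x i, ?_⟩
        rw [leftLim_one, leftLim_one]
      · exact Or.inr h)
  simp only [leftLim_one, derivWithin_fun_const, Pi.zero_apply, mul_zero, intervalIntegral.integral_zero,
    zero_add, one_mul, mul_one, sub_self, Finset.sum_const_zero, add_zero] at h ⊢
  rw [← h]
  congr 1
  exact intervalIntegral.integral_congr fun s _ => mul_comm _ _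

lemma partsRule_dual (hψ : ψ ∈ PW k (N + 1) d) (hψc : FaceCont N J 0 ψ)
    (hbc : (θ = 0 ∧ J = Finset.range (2 ^ N) ∧ PerTrace ψ) ∨
      (θ = 1 ∧ J = Finset.Ico 1 (2 ^ N))) : PartsRule θ N (Finset.range (2 ^ N)) (1 / 2) ψ := by
  intro x i F hF hFb
  have h := PW1.integral_by_parts_staggered (J := J) (θ := θ) (one_mem_PW1 k (N + 1))
    ⟨1, by simp⟩ (by simp) ⟨0, by simp⟩ (PW.slice hψ x i)
    (Adm.slice_bdd (PW_le_Adm _ _ _ hψ) x i)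
    (PW.measurable_deriv_slice hψ x i) (PW.deriv_slice_bdd hψ x i) hF (fun j _ => leftLim_one _)
    (hψc x i) (by
      rcases hbc with ⟨e1, e2, e3⟩ | h
      · refine Or.inl ⟨e1, e2, hFb.resolve_left (by rw [e1]; norm_num), ?_, e3 x i⟩
        rw [leftLim_one, leftLim_one]
      · exact Or.inr h)
  simp only [leftLim_one, derivWithin_fun_const, Pi.zero_apply, mul_zero, intervalIntegral.integral_zero,
    zero_add, one_mul, sub_self, Finset.sum_const_zero, add_zero] at h ⊢
  exact h

/-- The contribution of the inflow data `u` to the flux form. -/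
noncomputable def inflowTerm (A : (Fin d → ℝ) → Fin d → ℝ) (u φ : (Fin d → ℝ) → ℝ) : ℝ :=
  ∑ i : Fin d, ∫ x in unitCube d,
    (min (A (Function.update x i 1) i) 0 * u (Function.update x i 1) * traceL i 1 φ x -
      max (A (Function.update x i 0) i) 0 * u (Function.update x i 0) * traceR i 0 φ x)

lemma integrable_inflow (hA : ∀ i, ContinuousOn (fun x => A x i) (unitCube d))
    (hu : ContinuousOn u (unitCube d)) (hφ : φ ∈ Adm d) (i : Fin d) :
    Integrable (fun x => min (A (Function.update x i 1) i) 0 * u (Function.update x i 1) *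
      traceL i 1 φ x) (volume.restrict (unitCube d)) ∧
    Integrable (fun x => max (A (Function.update x i 0) i) 0 * u (Function.update x i 0) *
      traceR i 0 φ x) (volume.restrict (unitCube d)) := by
  constructor
  · exact BM.integrable (BM.mul (BM.mul (BM.of_continuousOn (ContinuousOn.inf (continuousOn_update
      (hA i) i (c := 1) (by simp)) continuousOn_const)) (BM.of_continuousOn (continuousOn_update
      hu i (c := 1) (by simp)))) (Adm.traceL_mem_BM hφ i _))
  · exact BM.integrable (BM.mul (BM.mul (BM.of_continuousOn (ContinuousOn.sup (continuousOn_update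
      (hA i) i (c := 0) (by simp)) continuousOn_const)) (BM.of_continuousOn (continuousOn_update
      hu i (c := 0) (by simp)))) (Adm.traceR_mem_BM hφ i _))

/-- The boundary term of the scheme splits into the homogeneous one and the inflow data. -/
lemma boundaryTerm_eq (hA : ∀ i, ContinuousOn (fun x => A x i) (unitCube d))
    (hu : ContinuousOn u (unitCube d)) (hf : f ∈ Adm d) (hφ : φ ∈ Adm d)
    {g : Fin d → (Fin d → ℝ) → ℝ}
    (hg : ∀ x ∈ unitCube d, ∀ i, (x i = 0 ∧ 0 < A x i) ∨ (x i = 1 ∧ A x i < 0) → u x = g i x) :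
    boundaryTerm A g f φ = boundaryTerm A 0 f φ + inflowTerm A u φ := by
  rw [boundaryTerm_zero, inflowTerm, ← Finset.sum_add_distrib, boundaryTerm]
  refine Finset.sum_congr rfl fun i _ => ?_
  obtain ⟨k1, k0⟩ := integrable_inflow hA hu hφ i
  have m1 := integrable_outflow_one hA hf hφ i
  have m0 := integrable_outflow_zero hA hf hφ i
  have e1 : ∫ x in unitCube d, (if A (Function.update x i 1) i < 0 then g i (Function.update x i 1)
      else traceL i 1 f x) * A (Function.update x i 1) i * traceL i 1 φ x =
      ∫ x in unitCube d, (max (A (Function.update x i 1) i) 0 * traceL i 1 f x * traceL i 1 φ x +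
        min (A (Function.update x i 1) i) 0 * u (Function.update x i 1) * traceL i 1 φ x) := by
    refine setIntegral_congr_fun (measurableSet_unitCube d) fun x hx => ?_
    split_ifs with h
    · rw [hg _ (update_mem_unitCube hx i (c := 1) (by simp)) i (Or.inr ⟨by simp, h⟩),
        max_eq_right h.le, min_eq_left h.le]; ring
    · rw [max_eq_left (not_lt.1 h), min_eq_right (not_lt.1 h)]; ring
  have e0 : ∫ x in unitCube d, (if 0 < A (Function.update x i 0) i then g i (Function.update x i 0)
      else traceR i 0 f x) * A (Function.update x i 0) i * traceR i 0 φ x =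
      ∫ x in unitCube d, (min (A (Function.update x i 0) i) 0 * traceR i 0 f x * traceR i 0 φ x +
        max (A (Function.update x i 0) i) 0 * u (Function.update x i 0) * traceR i 0 φ x) := by
    refine setIntegral_congr_fun (measurableSet_unitCube d) fun x hx => ?_
    split_ifs with h
    · rw [hg _ (update_mem_unitCube hx i (c := 0) (by simp)) i (Or.inl ⟨by simp, h⟩),
        max_eq_left h.le, min_eq_right h.le]; ring
    · rw [max_eq_right (not_lt.1 h), min_eq_left (not_lt.1 h)]; ring
  rw [e1, e0, integral_add m1 k1, integral_add m0 k0, integral_sub k1 k0]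
  ring

lemma unitCube_eq_pi (d : ℕ) : unitCube d = pi univ fun _ => Icc (0 : ℝ) 1 := by
  rw [pi_univ_Icc]; rfl

lemma interior_unitCube (d : ℕ) : interior (unitCube d) = pi univ fun _ => Ioo (0 : ℝ) 1 := by
  rw [unitCube_eq_pi, interior_pi_set finite_univ]
  simp

lemma ae_mem_interior (d : ℕ) : ∀ᵐ x ∂(volume.restrict (unitCube d)), x ∈ interior (unitCube d) := by
  filter_upwards [ae_mem_box d, ae_all_iff.2 fun i => ae_coord_ne i 0] with x hx h0
  rw [interior_unitCube]
  intro i _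
  have := hx i trivial
  exact ⟨lt_of_le_of_ne this.1 (h0 i).symm, by simpa using this.2⟩

lemma uniqueDiffOn_unitCube (d : ℕ) : UniqueDiffOn ℝ (unitCube d) := by
  rw [unitCube_eq_pi]
  exact UniqueDiffOn.univ_pi fun _ => uniqueDiffOn_Icc zero_lt_one

/-- The exact solution satisfies the equations of the scheme. -/
lemma integral_mul_eq_hflux (hA : ∀ i, ContinuousOn (fun x => A x i) (unitCube d))
    (hu : ContinuousOn u (unitCube d))
    (hF : ∀ i, ContDiffOn ℝ 1 (fun x => A x i * u x) (unitCube d))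
    (hUt : ∀ x ∈ interior (unitCube d), Ut x + ∑ i, pderiv i (fun y => A y i * u y) x = 0)
    (hU : U ∈ Adm d) (hUc : Continuous U) (hUu : ∀ x ∈ unitCube d, U x = u x)
    (hφ : φ ∈ PW k m d) (hJ : J ⊆ Finset.range (2 ^ N)) (hδ : δ = 0 ∨ δ = 1 / 2)
    (hrule : PartsRule θ N J δ φ)
    (hbc : θ = 1 ∨ ∀ x i, A (Function.update x i 1) i * u (Function.update x i 1) =
      A (Function.update x i 0) i * u (Function.update x i 0)) :
    ∫ x in unitCube d, Ut x * φ x = hflux θ N J δ A U φ - θ * inflowTerm A u φ := by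
  have hφA := PW_le_Adm _ _ _ hφ
  set dF : Fin d → (Fin d → ℝ) → ℝ := fun i x =>
    fderivWithin ℝ (fun x => A x i * u x) (unitCube d) x (Pi.single i 1) with hdF
  have hdFBM : ∀ i, dF i ∈ BM d := fun i => BM.of_continuousOn
    (((hF i).continuousOn_fderivWithin (uniqueDiffOn_unitCube d) le_rfl).clm_apply continuousOn_const)
  have hint : ∀ i, Integrable (fun x => dF i x * φ x) (volume.restrict (unitCube d)) := fun i =>
    BM.integrable (BM.mul (hdFBM i) (Adm_le_BM d hφA))
  have h1 : ∫ x in unitCube d, Ut x * φ x = -∑ i, ∫ x in unitCube d, dF i x * φ x := by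
    rw [← integral_finsetSum _ fun i _ => hint i, ← integral_neg]
    refine integral_congr_ae ?_
    filter_upwards [ae_mem_interior d] with x hx
    have hp : ∀ i, pderiv i (fun y => A y i * u y) x = dF i x := by
      intro i
      have hn : unitCube d ∈ 𝓝 x := mem_interior_iff_mem_nhds.1 hx
      have hd : DifferentiableAt ℝ (fun y => A y i * u y) x :=
        ((hF i).differentiableOn one_ne_zero).differentiableAt hn
      rw [pderiv, hd.lineDeriv_eq_fderiv, hdF]
      simp only
      rw [fderivWithin_of_mem_nhds hn]
    have := hUt x hx
    simp_rw [hp] at this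
    rw [← Finset.sum_mul, ← neg_mul]
    congr 1
    linarith
  have hslice : ∀ i, ∀ x ∈ unitCube d, ∀ s ∈ Icc (0 : ℝ) 1, dF i (Function.update x i s) =
      derivWithin (fun s => A (Function.update x i s) i * u (Function.update x i s)) (Icc 0 1) s := by
    intro i x hx s hs
    have hfd := ((hF i).differentiableOn one_ne_zero _ (update_mem_unitCube hx i hs)).hasFDerivWithinAt
    have := hfd.comp_hasDerivWithinAt s (hasDerivAt_update x i s).hasDerivWithinAt
      (fun r hr => update_mem_unitCube hx i hr)
    exact (this.derivWithin (uniqueDiffOn_Icc zero_lt_one s hs)).symm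
  obtain ⟨g1, g2⟩ := hflux_eq hA hU hφ hJ hδ θ
  rw [h1, g2, inflowTerm, ← Finset.sum_neg_distrib, Finset.mul_sum, ← Finset.sum_sub_distrib]
  refine Finset.sum_congr rfl fun i _ => ?_
  obtain ⟨k1, k0⟩ := integrable_inflow hA hu hφA i
  rw [integral_slice i (hint i), ← integral_const_mul, ← integral_neg]
  refine Eq.trans ?_ (integral_sub (g1 i) ((k1.sub k0).const_mul θ))
  refine setIntegral_congr_fun (measurableSet_unitCube d) fun x hx => ?_
  have hFs := contDiffOn_slice (hF i) hx i
  have hr := hrule x i _ hFs (hbc.imp_right fun h => h x i)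
  have hcU : Continuous fun s => U (Function.update x i s) := hUc.comp (by fun_prop)
  have hUL : Function.leftLim (fun s => U (Function.update x i s)) 1 = u (Function.update x i 1) := by
    rw [← hUu _ (update_mem_unitCube hx i (by simp))]
    exact leftLim_eq (hcU.continuousAt.mono_left nhdsWithin_le_nhds)
  have hUR : Function.rightLim (fun s => U (Function.update x i s)) 0 = u (Function.update x i 0) := by
    rw [← hUu _ (update_mem_unitCube hx i (by simp))]
    exact rightLim_eq (hcU.continuousAt.mono_left nhdsWithin_le_nhds)
  have hRφ : ∀ c, Function.rightLim (fun s => φ (Function.update x i s)) c =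
      φ (Function.update x i c) := fun c => rightLim_eq (PW1.tendsto_right (PW.slice hφ x i) c)
  have e1 : ∫ s in (0 : ℝ)..1, dF i (Function.update x i s) * φ (Function.update x i s) =
      ∫ s in (0 : ℝ)..1, derivWithin (fun s => A (Function.update x i s) i *
        u (Function.update x i s)) (Icc 0 1) s * φ (Function.update x i s) := by
    refine intervalIntegral.integral_congr fun s hs => ?_
    rw [uIcc_of_le zero_le_one] at hs
    rw [hslice i x hx s hs]
  have e2 : ∫ s in (0 : ℝ)..1, U (Function.update x i s) * (A (Function.update x i s) i *
      derivWithin (fun s => φ (Function.update x i s)) (Ici s) s) =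
      ∫ s in (0 : ℝ)..1, A (Function.update x i s) i * u (Function.update x i s) *
        derivWithin (fun s => φ (Function.update x i s)) (Ici s) s := by
    refine intervalIntegral.integral_congr fun s hs => ?_
    rw [uIcc_of_le zero_le_one] at hs
    rw [hUu _ (update_mem_unitCube hx i hs)]
    ring
  have e3 : ∑ j ∈ J, U (Function.update x i ((j + δ) * meshSize N)) *
      A (Function.update x i ((j + δ) * meshSize N)) i *
      (Function.leftLim (fun s => φ (Function.update x i s)) ((j + δ) * meshSize N) -
        φ (Function.update x i ((j + δ) * meshSize N))) =
      ∑ j ∈ J, A (Function.update x i ((j + δ) * meshSize N)) i *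
      u (Function.update x i ((j + δ) * meshSize N)) *
      (Function.leftLim (fun s => φ (Function.update x i s)) ((j + δ) * meshSize N) -
        φ (Function.update x i ((j + δ) * meshSize N))) :=
    Finset.sum_congr rfl fun j hj => by
      rw [hUu _ (update_mem_unitCube hx i (Ico_subset_Icc_self (face_mem_Icc hJ hδ hj)))]
      ring
  unfold hflux1
  simp only [hUL, hUR, hRφ, traceL, traceR]
  rw [e1, e2, e3]
  -- outflow and inflow parts of the field at the two end points
  have a1 : A (Function.update x i 1) i = max (A (Function.update x i 1) i) 0 +
    min (A (Function.update x i 1) i) 0 := by rw [max_add_min, add_zero]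
  have a0 : A (Function.update x i 0) i = max (A (Function.update x i 0) i) 0 +
    min (A (Function.update x i 0) i) 0 := by rw [max_add_min, add_zero]
  have b1 : A (Function.update x i 1) i * u (Function.update x i 1) =
    (max (A (Function.update x i 1) i) 0 + min (A (Function.update x i 1) i) 0) *
      u (Function.update x i 1) := by rw [← a1]
  have b0 : A (Function.update x i 0) i * u (Function.update x i 0) =
    (max (A (Function.update x i 0) i) 0 + min (A (Function.update x i 0) i) 0) *
      u (Function.update x i 0) := by rw [← a0]
  rw [b1, b0] at hr
  linear_combination -hr

end stab

/-! ### One-dimensional spaces on the primal and on the dual mesh -/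

section line
variable {k m n N : ℕ} {a : ℝ} {f g : ℝ → ℝ}

lemma PW1.translate (hf : f ∈ PW1 k m) (z : ℤ) : (fun x => f (x + z * meshSize m)) ∈ PW1 k m := by
  intro j
  obtain ⟨p, hp, h⟩ := hf (j + z)
  refine ⟨p.comp (Polynomial.C 1 * Polynomial.X + Polynomial.C (z * meshSize m)),
    ?_, fun x hx => ?_⟩
  · refine Polynomial.natDegree_comp_le.trans ?_
    refine (Nat.mul_le_mul hp (Polynomial.natDegree_linear_le)).trans (by omega)
  · have := h (x + z * meshSize m) ⟨by push_cast; linarith [hx.1], by push_cast; linarith [hx.2]⟩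
    simpa using this

lemma PW1.comp_fract (hf : f ∈ PW1 k m) : (fun x => f (Int.fract x)) ∈ PW1 k m := by
  intro j
  have hM := two_pow_mul_meshSize m
  have hp0 := meshSize_pos m
  set z : ℤ := j / 2 ^ m with hz
  have h1 : z * 2 ^ m ≤ j := Int.ediv_mul_le j (by positivity)
  have h2 : j + 1 ≤ (z + 1) * 2 ^ m := Int.lt_ediv_add_one_mul_self j (by positivity)
  have h1' : (z : ℝ) * 2 ^ m ≤ j := by exact_mod_cast h1
  have h2' : (j : ℝ) + 1 ≤ (z + 1) * 2 ^ m := by exact_mod_cast h2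
  have e1 : (z : ℝ) ≤ j * meshSize m := by
    calc (z : ℝ) = z * 2 ^ m * meshSize m := by rw [mul_assoc, hM, mul_one]
      _ ≤ _ := by gcongr
  have e2 : (j + 1) * meshSize m ≤ (z : ℝ) + 1 := by
    calc (j + 1) * meshSize m ≤ (z + 1) * 2 ^ m * meshSize m := by gcongr
      _ = _ := by rw [mul_assoc, hM, mul_one]
  obtain ⟨p, hp, h⟩ := PW1.translate hf (-(z * 2 ^ m)) j
  refine ⟨p, hp, fun x hx => ?_⟩
  have hfl : ⌊x⌋ = z := Int.floor_eq_iff.2 ⟨e1.trans hx.1, hx.2.trans_le e2⟩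
  have hfr : Int.fract x = x - z := by rw [← Int.self_sub_floor, hfl]
  rw [← h x hx]
  simp only [hfr]
  congr 1
  push_cast
  rw [neg_mul, mul_assoc, hM]
  ring

lemma PW1.indicator (hf : f ∈ PW1 k m) : (Ico (0 : ℝ) 1).indicator f ∈ PW1 k m := by
  intro j
  have hM := two_pow_mul_meshSize m
  have hp0 := meshSize_pos m
  by_cases hj : 0 ≤ j ∧ j < 2 ^ m
  · obtain ⟨p, hp, h⟩ := hf j
    refine ⟨p, hp, fun x hx => ?_⟩
    rw [indicator_of_mem, h x hx]
    have h1 : (0 : ℝ) ≤ j := by exact_mod_cast hj.1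
    have h2 : (j : ℝ) + 1 ≤ 2 ^ m := by exact_mod_cast hj.2
    exact ⟨(mul_nonneg h1 hp0.le).trans hx.1,
      hx.2.trans_le ((mul_le_mul_of_nonneg_right h2 hp0.le).trans hM.le)⟩
  · refine ⟨0, by simp, fun x hx => ?_⟩
    rw [indicator_of_notMem]
    · simp
    · rintro ⟨h0, h1⟩
      refine hj ⟨?_, ?_⟩
      · by_contra hneg
        have : (j : ℝ) + 1 ≤ 0 := by exact_mod_cast (not_le.1 hneg)
        nlinarith [hx.2]
      · by_contra hge
        have : (2 : ℝ) ^ m ≤ j := by exact_mod_cast (not_lt.1 hge)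
        nlinarith [hx.1]

lemma PW1.bdd_Ico (hf : f ∈ PW1 k m) : ∃ C : ℝ, ∀ x ∈ Ico (0 : ℝ) 1, |f x| ≤ C := by
  have hM := two_pow_mul_meshSize m
  have hp0 := meshSize_pos m
  have hcell : ∀ j : ℤ, ∃ C : ℝ, ∀ x ∈ Ico (j * meshSize m) ((j + 1) * meshSize m), |f x| ≤ C := by
    intro j
    obtain ⟨p, -, h⟩ := hf j
    obtain ⟨C, hC⟩ := (isCompact_Icc (a := (j : ℝ) * meshSize m)
      (b := (j + 1) * meshSize m)).exists_bound_of_continuousOn p.continuous.continuousOn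
    exact ⟨C, fun x hx => by rw [h x hx]; exact hC x (Ico_subset_Icc_self hx)⟩
  choose C hC using hcell
  refine ⟨∑ j ∈ Finset.range (2 ^ m), |C j|, fun x hx => ?_⟩
  obtain ⟨j, hj⟩ := exists_mem_Ico_grid m x
  have hj0 : 0 ≤ j := by
    by_contra hneg
    have : (j : ℝ) + 1 ≤ 0 := by exact_mod_cast (not_le.1 hneg)
    nlinarith [hj.2, hx.1]
  have hj1 : j < 2 ^ m := by
    by_contra hge
    have : (2 : ℝ) ^ m ≤ j := by exact_mod_cast (not_lt.1 hge)
    nlinarith [hj.1, hx.2]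
  lift j to ℕ using hj0
  refine (hC j x hj).trans ((le_abs_self _).trans ?_)
  exact Finset.single_le_sum (f := fun j : ℕ => |C j|) (fun i _ => abs_nonneg _)
    (Finset.mem_range.2 (by exact_mod_cast hj1))

/-- A finite spanning set for the piecewise polynomials vanishing outside `[0, 1)`. -/
noncomputable def lineBasis (k m : ℕ) : Finset (ℝ → ℝ) := by
  classical
  exact (Finset.range (2 ^ m) ×ˢ Finset.range (k + 1)).image fun z =>
    (Ico ((z.1 : ℝ) * meshSize m) ((z.1 + 1) * meshSize m)).indicator fun x => x ^ z.2

lemma PW1.mem_span_lineBasis (hf : f ∈ PW1 k m) (h0 : ∀ x, x ∉ Ico (0 : ℝ) 1 → f x = 0) :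
    f ∈ Submodule.span ℝ (lineBasis k m : Set (ℝ → ℝ)) := by
  classical
  have hM := two_pow_mul_meshSize m
  have hp0 := meshSize_pos m
  choose p hp h using hf
  have : f = ∑ j ∈ Finset.range (2 ^ m), ∑ i ∈ Finset.range (k + 1), (p j).coeff i •
      (Ico ((j : ℝ) * meshSize m) ((j + 1) * meshSize m)).indicator fun x => x ^ i := by
    ext x
    simp only [Finset.sum_apply, Pi.smul_apply, smul_eq_mul]
    by_cases hx : x ∈ Ico (0 : ℝ) 1
    · obtain ⟨j, hj⟩ := exists_mem_Ico_grid m x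
      have hj0 : 0 ≤ j := by
        by_contra hneg
        have : (j : ℝ) + 1 ≤ 0 := by exact_mod_cast (not_le.1 hneg)
        nlinarith [hj.2, hx.1]
      have hj1 : j < 2 ^ m := by
        by_contra hge
        have : (2 : ℝ) ^ m ≤ j := by exact_mod_cast (not_lt.1 hge)
        nlinarith [hj.1, hx.2]
      lift j to ℕ using hj0
      rw [Finset.sum_eq_single j]
      · rw [h j x hj, poly_eval_eq_sum (hp j)]
        refine Finset.sum_congr rfl fun i _ => ?_
        rw [indicator_of_mem (by exact_mod_cast hj)]
      · intro i _ hij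
        refine Finset.sum_eq_zero fun l _ => ?_
        rw [indicator_of_notMem, mul_zero]
        rintro ⟨h1, h2⟩
        push_cast at hj
        rcases lt_or_gt_of_ne hij with hlt | hlt
        · have : (i : ℝ) + 1 ≤ j := by exact_mod_cast hlt
          nlinarith [hj.1]
        · have : (j : ℝ) + 1 ≤ i := by exact_mod_cast hlt
          nlinarith [hj.2]
      · intro hj2
        exact absurd (Finset.mem_range.2 (by exact_mod_cast hj1)) hj2
    · rw [h0 x hx, eq_comm]
      refine Finset.sum_eq_zero fun j hj => Finset.sum_eq_zero fun l _ => ?_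
      rw [indicator_of_notMem, mul_zero]
      rintro ⟨h1, h2⟩
      have h3 : (j : ℝ) + 1 ≤ 2 ^ m := by exact_mod_cast Finset.mem_range.1 hj
      exact hx ⟨(by positivity : (0 : ℝ) ≤ j * meshSize m).trans h1,
        h2.trans_le ((mul_le_mul_of_nonneg_right h3 hp0.le).trans hM.le)⟩
  rw [this]
  refine Submodule.sum_mem _ fun j hj => Submodule.sum_mem _ fun i hi => Submodule.smul_mem _ _
    (Submodule.subset_span ?_)
  simp only [lineBasis, Finset.coe_image, mem_image, Finset.mem_coe, Finset.mem_product]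
  exact ⟨(j, i), ⟨hj, hi⟩, rfl⟩

/-- The offset of the primal or of the dual mesh. -/
def IsOffset (N : ℕ) (a : ℝ) : Prop := a = 0 ∨ a = -(meshSize N / 2)

lemma IsOffset.exists_int (ha : IsOffset N a) : ∃ z : ℤ, a = z * meshSize (N + 1) := by
  rcases ha with rfl | rfl
  · exact ⟨0, by simp⟩
  · exact ⟨-1, by rw [meshSize_succ]; push_cast; ring⟩

lemma IsOffset.exists_int_of_le (ha : IsOffset N a) (h : N + 1 ≤ m) :
    ∃ z : ℤ, a = z * meshSize m := by
  obtain ⟨z, rfl⟩ := ha.exists_int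
  refine ⟨z * 2 ^ (m - (N + 1)), ?_⟩
  push_cast
  rw [mul_assoc, meshSize_mul_pow h]

lemma PW1.of_shift {z : ℤ} (ha : a = z * meshSize m) (hf : (fun x => f (a + x)) ∈ PW1 k m) :
    f ∈ PW1 k m := by
  have := PW1.translate hf (-z)
  convert this using 2 with x
  rw [ha]; push_cast; ring_nf

lemma PW1.of_offset (ha : IsOffset N a) (h : N + 1 ≤ m) (hn : n ≤ m)
    (hf : (fun x => f (a + x)) ∈ PW1 k n) : f ∈ PW1 k m := by
  obtain ⟨z, hz⟩ := ha.exists_int_of_le h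
  exact PW1.of_shift hz (PW1_mono k hn hf)

/-- On the mesh with offset `a` the functions are continuous at the mid points of the cells. -/
lemma PW1.tendsto_midpoint (hf : (fun x => f (a + x)) ∈ PW1 k N) (j : ℤ) :
    Tendsto f (𝓝 (a + (j + 1 / 2) * meshSize N)) (𝓝 (f (a + (j + 1 / 2) * meshSize N))) := by
  obtain ⟨p, -, h⟩ := hf j
  have hp0 := meshSize_pos N
  have hev : ∀ y ∈ Ico (a + j * meshSize N) (a + (j + 1) * meshSize N),
      f y = p.eval (y - a) := by
    intro y hy
    have := h (y - a) ⟨by linarith [hy.1], by linarith [hy.2]⟩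
    simpa using this
  rw [hev _ ⟨by nlinarith, by nlinarith⟩]
  have hc : Continuous fun y => p.eval (y - a) := p.continuous.comp (by fun_prop)
  refine (hc.tendsto _).congr' ?_
  filter_upwards [Ioo_mem_nhds (show a + j * meshSize N < a + (j + 1 / 2) * meshSize N by nlinarith)
    (show a + (j + 1 / 2) * meshSize N < a + (j + 1) * meshSize N by nlinarith)] with y hy
  exact (hev y (Ioo_subset_Ico_self hy)).symm

/-- Periodic piecewise polynomials on the mesh with offset `a`. -/
def linePer (k N : ℕ) (a : ℝ) : Submodule ℝ (ℝ → ℝ) where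
  carrier := {f | (fun x => f (a + x)) ∈ PW1 k N ∧ ∀ x, f (x + 1) = f x}
  add_mem' := fun hf hg => ⟨add_mem hf.1 hg.1, fun x => by simp [hf.2 x, hg.2 x]⟩
  zero_mem' := ⟨zero_mem _, fun _ => rfl⟩
  smul_mem' := fun c _ hf => ⟨Submodule.smul_mem _ c hf.1, fun x => by simp [hf.2 x]⟩

/-- Restrictions to `[0, 1)` of piecewise polynomials on the mesh with offset `a`. -/
def lineDir (k N : ℕ) (a : ℝ) : Submodule ℝ (ℝ → ℝ) where
  carrier := {f | ∃ g : ℝ → ℝ, (fun x => g (a + x)) ∈ PW1 k N ∧ f = (Ico (0 : ℝ) 1).indicator g}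
  add_mem' := by
    rintro _ _ ⟨g, hg, rfl⟩ ⟨g', hg', rfl⟩
    exact ⟨g + g', add_mem hg hg', by rw [indicator_add']⟩
  zero_mem' := ⟨0, zero_mem _, by simp⟩
  smul_mem' := by
    rintro c _ ⟨g, hg, rfl⟩
    exact ⟨c • g, Submodule.smul_mem _ c hg, by
      ext x; by_cases hx : x ∈ Ico (0 : ℝ) 1 <;> simp [hx]⟩

/-- The properties of the one-dimensional spaces used in the analysis. -/
structure IsLineSpace (k N : ℕ) (S : Submodule ℝ (ℝ → ℝ)) : Prop where
  le : S ≤ PW1 k (N + 1)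
  bdd : ∀ f ∈ S, ∃ C : ℝ, ∀ x, |f x| ≤ C
  tail : ∀ f ∈ S, ∫ s in (-(meshSize N / 2))..0, f s ^ 2 ≤ ∫ s in (0 : ℝ)..1, f s ^ 2
  finite : ∃ b : Finset (ℝ → ℝ), S ≤ Submodule.span ℝ b
  eq_zero : ∀ f ∈ S, (∀ s ∈ Ico (0 : ℝ) 1, f s = 0) → f = 0

lemma linePer.fract (hf : f ∈ linePer k N a) (x : ℝ) : f (Int.fract x) = f x := by
  have h : Function.Periodic f 1 := hf.2
  have := h.sub_zsmul_eq (x := x) ⌊x⌋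
  rw [← this, Int.fract]; simp

lemma isLineSpace_linePer (ha : IsOffset N a) : IsLineSpace k N (linePer k N a) where
  le := fun f hf => PW1.of_offset ha le_rfl (Nat.le_succ N) hf.1
  bdd := fun f hf => by
    obtain ⟨C, hC⟩ := PW1.bdd_Ico (PW1.of_offset ha le_rfl (Nat.le_succ N) hf.1)
    refine ⟨C, fun x => ?_⟩
    rw [← linePer.fract hf]
    exact hC _ ⟨Int.fract_nonneg x, Int.fract_lt_one x⟩
  tail := fun f hf => by
    have hfm := PW1.of_offset ha le_rfl (Nat.le_succ N) hf.1
    obtain ⟨C, hC⟩ := PW1.bdd_Ico hfm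
    have hb : ∃ C : ℝ, ∀ x, |f x| ≤ C := ⟨C, fun x => by
      rw [← linePer.fract hf]
      exact hC _ ⟨Int.fract_nonneg x, Int.fract_lt_one x⟩⟩
    have h1 : ∫ s in (-(meshSize N / 2))..0, f s ^ 2 =
        ∫ s in (-(meshSize N / 2) + 1)..(0 + 1), f s ^ 2 := by
      rw [← intervalIntegral.integral_comp_add_right (fun s => f s ^ 2) 1]
      simp only [hf.2]
    rw [h1, zero_add]
    have := meshSize_le_one N
    have := meshSize_pos N
    exact integral_sq_mono (intervalIntegrable_sq (PW1.measurable hfm) hb) (by linarith)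
      (by linarith) le_rfl
  finite := by
    classical
    refine ⟨(lineBasis k (N + 1)).image (LinearMap.funLeft ℝ ℝ (Int.fract : ℝ → ℝ)), fun f hf => ?_⟩
    have hfm := PW1.of_offset ha le_rfl (Nat.le_succ N) hf.1
    have h1 := PW1.mem_span_lineBasis (PW1.indicator hfm) fun x hx => indicator_of_notMem hx _
    rw [Finset.coe_image, ← Submodule.map_span]
    refine ⟨_, h1, ?_⟩
    ext x
    have hx : Int.fract x ∈ Ico (0 : ℝ) 1 := ⟨Int.fract_nonneg x, Int.fract_lt_one x⟩
    rw [LinearMap.funLeft_apply, indicator_of_mem hx, linePer.fract hf]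
  eq_zero := fun f hf h => by
    ext x
    rw [← linePer.fract hf]
    exact h _ ⟨Int.fract_nonneg x, Int.fract_lt_one x⟩

lemma isLineSpace_lineDir (ha : IsOffset N a) : IsLineSpace k N (lineDir k N a) := by
  have hle : lineDir k N a ≤ PW1 k (N + 1) := by
    rintro _ ⟨g, hg, rfl⟩
    exact PW1.indicator (PW1.of_offset ha le_rfl (Nat.le_succ N) hg)
  refine ⟨hle, ?_, ?_, ⟨lineBasis k (N + 1), ?_⟩, ?_⟩
  · rintro f hf
    obtain ⟨C, hC⟩ := PW1.bdd_Ico (hle hf)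
    obtain ⟨g, -, rfl⟩ := hf
    refine ⟨max C 0, fun x => ?_⟩
    by_cases hx : x ∈ Ico (0 : ℝ) 1
    · exact (hC x hx).trans (le_max_left _ _)
    · rw [indicator_of_notMem hx, abs_zero]; exact le_max_right _ _
  · rintro _ ⟨g, hg, rfl⟩
    have hp := meshSize_pos N
    have h0 : ∫ s in (-(meshSize N / 2))..0, (Ico (0 : ℝ) 1).indicator g s ^ 2 = 0 := by
      rw [intervalIntegral.integral_of_le (by linarith), integral_Ioc_eq_integral_Ioo]
      refine (setIntegral_congr_fun (g := fun _ => (0 : ℝ)) measurableSet_Ioo fun s hs => ?_).trans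
        (by simp)
      have : s ∉ Ico (0 : ℝ) 1 := fun h => absurd h.1 (not_le.2 hs.2)
      rw [indicator_of_notMem this]; norm_num
    rw [h0]
    exact intervalIntegral.integral_nonneg zero_le_one fun _ _ => sq_nonneg _
  · intro f hf
    refine PW1.mem_span_lineBasis (hle hf) fun x hx => ?_
    obtain ⟨g, -, rfl⟩ := hf
    exact indicator_of_notMem hx _
  · rintro _ ⟨g, -, rfl⟩ h
    ext x
    by_cases hx : x ∈ Ico (0 : ℝ) 1
    · exact h x hx
    · exact indicator_of_notMem hx _

lemma linePer.leftLim_midpoint (hf : f ∈ linePer k N a) (j : ℤ) :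
    Function.leftLim f (a + (j + 1 / 2) * meshSize N) = f (a + (j + 1 / 2) * meshSize N) :=
  leftLim_eq ((PW1.tendsto_midpoint hf.1 j).mono_left nhdsWithin_le_nhds)

lemma lineDir.leftLim_midpoint (hf : f ∈ lineDir k N a) (j : ℤ)
    (h0 : 0 < a + (j + 1 / 2) * meshSize N) (h1 : a + (j + 1 / 2) * meshSize N < 1) :
    Function.leftLim f (a + (j + 1 / 2) * meshSize N) = f (a + (j + 1 / 2) * meshSize N) := by
  obtain ⟨g, hg, rfl⟩ := hf
  have hm : a + (j + 1 / 2) * meshSize N ∈ Ico (0 : ℝ) 1 := ⟨h0.le, h1⟩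
  rw [indicator_of_mem hm]
  refine leftLim_eq (((PW1.tendsto_midpoint hg j).congr' ?_).mono_left nhdsWithin_le_nhds)
  filter_upwards [Ioo_mem_nhds h0 h1] with y hy
  rw [indicator_of_mem (Ioo_subset_Ico_self hy)]

lemma linePer.leftLim_one (hf : f ∈ linePer k N a) (ha : IsOffset N a) :
    Function.leftLim f 1 = Function.leftLim f 0 := by
  have hfm := (isLineSpace_linePer ha).le hf
  refine leftLim_eq ?_
  have h1 := PW1.tendsto_leftLim hfm 0
  have h2 : Tendsto (fun s : ℝ => s - 1) (𝓝[<] 1) (𝓝[<] 0) := by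
    refine tendsto_nhdsWithin_iff.2 ⟨?_, ?_⟩
    · have : Tendsto (fun s : ℝ => s - 1) (𝓝 1) (𝓝 (1 - 1)) := (continuous_id.sub continuous_const).tendsto 1
      rw [sub_self] at this
      exact this.mono_left nhdsWithin_le_nhds
    · filter_upwards [self_mem_nhdsWithin] with s hs
      have : s < 1 := hs
      simpa using this
  refine (h1.comp h2).congr fun s => ?_
  have := hf.2 (s - 1)
  simpa using this.symm

end line

/-! ### Orthonormal systems and the multiwavelet decomposition -/

/-- Gram–Schmidt in a finite-dimensional space of functions on which the `L²` product is definite as a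
form on functions, not only on classes modulo null sets. -/
lemma exists_orthonormal_system {X : Type*} [MeasurableSpace X] {μ : Measure X}
    (V : Submodule ℝ (X → ℝ)) [FiniteDimensional ℝ V]
    (hint : ∀ f ∈ V, ∀ g ∈ V, Integrable (fun x => f x * g x) μ)
    (hdef : ∀ f ∈ V, ∫ x, f x * f x ∂μ = 0 → f = 0) :
    ∃ (n : ℕ) (e : Fin n → X → ℝ), (∀ i, e i ∈ V) ∧
      (∀ i j, ∫ x, e i x * e j x ∂μ = if i = j then 1 else 0) ∧
      ∀ f ∈ V, f = ∑ i, (∫ x, f x * e i x ∂μ) • e i := by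
  let B : LinearMap.BilinForm ℝ V := LinearMap.mk₂ ℝ (fun f g : V => ∫ x, f.1 x * g.1 x ∂μ)
    (fun f f' g => by
      rw [← integral_add (hint _ f.2 _ g.2) (hint _ f'.2 _ g.2)]
      simp [add_mul])
    (fun c f g => by
      rw [smul_eq_mul, ← integral_const_mul]
      simp [mul_assoc])
    (fun f g g' => by
      rw [← integral_add (hint _ f.2 _ g.2) (hint _ f.2 _ g'.2)]
      simp [mul_add])
    (fun c f g => by
      rw [smul_eq_mul, ← integral_const_mul]
      simp [mul_left_comm])
  have hB : ∀ f g : V, B f g = ∫ x, f.1 x * g.1 x ∂μ := fun f g => rfl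
  have hsymm : LinearMap.IsSymm B := LinearMap.BilinForm.isSymm_iff.1
    ⟨fun f g => by simp only [hB, mul_comm]⟩
  have hsl : ∀ (r : ℝ) (f g : V), B (r • f) g = r * B f g := fun r f g => LinearMap.map_smul₂ B r f g
  obtain ⟨v, hv⟩ := LinearMap.BilinForm.exists_orthogonal_basis hsymm
  have hpos : ∀ i, 0 < B (v i) (v i) := by
    intro i
    rw [hB]
    refine lt_of_le_of_ne (integral_nonneg fun x => mul_self_nonneg _) fun h => ?_
    exact v.ne_zero i (Subtype.ext (hdef _ (v i).2 h.symm))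
  set c : Fin (Module.finrank ℝ V) → ℝ := fun i => (Real.sqrt (B (v i) (v i)))⁻¹ with hc
  have hc2 : ∀ i, c i * c i * B (v i) (v i) = 1 := by
    intro i
    have := Real.mul_self_sqrt (hpos i).le
    have hs := (Real.sqrt_pos.2 (hpos i)).ne'
    rw [← this]
    simp only [hc]
    field_simp
  have horth : ∀ i j, i ≠ j → B (v i) (v j) = 0 := fun i j hij =>
    LinearMap.isOrthoᵢ_def.1 hv i j hij
  have hBc : ∀ i j, B (c i • v i) (c j • v j) = if i = j then 1 else 0 := by
    intro i j
    rw [map_smul, hsl, smul_eq_mul]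
    split_ifs with h
    · subst h; rw [← mul_assoc, hc2]
    · rw [horth i j h]; ring
  refine ⟨_, fun i => c i • (v i).1, fun i => V.smul_mem _ (v i).2, fun i j => hBc i j,
    fun f hf => ?_⟩
  have hrep := v.sum_repr ⟨f, hf⟩
  have hcoef : ∀ i, B ⟨f, hf⟩ (c i • v i) = c i * B (v i) (v i) * v.repr ⟨f, hf⟩ i := by
    intro i
    conv_lhs => rw [← hrep]
    rw [map_sum, LinearMap.sum_apply, Finset.sum_eq_single i]
    · rw [map_smul, hsl, smul_eq_mul]; ring
    · intro j _ hji
      rw [map_smul, hsl, horth j i hji]; simp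
    · simp
  have h2 : ∑ i, B ⟨f, hf⟩ (c i • v i) • (c i • v i) = (⟨f, hf⟩ : V) := by
    rw [← hrep]
    refine Finset.sum_congr rfl fun i _ => ?_
    rw [hrep, hcoef, smul_smul]
    congr 1
    linear_combination v.repr ⟨f, hf⟩ i * hc2 i
  have h3 := congrArg Subtype.val h2
  rw [AddSubmonoidClass.coe_finsetSum] at h3
  exact h3.symm

section wavelet
variable {k m n N : ℕ} {a : ℝ} {f g : ℝ → ℝ}

lemma piecewisePoly.shift (hf : f ∈ piecewisePoly k a n) : (fun x => f (a + x)) ∈ PW1 k n := by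
  have hp := meshSize_pos n
  have hM := two_pow_mul_meshSize n
  intro j
  by_cases hj : 0 ≤ j ∧ j < 2 ^ n
  · obtain ⟨hj0, hj1⟩ := hj
    lift j to ℕ using hj0
    obtain ⟨p, hp, h⟩ := hf.1 j (by exact_mod_cast hj1)
    refine ⟨p.comp (Polynomial.C 1 * Polynomial.X + Polynomial.C a),
      Polynomial.natDegree_comp_le.trans
        ((Nat.mul_le_mul hp (Polynomial.natDegree_linear_le)).trans (by omega)), fun x hx => ?_⟩
    push_cast at hx
    have := h (a + x) ⟨by linarith [hx.1], by linarith [hx.2]⟩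
    simpa [add_comm] using this
  · refine ⟨0, by simp, fun x hx => ?_⟩
    have : a + x ∉ Ico a (a + 1) := by
      rintro ⟨h0, h1⟩
      refine hj ⟨?_, ?_⟩
      · by_contra hneg
        have : (j : ℝ) + 1 ≤ 0 := by exact_mod_cast (not_le.1 hneg)
        nlinarith [hx.2]
      · by_contra hge
        have : (2 : ℝ) ^ n ≤ j := by exact_mod_cast (not_lt.1 hge)
        nlinarith [hx.1]
    simpa using hf.2 _ this

lemma piecewisePoly.of_shift (hf : (fun x => f (a + x)) ∈ PW1 k n)
    (h0 : ∀ x, x ∉ Ico a (a + 1) → f x = 0) : f ∈ piecewisePoly k a n := by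
  refine ⟨fun j _ => ?_, h0⟩
  obtain ⟨p, hp, h⟩ := hf j
  refine ⟨p.comp (Polynomial.C 1 * Polynomial.X + Polynomial.C (-a)),
    Polynomial.natDegree_comp_le.trans
      ((Nat.mul_le_mul hp (Polynomial.natDegree_linear_le)).trans (by omega)), fun x hx => ?_⟩
  push_cast at h
  have := h (x - a) ⟨by linarith [hx.1], by linarith [hx.2]⟩
  simpa [sub_eq_add_neg] using this

/-- The space `V_n^k([a, a + 1])` as a submodule. -/
def piecewiseSub (k : ℕ) (a : ℝ) (n : ℕ) : Submodule ℝ (ℝ → ℝ) where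
  carrier := piecewisePoly k a n
  add_mem' := fun hf hg => piecewisePoly.of_shift
    (add_mem (piecewisePoly.shift hf) (piecewisePoly.shift hg))
    fun x hx => by simp [hf.2 x hx, hg.2 x hx]
  zero_mem' := piecewisePoly.of_shift (zero_mem _) fun _ _ => rfl
  smul_mem' := fun c _ hf => piecewisePoly.of_shift
    (Submodule.smul_mem _ c (piecewisePoly.shift hf)) fun x hx => by simp [hf.2 x hx]

lemma piecewisePoly_mono (k : ℕ) (a : ℝ) (h : m ≤ n) : piecewisePoly k a m ⊆ piecewisePoly k a n :=
  fun _ hf => piecewisePoly.of_shift (PW1_mono k h (piecewisePoly.shift hf)) hf.2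

lemma piecewisePoly.shift_zero (hf : f ∈ piecewisePoly k a n) (x : ℝ) (hx : x ∉ Ico (0 : ℝ) 1) :
    f (a + x) = 0 := hf.2 _ fun h => hx ⟨by linarith [h.1], by linarith [h.2]⟩

lemma finiteDimensional_piecewiseSub (k : ℕ) (a : ℝ) (n : ℕ) :
    FiniteDimensional ℝ (piecewiseSub k a n) := by
  have hfin : FiniteDimensional ℝ (Submodule.map (LinearMap.funLeft ℝ ℝ fun x : ℝ => x - a)
      (Submodule.span ℝ (lineBasis k n : Set (ℝ → ℝ)))) := inferInstance
  refine Submodule.finiteDimensional_of_le (S₂ := Submodule.map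
    (LinearMap.funLeft ℝ ℝ fun x : ℝ => x - a)
      (Submodule.span ℝ (lineBasis k n : Set (ℝ → ℝ)))) fun f hf => ?_
  refine ⟨_, PW1.mem_span_lineBasis (piecewisePoly.shift hf) (piecewisePoly.shift_zero hf), ?_⟩
  ext x
  simp [LinearMap.funLeft_apply]

lemma piecewisePoly.bdd (hf : f ∈ piecewisePoly k a n) : ∃ C : ℝ, ∀ x, |f x| ≤ C := by
  obtain ⟨C, hC⟩ := PW1.bdd_Ico (piecewisePoly.shift hf)
  refine ⟨max C 0, fun x => ?_⟩
  by_cases hx : x - a ∈ Ico (0 : ℝ) 1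
  · have := hC _ hx
    rw [add_sub_cancel] at this
    exact this.trans (le_max_left _ _)
  · have := piecewisePoly.shift_zero hf _ hx
    rw [add_sub_cancel] at this
    rw [this, abs_zero]; exact le_max_right _ _

lemma piecewisePoly.measurable (hf : f ∈ piecewisePoly k a n) : Measurable f := by
  have h1 := (PW1.measurable (piecewisePoly.shift hf)).comp (measurable_id.sub_const a)
  convert h1 using 1
  ext x; simp

lemma piecewisePoly.integrable_mul (hf : f ∈ piecewisePoly k a n) (hg : g ∈ piecewisePoly k a m) :
    Integrable (fun x => f x * g x) (volume.restrict (Ico a (a + 1))) := by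
  obtain ⟨C, hC⟩ := piecewisePoly.bdd hf
  obtain ⟨D, hD⟩ := piecewisePoly.bdd hg
  refine (integrable_const (C * D)).mono' ((piecewisePoly.measurable hf).mul
    (piecewisePoly.measurable hg)).aestronglyMeasurable (Eventually.of_forall fun x => ?_)
  rw [norm_mul]
  exact mul_le_mul (hC x) (hD x) (norm_nonneg _) ((abs_nonneg _).trans (hC x))

/-- Piecewise polynomials are determined everywhere by their classes modulo null sets. -/
lemma piecewisePoly.eq_zero (hf : f ∈ piecewisePoly k a n)
    (h : ∫ x in Ico a (a + 1), f x * f x = 0) : f = 0 := by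
  have hs := piecewisePoly.shift hf
  have hI := intervalIntegrable_sq (PW1.measurable hs)
    ((piecewisePoly.bdd hf).imp fun C hC x => hC (a + x))
  have h1 : ∫ s in (0 : ℝ)..1, f (a + s) ^ 2 = 0 := by
    rw [intervalIntegral.integral_comp_add_left (fun s => f s ^ 2) a, add_zero,
      intervalIntegral.integral_of_le (by linarith), ← integral_Ico_eq_integral_Ioc]
    simpa [sq] using h
  have hp := meshSize_pos n
  have hM := two_pow_mul_meshSize n
  ext x
  by_cases hx : x - a ∈ Ico (0 : ℝ) 1
  · obtain ⟨j, hj⟩ := exists_mem_Ico_grid n (x - a)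
    have h2 := (PW1.cell_estimate hs hj).1
    simp only [add_sub_cancel] at h2
    have h3 : ∫ y in (j * meshSize n)..((j + 1) * meshSize n), f (a + y) ^ 2 ≤
        ∫ s in (0 : ℝ)..1, f (a + s) ^ 2 := by
      refine integral_sq_mono (g := fun y => f (a + y)) hI ?_ (by nlinarith) ?_
      · have : 0 ≤ j := by
          by_contra hneg
          have : (j : ℝ) + 1 ≤ 0 := by exact_mod_cast (not_le.1 hneg)
          nlinarith [hj.2, hx.1]
        have : (0 : ℝ) ≤ j := by exact_mod_cast this
        positivity
      · have : j < 2 ^ n := by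
          by_contra hge
          have : (2 : ℝ) ^ n ≤ j := by exact_mod_cast (not_lt.1 hge)
          nlinarith [hj.1, hx.2]
        have h4 : (j : ℝ) + 1 ≤ 2 ^ n := by exact_mod_cast this
        exact (mul_le_mul_of_nonneg_right h4 hp.le).trans hM.le
    have hC := invConst_pos k
    have h4 : f x ^ 2 ≤ 0 := by
      refine h2.trans ?_
      have : invConst k * 2 ^ n * ∫ y in (j * meshSize n)..((j + 1) * meshSize n), f (a + y) ^ 2 ≤
        invConst k * 2 ^ n * 0 := by rw [← h1]; gcongr
      simpa using this
    simpa using le_antisymm h4 (sq_nonneg _)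
  · have := piecewisePoly.shift_zero hf _ hx
    rw [add_sub_cancel] at this
    simpa using this

/-- `V_n = W_0 + ⋯ + W_n`. -/
lemma piecewisePoly_subset_span (k : ℕ) (a : ℝ) (n : ℕ) :
    piecewisePoly k a n ⊆ Submodule.span ℝ {f | ∃ m ≤ n, f ∈ multiwavelet k a m} := by
  induction n with
  | zero => exact fun f hf => Submodule.subset_span ⟨0, le_rfl, hf⟩
  | succ n ih =>
    intro f hf
    have := finiteDimensional_piecewiseSub k a n
    obtain ⟨r, e, he, heo, hrep⟩ := exists_orthonormal_system
      (μ := volume.restrict (Ico a (a + 1))) (piecewiseSub k a n)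
      (fun f hf g hg => piecewisePoly.integrable_mul hf hg) (fun f hf h => piecewisePoly.eq_zero hf h)
    set P : ℝ → ℝ := ∑ i, (∫ x in Ico a (a + 1), f x * e i x) • e i with hP
    have hPV : P ∈ piecewiseSub k a n := Submodule.sum_mem _ fun i _ => Submodule.smul_mem _ _ (he i)
    have hPV' : P ∈ piecewiseSub k a (n + 1) := piecewisePoly_mono k a (Nat.le_succ n) hPV
    have hPe : ∀ j, ∫ x in Ico a (a + 1), P x * e j x = ∫ x in Ico a (a + 1), f x * e j x := by
      intro j
      have h1 : ∀ x, P x * e j x =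
          ∑ i, (∫ x in Ico a (a + 1), f x * e i x) * (e i x * e j x) := fun x => by
        simp only [hP, Finset.sum_apply, Pi.smul_apply, smul_eq_mul, Finset.sum_mul, mul_assoc]
      simp_rw [h1]
      rw [integral_finsetSum _ fun i _ => (piecewisePoly.integrable_mul (he i) (he j)).const_mul _]
      simp_rw [integral_const_mul, heo]
      simp
    have hW : f - P ∈ multiwavelet k a (n + 1) := by
      refine ⟨Submodule.sub_mem (piecewiseSub k a (n + 1)) hf hPV', fun v hv => ?_⟩
      have h0 : ∀ j, ∫ x in Ico a (a + 1), (f - P) x * e j x = 0 := by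
        intro j
        simp only [Pi.sub_apply, sub_mul]
        rw [integral_sub (piecewisePoly.integrable_mul hf (he j))
          (piecewisePoly.integrable_mul hPV (he j)), hPe, sub_self]
      have hfP : f - P ∈ piecewisePoly k a (n + 1) := Submodule.sub_mem (piecewiseSub k a (n + 1)) hf hPV'
      have h1 : ∀ x, (f - P) x * v x =
          ∑ i, (∫ x in Ico a (a + 1), v x * e i x) * ((f - P) x * e i x) := fun x => by
        conv_lhs => rw [hrep v hv]
        simp only [Finset.sum_apply, Pi.smul_apply, smul_eq_mul, Finset.mul_sum]
        exact Finset.sum_congr rfl fun i _ => by ring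
      simp_rw [h1]
      rw [integral_finsetSum _ fun i _ => (piecewisePoly.integrable_mul hfP (he i)).const_mul _]
      simp_rw [integral_const_mul, h0]
      simp
    have h2 : f = P + (f - P) := by ring
    rw [h2]
    refine Submodule.add_mem _ ?_ (Submodule.subset_span ⟨n + 1, le_rfl, hW⟩)
    refine Submodule.span_mono ?_ (ih hPV)
    rintro g ⟨m, hm, hg⟩
    exact ⟨m, hm.trans (Nat.le_succ n), hg⟩

lemma multiwavelet_subset (k : ℕ) (a : ℝ) (l : ℕ) : multiwavelet k a l ⊆ piecewisePoly k a l := by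
  cases l with
  | zero => exact le_rfl
  | succ l => exact fun f hf => hf.1

/-! ### The cells of the clipped meshes and the increment spaces -/

lemma indicator_cell_mem {p : ℝ[X]} (hp : p.natDegree ≤ k) {j : ℕ} (hj : j < 2 ^ n) :
    (Ico (a + j * meshSize n) (a + (j + 1) * meshSize n)).indicator (fun x => p.eval x) ∈
      piecewisePoly k a n := by
  have hp0 := meshSize_pos n
  have hM := two_pow_mul_meshSize n
  refine ⟨fun i hi => ?_, fun x hx => indicator_of_notMem (fun h => hx ?_) _⟩
  · by_cases hij : i = j
    · subst hij
      exact ⟨p, hp, fun x hx => indicator_of_mem hx _⟩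
    · refine ⟨0, by simp, fun x hx => ?_⟩
      rw [indicator_of_notMem, Polynomial.eval_zero]
      rintro ⟨h1, h2⟩
      rcases lt_or_gt_of_ne hij with hlt | hlt
      · have : (i : ℝ) + 1 ≤ j := by exact_mod_cast hlt
        nlinarith [hx.2]
      · have : (j : ℝ) + 1 ≤ i := by exact_mod_cast hlt
        nlinarith [hx.1]
  · have h4 : (j : ℝ) + 1 ≤ 2 ^ n := by exact_mod_cast hj
    have h5 := (mul_le_mul_of_nonneg_right h4 hp0.le).trans hM.le
    have h6 : (0 : ℝ) ≤ j * meshSize n := by positivity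
    exact ⟨by linarith [h.1], by linarith [h.2]⟩

/-- A polynomial on a cell of level `n` is a sum of multiwavelets of levels at most `n`. -/
lemma cellPoly_subset_span (k : ℕ) (a : ℝ) (n : ℕ) :
    cellPoly k a a n ⊆ Submodule.span ℝ {f | ∃ m ≤ n, f ∈ multiwavelet k a m} := by
  rintro _ ⟨n', hn', j, p, hp, rfl⟩
  have hp0 := meshSize_pos n'
  have hM := two_pow_mul_meshSize n'
  have hj0 : (0 : ℝ) ≤ j * meshSize n' := by positivity
  by_cases hj : j < 2 ^ n'
  · have h4 : (j : ℝ) + 1 ≤ 2 ^ n' := by exact_mod_cast hj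
    have h5 := (mul_le_mul_of_nonneg_right h4 hp0.le).trans hM.le
    have e1 : cellL a a n' j = a + j * meshSize n' := max_eq_right (by linarith)
    have e2 : cellR a a n' j = a + (j + 1) * meshSize n' := min_eq_right (by linarith)
    rw [e1, e2]
    refine Submodule.span_mono ?_ (piecewisePoly_subset_span k a n' (indicator_cell_mem hp hj))
    rintro g ⟨m, hm, hg⟩
    exact ⟨m, hm.trans hn', hg⟩
  · have h4 : (2 : ℝ) ^ n' ≤ j := by exact_mod_cast not_lt.1 hj
    have h5 := hM.symm.le.trans (mul_le_mul_of_nonneg_right h4 hp0.le)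
    have e : Ico (cellL a a n' j) (cellR a a n' j) = ∅ := by
      refine Ico_eq_empty (not_lt.2 ?_)
      exact (min_le_left _ _).trans (le_trans (by linarith) (le_max_right _ _))
    rw [e, indicator_empty]
    exact zero_mem _

/-- Restriction to `[0, 1)` as a linear map. -/
noncomputable def restrictUnit : (ℝ → ℝ) →ₗ[ℝ] (ℝ → ℝ) where
  toFun f := (Ico (0 : ℝ) 1).indicator f
  map_add' f g := indicator_add' _ _ _
  map_smul' c f := by ext x; by_cases hx : x ∈ Ico (0 : ℝ) 1 <;> simp [hx]

/-- The cells of the clipped mesh are restrictions of shifted cells, except for the additional last cell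
`[1 - h_N / 2, 1)`, which is the same on all levels `n ≤ N` and is supplied by the space of level `0`. -/
lemma cellPoly_subset_span_dualWavelet (k N : ℕ) {n : ℕ} (hn : n ≤ N) :
    cellPoly k (-(meshSize N / 2)) 0 n ⊆ Submodule.span ℝ {f | ∃ m ≤ n, f ∈ dualWavelet k N m} := by
  rintro _ ⟨n', hn', j, p, hp, rfl⟩
  have hp0 := meshSize_pos n'
  have hpN := meshSize_pos N
  have hN1 := meshSize_le_one N
  have hM := two_pow_mul_meshSize n'
  have hle : meshSize N ≤ meshSize n' := by
    rw [← meshSize_mul_pow (hn'.trans hn)]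
    have : (1 : ℝ) ≤ 2 ^ (N - n') := one_le_pow₀ one_le_two
    nlinarith
  set a := -(meshSize N / 2) with ha
  rcases lt_trichotomy j (2 ^ n') with hj | hj | hj
  · have e1 : (Ico (cellL a 0 n' j) (cellR a 0 n' j)).indicator (fun x => p.eval x) =
        restrictUnit ((Ico (a + j * meshSize n') (a + (j + 1) * meshSize n')).indicator
          fun x => p.eval x) := by
      change _ = (Ico (0 : ℝ) 1).indicator _
      rw [indicator_indicator, cellL, cellR, zero_add, Ico_inter_Ico]
    rw [e1]
    have h1 := piecewisePoly_subset_span k a n' (indicator_cell_mem hp hj)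
    have h2 := Submodule.mem_map_of_mem (f := restrictUnit) h1
    rw [Submodule.map_span] at h2
    refine Submodule.span_mono ?_ h2
    rintro _ ⟨g, ⟨m, hm, hg⟩, rfl⟩
    refine ⟨m, hm.trans hn', ?_⟩
    cases m with
    | succ m => exact ⟨g, hg, rfl⟩
    | zero =>
      obtain ⟨r, hr, h⟩ := hg.1 0 (by simp)
      have h0 := hg.2
      simp only [Nat.cast_zero, zero_mul, add_zero, zero_add, one_mul] at h
      have hm0 : meshSize 0 = 1 := by simp [meshSize]
      rw [hm0] at h
      refine ⟨⟨r, hr, fun x hx => ?_⟩, ⟨0, by simp, fun x hx => ?_⟩, fun x hx =>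
        indicator_of_notMem hx _⟩
      · have hx' : x ∈ Ico (0 : ℝ) 1 := ⟨hx.1, hx.2.trans_le (by linarith)⟩
        change (Ico (0 : ℝ) 1).indicator g x = _
        rw [indicator_of_mem hx']
        exact h x ⟨by linarith [hx.1], by linarith [hx.2]⟩
      · change (Ico (0 : ℝ) 1).indicator g x = _
        have : g x = 0 := h0 x fun hh => by linarith [hh.2, hx.1]
        rw [indicator_apply, this]
        simp
  · refine Submodule.subset_span ⟨0, Nat.zero_le _, ?_⟩
    have e1 : cellL a 0 n' j = 1 - meshSize N / 2 := by
      rw [cellL, hj]; push_cast; rw [hM, max_eq_right (by linarith)]; linarith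
    have e2 : cellR a 0 n' j = 1 := by
      rw [cellR, hj]; push_cast; rw [add_mul, hM, min_eq_left (by linarith)]; linarith
    rw [e1, e2]
    refine ⟨⟨0, by simp, fun x hx => ?_⟩, ⟨p, hp, fun x hx => indicator_of_mem hx _⟩, fun x hx => ?_⟩
    · rw [indicator_of_notMem (fun h => by linarith [h.1, hx.2]), Polynomial.eval_zero]
    · exact indicator_of_notMem (fun h => hx ⟨by linarith [h.1], h.2⟩) _
  · have h4 : (2 : ℝ) ^ n' + 1 ≤ j := by exact_mod_cast hj
    have h5 := mul_le_mul_of_nonneg_right h4 hp0.le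
    rw [add_mul, hM] at h5
    have e : Ico (cellL a 0 n' j) (cellR a 0 n' j) = ∅ := by
      refine Ico_eq_empty (not_lt.2 ?_)
      exact (min_le_left _ _).trans (le_trans (by linarith) (le_max_right _ _))
    rw [e, indicator_empty]
    exact zero_mem _

lemma multiwavelet_shift (ha : l ≤ N) (hf : f ∈ multiwavelet k a l) :
    (fun x => f (a + x)) ∈ PW1 k N ∧ ∀ x, x ∉ Ico a (a + 1) → f x = 0 :=
  ⟨PW1_mono k ha (piecewisePoly.shift (multiwavelet_subset k a l hf)),
    (multiwavelet_subset k a l hf).2⟩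

lemma multiwavelet_mem_lineDir (hl : l ≤ N) (hf : f ∈ multiwavelet k 0 l) : f ∈ lineDir k N 0 := by
  obtain ⟨h1, h2⟩ := multiwavelet_shift hl hf
  refine ⟨f, h1, (indicator_eq_self.2 fun x hx => ?_).symm⟩
  by_contra h
  exact hx (h2 x (by simpa using h))

lemma dualWavelet_mem_lineDir (hl : l ≤ N) (hf : f ∈ dualWavelet k N l) :
    f ∈ lineDir k N (-(meshSize N / 2)) := by
  cases l with
  | succ l =>
    obtain ⟨g, hg, rfl⟩ := hf
    exact ⟨g, (multiwavelet_shift hl hg).1, rfl⟩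
  | zero =>
    obtain ⟨⟨p, hp, h1⟩, ⟨r, hr, h2⟩, h3⟩ := hf
    have hpN := meshSize_pos N
    have hM := two_pow_mul_meshSize N
    refine ⟨fun x => if x < 1 - meshSize N / 2 then p.eval x else r.eval x, fun j => ?_, ?_⟩
    · by_cases hj : j < 2 ^ N
      · refine ⟨p.comp (Polynomial.C 1 * Polynomial.X + Polynomial.C (-(meshSize N / 2))),
          Polynomial.natDegree_comp_le.trans
          ((Nat.mul_le_mul hp (Polynomial.natDegree_linear_le)).trans (by omega)), fun x hx => ?_⟩
        have h4 : (j : ℝ) + 1 ≤ 2 ^ N := by exact_mod_cast hj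
        have h5 := (mul_le_mul_of_nonneg_right h4 hpN.le).trans hM.le
        have h6 : -(meshSize N / 2) + x < 1 - meshSize N / 2 := by linarith [hx.2]
        simp only [h6, if_true]
        simp [add_comm]
      · refine ⟨r.comp (Polynomial.C 1 * Polynomial.X + Polynomial.C (-(meshSize N / 2))),
          Polynomial.natDegree_comp_le.trans
          ((Nat.mul_le_mul hr (Polynomial.natDegree_linear_le)).trans (by omega)), fun x hx => ?_⟩
        have h4 : (2 : ℝ) ^ N ≤ j := by exact_mod_cast not_lt.1 hj
        have h5 := hM.symm.le.trans (mul_le_mul_of_nonneg_right h4 hpN.le)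
        have h6 : ¬ -(meshSize N / 2) + x < 1 - meshSize N / 2 := by linarith [hx.1]
        simp only [h6, if_false]
        simp [add_comm]
    · ext x
      by_cases hx : x ∈ Ico (0 : ℝ) 1
      · rw [indicator_of_mem hx]
        split_ifs with h
        · exact h1 x ⟨hx.1, h⟩
        · exact h2 x ⟨not_lt.1 h, hx.2⟩
      · rw [indicator_of_notMem hx, h3 x hx]

/-- The representative in `[a, a + 1)` of a number modulo `ℤ`. -/
noncomputable def wrap1 (a x : ℝ) : ℝ := a + Int.fract (x - a)

lemma multiwavelet_comp_wrap (hl : l ≤ N) (hf : f ∈ multiwavelet k a l) :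
    (fun x => f (wrap1 a x)) ∈ linePer k N a := by
  obtain ⟨h1, -⟩ := multiwavelet_shift hl hf
  refine ⟨?_, fun x => ?_⟩
  · simpa [wrap1] using PW1.comp_fract h1
  · have : x + 1 - a = x - a + 1 := by ring
    simp only [wrap1, this, Int.fract_add_one]

/-! ### Admissible meshes -/

lemma isMesh_self (a : ℝ) : IsMesh a a where
  le := le_rfl
  le' := by linarith
  ratio := fun n x hx => by
    refine (rgt_sub_lft_le).trans ?_
    have hb := cellIdx_bounds hx.1 (n + 1)
    have hp := meshSize_pos (n + 1)
    have hM := two_pow_mul_meshSize (n + 1)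
    set j := cellIdx a (n + 1) x with hj
    have hj1 : j < 2 ^ (n + 1) := by
      by_contra hge
      have : (2 : ℝ) ^ (n + 1) ≤ j := by exact_mod_cast (not_lt.1 hge)
      nlinarith [hx.2, hb.1]
    have h4 : (j : ℝ) + 1 ≤ 2 ^ (n + 1) := by exact_mod_cast hj1
    have h5 := (mul_le_mul_of_nonneg_right h4 hp.le).trans hM.le
    have hj0 : (0 : ℝ) ≤ j * meshSize (n + 1) := by positivity
    have e1 : lft a a (n + 1) x = a + j * meshSize (n + 1) := max_eq_right (by linarith)
    have e2 : rgt a a (n + 1) x = a + (j + 1) * meshSize (n + 1) := min_eq_right (by linarith)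
    rw [e1, e2, meshSize_succ] at *
    linarith [meshSize_pos n]

/-- Clipped cells of level at most `N` keep at least half of their length, except for the last one, which
has length `h_N / 2` on all these levels; on finer levels both end points of the interval are grid
points. -/
lemma isMesh_clipped (N : ℕ) : IsMesh (-(meshSize N / 2)) 0 where
  le := by linarith [meshSize_pos N]
  le' := by linarith [meshSize_le_one N]
  ratio := fun n x hx => by
    have hpN := meshSize_pos N
    have hN1 := meshSize_le_one N
    set a := -(meshSize N / 2) with ha
    have hax : a ≤ x := by linarith [hx.1]
    have hb := cellIdx_bounds hax (n + 1)
    have hp := meshSize_pos (n + 1)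
    have hM := two_pow_mul_meshSize (n + 1)
    have hMn := two_pow_mul_meshSize n
    have hw : rgt a 0 n x - lft a 0 n x ≤ meshSize n := rgt_sub_lft_le
    have hs := meshSize_succ n
    set j := cellIdx a (n + 1) x with hj
    have eL : lft a 0 (n + 1) x = max 0 (a + j * meshSize (n + 1)) := rfl
    have eR : rgt a 0 (n + 1) x = min (0 + 1) (a + (j + 1) * meshSize (n + 1)) := rfl
    rcases Nat.lt_or_ge n N with hnN | hnN
    · have hle : meshSize N ≤ meshSize (n + 1) := by
        rw [← meshSize_mul_pow (show n + 1 ≤ N from hnN)]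
        have : (1 : ℝ) ≤ 2 ^ (N - (n + 1)) := one_le_pow₀ one_le_two
        nlinarith
      rcases Nat.lt_or_ge j (2 ^ (n + 1)) with hj1 | hj1
      · have h4 : (j : ℝ) + 1 ≤ 2 ^ (n + 1) := by exact_mod_cast hj1
        have h5 := (mul_le_mul_of_nonneg_right h4 hp.le).trans hM.le
        rw [eR, min_eq_right (by linarith)]
        rcases Nat.eq_zero_or_pos j with hj0 | hj0
        · rw [eL, hj0]
          simp only [Nat.cast_zero, zero_mul, add_zero, zero_add, one_mul]
          rw [max_eq_left (by linarith)]
          linarith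
        · have h6 : (1 : ℝ) ≤ j := by exact_mod_cast hj0
          have h7 := mul_le_mul_of_nonneg_right h6 hp.le
          rw [eL, max_eq_right (by linarith)]
          linarith
      · -- the last cell is cut at the same length on both levels
        have h4 : (2 : ℝ) ^ (n + 1) ≤ j := by exact_mod_cast hj1
        have h5 := hM.symm.le.trans (mul_le_mul_of_nonneg_right h4 hp.le)
        have hjn : 2 ^ n ≤ cellIdx a n x := by
          rw [cellIdx_succ, ← hj, Nat.le_div_iff_mul_le two_pos, ← pow_succ]
          exact hj1
        have h8 : (2 : ℝ) ^ n ≤ cellIdx a n x := by exact_mod_cast hjn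
        have h9 := hMn.symm.le.trans (mul_le_mul_of_nonneg_right h8 (meshSize_pos n).le)
        have k1 : 1 + a ≤ lft a 0 n x := le_trans (by linarith) (le_max_right _ _)
        have k2 : rgt a 0 n x ≤ 1 := (min_le_left _ _).trans (by linarith)
        have hjle : j ≤ 2 ^ (n + 1) := by
          by_contra hgt
          have : (2 : ℝ) ^ (n + 1) + 1 ≤ j := by exact_mod_cast not_le.1 hgt
          have := mul_le_mul_of_nonneg_right this hp.le
          rw [add_mul, hM] at this
          linarith [hb.1, hx.2]
        have hjeq : (j : ℝ) = 2 ^ (n + 1) := by exact_mod_cast le_antisymm hjle hj1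
        rw [eL, eR, hjeq, add_mul, hM, max_eq_right (by linarith), min_eq_left (by linarith)]
        linarith
    · -- here the end points of the interval belong to the grid
      have hz : meshSize N / 2 = 2 ^ (n - N) * meshSize (n + 1) := by
        have := meshSize_mul_pow (show N + 1 ≤ n + 1 by omega)
        rw [show n + 1 - (N + 1) = n - N by omega, meshSize_succ N] at this
        exact this.symm
      have hj2 : 2 ^ (n - N) ≤ j := by
        by_contra hlt
        have : (j : ℝ) + 1 ≤ 2 ^ (n - N) := by exact_mod_cast not_le.1 hlt
        have := mul_le_mul_of_nonneg_right this hp.le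
        linarith [hb.2, hx.1]
      have hj3 : j < 2 ^ (n + 1) + 2 ^ (n - N) := by
        by_contra hge
        have : (2 : ℝ) ^ (n + 1) + 2 ^ (n - N) ≤ j := by exact_mod_cast not_lt.1 hge
        have := mul_le_mul_of_nonneg_right this hp.le
        rw [add_mul, hM] at this
        linarith [hb.1, hx.2]
      have h2 : (2 : ℝ) ^ (n - N) ≤ j := by exact_mod_cast hj2
      have h3 : (j : ℝ) + 1 ≤ 2 ^ (n + 1) + 2 ^ (n - N) := by exact_mod_cast hj3
      have h2' := mul_le_mul_of_nonneg_right h2 hp.le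
      have h3' := mul_le_mul_of_nonneg_right h3 hp.le
      rw [add_mul (2 ^ (n + 1)), hM] at h3'
      rw [eL, eR, max_eq_right (by linarith), min_eq_right (by linarith)]
      linarith

end wavelet

/-! ### The multi-dimensional spaces -/

section spaces
variable {d k m n N l : ℕ} {a lo : ℝ} {S : Submodule ℝ (ℝ → ℝ)} {f : (Fin d → ℝ) → ℝ}

/-- The functions all of whose restrictions to coordinate lines lie in `S`. -/
def sliceSub (d : ℕ) (S : Submodule ℝ (ℝ → ℝ)) : Submodule ℝ ((Fin d → ℝ) → ℝ) where
  carrier := {f | ∀ x i, (fun s => f (Function.update x i s)) ∈ S}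
  add_mem' := fun hf hg x i => add_mem (hf x i) (hg x i)
  zero_mem' := fun _ _ => zero_mem S
  smul_mem' := fun c _ hf x i => Submodule.smul_mem S c (hf x i)

lemma tensorSpan_le_sliceSub : tensorSpan (fun _ : Fin d => (S : Set (ℝ → ℝ))) ≤ sliceSub d S := by
  classical
  refine Submodule.span_le.2 ?_
  rintro _ ⟨w, hw, rfl⟩ x i
  have : (fun s => ∏ j, w j (Function.update x i s j)) =
      (∏ j ∈ Finset.univ.erase i, w j (x j)) • w i := by
    ext s
    rw [← Finset.mul_prod_erase _ _ (Finset.mem_univ i), Function.update_self, Pi.smul_apply,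
      smul_eq_mul, mul_comm]
    congr 1
    exact Finset.prod_congr rfl fun j hj => by rw [Function.update_of_ne (Finset.ne_of_mem_erase hj)]
  change (fun s => ∏ j, w j (Function.update x i s j)) ∈ S
  rw [this]
  exact Submodule.smul_mem S _ (hw i)

/-- A function that vanishes on the cube, and whose restrictions to lines are determined by their values
on `[0, 1)`, vanishes: the coordinates are freed one after the other. -/
lemma eq_zero_of_mem_sliceSub (hS : ∀ f ∈ S, (∀ s ∈ Ico (0 : ℝ) 1, f s = 0) → f = 0)
    (hf : f ∈ sliceSub d S) (h : ∀ x ∈ box d 0, f x = 0) : f = 0 := by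
  classical
  have key : ∀ s : Finset (Fin d), ∀ x, (∀ i ∉ s, x i ∈ Ico (0 : ℝ) 1) → f x = 0 := by
    intro s
    induction s using Finset.induction_on with
    | empty => exact fun x hx => h x fun i _ => by simpa using hx i (by simp)
    | insert i s _ ih =>
      intro x hx
      have h1 := hS _ (hf x i) fun c hc => ih _ fun j hj => by
        by_cases hji : j = i
        · subst hji; rwa [Function.update_self]
        · rw [Function.update_of_ne hji]; exact hx j (by simp [hji, hj])
      have h2 := congrFun h1 (x i)
      simpa using h2
  ext x
  exact key Finset.univ x (by simp)

/-- The properties of the sparse spaces on which the analysis of the scheme is based. -/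
structure IsSchemeSpace (k N : ℕ) (V : Submodule ℝ ((Fin d → ℝ) → ℝ)) : Prop where
  le : V ≤ PW k (N + 1) d
  tail : ∀ f ∈ V, TailLe N f
  finite : FiniteDimensional ℝ V
  eq_zero : ∀ f ∈ V, (∀ x ∈ box d 0, f x = 0) → f = 0

lemma finiteDimensional_tensorSpan (b : Finset (ℝ → ℝ)) :
    FiniteDimensional ℝ (tensorSpan fun _ : Fin d => (b : Set (ℝ → ℝ))) := by
  classical
  refine FiniteDimensional.span_of_finite ℝ ((((Fintype.piFinset fun _ : Fin d => b).image
    fun w => fun x : Fin d → ℝ => ∏ i, w i (x i)).finite_toSet).subset ?_)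
  rintro _ ⟨w, hw, rfl⟩
  exact Finset.mem_coe.2 (Finset.mem_image_of_mem _ (Fintype.mem_piFinset.2 hw))

lemma IsLineSpace.isSchemeSpace (hS : IsLineSpace k N S) {V : Submodule ℝ ((Fin d → ℝ) → ℝ)}
    (hV : V ≤ tensorSpan fun _ => (S : Set (ℝ → ℝ))) : IsSchemeSpace k N V where
  le := hV.trans <| Submodule.span_le.2 <| by
    rintro _ ⟨w, hw, rfl⟩
    exact prod_mem_PW (fun i => hS.le (hw i)) fun i => hS.bdd _ (hw i)
  tail := fun _ hf x i => hS.tail _ (tensorSpan_le_sliceSub (hV hf) x i)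
  finite := by
    obtain ⟨b, hb⟩ := hS.finite
    have := finiteDimensional_tensorSpan (d := d) b
    refine Submodule.finiteDimensional_of_le (hV.trans (Submodule.span_le.2 ?_) : V ≤
      tensorSpan fun _ : Fin d => (b : Set (ℝ → ℝ)))
    rintro _ ⟨w, hw, rfl⟩
    exact tensor_mem_tensorSpan fun i => hb (hw i)
  eq_zero := fun _ hf => eq_zero_of_mem_sliceSub hS.eq_zero (tensorSpan_le_sliceSub (hV hf))

lemma sparseSpace_le {W : ℕ → Set (ℝ → ℝ)} (hW : ∀ l ≤ N, W l ⊆ S) :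
    sparseSpace W d N ≤ tensorSpan fun _ => (S : Set (ℝ → ℝ)) := by
  refine Submodule.span_mono ?_
  rintro _ ⟨l, hl, w, hw, rfl⟩
  exact ⟨w, fun i => hW (l i) ((Finset.single_le_sum (f := l) (fun _ _ => Nat.zero_le _)
    (Finset.mem_univ i)).trans hl) (hw i), rfl⟩

lemma primalDir_le (d k N : ℕ) :
    primalDir k d N ≤ tensorSpan fun _ => (lineDir k N 0 : Set (ℝ → ℝ)) :=
  sparseSpace_le fun _ hl _ hf => multiwavelet_mem_lineDir hl hf

lemma dualDir_le (d k N : ℕ) :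
    dualDir k d N ≤ tensorSpan fun _ => (lineDir k N (-(meshSize N / 2)) : Set (ℝ → ℝ)) :=
  sparseSpace_le fun _ hl _ hf => dualWavelet_mem_lineDir hl hf

lemma periodicSpace_le (d k N : ℕ) (a : ℝ) :
    periodicSpace k d N a ≤ tensorSpan fun _ => (linePer k N a : Set (ℝ → ℝ)) := by
  rw [periodicSpace, sparseSpace, Submodule.map_span]
  refine Submodule.span_mono ?_
  rintro _ ⟨_, ⟨l, hl, w, hw, rfl⟩, rfl⟩
  exact ⟨fun i x => w i (wrap1 a x), fun i => multiwavelet_comp_wrap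
    ((Finset.single_le_sum (f := l) (fun _ _ => Nat.zero_le _) (Finset.mem_univ i)).trans hl)
    (hw i), rfl⟩

/-- The functions of the space on one of the meshes are continuous across the interior faces of
the other one. -/
lemma faceCont_of_midpoint {J : Finset ℕ} {δ : ℝ} (hf : f ∈ sliceSub d S)
    (hS : ∀ g ∈ S, ∀ j ∈ J, Function.leftLim g (a + ((j : ℤ) + 1 / 2) * meshSize N) =
      g (a + ((j : ℤ) + 1 / 2) * meshSize N))
    (hδ : a + 1 / 2 * meshSize N = δ * meshSize N) : FaceCont N J δ f := by
  intro x i j hj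
  have h := hS _ (hf x i) j hj
  have e : a + ((j : ℤ) + 1 / 2) * meshSize N = (j + δ) * meshSize N := by
    push_cast; linear_combination hδ
  rwa [e] at h

lemma faceCont_primalDir (hf : f ∈ primalDir k d N) :
    FaceCont N (Finset.range (2 ^ N)) (1 / 2) f := by
  refine faceCont_of_midpoint (a := 0) (tensorSpan_le_sliceSub (primalDir_le d k N hf))
    (fun g hg j hj => ?_) (by ring)
  have hp := meshSize_pos N
  have h1 : (j : ℝ) + 1 ≤ 2 ^ N := by exact_mod_cast Finset.mem_range.1 hj
  have h2 := (mul_le_mul_of_nonneg_right h1 hp.le).trans (two_pow_mul_meshSize N).le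
  refine lineDir.leftLim_midpoint hg j ?_ ?_ <;> push_cast
  · positivity
  · nlinarith

lemma faceCont_dualDir (hf : f ∈ dualDir k d N) :
    FaceCont N (Finset.Ico 1 (2 ^ N)) 0 f := by
  refine faceCont_of_midpoint (a := -(meshSize N / 2)) (tensorSpan_le_sliceSub (dualDir_le d k N hf))
    (fun g hg j hj => ?_) (by ring)
  have hp := meshSize_pos N
  rw [Finset.mem_Ico] at hj
  have h0 : (1 : ℝ) ≤ j := by exact_mod_cast hj.1
  have h1 : (j : ℝ) < 2 ^ N := by exact_mod_cast hj.2
  have h2 := (mul_lt_mul_of_pos_right h1 hp).trans_le (two_pow_mul_meshSize N).le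
  refine lineDir.leftLim_midpoint hg j ?_ ?_ <;> push_cast <;> nlinarith

lemma faceCont_primalPer (hf : f ∈ primalPer k d N) :
    FaceCont N (Finset.range (2 ^ N)) (1 / 2) f :=
  faceCont_of_midpoint (a := 0) (tensorSpan_le_sliceSub (periodicSpace_le d k N 0 hf))
    (fun _ hg j _ => linePer.leftLim_midpoint hg j) (by ring)

lemma faceCont_dualPer (hf : f ∈ dualPer k d N) :
    FaceCont N (Finset.range (2 ^ N)) 0 f :=
  faceCont_of_midpoint (tensorSpan_le_sliceSub (periodicSpace_le d k N _ hf))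
    (fun _ hg j _ => linePer.leftLim_midpoint hg j) (by ring)

lemma perTrace_of_mem (ha : IsOffset N a) (hf : f ∈ periodicSpace k d N a) : PerTrace f :=
  fun x i => linePer.leftLim_one (tensorSpan_le_sliceSub (periodicSpace_le d k N a hf) x i) ha

/-! ### The sparse quasi-interpolant and the parts of its error as discrete functions -/

lemma sparseInterp_mem (hm : IsMesh a lo) {W : ℕ → Set (ℝ → ℝ)}
    (hW : ∀ n ≤ N, cellPoly k a lo n ⊆ Submodule.span ℝ {f | ∃ m ≤ n, f ∈ W m})
    (hf : ContinuousOn f (cbox d lo)) : sparseInterp k a lo N f ∈ sparseSpace W d N := by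
  refine Submodule.sum_mem _ fun l hl => ?_
  have hl := (Finset.mem_filter.1 hl).2
  have hle : (tensorSpan fun i : Fin d => {f | ∃ m ≤ l i, f ∈ W m}) ≤ sparseSpace W d N := by
    refine Submodule.span_mono ?_
    rintro _ ⟨v, hv, rfl⟩
    choose m hm hv using hv
    exact ⟨m, le_trans (Finset.sum_le_sum fun i _ => hm i) hl, v, hv, rfl⟩
  refine (Submodule.span_le.2 ?_ : tensorSpan (fun i => cellPoly k a lo (l i)) ≤ _)
    (incr_mem_tensorSpan hm l hf)
  rintro _ ⟨w, hw, rfl⟩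
  refine hle (tensor_mem_tensorSpan fun i => hW (l i) (le_trans ?_ hl) (hw i))
  exact Finset.single_le_sum (f := l) (fun _ _ => Nat.zero_le _) (Finset.mem_univ i)

lemma indicator_grid_mem_PW1 {p : ℝ[X]} (hp : p.natDegree ≤ k) (y z : ℤ) :
    (Ico (y * meshSize m) (z * meshSize m)).indicator (fun x => p.eval x) ∈ PW1 k m := by
  have hp0 := meshSize_pos m
  intro j
  by_cases hj : y ≤ j ∧ j < z
  · refine ⟨p, hp, fun x hx => ?_⟩
    refine indicator_of_mem (mem_Ico.2 ⟨?_, ?_⟩) _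
    · have : (y : ℝ) ≤ j := by exact_mod_cast hj.1
      exact (mul_le_mul_of_nonneg_right this hp0.le).trans hx.1
    · have : (j : ℝ) + 1 ≤ z := by exact_mod_cast hj.2
      exact hx.2.trans_le (mul_le_mul_of_nonneg_right this hp0.le)
  · refine ⟨0, by simp, fun x hx => ?_⟩
    rw [Polynomial.eval_zero]
    refine indicator_of_notMem (fun h => hj ⟨?_, ?_⟩) _
    · have := lt_of_mul_lt_mul_right (h.1.trans_lt hx.2) hp0.le
      exact Int.lt_add_one_iff.1 (by exact_mod_cast this)
    · have := lt_of_mul_lt_mul_right (hx.1.trans_lt h.2) hp0.le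
      exact_mod_cast this

lemma bdd_indicator_Ico (p : ℝ[X]) (b c : ℝ) :
    ∃ C : ℝ, ∀ x, |(Ico b c).indicator (fun x => p.eval x) x| ≤ C := by
  obtain ⟨C, hC⟩ := (isCompact_Icc (a := b) (b := c)).exists_bound_of_continuousOn
    (f := fun x => p.eval x) (by fun_prop)
  refine ⟨max C 0, fun x => ?_⟩
  by_cases hx : x ∈ Ico b c
  · rw [indicator_of_mem hx]; exact (hC x (Ico_subset_Icc_self hx)).trans (le_max_left _ _)
  · rw [indicator_of_notMem hx]; simp

lemma cellPoly_subset_PW1 (ha : IsOffset N a) (hlo : IsOffset N lo) (hm : N + 1 ≤ m) (hn : n ≤ m)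
    {g : ℝ → ℝ} (hg : g ∈ cellPoly k a lo n) : g ∈ PW1 k m ∧ ∃ C : ℝ, ∀ x, |g x| ≤ C := by
  obtain ⟨n', hn', j, p, hp, rfl⟩ := hg
  refine ⟨?_, bdd_indicator_Ico p _ _⟩
  obtain ⟨z, hz⟩ := ha.exists_int_of_le hm
  obtain ⟨y, hy⟩ := hlo.exists_int_of_le hm
  have h1 : (1 : ℝ) = ((2 ^ m : ℕ) : ℤ) * meshSize m := by
    push_cast; exact (two_pow_mul_meshSize m).symm
  have h2 : meshSize n' = ((2 ^ (m - n') : ℕ) : ℤ) * meshSize m := by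
    push_cast; exact (meshSize_mul_pow (hn'.trans hn)).symm
  have hp0 := (meshSize_pos m).le
  have eL : cellL a lo n' j = (max y (z + j * (2 ^ (m - n') : ℕ)) : ℤ) * meshSize m := by
    push_cast
    rw [cellL, max_mul_of_nonneg _ _ hp0, ← hy]
    congr 1
    rw [h2, hz]; push_cast; ring
  have eR : cellR a lo n' j =
      (min (y + (2 ^ m : ℕ)) (z + (j + 1) * (2 ^ (m - n') : ℕ)) : ℤ) * meshSize m := by
    push_cast
    rw [cellR, min_mul_of_nonneg _ _ hp0, hy, h2, hz]
    congr 1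
    · rw [add_mul, two_pow_mul_meshSize]
    · push_cast; ring
  rw [eL, eR]
  exact indicator_grid_mem_PW1 hp _ _

lemma PW1.comp_wrap {g : ℝ → ℝ} (ha : IsOffset N a) (hm : N + 1 ≤ m) (hg : g ∈ PW1 k m) :
    (fun x => g (wrap1 a x)) ∈ PW1 k m := by
  obtain ⟨z, hz⟩ := ha.exists_int_of_le hm
  have h := PW1.translate (PW1.comp_fract (PW1.translate hg z)) (-z)
  convert h using 2 with x
  rw [wrap1, hz]; push_cast; ring_nf

lemma tensorSpan_cellPoly_le (ha : IsOffset N a) (hlo : IsOffset N lo) (hn : N ≤ n) {l : Fin d → ℕ}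
    (hl : ∀ i, l i ≤ n) (hf : f ∈ tensorSpan fun i => cellPoly k a lo (l i)) :
    f ∈ PW k (n + 1) d ∧ (fun x => f (wrap a x)) ∈ PW k (n + 1) d := by
  have h : ∀ i, ∀ g ∈ cellPoly k a lo (l i), g ∈ PW1 k (n + 1) ∧ ∃ C : ℝ, ∀ x, |g x| ≤ C :=
    fun i g hg => cellPoly_subset_PW1 ha hlo (by omega) ((hl i).trans (Nat.le_succ n)) hg
  constructor
  · refine (Submodule.span_le.2 ?_ : _ ≤ PW k (n + 1) d) hf
    rintro _ ⟨w, hw, rfl⟩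
    exact prod_mem_PW (fun i => (h i _ (hw i)).1) fun i => (h i _ (hw i)).2
  · refine (Submodule.span_le.2 ?_ : _ ≤ (PW k (n + 1) d).comap (LinearMap.funLeft ℝ ℝ (wrap a))) hf
    rintro _ ⟨w, hw, rfl⟩
    exact prod_mem_PW (w := fun i x => w i (wrap1 a x))
      (fun i => PW1.comp_wrap ha (by omega) (h i _ (hw i)).1)
      fun i => (h i _ (hw i)).2.imp fun C hC x => hC _

lemma sparseRes_mem_PW (hm : IsMesh a lo) (ha : IsOffset N a) (hlo : IsOffset N lo) (hN : 1 ≤ N)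
    (hn : N ≤ n) (hf : ContinuousOn f (cbox d lo)) : sparseRes k a lo N n f ∈ PW k (n + 1) d ∧
      (fun x => sparseRes k a lo N n f (wrap a x)) ∈ PW k (n + 1) d := by
  have h : ∀ l ∈ resLevels d N n, incr k a lo l f ∈ PW k (n + 1) d ∧
      (fun x => incr k a lo l f (wrap a x)) ∈ PW k (n + 1) d := fun l hl =>
    tensorSpan_cellPoly_le ha hlo hn (resLevels_spec hn hl hN).1 (incr_mem_tensorSpan hm l hf)
  refine ⟨Submodule.sum_mem _ fun l hl => (h l hl).1, ?_⟩
  have := Submodule.sum_mem _ fun l hl => (h l hl).2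
  convert this using 1
  ext x
  simp [sparseRes, Finset.sum_apply]

lemma measurable_incr (hm : IsMesh a lo) (ha : IsOffset N a) (hlo : IsOffset N lo)
    (hf : ContinuousOn f (cbox d lo)) (l : Fin d → ℕ) : Measurable (incr k a lo l f) :=
  PW.measurable (tensorSpan_cellPoly_le ha hlo (n := N + ∑ i, l i) (by omega) (fun i =>
    (Finset.single_le_sum (f := l) (fun _ _ => Nat.zero_le _) (Finset.mem_univ i)).trans (by omega))
    (incr_mem_tensorSpan hm l hf)).1

end spaces

/-! ### Consequences of multilevel approximation -/

/-- `u` is the uniform limit on the cube of a function of `V` plus parts of level `n ≥ N` which are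
small in `L²` and are piecewise polynomials on a mesh of size `2^{-(n+1)}`. -/
def MultilevelApprox {d : ℕ} (k q N : ℕ) (V : Submodule ℝ ((Fin d → ℝ) → ℝ)) (M : ℝ)
    (u : (Fin d → ℝ) → ℝ) : Prop :=
  ∃ w ∈ V, ∀ ε > 0, ∃ m, ∃ r : ℕ → (Fin d → ℝ) → ℝ,
    (∀ n ∈ Finset.Icc N m, r n ∈ PW k (n + 1) d ∧
      nrm (r n) ≤ ((n : ℝ) + 1) ^ d * meshSize n ^ (q + 1) * M) ∧
    ∀ x ∈ box d 0, |(u - w - ∑ n ∈ Finset.Icc N m, r n) x| ≤ ε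

/-- The constant in the sum of the errors of all levels. -/
noncomputable def levelConst (d : ℕ) : ℝ := ∑' j : ℕ, ((j : ℝ) + 2) ^ d * (1 / 2) ^ j

lemma summable_levelConst (d : ℕ) : Summable fun j : ℕ => ((j : ℝ) + 2) ^ d * (1 / 2 : ℝ) ^ j := by
  have h := summable_pow_mul_geometric_of_norm_lt_one d (r := (1 / 2 : ℝ)) (by norm_num)
  have h2 := ((summable_nat_add_iff 2).2 h).mul_left 4
  refine h2.congr fun j => ?_
  push_cast
  rw [pow_add]; ring

lemma levelConst_pos (d : ℕ) : 0 < levelConst d :=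
  (summable_levelConst d).tsum_pos (fun j => by positivity) 0 (by positivity)

/-- Uses `n + 1 ≤ N (n - N + 2)`, so that the polynomial growth costs only the factor `N ^ d`. -/
lemma sum_level_le (d : ℕ) {N q : ℕ} (m : ℕ) (hN : 1 ≤ N) (hq : 1 ≤ q) :
    ∑ n ∈ Finset.Icc N m, ((n : ℝ) + 1) ^ d * meshSize n ^ q ≤
      levelConst d * (N : ℝ) ^ d * meshSize N ^ q := by
  have hN' : (1 : ℝ) ≤ N := by exact_mod_cast hN
  have hterm : ∀ n ∈ Finset.Icc N m, ((n : ℝ) + 1) ^ d * meshSize n ^ q ≤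
      (N : ℝ) ^ d * meshSize N ^ q * ((((n - N : ℕ) : ℝ) + 2) ^ d * (1 / 2) ^ (n - N)) := by
    intro n hn
    have hn := (Finset.mem_Icc.1 hn).1
    obtain ⟨j, rfl⟩ := Nat.exists_eq_add_of_le hn
    rw [Nat.add_sub_cancel_left]
    push_cast
    have h1 : (N : ℝ) + j + 1 ≤ N * (j + 2) := by
      have : (0 : ℝ) ≤ j := by positivity
      nlinarith
    have h2 : meshSize (N + j) ^ q ≤ meshSize N ^ q * (1 / 2) ^ j := by
      have e : meshSize (N + j) = meshSize N * (1 / 2) ^ j := by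
        unfold meshSize; rw [pow_add, mul_inv, one_div, inv_pow]
      rw [e, mul_pow]
      have hp := meshSize_pos N
      refine mul_le_mul_of_nonneg_left ?_ (by positivity)
      exact pow_le_of_le_one (by positivity) (pow_le_one₀ (by norm_num) (by norm_num)) (by omega)
    have hp := meshSize_pos (N + j)
    calc ((N : ℝ) + j + 1) ^ d * meshSize (N + j) ^ q
        ≤ (N * (j + 2)) ^ d * (meshSize N ^ q * (1 / 2) ^ j) := by gcongr
      _ = _ := by rw [mul_pow]; ring
  refine (Finset.sum_le_sum hterm).trans ?_
  rw [← Finset.mul_sum]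
  have hle : ∑ n ∈ Finset.Icc N m, ((((n - N : ℕ) : ℝ) + 2) ^ d * (1 / 2 : ℝ) ^ (n - N)) ≤
      levelConst d := by
    rw [← Finset.sum_image (f := fun j : ℕ => ((j : ℝ) + 2) ^ d * (1 / 2 : ℝ) ^ j)
      (g := fun n => n - N)]
    · exact (summable_levelConst d).sum_le_tsum _ fun j _ => by positivity
    · intro a ha b hb h
      have := (Finset.mem_Icc.1 (Finset.mem_coe.1 ha)).1
      have := (Finset.mem_Icc.1 (Finset.mem_coe.1 hb)).1
      simp only at h
      omega
  have hp := meshSize_pos N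
  calc _ ≤ (N : ℝ) ^ d * meshSize N ^ q * levelConst d := by gcongr
    _ = _ := by ring

section consequences
variable {d k q N : ℕ} {V : Submodule ℝ ((Fin d → ℝ) → ℝ)} {M : ℝ} {u w : (Fin d → ℝ) → ℝ}

/-- Common assumptions on the data of a flux form. -/
structure IsFluxData (θ : ℝ) (N : ℕ) (J : Finset ℕ) (δ : ℝ) (A : (Fin d → ℝ) → Fin d → ℝ)
    (K : ℝ) : Prop where
  cont : ∀ i, ContinuousOn (fun x => A x i) (unitCube d)
  bound : ∀ x ∈ unitCube d, ∀ i, |A x i| ≤ K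
  nonneg : 0 ≤ K
  faces : J ⊆ Finset.range (2 ^ N)
  offset : δ = 0 ∨ δ = 1 / 2
  theta : θ = 0 ∨ θ = 1

variable {θ δ K : ℝ} {J : Finset ℕ} {A : (Fin d → ℝ) → Fin d → ℝ} {f g φ : (Fin d → ℝ) → ℝ} {m : ℕ}

lemma IsFluxData.add (h : IsFluxData θ N J δ A K) (hf : f ∈ Adm d) (hg : g ∈ Adm d)
    (hφ : φ ∈ PW k m d) : hflux θ N J δ A (f + g) φ = hflux θ N J δ A f φ + hflux θ N J δ A g φ := by
  have := hflux_sub h.cont (add_mem hf hg) hg hφ h.faces h.offset θ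
  rw [add_sub_cancel_right] at this
  linarith

lemma IsFluxData.abs_sum_le (h : IsFluxData θ N J δ A K) {ι : Type*} (s : Finset ι)
    {r : ι → (Fin d → ℝ) → ℝ} (hr : ∀ i ∈ s, r i ∈ Adm d) (hφ : φ ∈ PW k m d) :
    |hflux θ N J δ A (∑ i ∈ s, r i) φ| ≤ ∑ i ∈ s, |hflux θ N J δ A (r i) φ| := by
  classical
  induction s using Finset.induction_on with
  | empty =>
    have := hflux_sub h.cont (zero_mem (Adm d)) (zero_mem (Adm d)) hφ h.faces h.offset θ
    simp only [sub_self] at this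
    simp [this]
  | insert i s hi ih =>
    have hr' : ∀ j ∈ s, r j ∈ Adm d := fun j hj => hr j (Finset.mem_insert_of_mem hj)
    rw [Finset.sum_insert hi, Finset.sum_insert hi,
      h.add (hr i (Finset.mem_insert_self _ _)) (Submodule.sum_mem _ hr') hφ]
    exact (abs_add_le _ _).trans (add_le_add le_rfl (ih hr'))

/-- The constant in the bounds for flux forms of piecewise polynomials. -/
noncomputable def fluxConst (d k : ℕ) (K : ℝ) : ℝ := d * (4 * K * (1 + 3 * invConst k))

lemma fluxConst_nonneg (d k : ℕ) (hK : 0 ≤ K) : 0 ≤ fluxConst d k K := by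
  have := invConst_pos k
  unfold fluxConst; positivity

lemma IsFluxData.abs_le (h : IsFluxData θ N J δ A K) (hf : f ∈ PW k m d) (hm : N + 1 ≤ m)
    (hφ : φ ∈ PW k (N + 1) d) (ht : TailLe N φ) :
    |hflux θ N J δ A f φ| ≤ fluxConst d k K * 2 ^ m * nrm f * nrm φ := by
  refine (abs_hflux_le_of_PW h.cont h.bound h.nonneg hf hm hφ ht h.faces h.offset h.theta).trans_eq ?_
  rw [fluxConst]; ring

/-- Approximation error in `L²` and in the flux form. The inverse estimate is applied to each level
separately; the uniformly small remainder is negligible. -/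
lemma MultilevelApprox.exists_bounds (hN : 1 ≤ N) (hq : 1 ≤ q) (hM : 0 ≤ M) (hV : V ≤ PW k (N + 1) d)
    (hu : u ∈ Adm d) (happ : MultilevelApprox k q N V M u) :
    ∃ w ∈ V, nrm (u - w) ≤ levelConst d * (N : ℝ) ^ d * meshSize N ^ (q + 1) * M ∧
      ∀ θ J δ A K φ, IsFluxData θ N J δ A K → φ ∈ PW k (N + 1) d → TailLe N φ →
        |hflux θ N J δ A (u - w) φ| ≤
          2 * fluxConst d k K * (levelConst d * (N : ℝ) ^ d * meshSize N ^ q * M) * nrm φ := by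
  obtain ⟨w, hw, happ⟩ := happ
  have hwA : w ∈ Adm d := PW_le_Adm _ _ _ (hV hw)
  have hsmall : ∀ f ∈ Adm d, ∀ ε : ℝ, 0 ≤ ε → (∀ x ∈ box d 0, |f x| ≤ ε) → nrm f ≤ ε := by
    intro f _ ε hε hb
    exact nrm_le_of_abs_le hε ((ae_mem_box d).mono fun x hx => hb x hx)
  refine ⟨w, hw, le_of_forall_pos_le_add fun ε hε => ?_, fun θ J δ A K φ hD hφ ht => ?_⟩
  · obtain ⟨m, r, hr, hε'⟩ := happ ε hε
    have hrA : ∀ n ∈ Finset.Icc N m, r n ∈ Adm d := fun n hn => PW_le_Adm _ _ _ (hr n hn).1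
    have hsA := Submodule.sum_mem _ hrA
    have hrem := sub_mem (sub_mem hu hwA) hsA
    have e : u - w = (∑ n ∈ Finset.Icc N m, r n) + (u - w - ∑ n ∈ Finset.Icc N m, r n) := by abel
    rw [e]
    refine (nrm_add_le (Adm_le_BM d hsA) (Adm_le_BM d hrem)).trans
      (add_le_add ?_ (hsmall _ hrem ε hε.le hε'))
    refine (nrm_sum_le _ fun n hn => Adm_le_BM d (hrA n hn)).trans
      ((Finset.sum_le_sum fun n hn => (hr n hn).2).trans ?_)
    rw [← Finset.sum_mul]
    exact mul_le_mul_of_nonneg_right (sum_level_le d m hN (by omega)) hM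
  · set c := d * (K * (2 * 2 ^ N) * (4 * Real.sqrt (invConst k * 2 ^ N) * nrm φ)) with hc
    have hφ0 := nrm_nonneg φ
    have hK := hD.nonneg
    have hF := fluxConst_nonneg d k hK
    have hc0 : 0 ≤ c := by positivity
    refine le_of_forall_pos_le_add fun ε hε => ?_
    -- `c` is the factor in the bound for small flux functions; it may vanish
    obtain ⟨m, r, hr, hε'⟩ := happ (ε / (c + 1)) (by positivity)
    have hrA : ∀ n ∈ Finset.Icc N m, r n ∈ Adm d := fun n hn => PW_le_Adm _ _ _ (hr n hn).1
    have hsA := Submodule.sum_mem _ hrA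
    have hrem := sub_mem (sub_mem hu hwA) hsA
    have e : u - w = (∑ n ∈ Finset.Icc N m, r n) + (u - w - ∑ n ∈ Finset.Icc N m, r n) := by abel
    rw [e, hD.add hsA hrem hφ]
    refine (abs_add_le _ _).trans (add_le_add ?_ ?_)
    · refine (hD.abs_sum_le _ hrA hφ).trans ?_
      have : ∀ n ∈ Finset.Icc N m, |hflux θ N J δ A (r n) φ| ≤
          (((n : ℝ) + 1) ^ d * meshSize n ^ q) * (2 * fluxConst d k K * M * nrm φ) := by
        intro n hn
        have h1 := hD.abs_le (hr n hn).1 (by have := (Finset.mem_Icc.1 hn).1; omega) hφ ht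
        -- the inverse estimate costs one power of the mesh size
        have e2 : (2 : ℝ) ^ (n + 1) * meshSize n ^ (q + 1) = 2 * meshSize n ^ q := by
          rw [pow_succ, pow_succ, ← mul_one (2 * meshSize n ^ q), ← two_pow_mul_meshSize n]; ring
        calc _ ≤ fluxConst d k K * 2 ^ (n + 1) *
              (((n : ℝ) + 1) ^ d * meshSize n ^ (q + 1) * M) * nrm φ := by
              refine h1.trans ?_
              have := (hr n hn).2
              gcongr
          _ = fluxConst d k K * (2 ^ (n + 1) * meshSize n ^ (q + 1)) *
              (((n : ℝ) + 1) ^ d * M) * nrm φ := by ring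
          _ = _ := by rw [e2]; ring
      refine (Finset.sum_le_sum this).trans ?_
      rw [← Finset.sum_mul]
      calc _ ≤ levelConst d * (N : ℝ) ^ d * meshSize N ^ q * (2 * fluxConst d k K * M * nrm φ) := by
            gcongr
            exact sum_level_le d m hN hq
        _ = _ := by ring
    · refine (abs_hflux_le_of_small hD.cont hD.bound hK hrem hε' (by positivity) hφ ht hD.faces
        hD.offset hD.theta).trans ?_
      calc _ = c * (ε / (c + 1)) := by rw [hc]; ring
        _ ≤ ε := by
          rw [mul_div_assoc', div_le_iff₀ (by positivity)]
          nlinarith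

/-- Errors of the `L²` projection, by best approximation. -/
lemma MultilevelApprox.proj_bounds (hN : 1 ≤ N) (hq : 1 ≤ q) (hM : 0 ≤ M)
    (hV : V ≤ PW k (N + 1) d) (hu : u ∈ Adm d) (happ : MultilevelApprox k q N V M u)
    {P : (Fin d → ℝ) → ℝ} (hP : IsL2Proj V u P) :
    nrm (u - P) ≤ levelConst d * (N : ℝ) ^ d * meshSize N ^ (q + 1) * M ∧
      ∀ θ J δ A K φ, IsFluxData θ N J δ A K → φ ∈ PW k (N + 1) d → TailLe N φ →
        |hflux θ N J δ A (u - P) φ| ≤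
          4 * fluxConst d k K * (levelConst d * (N : ℝ) ^ d * meshSize N ^ q * M) * nrm φ := by
  obtain ⟨w, hw, h1, h2⟩ := happ.exists_bounds hN hq hM hV hu
  have hPA : P ∈ Adm d := PW_le_Adm _ _ _ (hV hP.1)
  have hwA : w ∈ Adm d := PW_le_Adm _ _ _ (hV hw)
  -- Pythagoras: `u - P` is orthogonal to `P - w`
  have hpyth : nrm (u - w) ^ 2 = nrm (u - P) ^ 2 + nrm (P - w) ^ 2 := by
    have i1 := Adm_le_BM d (sub_mem hu hPA)
    have i2 := Adm_le_BM d (sub_mem hPA hwA)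
    have horth := hP.2 (P - w) (sub_mem hP.1 hw)
    have j1 := BM.integrable (BM.mul i1 i1)
    have j2 := BM.integrable (BM.mul i2 i2)
    have j3 := BM.integrable (BM.mul (neg_mem i1) i2)
    have e3 : ∫ x in unitCube d, (-(u - P)) x * (P - w) x = 0 := by
      rw [← horth]
      refine integral_congr_ae (Eventually.of_forall fun x => ?_)
      simp
    rw [nrm_sq, nrm_sq, nrm_sq, ← integral_add (by simpa [sq] using j1) (by simpa [sq] using j2)]
    have e4 : ∫ x in unitCube d, (u - w) x ^ 2 =
        (∫ x in unitCube d, ((u - P) x ^ 2 + (P - w) x ^ 2)) -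
          2 * ∫ x in unitCube d, (-(u - P)) x * (P - w) x := by
      rw [← integral_const_mul]
      refine Eq.trans ?_ (integral_sub ((j1.add j2).congr
        (Eventually.of_forall fun x => by simp [sq])) (j3.const_mul 2))
      refine integral_congr_ae (Eventually.of_forall fun x => ?_)
      simp only [Pi.sub_apply, Pi.neg_apply]
      ring
    rw [e4, e3]; ring
  have hb1 : nrm (u - P) ≤ nrm (u - w) := by
    refine le_of_sq_le_sq ?_ (nrm_nonneg _)
    nlinarith [sq_nonneg (nrm (P - w))]
  have hb2 : nrm (P - w) ≤ nrm (u - w) := by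
    refine le_of_sq_le_sq ?_ (nrm_nonneg _)
    nlinarith [sq_nonneg (nrm (u - P))]
  refine ⟨hb1.trans h1, fun θ J δ A K φ hD hφ ht => ?_⟩
  -- the discrete part `P - w` is covered by the inverse estimate of level `N + 1`
  have e : u - P = (u - w) - (P - w) := by abel
  have hF := fluxConst_nonneg d k hD.nonneg
  have hφ0 := nrm_nonneg φ
  rw [e, hflux_sub hD.cont (sub_mem hu hwA) (sub_mem hPA hwA) hφ hD.faces hD.offset θ]
  refine (abs_sub _ _).trans ?_
  have h3 := hD.abs_le (hV (sub_mem hP.1 hw)) le_rfl hφ ht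
  have h4 := h2 θ J δ A K φ hD hφ ht
  have h5 : fluxConst d k K * 2 ^ (N + 1) * nrm (P - w) * nrm φ ≤
      2 * fluxConst d k K * (levelConst d * (N : ℝ) ^ d * meshSize N ^ q * M) * nrm φ := by
    calc _ ≤ fluxConst d k K * 2 ^ (N + 1) *
          (levelConst d * (N : ℝ) ^ d * meshSize N ^ (q + 1) * M) * nrm φ := by
          have := hb2.trans h1
          gcongr
      _ = 2 * fluxConst d k K * (levelConst d * (N : ℝ) ^ d *
          (2 ^ N * meshSize N * meshSize N ^ q) * M) * nrm φ := by ring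
      _ = _ := by rw [two_pow_mul_meshSize, one_mul]
  linarith

end consequences

/-! ### Differentiation in time -/

/-- On a finite-dimensional space of functions every linear functional is a combination of point
evaluations. -/
lemma exists_eq_sum_eval {X : Type*} (V : Submodule ℝ (X → ℝ)) [FiniteDimensional ℝ V]
    (ℓ : V →ₗ[ℝ] ℝ) : ∃ c : X →₀ ℝ, ∀ v : V, ℓ v = c.sum fun x a => a * v.1 x := by
  let ev : X → Module.Dual ℝ V := fun x => (LinearMap.proj x).comp V.subtype
  -- the evaluations separate the functions, so they span the dual space
  have htop : Submodule.span ℝ (range ev) = ⊤ := by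
    rw [← Subspace.dualCoannihilator_dualAnnihilator_eq (W := Submodule.span ℝ (range ev))]
    have : (Submodule.span ℝ (range ev)).dualCoannihilator = ⊥ := by
      refine (Submodule.eq_bot_iff _).2 fun v hv => ?_
      rw [Submodule.mem_dualCoannihilator] at hv
      ext x
      exact hv (ev x) (Submodule.subset_span ⟨x, rfl⟩)
    rw [this, Submodule.dualAnnihilator_bot]
  have hℓ : ℓ ∈ Submodule.span ℝ (range ev) := htop ▸ Submodule.mem_top
  obtain ⟨c, hc⟩ := Finsupp.mem_span_range_iff_exists_finsupp.1 hℓ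
  refine ⟨c, fun v => ?_⟩
  rw [← hc, Finsupp.sum, Finsupp.sum, LinearMap.sum_apply]
  rfl

section time
variable {d k N : ℕ} {V : Submodule ℝ ((Fin d → ℝ) → ℝ)} {T t : ℝ} {u uh : ℝ → (Fin d → ℝ) → ℝ}
  {φ : (Fin d → ℝ) → ℝ}

lemma IsSchemeSpace.exists_orthonormal (hV : IsSchemeSpace k N V) :
    ∃ (n : ℕ) (e : Fin n → (Fin d → ℝ) → ℝ), (∀ i, e i ∈ V) ∧
      (∀ i j, ∫ x in unitCube d, e i x * e j x = if i = j then 1 else 0) ∧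
      ∀ f ∈ V, f = ∑ i, (∫ x in unitCube d, f x * e i x) • e i := by
  have := hV.finite
  refine exists_orthonormal_system V (fun f hf g hg => BM.integrable (BM.mul
    (PW_le_BM _ _ _ (hV.le hf)) (PW_le_BM _ _ _ (hV.le hg)))) fun f hf h => ?_
  exact hV.eq_zero f hf fun x hx => PW.eq_zero_of_integral (hV.le hf) h hx

/-- A curve in the discrete space that is differentiable at every point of `ℝ^d` has its derivative in the
space and may be differentiated under the integral: integrals against a fixed function are finite
combinations of point values. -/
lemma IsSchemeSpace.hasDerivWithinAt_integral (hV : IsSchemeSpace k N V) (hT : 0 < T)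
    (huh : ∀ t ∈ Icc 0 T, uh t ∈ V)
    (hd : ∀ t ∈ Icc 0 T, ∀ x, DifferentiableWithinAt ℝ (fun s => uh s x) (Icc 0 T) t)
    (ht : t ∈ Icc 0 T) : timeDeriv T uh t ∈ V ∧ ∀ φ ∈ BM d,
      HasDerivWithinAt (fun s => ∫ x in unitCube d, uh s x * φ x)
        (∫ x in unitCube d, timeDeriv T uh t x * φ x) (Icc 0 T) t := by
  have := hV.finite
  have hpt : ∀ x, HasDerivWithinAt (fun s => uh s x) (timeDeriv T uh t x) (Icc 0 T) t :=
    fun x => (hd t ht x).hasDerivWithinAt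
  let ℓ : (φ : (Fin d → ℝ) → ℝ) → φ ∈ BM d → V →ₗ[ℝ] ℝ := fun φ hφ =>
    { toFun := fun v => ∫ x in unitCube d, v.1 x * φ x
      map_add' := fun v w => by
        refine Eq.trans ?_ (integral_add
          (BM.integrable (BM.mul (PW_le_BM _ _ _ (hV.le v.2)) hφ))
          (BM.integrable (BM.mul (PW_le_BM _ _ _ (hV.le w.2)) hφ)))
        refine integral_congr_ae (Eventually.of_forall fun x => ?_)
        simp [add_mul]
      map_smul' := fun c v => by
        rw [RingHom.id_apply, smul_eq_mul, ← integral_const_mul]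
        refine integral_congr_ae (Eventually.of_forall fun x => ?_)
        simp [mul_assoc] }
  have key : ∀ (φ : (Fin d → ℝ) → ℝ) (hφ : φ ∈ BM d), ∃ c : (Fin d → ℝ) →₀ ℝ,
      (∀ v : V, ∫ x in unitCube d, v.1 x * φ x = c.sum fun x a => a * v.1 x) ∧
      HasDerivWithinAt (fun s => ∫ x in unitCube d, uh s x * φ x)
        (c.sum fun x a => a * timeDeriv T uh t x) (Icc 0 T) t := by
    intro φ hφ
    obtain ⟨c, hc⟩ := exists_eq_sum_eval V (ℓ φ hφ)
    refine ⟨c, hc, ?_⟩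
    have h1 : HasDerivWithinAt (fun s => c.sum fun x a => a * uh s x)
        (c.sum fun x a => a * timeDeriv T uh t x) (Icc 0 T) t :=
      HasDerivWithinAt.fun_sum fun x _ => (hpt x).const_mul (c x)
    exact h1.congr (fun s hs => hc ⟨uh s, huh s hs⟩) (hc ⟨uh t, huh t ht⟩)
  have hmem : timeDeriv T uh t ∈ V := by
    obtain ⟨n, e, he, -, hrep⟩ := hV.exists_orthonormal
    choose c _ hc using fun i => key (e i) (PW_le_BM _ _ _ (hV.le (he i)))
    have : timeDeriv T uh t = ∑ i, ((c i).sum fun x a => a * timeDeriv T uh t x) • e i := by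
      ext x
      have h1 : HasDerivWithinAt (fun s => ∑ i, (∫ y in unitCube d, uh s y * e i y) * e i x)
          (∑ i, ((c i).sum fun x a => a * timeDeriv T uh t x) * e i x) (Icc 0 T) t :=
        HasDerivWithinAt.fun_sum fun i _ => (hc i).mul_const _
      have h2 : ∀ s ∈ Icc 0 T, uh s x = ∑ i, (∫ y in unitCube d, uh s y * e i y) * e i x := by
        intro s hs
        conv_lhs => rw [hrep _ (huh s hs)]
        simp [Finset.sum_apply]
      have h3 := (h1.congr h2 (h2 t ht)).derivWithin (uniqueDiffOn_Icc hT t ht)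
      rw [timeDeriv, h3]
      simp [Finset.sum_apply]
    rw [this]
    exact Submodule.sum_mem _ fun i _ => Submodule.smul_mem _ _ (he i)
  refine ⟨hmem, fun φ hφ => ?_⟩
  obtain ⟨c, hc, hder⟩ := key φ hφ
  rwa [← hc ⟨_, hmem⟩] at hder

/-- Differentiation under the integral sign for `C¹` functions on `[0,T] × Ω`. -/
lemma hasDerivAt_integral_mul (hT : 0 < T)
    (hu : ContDiffOn ℝ 1 (fun z : ℝ × (Fin d → ℝ) => u z.1 z.2) (Icc 0 T ×ˢ unitCube d))
    (hφ : φ ∈ BM d) :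
    ContinuousOn (fun t => ∫ x in unitCube d, u t x * φ x) (Icc 0 T) ∧
    ∀ t ∈ Ioo 0 T, (fun x => deriv (fun s => u s x) t) ∈ BM d ∧
      HasDerivAt (fun s => ∫ x in unitCube d, u s x * φ x)
        (∫ x in unitCube d, deriv (fun s => u s x) t * φ x) t := by
  set D : Set (ℝ × (Fin d → ℝ)) := Icc 0 T ×ˢ unitCube d with hD
  have hDc : IsCompact D := isCompact_Icc.prod isCompact_Icc
  have hDu : UniqueDiffOn ℝ D := (uniqueDiffOn_Icc hT).prod (uniqueDiffOn_unitCube d)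
  set G : ℝ × (Fin d → ℝ) → ℝ := fun z =>
    fderivWithin ℝ (fun z : ℝ × (Fin d → ℝ) => u z.1 z.2) D z (1, 0) with hG
  have hGc : ContinuousOn G D :=
    (hu.continuousOn_fderivWithin hDu le_rfl).clm_apply continuousOn_const
  obtain ⟨C, hC⟩ := hDc.exists_bound_of_continuousOn hGc
  obtain ⟨C', hC'⟩ := hDc.exists_bound_of_continuousOn hu.continuousOn
  have hslice : ∀ t ∈ Icc 0 T, ContinuousOn (u t) (unitCube d) := fun t ht =>
    hu.continuousOn.comp (f := fun x : Fin d → ℝ => (t, x)) (by fun_prop) fun x hx => ⟨ht, hx⟩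
  have hmeas : ∀ t ∈ Icc 0 T, AEStronglyMeasurable (fun x => u t x * φ x)
      (volume.restrict (unitCube d)) := fun t ht =>
    (BM.mul (BM.of_continuousOn (hslice t ht)) hφ).1
  have hint : Integrable (fun x => |C'| * |φ x|) (volume.restrict (unitCube d)) :=
    (BM.integrable hφ).abs.const_mul _
  have hder : ∀ t ∈ Ioo 0 T, ∀ x ∈ unitCube d, HasDerivAt (fun s => u s x) (G (t, x)) t := by
    intro t ht x hx
    have hz : (t, x) ∈ D := ⟨Ioo_subset_Icc_self ht, hx⟩
    have h1 := ((hu.differentiableOn (by norm_num)) _ hz).hasFDerivWithinAt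
    have h2 : HasDerivWithinAt (fun s : ℝ => (s, x)) ((1 : ℝ), (0 : Fin d → ℝ)) (Icc 0 T) t :=
      ((hasDerivAt_id t).prodMk (hasDerivAt_const t x)).hasDerivWithinAt
    have h3 := h1.comp_hasDerivWithinAt t h2
      (show MapsTo (fun s : ℝ => (s, x)) (Icc 0 T) D from fun s hs => ⟨hs, hx⟩)
    exact h3.hasDerivAt (Icc_mem_nhds ht.1 ht.2)
  refine ⟨fun t ht => ?_, fun t ht => ?_⟩
  · refine continuousWithinAt_of_dominated (bound := fun x => |C'| * |φ x|) ?_ ?_ hint ?_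
    · filter_upwards [self_mem_nhdsWithin] with s hs using hmeas s hs
    · filter_upwards [self_mem_nhdsWithin] with s hs
      filter_upwards [ae_restrict_mem (measurableSet_unitCube d)] with x hx
      rw [norm_mul]
      exact mul_le_mul ((hC' (s, x) ⟨hs, hx⟩).trans (le_abs_self _)) le_rfl (norm_nonneg _)
        (abs_nonneg _)
    · filter_upwards [ae_restrict_mem (measurableSet_unitCube d)] with x hx
      have h1 : ContinuousOn (fun s => u s x) (Icc 0 T) :=
        hu.continuousOn.comp (f := fun s : ℝ => (s, x)) (by fun_prop) fun s hs => ⟨hs, hx⟩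
      exact (h1 t ht).mul continuousWithinAt_const
  · have htI := Ioo_subset_Icc_self ht
    have hGt : (fun x => G (t, x)) ∈ BM d := BM.of_continuousOn
      (hGc.comp (f := fun x : Fin d → ℝ => (t, x)) (by fun_prop) fun x hx => ⟨htI, hx⟩)
    have hmem : (fun x => deriv (fun s => u s x) t) ∈ BM d := by
      refine BM.congr hGt ?_
      filter_upwards [ae_restrict_mem (measurableSet_unitCube d)] with x hx
      exact (hder t ht x hx).deriv.symm
    refine ⟨hmem, (hasDerivAt_integral_of_dominated_loc_of_deriv_le
      (F := fun s x => u s x * φ x) (F' := fun s x => deriv (fun s => u s x) s * φ x)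
      (bound := fun x => |C| * |φ x|) (s := Ioo 0 T)
      (Ioo_mem_nhds ht.1 ht.2) ?_ (BM.integrable (BM.mul (BM.of_continuousOn (hslice t htI)) hφ))
      (BM.mul hmem hφ).1 ?_ ((BM.integrable hφ).abs.const_mul _) ?_).2⟩
    · filter_upwards [Ioo_mem_nhds ht.1 ht.2] with s hs using hmeas s (Ioo_subset_Icc_self hs)
    · filter_upwards [ae_restrict_mem (measurableSet_unitCube d)] with x hx s hs
      rw [(hder s hs x hx).deriv, norm_mul]
      exact mul_le_mul ((hC (s, x) ⟨Ioo_subset_Icc_self hs, hx⟩).trans (le_abs_self _)) le_rfl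
        (norm_nonneg _) (abs_nonneg _)
    · filter_upwards [ae_restrict_mem (measurableSet_unitCube d)] with x hx s hs
      have := (hder s hs x hx).mul_const (φ x)
      rwa [← (hder s hs x hx).deriv] at this

lemma integral_mul_sum {n : ℕ} {e : Fin n → (Fin d → ℝ) → ℝ} {g : (Fin d → ℝ) → ℝ} (hg : g ∈ BM d)
    (he : ∀ i, e i ∈ BM d) (a : Fin n → ℝ) :
    ∫ x in unitCube d, g x * (∑ i, a i • e i) x = ∑ i, a i * ∫ x in unitCube d, g x * e i x := by
  simp only [← integral_const_mul]
  rw [← integral_finsetSum _ fun i _ => (BM.integrable (BM.mul hg (he i))).const_mul (a i)]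
  refine integral_congr_ae (Eventually.of_forall fun x => ?_)
  simp only [Finset.sum_apply, Pi.smul_apply, smul_eq_mul, Finset.mul_sum]
  exact Finset.sum_congr rfl fun i _ => by ring

/-- The difference `ξ` between the `L²` projection of a smooth function and a differentiable curve
in the discrete space, with the derivative of its energy. -/
lemma IsSchemeSpace.exists_error_curve (hV : IsSchemeSpace k N V) (hT : 0 < T)
    (hu : ContDiffOn ℝ 1 (fun z : ℝ × (Fin d → ℝ) => u z.1 z.2) (Icc 0 T ×ˢ unitCube d))
    (huh : ∀ t ∈ Icc 0 T, uh t ∈ V)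
    (hd : ∀ t ∈ Icc 0 T, ∀ x, DifferentiableWithinAt ℝ (fun s => uh s x) (Icc 0 T) t)
    (h0 : IsL2Proj V (u 0) (uh 0)) :
    ∃ ξ : ℝ → (Fin d → ℝ) → ℝ, (∀ t ∈ Icc 0 T, ξ t ∈ V ∧ IsL2Proj V (u t) (uh t + ξ t)) ∧
      ξ 0 = 0 ∧ ContinuousOn (fun t => nrm (ξ t) ^ 2) (Icc 0 T) ∧
      ∀ t ∈ Ioo 0 T, HasDerivAt (fun t => nrm (ξ t) ^ 2)
        (2 * ((∫ x in unitCube d, deriv (fun s => u s x) t * ξ t x) -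
          ∫ x in unitCube d, timeDeriv T uh t x * ξ t x)) t := by
  obtain ⟨n, e, he, heo, hrep⟩ := hV.exists_orthonormal
  have heB : ∀ i, e i ∈ BM d := fun i => PW_le_BM _ _ _ (hV.le (he i))
  have huB : ∀ t ∈ Icc 0 T, u t ∈ BM d := fun t ht => BM.of_continuousOn
    (hu.continuousOn.comp (f := fun x : Fin d → ℝ => (t, x)) (by fun_prop) fun x hx => ⟨ht, hx⟩)
  set a : Fin n → ℝ → ℝ := fun i t =>
    (∫ x in unitCube d, u t x * e i x) - ∫ x in unitCube d, uh t x * e i x with ha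
  set ξ : ℝ → (Fin d → ℝ) → ℝ := fun t => ∑ i, a i t • e i with hξ
  have hξV : ∀ t, ξ t ∈ V := fun t => Submodule.sum_mem _ fun i _ => Submodule.smul_mem _ _ (he i)
  have hξB : ∀ t, ξ t ∈ BM d := fun t => PW_le_BM _ _ _ (hV.le (hξV t))
  have hcoef : ∀ t i, ∫ x in unitCube d, ξ t x * e i x = a i t := by
    intro t i
    have h := integral_mul_sum (heB i) heB (fun i => a i t)
    simp only [heo, mul_ite, mul_one, mul_zero, Finset.sum_ite_eq, Finset.mem_univ, if_true] at h
    rw [← h]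
    exact integral_congr_ae (Eventually.of_forall fun x => mul_comm _ _)
  have hsq : ∀ t, nrm (ξ t) ^ 2 = ∑ i, a i t ^ 2 := by
    intro t
    have h := integral_mul_sum (hξB t) heB (fun i => a i t)
    simp only [hcoef, ← sq] at h
    rw [← h, nrm_sq]
    exact integral_congr_ae (Eventually.of_forall fun x => sq _)
  have hsub : ∀ t ∈ Icc 0 T, ∀ i, a i t = ∫ x in unitCube d, (u t - uh t) x * e i x := by
    intro t ht i
    refine (integral_sub (BM.integrable (BM.mul (huB t ht) (heB i)))
      (BM.integrable (BM.mul (PW_le_BM _ _ _ (hV.le (huh t ht))) (heB i)))).symm.trans ?_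
    refine integral_congr_ae (Eventually.of_forall fun x => ?_)
    simp only [Pi.sub_apply]; ring
  refine ⟨ξ, fun t ht => ⟨hξV t, add_mem (huh t ht) (hξV t), fun φ hφ => ?_⟩, ?_, ?_, ?_⟩
  · have hB : uh t + ξ t - u t ∈ BM d :=
      sub_mem (add_mem (PW_le_BM _ _ _ (hV.le (huh t ht))) (hξB t)) (huB t ht)
    rw [hrep φ hφ]
    refine (integral_mul_sum hB heB _).trans (Finset.sum_eq_zero fun i _ => ?_)
    have h1 : ∫ x in unitCube d, (uh t + ξ t - u t) x * e i x =
        (∫ x in unitCube d, ξ t x * e i x) - ∫ x in unitCube d, (u t - uh t) x * e i x := by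
      refine Eq.trans ?_ (integral_sub (BM.integrable (BM.mul (hξB t) (heB i)))
        (BM.integrable (BM.mul (sub_mem (huB t ht) (PW_le_BM _ _ _ (hV.le (huh t ht))))
          (heB i))))
      refine integral_congr_ae (Eventually.of_forall fun x => ?_)
      simp only [Pi.sub_apply, Pi.add_apply]; ring
    rw [h1, hcoef, ← hsub t ht, sub_self, mul_zero]
  · have h00 : (0 : ℝ) ∈ Icc 0 T := ⟨le_rfl, hT.le⟩
    refine Finset.sum_eq_zero fun i _ => ?_
    rw [hsub 0 h00]
    have h1 := h0.2 (e i) (he i)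
    have h2 : ∫ x in unitCube d, (u 0 - uh 0) x * e i x = 0 := by
      refine neg_eq_zero.1 (Eq.trans ?_ h1)
      rw [← integral_neg]
      refine integral_congr_ae (Eventually.of_forall fun x => ?_)
      simp only [Pi.sub_apply]; ring
    rw [h2, zero_smul]
  · simp only [hsq]
    refine continuousOn_finsetSum _ fun i _ => ContinuousOn.pow (ContinuousOn.sub
      (hasDerivAt_integral_mul hT hu (heB i)).1 fun t ht => ?_) 2
    exact ((hV.hasDerivWithinAt_integral hT huh hd ht).2 _ (heB i)).continuousWithinAt
  · intro t ht
    have htI := Ioo_subset_Icc_self ht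
    have hVt := hV.hasDerivWithinAt_integral hT huh hd htI
    simp only [hsq]
    have hder : ∀ i, HasDerivAt (a i) ((∫ x in unitCube d, deriv (fun s => u s x) t * e i x) -
        ∫ x in unitCube d, timeDeriv T uh t x * e i x) t := fun i =>
      (((hasDerivAt_integral_mul hT hu (heB i)).2 t ht).2).sub
        ((hVt.2 _ (heB i)).hasDerivAt (Icc_mem_nhds ht.1 ht.2))
    have hsum : HasDerivAt (fun t => ∑ i, a i t ^ 2) (∑ i, (2 : ℕ) * a i t ^ (2 - 1) *
        ((∫ x in unitCube d, deriv (fun s => u s x) t * e i x) -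
          ∫ x in unitCube d, timeDeriv T uh t x * e i x)) t :=
      HasDerivAt.fun_sum fun i _ => (hder i).pow 2
    convert hsum using 1
    have hdB := ((hasDerivAt_integral_mul hT hu (hξB t)).2 t ht).1
    rw [integral_mul_sum hdB heB (fun i => a i t),
      integral_mul_sum (PW_le_BM _ _ _ (hV.le hVt.1)) heB (fun i => a i t),
      ← Finset.sum_sub_distrib, Finset.mul_sum]
    refine Finset.sum_congr rfl fun i _ => ?_
    push_cast
    ring

end time

/-! ### The energy estimate -/

/-- Grönwall's inequality; the derivative is needed only in the open interval, where the differential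
equation is assumed. -/
lemma le_exp_of_deriv_le {E E' : ℝ → ℝ} {K B t : ℝ} (hK : 1 ≤ K) (hB : 0 ≤ B) (ht : 0 ≤ t)
    (hc : ContinuousOn E (Icc 0 t)) (hd : ∀ s ∈ Ioo 0 t, HasDerivAt E (E' s) s)
    (hle : ∀ s ∈ Ioo 0 t, E' s ≤ K * E s + B) (h0 : E 0 = 0) : E t ≤ B * Real.exp (K * t) := by
  have hK0 : 0 < K := by linarith
  set G : ℝ → ℝ := fun s => Real.exp (-(K * s)) * (E s + B / K) with hG
  have hder : ∀ s ∈ Ioo 0 t, HasDerivAt G (Real.exp (-(K * s)) * (-K) * (E s + B / K) +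
      Real.exp (-(K * s)) * E' s) s := by
    intro s hs
    have h1 : HasDerivAt (fun s : ℝ => -(K * s)) (-K) s := by
      simpa using ((hasDerivAt_id' s).const_mul K).fun_neg
    exact h1.exp.mul ((hd s hs).add_const _)
  have hanti : AntitoneOn G (Icc 0 t) := by
    refine antitoneOn_of_deriv_nonpos (convex_Icc 0 t) ?_ ?_ ?_
    · exact (Continuous.continuousOn (by fun_prop)).mul (hc.add continuousOn_const)
    · rw [interior_Icc]
      exact fun s hs => (hder s hs).differentiableAt.differentiableWithinAt
    · rw [interior_Icc]
      intro s hs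
      rw [(hder s hs).deriv]
      have e : Real.exp (-(K * s)) * (-K) * (E s + B / K) + Real.exp (-(K * s)) * E' s =
          Real.exp (-(K * s)) * (E' s - (K * E s + B)) := by field_simp; ring
      rw [e]
      exact mul_nonpos_of_nonneg_of_nonpos (Real.exp_pos _).le (by linarith [hle s hs])
  have h := hanti ⟨le_rfl, ht⟩ ⟨ht, le_rfl⟩ ht
  simp only [hG, h0, mul_zero, neg_zero, Real.exp_zero, one_mul, zero_add] at h
  rw [Real.exp_neg, inv_mul_le_iff₀ (Real.exp_pos _)] at h
  have h1 : B / K ≤ B := div_le_self hB hK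
  have h2 : 0 ≤ B / K := by positivity
  have h3 := Real.exp_pos (K * t)
  nlinarith

section energy
variable {d k N : ℕ} {θ β K K' τ R₀ R₁ : ℝ} {J : Finset ℕ}

/-- The dissipation by the coupling term `τ⁻¹ (v_h - u_h)` absorbs the contribution of the boundary
to the sum of the flux forms, and the approximation errors enter linearly. -/
lemma flux_sum_le {A : (Fin d → ℝ) → Fin d → ℝ} {U f g ξ ζ : (Fin d → ℝ) → ℝ}
    (hA : ∀ i, ContDiffOn ℝ 1 (fun x => A x i) (unitCube d))
    (hAK : ∀ x ∈ unitCube d, ∀ i, ∀ s ∈ Icc (0 : ℝ) 1,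
      |derivWithin (fun s => A (Function.update x i s) i) (Icc 0 1) s| ≤ K')
    (hDP : IsFluxData θ N J 0 A K) (hDD : IsFluxData θ N (Finset.range (2 ^ N)) (1 / 2) A K)
    (hU : U ∈ Adm d) (hf : f ∈ PW k (N + 1) d) (hg : g ∈ PW k (N + 1) d)
    (hξ : ξ ∈ PW k (N + 1) d) (hζ : ζ ∈ PW k (N + 1) d)
    (hξc : FaceCont N (Finset.range (2 ^ N)) (1 / 2) ξ) (hζc : FaceCont N J 0 ζ)
    (hbc : (θ = 0 ∧ J = Finset.range (2 ^ N) ∧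
      (∀ x i, A (Function.update x i 1) i = A (Function.update x i 0) i) ∧ PerTrace ξ ∧ PerTrace ζ) ∨
      (θ = 1 ∧ J = Finset.Ico 1 (2 ^ N)))
    (hβ : 0 ≤ β) (hβA : θ = 0 ∨ ∀ x ∈ unitCube d, ∀ i, |A x i| ≤ β)
    (hβτ : d * (β * invConst k * 2 ^ N) ≤ 1 / τ) (hτ : 0 < τ)
    (hP : |hflux θ N (Finset.range (2 ^ N)) (1 / 2) A (U - (f + ξ)) ζ| ≤ R₁ * nrm ζ)
    (hQ : |hflux θ N J 0 A (U - (g + ζ)) ξ| ≤ R₁ * nrm ξ)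
    (hPn : nrm (U - (f + ξ)) ≤ R₀) (hQn : nrm (U - (g + ζ)) ≤ R₀) :
    hflux θ N J 0 A (U - g) ξ + hflux θ N (Finset.range (2 ^ N)) (1 / 2) A (U - f) ζ -
        1 / τ * ∫ x in unitCube d, (g - f) x * (ξ - ζ) x ≤
      d * (K' / 2 * (nrm ξ ^ 2 + nrm ζ ^ 2)) + (R₁ + 2 * R₀ / τ) * (nrm ξ + nrm ζ) := by
  have hle := PW_le_Adm k (N + 1) d
  have hP1 : U - (f + ξ) ∈ Adm d := sub_mem hU (hle (add_mem hf hξ))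
  have hQ1 : U - (g + ζ) ∈ Adm d := sub_mem hU (hle (add_mem hg hζ))
  have e1 : U - g = (U - (g + ζ)) + ζ := by abel
  have e2 : U - f = (U - (f + ξ)) + ξ := by abel
  rw [e1, e2, hDP.add hQ1 (hle hζ) hξ, hDD.add hP1 (hle hξ) hζ]
  have hmain := hflux_add_hflux_le hA hAK hξ hζ hξc hζc hbc hβ hβA
  have hηB : (U - (f + ξ)) - (U - (g + ζ)) ∈ BM d := Adm_le_BM d (sub_mem hP1 hQ1)
  have hdB : ξ - ζ ∈ BM d := PW_le_BM _ _ _ (sub_mem hξ hζ)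
  have e3 : ∫ x in unitCube d, (g - f) x * (ξ - ζ) x =
      (∫ x in unitCube d, ((U - (f + ξ)) - (U - (g + ζ))) x * (ξ - ζ) x) + nrm (ξ - ζ) ^ 2 := by
    rw [nrm_sq]
    refine Eq.trans ?_ (integral_add (BM.integrable (BM.mul hηB hdB))
      ((BM.integrable (BM.mul hdB hdB)).congr (Eventually.of_forall fun x => (sq _).symm)))
    refine integral_congr_ae (Eventually.of_forall fun x => ?_)
    simp only [Pi.sub_apply, Pi.add_apply]; ring
  have h4 := abs_integral_mul_le hηB hdB
  have h5 := nrm_sub_le (Adm_le_BM d hP1) (Adm_le_BM d hQ1)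
  have h6 := nrm_sub_le (PW_le_BM _ _ _ hξ) (PW_le_BM _ _ _ hζ)
  have h7 : nrm ((U - (f + ξ)) - (U - (g + ζ))) * nrm (ξ - ζ) ≤ 2 * R₀ * (nrm ξ + nrm ζ) :=
    mul_le_mul (by linarith) h6 (nrm_nonneg _) (by linarith [nrm_nonneg (U - (f + ξ))])
  have h8 := (abs_le.1 (h4.trans h7)).1
  have h9 : d * (β * invConst k * 2 ^ N) * nrm (ξ - ζ) ^ 2 ≤ 1 / τ * nrm (ξ - ζ) ^ 2 :=
    mul_le_mul_of_nonneg_right hβτ (sq_nonneg _)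
  have h10 : 1 / τ * -(2 * R₀ * (nrm ξ + nrm ζ)) ≤
      1 / τ * ∫ x in unitCube d, ((U - (f + ξ)) - (U - (g + ζ))) x * (ξ - ζ) x :=
    mul_le_mul_of_nonneg_left h8 (by positivity)
  have e4 : 2 * R₀ / τ * (nrm ξ + nrm ζ) = -(1 / τ * -(2 * R₀ * (nrm ξ + nrm ζ))) := by ring
  rw [e3, mul_add, add_mul, e4]
  have := (abs_le.1 hP).2
  have := (abs_le.1 hQ).2
  linarith

/-- The values of `u` at the nearest points of the cube. -/
def clampExt {d : ℕ} (u : (Fin d → ℝ) → ℝ) (x : Fin d → ℝ) : ℝ :=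
  u fun i => max 0 (min 1 (x i))

lemma clampExt_eq {u : (Fin d → ℝ) → ℝ} {x : Fin d → ℝ} (hx : x ∈ unitCube d) :
    clampExt u x = u x := by
  unfold clampExt
  congr 1
  ext i
  have h0 := hx.1 i
  have h1 := hx.2 i
  simp only [Pi.zero_apply, Pi.one_apply] at h0 h1
  rw [min_eq_right h1, max_eq_right h0]

lemma continuous_clampExt {u : (Fin d → ℝ) → ℝ} (hu : ContinuousOn u (unitCube d)) :
    Continuous (clampExt u) ∧ clampExt u ∈ Adm d := by
  have hmem : ∀ x : Fin d → ℝ, (fun i => max 0 (min 1 (x i))) ∈ unitCube d := fun x =>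
    ⟨fun i => le_max_left _ _, fun i => max_le zero_le_one (min_le_left _ _)⟩
  have hc : Continuous (clampExt u) :=
    hu.comp_continuous (f := fun x : Fin d → ℝ => fun i => max 0 (min 1 (x i))) (by fun_prop) hmem
  obtain ⟨C, hC⟩ := (isCompact_Icc : IsCompact (unitCube d)).exists_bound_of_continuousOn hu
  refine ⟨hc, hc.measurable, ⟨C, fun x => hC _ (hmem x)⟩, fun x i c => ?_⟩
  have h : Continuous fun s => clampExt u (Function.update x i s) :=
    hc.comp (continuous_const.update i continuous_id)
  exact ⟨⟨_, (h.tendsto c).mono_left nhdsWithin_le_nhds⟩,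
    _, (h.tendsto c).mono_left nhdsWithin_le_nhds⟩

/-- The constant of the error estimate. -/
noncomputable def energyConst (d k : ℕ) (K K' T c₁ : ℝ) : ℝ :=
  (2 + 2 * (4 * fluxConst d k K + 2 / c₁) * Real.exp ((d * K' + 1) * T)) * levelConst d

lemma energyConst_pos (d k : ℕ) {K c₁ : ℝ} (hK : 0 ≤ K) (K' T : ℝ) (hc₁ : 0 < c₁) :
    0 < energyConst d k K K' T c₁ := by
  have := fluxConst_nonneg d k hK
  have := levelConst_pos d
  unfold energyConst; positivity

variable {VP VD : Submodule ℝ ((Fin d → ℝ) → ℝ)} {q : ℕ} {T M c₁ t : ℝ}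
  {A : ℝ → (Fin d → ℝ) → Fin d → ℝ} {u uh vh : ℝ → (Fin d → ℝ) → ℝ}
  {FP FD : ℝ → ((Fin d → ℝ) → ℝ) → ((Fin d → ℝ) → ℝ) → ℝ}

set_option maxHeartbeats 1000000 in
/-- The error estimate for both kinds of boundary conditions: `θ = 0` in the periodic case, `θ = 1` in the
inflow case, where the boundary faces are not among the interior faces `J` of the primal mesh.
The constant `β` bounds the field in the boundary terms, `M` the multilevel approximation errors. -/
theorem energy_estimate (hN : 1 ≤ N) (hq : 1 ≤ q) (hT : 0 < T) (hM : 0 ≤ M) (hK : 0 ≤ K)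
    (hK' : 0 ≤ K') (hc₁ : 0 < c₁) (hτ : c₁ * meshSize N ≤ τ)
    (hVP : IsSchemeSpace k N VP) (hVD : IsSchemeSpace k N VD)
    (hPc : ∀ φ ∈ VP, FaceCont N (Finset.range (2 ^ N)) (1 / 2) φ) (hDc : ∀ ψ ∈ VD, FaceCont N J 0 ψ)
    (hbc : (θ = 0 ∧ J = Finset.range (2 ^ N) ∧
      (∀ t ∈ Icc 0 T, ∀ x i, A t (Function.update x i 1) = A t (Function.update x i 0) ∧
        u t (Function.update x i 1) = u t (Function.update x i 0)) ∧
      (∀ φ ∈ VP, PerTrace φ) ∧ ∀ ψ ∈ VD, PerTrace ψ) ∨ (θ = 1 ∧ J = Finset.Ico 1 (2 ^ N)))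
    (hA : ∀ t ∈ Icc 0 T, ∀ i, ContDiffOn ℝ 1 (fun x => A t x i) (unitCube d))
    (hAK : ∀ t ∈ Icc 0 T, ∀ x ∈ unitCube d, ∀ i, |A t x i| ≤ K)
    (hAK' : ∀ t ∈ Icc 0 T, ∀ x ∈ unitCube d, ∀ i, ∀ s ∈ Icc (0 : ℝ) 1,
      |derivWithin (fun s => A t (Function.update x i s) i) (Icc 0 1) s| ≤ K')
    (hβ : 0 ≤ β) (hβA : θ = 0 ∨ ∀ t ∈ Icc 0 T, ∀ x ∈ unitCube d, ∀ i, |A t x i| ≤ β)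
    (hβτ : d * (β * invConst k * 2 ^ N) ≤ 1 / τ)
    (hu : ContDiffOn ℝ 1 (fun z : ℝ × (Fin d → ℝ) => u z.1 z.2) (Icc 0 T ×ˢ unitCube d))
    (hut : ∀ t ∈ Ioo 0 T, ∀ x ∈ interior (unitCube d),
      deriv (fun s => u s x) t + ∑ i, pderiv i (fun y => A t y i * u t y) x = 0)
    (hFP : ∀ t ∈ Icc 0 T, ∀ w ∈ VD, ∀ φ ∈ VP,
      FP t w φ = hflux θ N J 0 (A t) w φ - θ * inflowTerm (A t) (u t) φ)
    (hFD : ∀ t ∈ Icc 0 T, ∀ w ∈ VP, ∀ ψ ∈ VD, FD t w ψ =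
      hflux θ N (Finset.range (2 ^ N)) (1 / 2) (A t) w ψ - θ * inflowTerm (A t) (u t) ψ)
    (hsol : IsCDGSolution T τ VP VD FP FD uh vh) (h0P : IsL2Proj VP (u 0) (uh 0))
    (h0D : IsL2Proj VD (u 0) (vh 0)) (ht : t ∈ Icc 0 T)
    (happP : ∀ s ∈ Icc 0 t, MultilevelApprox k q N VP M (u s))
    (happD : ∀ s ∈ Icc 0 t, MultilevelApprox k q N VD M (u s)) :
    nrm (fun x => u t x - uh t x) + nrm (fun x => u t x - vh t x) ≤
      energyConst d k K K' T c₁ * ((N : ℝ) ^ d * meshSize N ^ q * M) := by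
  have hp := meshSize_pos N
  have hτ0 : 0 < τ := (mul_pos hc₁ hp).trans_le hτ
  have hLp := levelConst_pos d
  have hF := fluxConst_nonneg d k hK
  have hθ : θ = 0 ∨ θ = 1 := by rcases hbc with h | h <;> simp [h.1]
  have hJ : J ⊆ Finset.range (2 ^ N) := by
    rcases hbc with ⟨-, rfl, -⟩ | ⟨-, rfl⟩
    · exact le_rfl
    · intro j hj; simp at hj ⊢; omega
  have hsl : ∀ s ∈ Icc 0 T, ContDiffOn ℝ 1 (u s) (unitCube d) := fun s hs =>
    hu.comp (f := fun x : Fin d → ℝ => (s, x)) (by fun_prop) fun x hx => ⟨hs, hx⟩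
  have hDP : ∀ s ∈ Icc 0 T, IsFluxData θ N J 0 (A s) K := fun s hs =>
    ⟨fun i => (hA s hs i).continuousOn, hAK s hs, hK, hJ, Or.inl rfl, hθ⟩
  have hDD : ∀ s ∈ Icc 0 T, IsFluxData θ N (Finset.range (2 ^ N)) (1 / 2) (A s) K := fun s hs =>
    ⟨fun i => (hA s hs i).continuousOn, hAK s hs, hK, le_rfl, Or.inr rfl, hθ⟩
  obtain ⟨ξ, hξ, hξ0, hξc, hξd⟩ :=
    hVP.exists_error_curve hT hu hsol.mem_primal hsol.diff_primal h0P
  obtain ⟨ζ, hζ, hζ0, hζc, hζd⟩ :=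
    hVD.exists_error_curve hT hu hsol.mem_dual hsol.diff_dual h0D
  set L := levelConst d * (N : ℝ) ^ d * meshSize N ^ q * M with hL
  have hL0 : 0 ≤ L := by positivity
  have hLs : levelConst d * (N : ℝ) ^ d * meshSize N ^ (q + 1) * M = meshSize N * L := by
    rw [hL, pow_succ]; ring
  -- `R` bounds the projection errors in the flux forms and, by `c₁ h_N ≤ τ`, in the coupling term
  set R := (4 * fluxConst d k K + 2 / c₁) * L with hR
  have hR0 : 0 ≤ R := by positivity
  have hRle : 4 * fluxConst d k K * L + 2 * (meshSize N * L) / τ ≤ R := by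
    rw [hR, add_mul]
    refine add_le_add le_rfl ?_
    rw [div_le_iff₀ hτ0]
    calc 2 * (meshSize N * L) = 2 / c₁ * L * (c₁ * meshSize N) := by field_simp
      _ ≤ _ := by gcongr
  -- `u s` is controlled on the cube only, so its traces are taken of the extension `clampExt`
  have hproj : ∀ (V : Submodule ℝ ((Fin d → ℝ) → ℝ)) (_ : IsSchemeSpace k N V) (s : ℝ)
      (_ : s ∈ Icc 0 T) (_ : MultilevelApprox k q N V M (u s)) (P : (Fin d → ℝ) → ℝ)
      (_ : IsL2Proj V (u s) P), nrm (clampExt (u s) - P) ≤ meshSize N * L ∧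
      ∀ θ J δ A K φ, IsFluxData θ N J δ A K → φ ∈ PW k (N + 1) d → TailLe N φ →
        |hflux θ N J δ A (clampExt (u s) - P) φ| ≤ 4 * fluxConst d k K * L * nrm φ := by
    intro V hV s hs happ P hP
    have hbox : box d 0 ⊆ unitCube d := fun x hx =>
      ⟨fun i => (hx i trivial).1, fun i => by simpa using (hx i trivial).2.le⟩
    have happ' : MultilevelApprox k q N V M (clampExt (u s)) := by
      obtain ⟨w, hw, h⟩ := happ
      refine ⟨w, hw, fun ε hε => ?_⟩
      obtain ⟨m, r, hr, h⟩ := h ε hε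
      refine ⟨m, r, hr, fun x hx => ?_⟩
      have := h x hx
      simpa only [Pi.sub_apply, clampExt_eq (hbox hx)] using this
    have hP' : IsL2Proj V (clampExt (u s)) P := by
      refine ⟨hP.1, fun φ hφ => ?_⟩
      rw [← hP.2 φ hφ]
      refine setIntegral_congr_fun (measurableSet_unitCube d) fun x hx => ?_
      simp only [clampExt_eq hx]
    have h := happ'.proj_bounds hN hq hM hV.le (continuous_clampExt (hsl s hs).continuousOn).2 hP'
    rw [hLs] at h
    exact h
  have hder : ∀ s ∈ Ioo 0 t,
      2 * ((∫ x in unitCube d, deriv (fun r => u r x) s * ξ s x) -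
          ∫ x in unitCube d, timeDeriv T uh s x * ξ s x) +
        2 * ((∫ x in unitCube d, deriv (fun r => u r x) s * ζ s x) -
          ∫ x in unitCube d, timeDeriv T vh s x * ζ s x) ≤
      (d * K' + 1) * (nrm (ξ s) ^ 2 + nrm (ζ s) ^ 2) + 2 * R ^ 2 := by
    intro s hs
    have hsI : s ∈ Icc 0 t := Ioo_subset_Icc_self hs
    have hsT : s ∈ Ioo 0 T := ⟨hs.1, hs.2.trans_le ht.2⟩
    have hsT' := Ioo_subset_Icc_self hsT
    obtain ⟨hξs, hPs⟩ := hξ s hsT'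
    obtain ⟨hζs, hQs⟩ := hζ s hsT'
    have huP := hsol.mem_primal s hsT'
    have hvD := hsol.mem_dual s hsT'
    obtain ⟨hUc, hUA⟩ := continuous_clampExt (hsl s hsT').continuousOn
    have hF : ∀ i, ContDiffOn ℝ 1 (fun x => A s x i * u s x) (unitCube d) := fun i =>
      (hA s hsT' i).mul (hsl s hsT')
    have hbc' : θ = 1 ∨ ∀ x i, A s (Function.update x i 1) i * u s (Function.update x i 1) =
        A s (Function.update x i 0) i * u s (Function.update x i 0) := by
      rcases hbc with ⟨-, -, h, -⟩ | h
      · exact Or.inr fun x i => by rw [(h s hsT' x i).1, (h s hsT' x i).2]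
      · exact Or.inl h.1
    have hruleP : PartsRule θ N J 0 (ξ s) := partsRule_primal (hVP.le hξs) (hPc _ hξs) (by
      rcases hbc with ⟨h1, h2, -, h3, -⟩ | h
      · exact Or.inl ⟨h1, h2, h3 _ hξs⟩
      · exact Or.inr h)
    have hruleD : PartsRule θ N (Finset.range (2 ^ N)) (1 / 2) (ζ s) :=
      partsRule_dual (hVD.le hζs) (hDc _ hζs) (by
        rcases hbc with ⟨h1, h2, -, -, h3⟩ | h
        · exact Or.inl ⟨h1, h2, h3 _ hζs⟩
        · exact Or.inr h)
    have x1 := integral_mul_eq_hflux (Ut := fun x => deriv (fun r => u r x) s) (hDP s hsT').cont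
      (hsl s hsT').continuousOn hF (hut s hsT) hUA hUc (fun x hx => clampExt_eq hx) (hVP.le hξs)
      hJ (Or.inl rfl) hruleP hbc'
    have x2 := integral_mul_eq_hflux (Ut := fun x => deriv (fun r => u r x) s) (hDP s hsT').cont
      (hsl s hsT').continuousOn hF (hut s hsT) hUA hUc (fun x hx => clampExt_eq hx) (hVD.le hζs)
      le_rfl (Or.inr rfl) hruleD hbc'
    have y1 := hsol.eq_primal s hsT' (ξ s) hξs
    have y2 := hsol.eq_dual s hsT' (ζ s) hζs
    rw [hFP s hsT' _ hvD _ hξs] at y1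
    rw [hFD s hsT' _ huP _ hζs] at y2
    have z1 := hflux_sub (hDP s hsT').cont hUA (PW_le_Adm _ _ _ (hVD.le hvD)) (hVP.le hξs) hJ
      (Or.inl rfl) θ
    have z2 := hflux_sub (N := N) (hDD s hsT').cont hUA (PW_le_Adm _ _ _ (hVP.le huP)) (hVD.le hζs) le_rfl
      (Or.inr rfl) θ
    have hdB : vh s - uh s ∈ BM d := PW_le_BM _ _ _ (sub_mem (hVD.le hvD) (hVP.le huP))
    have e : (∫ x in unitCube d, (vh s - uh s) x * (ξ s - ζ s) x) =
        (∫ x in unitCube d, (vh s x - uh s x) * ξ s x) +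
          ∫ x in unitCube d, (uh s x - vh s x) * ζ s x := by
      refine Eq.trans ?_ (integral_add (BM.integrable (BM.mul hdB (PW_le_BM _ _ _ (hVP.le hξs))))
        ((BM.integrable (BM.mul (neg_mem hdB) (PW_le_BM _ _ _ (hVD.le hζs)))).congr
          (Eventually.of_forall fun x => by simp)))
      refine integral_congr_ae (Eventually.of_forall fun x => ?_)
      simp only [Pi.sub_apply]; ring
    obtain ⟨p1, p2⟩ := hproj VP hVP s hsT' (happP s hsI) _ hPs
    obtain ⟨q1, q2⟩ := hproj VD hVD s hsT' (happD s hsI) _ hQs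
    have key := flux_sum_le (β := β) (hA s hsT') (hAK' s hsT') (hDP s hsT') (hDD s hsT') hUA
      (hVP.le huP) (hVD.le hvD) (hVP.le hξs) (hVD.le hζs) (hPc _ hξs) (hDc _ hζs) (by
        rcases hbc with ⟨h1, h2, h3, h4, h5⟩ | h
        · exact Or.inl ⟨h1, h2, fun x i => by rw [(h3 s hsT' x i).1], h4 _ hξs, h5 _ hζs⟩
        · exact Or.inr h) hβ (hβA.imp id fun h => h s hsT') hβτ hτ0
      (p2 _ _ _ _ _ _ (hDD s hsT') (hVD.le hζs) (hVD.tail _ hζs))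
      (q2 _ _ _ _ _ _ (hDP s hsT') (hVP.le hξs) (hVP.tail _ hξs)) p1 q1
    rw [e, z1, z2] at key
    have hξn := nrm_nonneg (ξ s)
    have hζn := nrm_nonneg (ζ s)
    have hsum : (4 * fluxConst d k K * L + 2 * (meshSize N * L) / τ) * (nrm (ξ s) + nrm (ζ s)) ≤
        R * (nrm (ξ s) + nrm (ζ s)) := mul_le_mul_of_nonneg_right hRle (by positivity)
    rw [x1, x2, y1, y2]
    nlinarith [sq_nonneg (R - nrm (ξ s)), sq_nonneg (R - nrm (ζ s))]
  have hsub : Icc 0 t ⊆ Icc 0 T := Icc_subset_Icc_right ht.2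
  -- Young's inequality has added `1` to the rate `d K'` and the source `2 R ^ 2`
  have hgron := le_exp_of_deriv_le (E := fun s => nrm (ξ s) ^ 2 + nrm (ζ s) ^ 2)
    (K := d * K' + 1) (B := 2 * R ^ 2) (by nlinarith [mul_nonneg (Nat.cast_nonneg (α := ℝ) d) hK'])
    (by positivity) ht.1 ((hξc.mono hsub).add (hζc.mono hsub))
    (fun s hs => (hξd s ⟨hs.1, hs.2.trans_le ht.2⟩).add (hζd s ⟨hs.1, hs.2.trans_le ht.2⟩)) hder
    (by simp [hξ0, hζ0, nrm])
  have hexp : Real.exp ((d * K' + 1) * t) ≤ Real.exp ((d * K' + 1) * T) := by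
    have := ht.2
    gcongr
  set X := Real.exp ((d * K' + 1) * T) with hX
  have hX1 : 1 ≤ X := Real.one_le_exp (by positivity)
  have hfin : nrm (ξ t) + nrm (ζ t) ≤ 2 * R * X := by
    refine le_of_sq_le_sq ?_ (by positivity)
    have h1 : nrm (ξ t) ^ 2 + nrm (ζ t) ^ 2 ≤ 2 * R ^ 2 * X := hgron.trans (by gcongr)
    have h2 : 2 * R ^ 2 * X ≤ 2 * R ^ 2 * X ^ 2 := by
      have : X ≤ X ^ 2 := by nlinarith
      gcongr
    nlinarith [sq_nonneg (nrm (ξ t) - nrm (ζ t))]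
  have htt : t ∈ Icc 0 t := ⟨ht.1, le_rfl⟩
  have hone : ∀ (V : Submodule ℝ ((Fin d → ℝ) → ℝ)) (_ : IsSchemeSpace k N V)
      (_ : MultilevelApprox k q N V M (u t)) (f η : (Fin d → ℝ) → ℝ) (_ : f ∈ V) (_ : η ∈ V)
      (_ : IsL2Proj V (u t) (f + η)), nrm (fun x => u t x - f x) ≤ meshSize N * L + nrm η := by
    intro V hV happ f η hf hη hP
    have hUA := (continuous_clampExt (hsl t ht).continuousOn).2
    have h1 := (hproj V hV t ht happ _ hP).1
    have h2 := nrm_add_le (Adm_le_BM d (sub_mem hUA (PW_le_Adm _ _ _ (hV.le (add_mem hf hη)))))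
      (PW_le_BM _ _ _ (hV.le hη))
    have e : nrm (fun x => u t x - f x) = nrm (clampExt (u t) - (f + η) + η) := by
      unfold nrm
      congr 1
      refine setIntegral_congr_fun (measurableSet_unitCube d) fun x hx => ?_
      simp only [Pi.add_apply, Pi.sub_apply, clampExt_eq hx]
      ring
    rw [e]
    linarith
  have h1 := hone VP hVP (happP t htt) _ _ (hsol.mem_primal t ht) (hξ t ht).1 (hξ t ht).2
  have h2 := hone VD hVD (happD t htt) _ _ (hsol.mem_dual t ht) (hζ t ht).1 (hζ t ht).2
  have h3 : meshSize N * L ≤ L := mul_le_of_le_one_left hL0 (meshSize_le_one N)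
  calc _ ≤ 2 * L + 2 * R * X := by linarith
    _ = _ := by rw [hR, hL, energyConst]; ring

end energy

/-! ### Periodicity and weak derivatives -/

section periodic
variable {d : ℕ} {α : Fin d → ℕ} {u w φ : (Fin d → ℝ) → ℝ} {a : ℝ}

lemma restrict_box_zero (d : ℕ) :
    (volume.restrict (box d 0) : Measure (Fin d → ℝ)) = volume.restrict (unitCube d) := by
  have hbox : box d 0 ⊆ unitCube d := fun x hx =>
    ⟨fun i => (hx i trivial).1, fun i => by simpa using (hx i trivial).2.le⟩
  refine Measure.restrict_congr_set ?_
  have h := (ae_restrict_iff' (measurableSet_unitCube d)).1 (ae_mem_box d)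
  filter_upwards [h] with x hx
  exact propext ⟨fun h => hbox h, hx⟩

lemma restrict_interior_unitCube (d : ℕ) :
    (volume.restrict (interior (unitCube d)) : Measure (Fin d → ℝ)) =
      volume.restrict (unitCube d) := by
  refine Measure.restrict_congr_set ?_
  have h := (ae_restrict_iff' (measurableSet_unitCube d)).1 (ae_mem_interior d)
  filter_upwards [h] with x hx
  exact propext ⟨fun h => interior_subset (s := unitCube d) h, hx⟩

lemma measurable_wrap1 (a : ℝ) : Measurable (wrap1 a) :=
  (measurable_fract.comp (measurable_id.sub_const a)).const_add a

/-- Both intervals are fundamental domains of the translations by integers. -/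
lemma measurePreserving_wrap1 (a : ℝ) : MeasurePreserving (wrap1 a)
    (volume.restrict (Ico (0 : ℝ) (0 + 1))) (volume.restrict (Ico a (a + 1))) := by
  refine ⟨measurable_wrap1 a, ?_⟩
  ext S hS
  have hpre := measurable_wrap1 a hS
  rw [Measure.map_apply (measurable_wrap1 a) hS, Measure.restrict_apply hpre,
    Measure.restrict_apply hS]
  have hinv : ∀ g : AddSubgroup.zmultiples (1 : ℝ),
      (fun x => g +ᵥ x) ⁻¹' (wrap1 a ⁻¹' S) = wrap1 a ⁻¹' S := by
    rintro ⟨_, n, rfl⟩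
    ext x
    have : (n • (1 : ℝ)) + x - a = x - a + n := by rw [zsmul_one]; ring
    change a + Int.fract (n • (1 : ℝ) + x - a) ∈ S ↔ a + Int.fract (x - a) ∈ S
    rw [this, Int.fract_add_intCast]
  have h1 := (isAddFundamentalDomain_Ioc one_pos (0 : ℝ)).measure_set_eq
    (isAddFundamentalDomain_Ioc one_pos a) hpre hinv
  have h2 : ∀ b : ℝ, volume (wrap1 a ⁻¹' S ∩ Ico b (b + 1)) = volume (wrap1 a ⁻¹' S ∩ Ioc b (b + 1)) :=
    fun b => measure_congr ((ae_eq_refl _).inter Ico_ae_eq_Ioc)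
  rw [h2, h1, ← h2]
  congr 1
  ext x
  refine and_congr_left fun hx => ?_
  have : Int.fract (x - a) = x - a :=
    Int.fract_eq_self.2 ⟨by linarith [hx.1], by linarith [hx.2]⟩
  simp only [mem_preimage, wrap1, this, add_sub_cancel]

lemma measurePreserving_wrap (d : ℕ) (a : ℝ) : MeasurePreserving (wrap a)
    (volume.restrict (box d 0)) (volume.restrict (box d a)) := by
  have h : ∀ b : ℝ, (volume.restrict (box d b) : Measure (Fin d → ℝ)) =
      Measure.pi fun _ => volume.restrict (Ico b (b + 1)) := fun b => by
    rw [box, volume_pi, Measure.restrict_pi_pi]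
  rw [h, h]
  exact measurePreserving_pi _ _ fun _ => measurePreserving_wrap1 a

lemma wrap_mem_box (a : ℝ) (x : Fin d → ℝ) : wrap a x ∈ box d a := fun i _ =>
  ⟨by simp [wrap], by simp only [wrap]; linarith [Int.fract_lt_one (x i - a)]⟩

lemma wrap_eq_add (a : ℝ) (x : Fin d → ℝ) : ∃ z : Fin d → ℤ, wrap a x = x + fun i => (z i : ℝ) := by
  refine ⟨fun i => -⌊x i - a⌋, ?_⟩
  ext i
  simp only [wrap, Int.fract, Pi.add_apply]
  push_cast
  ring

lemma IsPeriodic.add_int {β : Type*} {f : (Fin d → ℝ) → β} (hf : IsPeriodic f) (z : Fin d → ℤ)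
    (x : Fin d → ℝ) : f (x + fun i => (z i : ℝ)) = f x := by
  have key : ∀ s : Finset (Fin d), ∀ x, f (x + ∑ i ∈ s, z i • Pi.single i (1 : ℝ)) = f x := by
    intro s
    induction s using Finset.induction_on with
    | empty => simp
    | insert i s hi ih =>
      intro x
      rw [Finset.sum_insert hi, ← add_assoc, add_right_comm]
      exact ((hf i).zsmul (z i) _).trans (ih x)
  rw [← key Finset.univ x]
  congr 2
  ext i
  simp [Finset.sum_apply, Pi.single_apply]

lemma pderiv_add_right (i : Fin d) (f : (Fin d → ℝ) → ℝ) (y : Fin d → ℝ) :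
    pderiv i (fun x => f (x + y)) = fun x => pderiv i f (x + y) := by
  ext x
  simp only [pderiv, lineDeriv]
  congr 1
  ext t
  congr 1
  abel

lemma mixedDeriv_add_right (α : Fin d → ℕ) (f : (Fin d → ℝ) → ℝ) (y : Fin d → ℝ) :
    mixedDeriv α (fun x => f (x + y)) = fun x => mixedDeriv α f (x + y) := by
  unfold mixedDeriv
  have hit : ∀ (i : Fin d) (n : ℕ) (g : (Fin d → ℝ) → ℝ),
      (pderiv i)^[n] (fun x => g (x + y)) = fun x => (pderiv i)^[n] g (x + y) := by
    intro i n
    induction n with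
    | zero => intro g; rfl
    | succ n ih =>
      intro g
      rw [Function.iterate_succ_apply, pderiv_add_right, ih, Function.iterate_succ_apply]
  induction List.finRange d with
  | nil => rfl
  | cons i l ih => rw [List.foldr_cons, ih, hit, List.foldr_cons]

/-- Weak derivatives of periodic functions are periodic, by uniqueness. -/
lemma HasWeakDeriv.ae_add_int (hu : IsPeriodic u) (h : HasWeakDeriv univ α u w) (z : Fin d → ℤ) :
    ∀ᵐ x, w (x + fun i => (z i : ℝ)) = w x := by
  obtain ⟨-, hw, hφ⟩ := h
  rw [locallyIntegrableOn_univ] at hw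
  simp only [Measure.restrict_univ] at hφ
  set y : Fin d → ℝ := fun i => (z i : ℝ) with hy
  have hwy : LocallyIntegrable (fun x => w (x + y)) := by
    intro x
    obtain ⟨s, hs, hi⟩ := hw (x + y)
    refine ⟨(fun x => x + y) ⁻¹' s, (continuous_add_const y).continuousAt.preimage_mem_nhds hs, ?_⟩
    exact ((measurePreserving_add_right volume y).integrableOn_comp_preimage
      (measurableEmbedding_addRight y)).2 hi
  refine ae_eq_of_integral_contDiff_smul_eq hwy hw fun g hg hgc => ?_
  have hg' : ContDiff ℝ (⊤ : ℕ∞) fun x => g (x + -y) := hg.comp (contDiff_id.add contDiff_const)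
  have hgc' : HasCompactSupport fun x => g (x + -y) :=
    hgc.comp_homeomorph (Homeomorph.addRight (-y))
  have h1 := hφ _ hg' hgc' (subset_univ _)
  have h2 := hφ _ hg hgc (subset_univ _)
  have e1 : ∫ x, u x * mixedDeriv α (fun x => g (x + -y)) x = ∫ x, u x * mixedDeriv α g x := by
    rw [mixedDeriv_add_right, ← integral_add_right_eq_self _ y]
    refine integral_congr_ae (Eventually.of_forall fun x => ?_)
    simp only [add_neg_cancel_right]
    rw [hu.add_int]
  have e2 : ∫ x, w x * g (x + -y) = ∫ x, w (x + y) * g x := by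
    rw [← integral_add_right_eq_self _ y]
    simp only [add_neg_cancel_right]
  rw [e1, e2, h2] at h1
  have h3 := mul_left_cancel₀ (pow_ne_zero _ (by norm_num)) h1
  simp only [smul_eq_mul, mul_comm (g _)]
  exact h3.symm

lemma HasWeakDeriv.eLpNorm_box (hu : IsPeriodic u) (h : HasWeakDeriv univ α u w) (a : ℝ) :
    eLpNorm w 2 (volume.restrict (box d a)) = eLpNorm w 2 (volume.restrict (unitCube d)) := by
  have hm : AEStronglyMeasurable w (volume.restrict (box d a)) :=
    ((locallyIntegrableOn_univ.1 h.2.1).aestronglyMeasurable).restrict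
  rw [← eLpNorm_comp_measurePreserving hm (measurePreserving_wrap d a), restrict_box_zero]
  refine eLpNorm_congr_ae (ae_restrict_of_ae ?_)
  filter_upwards [ae_all_iff.2 fun z => h.ae_add_int hu z] with x hx
  obtain ⟨z, hz⟩ := wrap_eq_add a x
  rw [Function.comp_apply, hz, hx]

end periodic

/-! ### Multilevel approximation in the sparse spaces -/

section approx
variable {d k q N : ℕ} {a lo M : ℝ} {u : (Fin d → ℝ) → ℝ}

/-- The quasi-interpolant on the box with lower corner `lo`, transported to the cube by `E`. -/
lemma multilevelApprox_of_transport (hm : IsMesh a lo) (ha : IsOffset N a) (hlo : IsOffset N lo)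
    (hN : 1 ≤ N) (hq : q ≤ k) (hM : 0 ≤ M) {V : Submodule ℝ ((Fin d → ℝ) → ℝ)}
    {U : Set (Fin d → ℝ)} (hU : (pi univ fun _ => Ioo lo (lo + 1)) ⊆ U)
    (hu : ContinuousOn u (cbox d lo)) {E : (Fin d → ℝ) → Fin d → ℝ}
    (hE : MeasurePreserving E (volume.restrict (box d 0)) (volume.restrict (box d lo)))
    (hEb : ∀ x ∈ box d 0, E x ∈ box d lo ∧ u (E x) = u x)
    (hPW : ∀ n, N ≤ n → (fun x => sparseRes k a lo N n u (E x)) ∈ PW k (n + 1) d)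
    (hV : (fun x => sparseInterp k a lo N u (E x)) ∈ V)
    (hw : ∀ L : Finset (Fin d), L.Nonempty →
      ∃ w, HasWeakDeriv U (fun i => if i ∈ L then q + 1 else 0) u w ∧
        AEStronglyMeasurable w (volume.restrict (box d lo)) ∧
        eLpNorm w 2 (volume.restrict (box d lo)) ≤ ENNReal.ofReal M) :
    MultilevelApprox k q N V (incrConst k q ^ d * M) u := by
  have hc := incrConst_pos k q
  refine ⟨_, hV, fun ε hε => ?_⟩
  obtain ⟨n₀, hn₀⟩ := fullInterp_tendsto (k := k) hm hu hε
  refine ⟨max N n₀, fun n x => sparseRes k a lo N n u (E x), fun n hn => ?_, fun x hx => ?_⟩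
  · have hn := (Finset.mem_Icc.1 hn).1
    refine ⟨hPW n hn, ?_⟩
    have h1 := eLpNorm_sparseRes_le hm hq hU (measurable_incr (k := k) hm ha hlo hu) hw hN hn
    have hmeas := (PW.measurable (sparseRes_mem_PW (k := k) hm ha hlo hN hn hu).1)
    rw [← eLpNorm_comp_measurePreserving hmeas.aestronglyMeasurable hE, restrict_box_zero] at h1
    change l2Norm (fun x => sparseRes k a lo N n u (E x)) ≤ _ at h1
    have hp := meshSize_pos n
    rw [l2Norm_eq (PW_le_BM _ _ _ (hPW n hn)), ← ENNReal.ofReal_mul (by positivity),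
      ENNReal.ofReal_le_ofReal_iff (by positivity)] at h1
    refine h1.trans_eq ?_
    ring
  · obtain ⟨h1, h2⟩ := hEb x hx
    have h3 := hn₀ (max N n₀) (le_max_right _ _) _ h1
    rw [← sparseInterp_add_sum_sparseRes hm (le_max_left N n₀) hu, h2] at h3
    simp only [Pi.add_apply, Finset.sum_apply, Pi.sub_apply] at h3 ⊢
    rwa [sub_sub]

lemma exists_of_mixedSeminorm_lt {U : Set (Fin d → ℝ)} (h : mixedSeminorm U (q + 1) u < ENNReal.ofReal M)
    (L : Finset (Fin d)) (hL : L.Nonempty) :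
    ∃ w, HasWeakDeriv U (fun i => if i ∈ L then q + 1 else 0) u w ∧
      eLpNorm w 2 (volume.restrict (unitCube d)) ≤ ENNReal.ofReal M := by
  have h1 := (le_iSup₂ (f := fun (L : Finset (Fin d)) (_ : L.Nonempty) =>
    ⨅ (w : (Fin d → ℝ) → ℝ) (_ : HasWeakDeriv U (fun i => if i ∈ L then q + 1 else 0) u w),
      eLpNorm w 2 (volume.restrict (unitCube d))) L hL).trans_lt h
  simp only [iInf_lt_iff] at h1
  obtain ⟨w, hw, h2⟩ := h1
  exact ⟨w, hw, h2.le⟩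

/-- Approximation on the cube, without periodicity: the meshes have lower corner `0`. -/
lemma multilevelApprox_dir {W : ℕ → Set (ℝ → ℝ)} (hm : IsMesh a 0) (ha : IsOffset N a)
    (hW : ∀ n ≤ N, cellPoly k a 0 n ⊆ Submodule.span ℝ {f | ∃ m ≤ n, f ∈ W m})
    (hN : 1 ≤ N) (hq : q ≤ k) (hM : 0 ≤ M) (hu : ContinuousOn u (unitCube d))
    (h : mixedSeminorm (interior (unitCube d)) (q + 1) u < ENNReal.ofReal M) :
    MultilevelApprox k q N (sparseSpace W d N) (incrConst k q ^ d * M) u := by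
  have hcb : cbox d 0 = unitCube d := by rw [cbox, unitCube_eq_pi, zero_add]
  have hu' : ContinuousOn u (cbox d 0) := by rwa [hcb]
  refine multilevelApprox_of_transport (E := id) hm ha (Or.inl rfl) hN hq hM
    (U := interior (unitCube d)) ?_ hu' (MeasurePreserving.id _) (fun x hx => ⟨hx, rfl⟩)
    (fun n hn => (sparseRes_mem_PW hm ha (Or.inl rfl) hN hn hu').1) (sparseInterp_mem hm hW hu')
    fun L hL => ?_
  · rw [interior_unitCube, zero_add]
  · obtain ⟨w, hw, hwM⟩ := exists_of_mixedSeminorm_lt h L hL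
    refine ⟨w, hw, ?_, by rwa [restrict_box_zero]⟩
    rw [restrict_box_zero, ← restrict_interior_unitCube]
    exact hw.2.1.aestronglyMeasurable

/-- Approximation of periodic functions: the quasi-interpolant on `[a, a + 1)^d`, extended periodically. -/
lemma multilevelApprox_per (ha : IsOffset N a) (hN : 1 ≤ N) (hq : q ≤ k) (hM : 0 ≤ M)
    (hu : Continuous u) (hper : IsPeriodic u)
    (h : mixedSeminorm univ (q + 1) u < ENNReal.ofReal M) :
    MultilevelApprox k q N (periodicSpace k d N a) (incrConst k q ^ d * M) u := by
  have hm := isMesh_self a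
  have hu' : ContinuousOn u (cbox d a) := hu.continuousOn
  refine multilevelApprox_of_transport (E := wrap a) hm ha ha hN hq hM
    (subset_univ _) hu' (measurePreserving_wrap d a) (fun x _ => ⟨wrap_mem_box a x, ?_⟩)
    (fun n hn => (sparseRes_mem_PW hm ha ha hN hn hu').2)
    ⟨_, sparseInterp_mem hm (fun n _ => cellPoly_subset_span k a n) hu', rfl⟩ fun L hL => ?_
  · obtain ⟨z, hz⟩ := wrap_eq_add a x
    rw [hz, hper.add_int]
  · obtain ⟨w, hw, hwM⟩ := exists_of_mixedSeminorm_lt h L hL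
    refine ⟨w, hw, ((locallyIntegrableOn_univ.1 hw.2.1).aestronglyMeasurable).restrict, ?_⟩
    rwa [hw.eLpNorm_box hper]

end approx

/-! ### The error estimates in the periodic and in the inflow case -/

section final
variable {d k q N : ℕ} {T τ c₁ t : ℝ} {A : ℝ → (Fin d → ℝ) → Fin d → ℝ}
  {u uh vh : ℝ → (Fin d → ℝ) → ℝ}

lemma le_ofReal_mul_of_forall {X S : ℝ≥0∞} {c : ℝ} (hc : 0 < c)
    (h : ∀ M : ℝ, 0 ≤ M → S < ENNReal.ofReal M → X ≤ ENNReal.ofReal c * ENNReal.ofReal M) :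
    X ≤ ENNReal.ofReal c * S := by
  have hc0 : ENNReal.ofReal c ≠ 0 := (ENNReal.ofReal_pos.2 hc).ne'
  rw [← ENNReal.inv_mul_le_iff hc0 ENNReal.ofReal_ne_top]
  refine le_of_forall_gt_imp_ge_of_dense fun b hb => ?_
  rcases eq_or_ne b ⊤ with rfl | hbt
  · exact le_top
  · rw [ENNReal.inv_mul_le_iff hc0 ENNReal.ofReal_ne_top]
    have := h b.toReal ENNReal.toReal_nonneg (by rwa [ENNReal.ofReal_toReal hbt])
    rwa [ENNReal.ofReal_toReal hbt] at this

lemma exists_field_bounds (hT : 0 < T)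
    (hA : ContDiffOn ℝ 1 (fun z : ℝ × (Fin d → ℝ) => A z.1 z.2) (Icc 0 T ×ˢ unitCube d)) :
    (∀ t ∈ Icc 0 T, ∀ i, ContDiffOn ℝ 1 (fun x => A t x i) (unitCube d)) ∧
    ∃ K : ℝ, 0 ≤ K ∧ (∀ t ∈ Icc 0 T, ∀ x ∈ unitCube d, ∀ i, |A t x i| ≤ K) ∧
      ∀ t ∈ Icc 0 T, ∀ x ∈ unitCube d, ∀ i, ∀ s ∈ Icc (0 : ℝ) 1,
        |derivWithin (fun s => A t (Function.update x i s) i) (Icc 0 1) s| ≤ K := by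
  set D : Set (ℝ × (Fin d → ℝ)) := Icc 0 T ×ˢ unitCube d with hD
  have hDc : IsCompact D := isCompact_Icc.prod isCompact_Icc
  have hDu : UniqueDiffOn ℝ D := (uniqueDiffOn_Icc hT).prod (uniqueDiffOn_unitCube d)
  obtain ⟨C, hC⟩ := hDc.exists_bound_of_continuousOn hA.continuousOn
  obtain ⟨C', hC'⟩ := hDc.exists_bound_of_continuousOn (hA.continuousOn_fderivWithin hDu le_rfl)
  refine ⟨fun t ht i => ?_, max (max C C') 0, le_max_right _ _, fun t ht x hx i => ?_,
    fun t ht x hx i s hs => ?_⟩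
  · exact contDiffOn_pi.1 (hA.comp (f := fun x : Fin d → ℝ => (t, x)) (by fun_prop)
      fun x hx => ⟨ht, hx⟩) i
  · exact ((norm_le_pi_norm (A t x) i).trans (hC (t, x) ⟨ht, hx⟩)).trans
      ((le_max_left _ _).trans (le_max_left _ _))
  · have hz : (t, Function.update x i s) ∈ D := ⟨ht, update_mem_unitCube hx i hs⟩
    have h1 := ((hA.differentiableOn (by norm_num)) _ hz).hasFDerivWithinAt
    have h2 : HasDerivWithinAt (fun s : ℝ => (t, Function.update x i s))
        ((0 : ℝ), (Pi.single i 1 : Fin d → ℝ)) (Icc 0 1) s :=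
      ((hasDerivAt_const s t).prodMk (hasDerivAt_update x i s)).hasDerivWithinAt
    have h3 := h1.comp_hasDerivWithinAt s h2 (show MapsTo (fun s : ℝ => (t, Function.update x i s))
      (Icc 0 1) D from fun s hs => ⟨ht, update_mem_unitCube hx i hs⟩)
    have h4 := (hasDerivWithinAt_pi.1 h3 i).derivWithin (uniqueDiffOn_Icc one_pos s hs)
    change |derivWithin (fun s => A t (Function.update x i s) i) (Icc 0 1) s| ≤ _
    refine (congrArg abs h4).le.trans ?_
    refine (norm_le_pi_norm (fderivWithin ℝ (fun z : ℝ × (Fin d → ℝ) => A z.1 z.2) D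
      (t, Function.update x i s) ((0 : ℝ), Pi.single i 1)) i).trans
      (((ContinuousLinearMap.le_opNorm _ _).trans ?_).trans
        ((le_max_right C C').trans (le_max_left _ _)))
    have hn : ‖((0 : ℝ), (Pi.single i 1 : Fin d → ℝ))‖ = 1 := by
      rw [Prod.norm_def, Pi.norm_single]; simp
    rw [hn, mul_one]
    exact hC' _ hz

/-- Passage from the estimates of the real `L²` norms, for all bounds `M` of the semi-norms, to the
form with values in `ℝ≥0∞`. -/
lemma error_le_of_forall {VP VD : Submodule ℝ ((Fin d → ℝ) → ℝ)} {B : ℝ} {S : ℝ≥0∞}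
    (hB : 0 < B) (hN : 1 ≤ N) (hVP : IsSchemeSpace k N VP) (hVD : IsSchemeSpace k N VD)
    {u f g : (Fin d → ℝ) → ℝ} (hu : ContinuousOn u (unitCube d)) (hf : f ∈ VP) (hg : g ∈ VD)
    (h : ∀ M : ℝ, 0 ≤ M → S < ENNReal.ofReal M → nrm (fun x => u x - f x) + nrm (fun x => u x - g x) ≤
      B * ((N : ℝ) ^ d * meshSize N ^ q * (incrConst k q ^ d * M))) :
    l2Norm (fun x => u x - f x) + l2Norm (fun x => u x - g x) ≤
      ENNReal.ofReal (B * incrConst k q ^ d * (N : ℝ) ^ d / (2 : ℝ) ^ (N * q)) * S := by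
  have hc := incrConst_pos k q
  have hN' : (0 : ℝ) < N := by exact_mod_cast hN
  have e : meshSize N ^ q = 1 / 2 ^ (N * q) := by
    rw [meshSize, inv_pow, ← pow_mul, one_div]
  refine le_ofReal_mul_of_forall (by positivity) fun M hM hS => ?_
  have hfB : (fun x => u x - f x) ∈ BM d :=
    sub_mem (BM.of_continuousOn hu) (PW_le_BM _ _ _ (hVP.le hf))
  have hgB : (fun x => u x - g x) ∈ BM d :=
    sub_mem (BM.of_continuousOn hu) (PW_le_BM _ _ _ (hVD.le hg))
  rw [l2Norm_eq hfB, l2Norm_eq hgB, ← ENNReal.ofReal_add (nrm_nonneg _) (nrm_nonneg _),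
    ← ENNReal.ofReal_mul (by positivity)]
  refine ENNReal.ofReal_le_ofReal ((h M hM hS).trans_eq ?_)
  rw [e]; ring

lemma contDiffOn_cube {D : Set (Fin d → ℝ)} {E : Type*} [NormedAddCommGroup E] [NormedSpace ℝ E]
    {F : ℝ × (Fin d → ℝ) → E} (h : ContDiffOn ℝ 1 F (Icc 0 T ×ˢ D)) (hD : unitCube d ⊆ D) :
    ContDiffOn ℝ 1 F (Icc 0 T ×ˢ unitCube d) := h.mono (prod_mono_right hD)

lemma mixedSeminorm_lt {U : Set (Fin d → ℝ)} {M : ℝ}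
    (h : ⨆ s ∈ Icc 0 t, mixedSeminorm U (q + 1) (u s) < ENNReal.ofReal M) {s : ℝ}
    (hs : s ∈ Icc 0 t) : mixedSeminorm U (q + 1) (u s) < ENNReal.ofReal M :=
  (le_iSup₂ (f := fun s (_ : s ∈ Icc 0 t) => mixedSeminorm U (q + 1) (u s)) s hs).trans_lt h

lemma IsPeriodic.update_one {β : Type*} {f : (Fin d → ℝ) → β} (hf : IsPeriodic f) (x : Fin d → ℝ)
    (i : Fin d) : f (Function.update x i 1) = f (Function.update x i 0) := by
  rw [← hf i (Function.update x i 0)]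
  congr 1
  ext j
  by_cases h : j = i
  · subst h; simp
  · simp [h]

theorem error_estimate_periodic (hq : 1 ≤ q) (hqk : q ≤ k) (hT : 0 < T)
    (hA : IsSmoothField T univ A) (hAp : ∀ t ∈ Icc 0 T, IsPeriodic (A t)) (hc₁ : 0 < c₁) :
    ∃ C : ℝ, 0 < C ∧ ∀ N : ℕ, 1 ≤ N → ∀ τ : ℝ, c₁ * meshSize N ≤ τ →
      ∀ u uh vh : ℝ → (Fin d → ℝ) → ℝ,
        IsClassicalSolution T univ A u → (∀ t ∈ Icc 0 T, IsPeriodic (u t)) →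
        IsCDGSolution T τ (primalPer k d N) (dualPer k d N)
          (fun t => fluxPrimalPer N (A t)) (fun t => fluxDualPer N (A t)) uh vh →
        IsL2Proj (primalPer k d N) (u 0) (uh 0) → IsL2Proj (dualPer k d N) (u 0) (vh 0) →
        ∀ t ∈ Icc 0 T,
          l2Norm (fun x => u t x - uh t x) + l2Norm (fun x => u t x - vh t x) ≤
            ENNReal.ofReal (C * (N : ℝ) ^ d / (2 : ℝ) ^ (N * q)) *
              ⨆ s ∈ Icc 0 t, mixedSeminorm univ (q + 1) (u s) := by
  obtain ⟨hAs, K, hK, hAK, hAK'⟩ := exists_field_bounds hT (contDiffOn_cube hA (subset_univ _))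
  have hB := energyConst_pos d k hK K T hc₁
  have hcpos := incrConst_pos k q
  refine ⟨energyConst d k K K T c₁ * incrConst k q ^ d, by positivity, ?_⟩
  intro N hN τ hτ u uh vh ⟨hu, hut⟩ hup hsol h0P h0D t ht
  have hucont : ∀ s ∈ Icc 0 T, Continuous (u s) := fun s hs => continuousOn_univ.1
    (hu.continuousOn.comp (f := fun x : Fin d → ℝ => (s, x)) (by fun_prop) fun x hx => ⟨hs, hx⟩)
  have o0 : IsOffset N 0 := Or.inl rfl
  have o1 : IsOffset N (-(meshSize N / 2)) := Or.inr rfl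
  have hVP : IsSchemeSpace k N (primalPer k d N) :=
    (isLineSpace_linePer o0).isSchemeSpace (periodicSpace_le d k N _)
  have hVD : IsSchemeSpace k N (dualPer k d N) :=
    (isLineSpace_linePer o1).isSchemeSpace (periodicSpace_le d k N _)
  have hsub : Icc 0 t ⊆ Icc 0 T := Icc_subset_Icc_right ht.2
  refine error_le_of_forall hB hN hVP hVD (hucont t ht).continuousOn (hsol.mem_primal t ht)
    (hsol.mem_dual t ht) fun M hM hS => ?_
  -- without boundary terms the stability estimate holds with `β = 0`
  refine energy_estimate (θ := 0) (β := 0) hN hq hT (by positivity) hK hK hc₁ hτ hVP hVD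
    (fun _ h => faceCont_primalPer h) (fun _ h => faceCont_dualPer h)
    (Or.inl ⟨rfl, rfl, fun s hs x i => ⟨(hAp s hs).update_one x i, (hup s hs).update_one x i⟩,
      fun _ h => perTrace_of_mem o0 h, fun _ h => perTrace_of_mem o1 h⟩)
    hAs hAK hAK' le_rfl (Or.inl rfl) ?_ (contDiffOn_cube hu (subset_univ _))
    (fun s hs x _ => hut s hs x (by simp)) (fun s _ w _ φ _ => by simp [hflux, fluxPrimalPer])
    (fun s _ w _ φ _ => by simp [hflux, fluxDualPer]) hsol h0P h0D ht
    (fun s hs => multilevelApprox_per o0 hN hqk hM (hucont s (hsub hs)) (hup s (hsub hs))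
      (mixedSeminorm_lt hS hs))
    (fun s hs => multilevelApprox_per o1 hN hqk hM (hucont s (hsub hs)) (hup s (hsub hs))
      (mixedSeminorm_lt hS hs))
  have := (mul_pos hc₁ (meshSize_pos N)).trans_le hτ
  rw [zero_mul, zero_mul, mul_zero]
  positivity

/-- The bound on `τ_max` under which the coupling term dominates the boundary contributions. -/
noncomputable def couplingConst (d k : ℕ) : ℝ := 1 / (d * invConst k)

theorem error_estimate_inflow (hd : 1 ≤ d) (hq : 1 ≤ q) (hqk : q ≤ k) (hT : 0 < T)
    (hA : IsSmoothField T (unitCube d) A) (hc₁ : 0 < c₁) :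
    ∃ C : ℝ, 0 < C ∧ ∀ N : ℕ, 1 ≤ N → ∀ τ : ℝ, c₁ * meshSize N ≤ τ →
      (∀ t ∈ Icc 0 T, ∀ x ∈ unitCube d, τ * ∑ i, |A t x i| ≤ couplingConst d k * meshSize N) →
      ∀ (u uh vh : ℝ → (Fin d → ℝ) → ℝ) (g : ℝ → Fin d → (Fin d → ℝ) → ℝ),
        IsClassicalSolution T (unitCube d) A u → HasInflowData T A g u →
        IsCDGSolution T τ (primalDir k d N) (dualDir k d N)
          (fun t => fluxPrimalDir N (A t) (g t)) (fun t => fluxDualDir N (A t) (g t)) uh vh →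
        IsL2Proj (primalDir k d N) (u 0) (uh 0) → IsL2Proj (dualDir k d N) (u 0) (vh 0) →
        ∀ t ∈ Icc 0 T,
          l2Norm (fun x => u t x - uh t x) + l2Norm (fun x => u t x - vh t x) ≤
            ENNReal.ofReal (C * (N : ℝ) ^ d / (2 : ℝ) ^ (N * q)) *
              ⨆ s ∈ Icc 0 t, mixedSeminorm (interior (unitCube d)) (q + 1) (u s) := by
  obtain ⟨hAs, K, hK, hAK, hAK'⟩ := exists_field_bounds hT hA
  have hB := energyConst_pos d k hK K T hc₁
  have hcpos := incrConst_pos k q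
  have hinv := invConst_pos k
  have hd' : (0 : ℝ) < d := by exact_mod_cast hd
  refine ⟨energyConst d k K K T c₁ * incrConst k q ^ d, by positivity, ?_⟩
  intro N hN τ hτ hκ u uh vh g ⟨hu, hut⟩ hg hsol h0P h0D t ht
  have hp := meshSize_pos N
  have hτ0 : 0 < τ := (mul_pos hc₁ hp).trans_le hτ
  have hucont : ∀ s ∈ Icc 0 T, ContinuousOn (u s) (unitCube d) := fun s hs =>
    hu.continuousOn.comp (f := fun x : Fin d → ℝ => (s, x)) (by fun_prop) fun x hx => ⟨hs, hx⟩
  have o0 : IsOffset N 0 := Or.inl rfl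
  have o1 : IsOffset N (-(meshSize N / 2)) := Or.inr rfl
  have hVP : IsSchemeSpace k N (primalDir k d N) :=
    (isLineSpace_lineDir o0).isSchemeSpace (primalDir_le d k N)
  have hVD : IsSchemeSpace k N (dualDir k d N) :=
    (isLineSpace_lineDir o1).isSchemeSpace (dualDir_le d k N)
  have hsub : Icc 0 t ⊆ Icc 0 T := Icc_subset_Icc_right ht.2
  have hbdry : ∀ s ∈ Icc 0 T, ∀ w ∈ Adm d, ∀ φ ∈ Adm d, boundaryTerm (A s) (g s) w φ =
      boundaryTerm (A s) 0 w φ + inflowTerm (A s) (u s) φ := fun s hs w hw φ hφ =>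
    boundaryTerm_eq (fun i => (hAs s hs i).continuousOn) (hucont s hs) hw hφ
      fun x hx i h => hg s hs x hx i h
  have hPA : primalDir k d N ≤ Adm d := hVP.le.trans (PW_le_Adm _ _ _)
  have hDA : dualDir k d N ≤ Adm d := hVD.le.trans (PW_le_Adm _ _ _)
  refine error_le_of_forall hB hN hVP hVD (hucont t ht) (hsol.mem_primal t ht)
    (hsol.mem_dual t ht) fun M hM hS => ?_
  -- the assumption on `τ Σ |A_i|` yields the bound `β = κ h_N / τ` for the field
  refine energy_estimate (θ := 1) (β := couplingConst d k * meshSize N / τ) hN hq hT (by positivity)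
    hK hK hc₁ hτ hVP hVD
    (fun _ h => faceCont_primalDir h) (fun _ h => faceCont_dualDir h) (Or.inr ⟨rfl, rfl⟩)
    hAs hAK hAK' (by unfold couplingConst; positivity) (Or.inr fun s hs x hx i => ?_) ?_ hu hut
    (fun s hs w hw φ hφ => ?_) (fun s hs w hw φ hφ => ?_) hsol h0P h0D ht
    (fun s hs => multilevelApprox_dir (isMesh_self 0) o0 (fun n _ => cellPoly_subset_span k 0 n)
      hN hqk hM (hucont s (hsub hs)) (mixedSeminorm_lt hS hs))
    (fun s hs => multilevelApprox_dir (isMesh_clipped N) o1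
      (fun n hn => cellPoly_subset_span_dualWavelet k N hn)
      hN hqk hM (hucont s (hsub hs)) (mixedSeminorm_lt hS hs))
  · rw [le_div_iff₀ hτ0, mul_comm]
    refine le_trans (mul_le_mul_of_nonneg_left ?_ hτ0.le) (hκ s hs x hx)
    exact Finset.single_le_sum (f := fun i => |A s x i|) (fun _ _ => abs_nonneg _)
      (Finset.mem_univ i)
  · refine le_of_eq ?_
    calc d * (couplingConst d k * meshSize N / τ * invConst k * 2 ^ N)
        = d * couplingConst d k * invConst k / τ * (2 ^ N * meshSize N) := by ring
      _ = 1 / τ := by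
        rw [two_pow_mul_meshSize, mul_one, couplingConst]
        field_simp
  · rw [fluxPrimalDir, hbdry s hs w (hDA hw) φ (hPA hφ), hflux]
    ring
  · rw [fluxDualDir, hbdry s hs w (hPA hw) φ (hDA hφ), hflux]
    ring

end final

end SparseCDG
end

open SparseCDG in
theorem theorem2 (d k : ℕ) (hd : 2 ≤ d) (hk : 1 ≤ k) :
    -- periodic boundary conditions
    (∀ p q : ℕ, 1 ≤ q → q ≤ min p k →
      ∀ T : ℝ, 0 < T → ∀ A : ℝ → (Fin d → ℝ) → Fin d → ℝ,
      IsSmoothField T Set.univ A → (∀ t ∈ Set.Icc 0 T, IsPeriodic (A t)) →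
      ∀ c₁ c₂ : ℝ, 0 < c₁ → 0 < c₂ →
      ∃ C : ℝ, 0 < C ∧
        ∀ N : ℕ, 1 ≤ N → ∀ τ : ℝ, c₁ * meshSize N ≤ τ → τ ≤ c₂ * meshSize N →
        ∀ u uh vh : ℝ → (Fin d → ℝ) → ℝ,
          IsClassicalSolution T Set.univ A u → (∀ t ∈ Set.Icc 0 T, IsPeriodic (u t)) →
          MemMixedSobolev Set.univ (p + 1) (u 0) →
          IsCDGSolution T τ (primalPer k d N) (dualPer k d N)
            (fun t => fluxPrimalPer N (A t)) (fun t => fluxDualPer N (A t)) uh vh →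
          IsL2Proj (primalPer k d N) (u 0) (uh 0) → IsL2Proj (dualPer k d N) (u 0) (vh 0) →
          ∀ t ∈ Set.Icc 0 T,
            l2Norm (fun x => u t x - uh t x) + l2Norm (fun x => u t x - vh t x) ≤
              ENNReal.ofReal (C * (N : ℝ) ^ d / (2 : ℝ) ^ (N * q)) *
                ⨆ s ∈ Set.Icc 0 t, mixedSeminorm Set.univ (q + 1) (u s)) ∧
    -- inflow (Dirichlet) boundary conditions
    (∃ κ : ℝ, 0 < κ ∧ ∀ p q : ℕ, 1 ≤ q → q ≤ min p k →
      ∀ T : ℝ, 0 < T → ∀ A : ℝ → (Fin d → ℝ) → Fin d → ℝ,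
      IsSmoothField T (unitCube d) A → (∀ t ∈ Set.Icc 0 T, ∀ x ∈ unitCube d, ∀ i, A t x i ≠ 0) →
      ∀ c₁ : ℝ, 0 < c₁ →
      ∃ C : ℝ, 0 < C ∧
        ∀ N : ℕ, 1 ≤ N → ∀ τ : ℝ, c₁ * meshSize N ≤ τ →
        (∀ t ∈ Set.Icc 0 T, ∀ x ∈ unitCube d, τ * ∑ i, |A t x i| ≤ κ * meshSize N) →
        ∀ (u uh vh : ℝ → (Fin d → ℝ) → ℝ) (g : ℝ → Fin d → (Fin d → ℝ) → ℝ),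
          IsClassicalSolution T (unitCube d) A u → HasInflowData T A g u →
          MemMixedSobolev (interior (unitCube d)) (p + 1) (u 0) →
          IsCDGSolution T τ (primalDir k d N) (dualDir k d N)
            (fun t => fluxPrimalDir N (A t) (g t)) (fun t => fluxDualDir N (A t) (g t)) uh vh →
          IsL2Proj (primalDir k d N) (u 0) (uh 0) → IsL2Proj (dualDir k d N) (u 0) (vh 0) →
          ∀ t ∈ Set.Icc 0 T,
            l2Norm (fun x => u t x - uh t x) + l2Norm (fun x => u t x - vh t x) ≤
              ENNReal.ofReal (C * (N : ℝ) ^ d / (2 : ℝ) ^ (N * q)) *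
                ⨆ s ∈ Set.Icc 0 t, mixedSeminorm (interior (unitCube d)) (q + 1) (u s)) := by
  refine ⟨fun p q hq hqp T hT A hA hAp c₁ c₂ hc₁ _ => ?_, couplingConst d k, ?_,
    fun p q hq hqp T hT A hA _ c₁ hc₁ => ?_⟩
  · obtain ⟨C, hC, h⟩ :=
      error_estimate_periodic (k := k) hq (hqp.trans (min_le_right p k)) hT hA hAp hc₁
    exact ⟨C, hC, fun N hN τ hτ _ u uh vh hu hup _ => h N hN τ hτ u uh vh hu hup⟩
  · have := invConst_pos k
    have : 0 < (d : ℝ) := by exact_mod_cast (by omega : 0 < d)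
    unfold couplingConst
    positivity
  · obtain ⟨C, hC, h⟩ := error_estimate_inflow (d := d) (k := k) (by omega) hq
      (hqp.trans (min_le_right p k)) hT hA hc₁
    exact ⟨C, hC, fun N hN τ hτ hκ u uh vh g hu hg _ => h N hN τ hτ hκ u uh vh g hu hg⟩
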